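/- Let $n\ge 1$, $\varepsilon\in\{0,1\}$, $D=2n+\varepsilon$, with coordinates $x_\mu$ $(1\le\mu\le n)$ and $\psi_k$ $(0\le k\le n-1+\varepsilon)$. Put $U_\mu=\prod_{\nu\ne\mu}(x_\mu^2-x_\nu^2)$, let $A^{(k)}$ (resp. $A^{(k)}_\mu$) be the $k$-th elementary symmetric polynomial in all $x_\nu^2$ (resp. in the $x_\nu^2$ with $\nu\neq\mu$), and $\mathcal A_\mu=\sum_{k=0}^{n-1}A_\mu^{(k)}d\psi_k$. Let $m_\mu,b_k,c_k$ $(0\le k\le n-1)$, $a,q$ and, if $\varepsilon=1$, $c>0$ be real constants with $$1+b_{n-1}=a\,c_{n-1}+a\,q^2 ,$$ and put $$X_\mu=\sum_{k=0}^{n-1}c_kx_\mu^{2k}+m_\mu x_\mu^{1-\varepsilon}+\varepsilon\frac{(-1)^nc}{x_\mu^2},\qquad N_\mu=\sum_{k=0}^{n-1}b_kx_\mu^{2k}+a\,m_\mu x_\mu^{1-\varepsilon},$$ $$Q_\mu=\frac{X_\mu}{U_\mu},\qquad \Phi=1+\sum_{\mu=1}^n\frac{N_\mu}{U_\mu},\qquad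 A_{(1)}=\frac1\Phi\sum_{\mu=1}^n\frac{N_\mu}{U_\mu}\mathcal A_\mu .$$ Let $\mathcal U$ be the set of points of the coordinate space at which the $x_\mu^2$ are pairwise distinct, all $Q_\mu>0$, $\Phi>0$ and, if $\varepsilon=1$, all $x_\mu\ne0$. On $\mathcal U$ consider the coframe $e^\mu=dx_\mu/\sqrt{Q_\mu}$, $e^{\hat\mu}=\sqrt{Q_\mu}(\mathcal A_\mu-A_{(1)})$ and, if $\varepsilon=1$, $e^0=\sqrt{Q_0}\,\big(\sum_{k=0}^nA^{(k)}d\psi_k-A_{(1)}\big)$ with $\sqrt{Q_0}=\sqrt c/\prod_\rho x_\rho$. Let $$g=\sum_\mu\frac{U_\mu}{X_\mu}dx_\mu^2+\sum_\mu\frac{X_\mu}{U_\mu}(\mathcal A_\mu-A_{(1)})^2+\frac{\varepsilon c}{\prod_\rho x_\rho^2}\Big(\sum_{k=0}^nA^{(k)}d\psi_k-A_{(1)}\Big)^2$$ (the type A metric with $f_\mu=1$, $k_1=\sqrt c$, $k_2=0$), $\phi=\ln\Phi$, $F=q\sum_\mu\partial_\mu\ln\Phi\;e^\mu\wedge e^{\hat\mu}$,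 and let $H=T$ be the torsion 3-form of the type A metric, i.e. in the present case $$H=-\sum_{\mu\ne\nu}\partial_\mu\ln\Phi\,\sqrt{Q_\nu}\;e^\mu\wedge e^{\hat\mu}\wedge e^{\hat\nu}-\varepsilon\sum_\mu\sqrt{Q_0}\,\partial_\mu\ln\Phi\;e^\mu\wedge e^{\hat\mu}\wedge e^0 .$$ Then: (i) $\mathcal U$ is open, $g$ is a smooth Riemannian metric on it with orthonormal coframe $(e^\mu,e^{\hat\mu},e^0)$ (without $e^0$ if $\varepsilon=0$), $F=dA$ with $A=qA_{(1)}$, there is a smooth 2-form $B$ on $\mathcal U$ with $H=dB-A\wedge dA$, and $(g,\phi,A,B)$ solves the equations of abelian heterotic supergravity on $\mathcal U$: $$R_{ab}-\nabla_a\nabla_b\phi-F_a{}^cF_{bc}-\tfrac14H_a{}^{cd}H_{bcd}=0,\quad d(e^\phi*F)=e^\phi*H\wedge F,\quad d(e^\phi*H)=0,$$ $$(\nabla\phi)^2+2\nabla^2\phi+\tfrac12F_{ab}F^{ab}+\tfrac1{12}H_{abc}H^{abc}-R=0 ,$$ where $*$ is the Hodge star with $\alpha\wedge*\beta=\langle\alpha,\beta\rangle\mathrm{vol}$,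 for either orientation. (ii) $\Phi=1+b_{n-1}+a\sum_\mu m_\mu x_\mu^{1-\varepsilon}/U_\mu$ and $H=-\big(\sum_\mu\partial_\mu\ln\Phi\,e^\mu\wedge e^{\hat\mu}\big)\wedge\big(\sum_\nu\sqrt{Q_\nu}\,e^{\hat\nu}+\varepsilon\sqrt{Q_0}\,e^0\big)$ on $\mathcal U$. (iii) If $b_k=0$ for all $k$, the fields are on $\mathcal U$ those of the charged Kerr–NUT black hole: $g$ as displayed above, with $$\Phi=1+a\sum_\mu\frac{m_\mu x_\mu^{1-\varepsilon}}{U_\mu},\quad A_{(1)}=\frac a\Phi\sum_\mu\frac{m_\mu x_\mu^{1-\varepsilon}}{U_\mu}\mathcal A_\mu,\quad \phi=\ln\Phi,\quad A=qA_{(1)},$$ $$F=q\,\omega,\quad H=-\omega\wedge\Big(\sum_\nu\frac{X_\nu}{U_\nu}(\mathcal A_\nu-A_{(1)})+\frac{\varepsilon c}{\prod_\rho x_\rho^2}\Big(\sum_{k=0}^nA^{(k)}d\psi_k-A_{(1)}\Big)\Big),$$ where $\omega=\sum_\mu\partial_\mu\ln\Phi\,dx_\mu\wedge(\mathcal A_\mu-A_{(1)})$.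 -/

import Mathlib

open scoped ContDiff

noncomputable section

namespace ChargedKerrNUT

/-! ### Differential forms on a coordinate space `ι → ℝ` -/

section Forms

variable {ι : Type} [Fintype ι] [DecidableEq ι]

/-- Alternating `k`-forms on the coordinate space; a differential `k`-form is a function
`(ι → ℝ) → Form ι k`, whose exterior derivative is Mathlib's `extDeriv`. -/
abbrev Form (ι : Type) [Fintype ι] (k : ℕ) : Type := (ι → ℝ) [⋀^Fin k]→L[ℝ] ℝ

/-- The coordinate vector `∂_i`. -/
def cvec (i : ι) : ι → ℝ := Pi.single i 1

/-- The partial derivative `∂_i f` at the point `x`. -/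
def pd (i : ι) (f : (ι → ℝ) → ℝ) (x : ι → ℝ) : ℝ := fderiv ℝ f x (cvec i)

/-- The coordinate 1-form `dx^i`. -/
def dcoord (i : ι) : Form ι 1 :=
  ContinuousAlternatingMap.ofSubsingleton ℝ (ι → ℝ) ℝ (0 : Fin 1) (ContinuousLinearMap.proj i)

theorem continuous_multilinear {κ : Type} [Fintype κ]
    (f : MultilinearMap ℝ (fun _ : κ => ι → ℝ) ℝ) : Continuous fun v => f v := by
  classical
  have h : ∀ v : κ → ι → ℝ,
      f v = ∑ r : κ → ι, (∏ i, v i (r i)) • f (fun i => Pi.single (r i) (1 : ℝ)) := by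
    intro v
    have hv : v = fun i => ∑ j : ι, v i j • (Pi.single j (1 : ℝ) : ι → ℝ) := by
      funext i
      exact pi_eq_sum_univ' (v i)
    conv_lhs => rw [hv]
    rw [MultilinearMap.map_sum]
    exact Finset.sum_congr rfl fun r _ => f.map_smul_univ _ _
  exact (continuous_congr h).mpr (by fun_prop)

/-- An alternating map on the (finite-dimensional) coordinate space, as a continuous one. -/
def toForm {k : ℕ} (f : (ι → ℝ) [⋀^Fin k]→ₗ[ℝ] ℝ) : Form ι k :=
  { f with cont := continuous_multilinear f.toMultilinearMap }

/-- The wedge product,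
`(α ∧ β)(v) = ∑ sign σ * α (v_{σ 1}, …, v_{σ p}) * β (v_{σ (p+1)}, …, v_{σ (p+q)})`,
the sum being over `(p, q)`-shuffles `σ`; thus `dx ∧ dy = dx ⊗ dy - dy ⊗ dx`. -/
def wedge {p q : ℕ} (α : Form ι p) (β : Form ι q) : Form ι (p + q) :=
  toForm (((LinearMap.mul' ℝ ℝ).compAlternatingMap
    (α.toAlternatingMap.domCoprod β.toAlternatingMap)).domDomCongr finSumFinEquiv)

/-- The volume form `√(det G) dx^{σ 1} ∧ … ∧ dx^{σ D}` of the metric with component matrix `G`, for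
the ordering `σ` of the coordinates (by an arbitrary index type `κ`). -/
def vol {κ : Type} [Fintype κ] [DecidableEq κ] (G : Matrix ι ι ℝ) (σ : κ ≃ ι) :
    (ι → ℝ) [⋀^κ]→ₗ[ℝ] ℝ :=
  √G.det • (Matrix.detRowAlternating (R := ℝ) (n := κ)).compLinearMap (LinearMap.funLeft ℝ ℝ σ)

/-- The vector dual to `dx^i` under the metric, `g^{ij} ∂_j`. -/
def sharp (G : Matrix ι ι ℝ) (i : ι) : ι → ℝ := fun j => G⁻¹ i j

/-- The remaining slots of an alternating map some of whose slots (those in `κ`) are filled. -/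
def fillLeft {κ κ' : Type} [Fintype κ] [Fintype κ'] (f : (ι → ℝ) [⋀^κ ⊕ κ']→ₗ[ℝ] ℝ)
    (u : κ → ι → ℝ) : (ι → ℝ) [⋀^κ']→ₗ[ℝ] ℝ where
  toFun w := f (Sum.elim u w)
  map_update_add' w i x y := by
    classical
    have h : ∀ z, Sum.elim u (Function.update w i z)
        = Function.update (Sum.elim u w) (Sum.inr i) z := fun z => by
      ext (a | a) b
      · simp
      · by_cases e : a = i
        · subst e; simp
        · simp [e]
    have h' : ∀ z, Sum.elim u (@Function.update κ' (fun _ => ι → ℝ) _ w i z)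
        = Function.update (Sum.elim u w) (Sum.inr i) z := fun z => by
      rw [← h z]
    rw [h', h', h', f.map_update_add]
  map_update_smul' w i c x := by
    classical
    have h : ∀ z, Sum.elim u (Function.update w i z)
        = Function.update (Sum.elim u w) (Sum.inr i) z := fun z => by
      ext (a | a) b
      · simp
      · by_cases e : a = i
        · subst e; simp
        · simp [e]
    have h' : ∀ z, Sum.elim u (@Function.update κ' (fun _ => ι → ℝ) _ w i z)
        = Function.update (Sum.elim u w) (Sum.inr i) z := fun z => by
      rw [← h z]
    rw [h', h', f.map_update_smul]
  map_eq_zero_of_eq' w i j hij hne :=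
    f.map_eq_zero_of_eq (i := Sum.inr i) (j := Sum.inr j) _ (by simpa using hij)
      (by simpa using hne)

/-- The Hodge star of a `p`-form in dimension `D = p + q`,
`(*α)_{b₁…b_q} = (1/p!) α^{a₁…a_p} vol_{a₁…a_p b₁…b_q}`, so that `α ∧ *β = ⟨α, β⟩ vol`. The
orientation is that of the ordering `o` of the coordinates. -/
def hodge {D p q : ℕ} (G : Matrix ι ι ℝ) (o : Fin D ≃ ι) (h : p + q = D) (α : Form ι p) :
    Form ι q :=
  toForm (((p.factorial : ℝ)⁻¹) • ∑ a : Fin p → ι, α (fun r => sharp G (a r)) •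
    fillLeft (vol G ((finSumFinEquiv.trans (finCongr h)).trans o)) (fun r => cvec (a r)))

/-- `η ⊗ η` as a matrix of components, for a 1-form `η`. -/
def tsq (η : Form ι 1) : Matrix ι ι ℝ := fun i j => η ![cvec i] * η ![cvec j]

end Forms

/-! ### Riemannian geometry in coordinates; a metric is its matrix of components `g_{ij}` -/

section Riemannian

variable {ι : Type} [Fintype ι] [DecidableEq ι]

/-- The Christoffel symbols `Γ^k_{ij}` of the Levi-Civita connection. -/
def christoffel (g : (ι → ℝ) → Matrix ι ι ℝ) (k i j : ι) (x : ι → ℝ) : ℝ :=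
  (1 / 2) * ∑ l, (g x)⁻¹ k l *
    (pd i (fun y => g y j l) x + pd j (fun y => g y i l) x - pd l (fun y => g y i j) x)

/-- The Ricci tensor `R_{ij}` (positive on round spheres). -/
def ricci (g : (ι → ℝ) → Matrix ι ι ℝ) (i j : ι) (x : ι → ℝ) : ℝ :=
  ∑ k, (pd k (christoffel g k i j) x - pd j (christoffel g k i k) x)
    + ∑ k, ∑ l, (christoffel g k k l x * christoffel g l i j x
      - christoffel g k j l x * christoffel g l i k x)

/-- The covariant Hessian `∇_i ∇_j φ`. -/
def hess (g : (ι → ℝ) → Matrix ι ι ℝ) (φ : (ι → ℝ) → ℝ) (i j : ι) (x : ι → ℝ) : ℝ :=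
  pd i (pd j φ) x - ∑ k, christoffel g k i j x * pd k φ x

/-- The metric trace `g^{ij} S_{ij}`. -/
def mtrace (G : Matrix ι ι ℝ) (S : ι → ι → ℝ) : ℝ := ∑ i, ∑ j, G⁻¹ i j * S i j

/-- `F_a{}^c F_{bc}`. -/
def contrF (G : Matrix ι ι ℝ) (F : Form ι 2) (a b : ι) : ℝ :=
  ∑ c, ∑ d, G⁻¹ c d * F ![cvec a, cvec d] * F ![cvec b, cvec c]

/-- `H_a{}^{cd} H_{bcd}`. -/
def contrH (G : Matrix ι ι ℝ) (H : Form ι 3) (a b : ι) : ℝ :=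
  ∑ c, ∑ d, ∑ c', ∑ d', G⁻¹ c c' * G⁻¹ d d' *
    H ![cvec a, cvec c', cvec d'] * H ![cvec b, cvec c, cvec d]

/-- The fields `(g, φ, A, B)`, with field strengths `F = dA` and `H = dB - A ∧ dA`, are smooth on
the open set `U`, `g` is a Riemannian metric there, and the field equations of abelian heterotic
supergravity in dimension `D` hold at every point of `U`. -/
structure SolvesHeterotic {D : ℕ} (o : Fin D ≃ ι) (U : Set (ι → ℝ))
    (g : (ι → ℝ) → Matrix ι ι ℝ) (φ : (ι → ℝ) → ℝ) (A : (ι → ℝ) → Form ι 1)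
    (B : (ι → ℝ) → Form ι 2) (F : (ι → ℝ) → Form ι 2) (H : (ι → ℝ) → Form ι 3) : Prop where
  isOpen : IsOpen U
  smooth_g : ∀ i j, ContDiffOn ℝ ∞ (fun x => g x i j) U
  smooth_phi : ContDiffOn ℝ ∞ φ U
  smooth_A : ContDiffOn ℝ ∞ A U
  smooth_B : ContDiffOn ℝ ∞ B U
  posDef : ∀ x ∈ U, (g x).PosDef
  F_eq : ∀ x ∈ U, F x = extDeriv A x
  H_eq : ∀ x ∈ U, H x = extDeriv B x - wedge (A x) (extDeriv A x)
  /-- `R_ab - ∇_a ∇_b φ - F_a^c F_bc - (1/4) H_a^cd H_bcd = 0` -/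
  einstein : ∀ x ∈ U, ∀ a b, ricci g a b x - hess g φ a b x - contrF (g x) (F x) a b
    - (1 / 4) * contrH (g x) (H x) a b = 0
  /-- `d(e^φ *F) = e^φ *H ∧ F`, in dimension `D = 3 + j` -/
  maxwell : ∀ x ∈ U, ∀ (j : ℕ) (h₂ : 2 + (j + 1) = D) (h₃ : 3 + j = D),
    extDeriv (fun y => Real.exp (φ y) • hodge (g y) o h₂ (F y)) x
      = Real.exp (φ x) • wedge (hodge (g x) o h₃ (H x)) (F x)
  /-- The same equation in dimension `D = 2`, where the 3-form `H` vanishes. -/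
  maxwell_two : ∀ x ∈ U, ∀ h₂ : 2 + 0 = D,
    extDeriv (fun y => Real.exp (φ y) • hodge (g y) o h₂ (F y)) x = 0
  /-- `d(e^φ *H) = 0` (void in dimension `D = 2`, where `H` vanishes) -/
  kalbRamond : ∀ x ∈ U, ∀ (j : ℕ) (h₃ : 3 + j = D),
    extDeriv (fun y => Real.exp (φ y) • hodge (g y) o h₃ (H y)) x = 0
  /-- `(∇φ)² + 2 ∇²φ + (1/2) F_ab F^ab + (1/12) H_abc H^abc - R = 0` -/
  dilaton : ∀ x ∈ U, mtrace (g x) (fun a b => pd a φ x * pd b φ x)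
    + 2 * mtrace (g x) (fun a b => hess g φ a b x)
    + (1 / 2) * mtrace (g x) (contrF (g x) (F x))
    + (1 / 12) * mtrace (g x) (contrH (g x) (H x))
    - mtrace (g x) (fun a b => ricci g a b x) = 0

end Riemannian

/-! ### Type A metrics in dimension `2 n + ε` -/

/-- Index of the coordinates `x_μ` (`μ < n`, left) and `ψ_k` (`k < n + ε`, right). -/
abbrev Idx (n ε : ℕ) : Type := Fin n ⊕ Fin (n + ε)

/-- Points of the coordinate space. -/
abbrev Pt (n ε : ℕ) : Type := Idx n ε → ℝ

section TypeA

variable {n ε : ℕ}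

/-- The coordinate `x_μ`. -/
def xc (p : Pt n ε) (μ : Fin n) : ℝ := p (Sum.inl μ)

/-- `U_μ = ∏_{ν ≠ μ} (x_μ² - x_ν²)` -/
def Ufun (p : Pt n ε) (μ : Fin n) : ℝ :=
  ∏ ν ∈ Finset.univ.erase μ, (xc p μ ^ 2 - xc p ν ^ 2)

/-- The `k`-th elementary symmetric polynomial of the `x_ν²`, `ν ∈ S`. It is `A^{(k)}` if `S` is
everything and `A_μ^{(k)}` if `S` is everything but `μ`. -/
def symA (p : Pt n ε) (S : Finset (Fin n)) (k : ℕ) : ℝ :=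
  ∑ s ∈ S.powersetCard k, ∏ ν ∈ s, xc p ν ^ 2

/-- `∂_μ` -/
def dmu (μ : Fin n) (f : Pt n ε → ℝ) (p : Pt n ε) : ℝ := pd (Sum.inl μ) f p

/-- `dx_μ` -/
def dxForm (μ : Fin n) : Form (Idx n ε) 1 := dcoord (Sum.inl μ)

/-- `dψ_k` for `k < n + ε` -/
def dpsi (k : ℕ) : Form (Idx n ε) 1 :=
  if h : k < n + ε then dcoord (Sum.inr ⟨k, h⟩) else 0

/-- `∑_{k=0}^{n-1} A_μ^{(k)} dψ_k` -/
def calA (p : Pt n ε) (μ : Fin n) : Form (Idx n ε) 1 :=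
  ∑ k ∈ Finset.range n, symA p (Finset.univ.erase μ) k • dpsi k

/-- `∑_{k=0}^{n} A^{(k)} dψ_k` (odd dimensions) -/
def calA0 (p : Pt n ε) : Form (Idx n ε) 1 :=
  ∑ k ∈ Finset.range (n + 1), symA p Finset.univ k • dpsi k

/-- The functions `f_μ`, `X_μ`, `N_μ` of one variable and (for odd dimensions) the constants
`k₁`, `k₂` that a type A metric depends on. -/
structure TypeAData (n : ℕ) where
  f : Fin n → ℝ → ℝ
  X : Fin n → ℝ → ℝ
  N : Fin n → ℝ → ℝ
  k₁ : ℝ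
  k₂ : ℝ

namespace TypeAData

variable (P : TypeAData n)

/-- `Q_μ = X_μ / U_μ` -/
def Q (p : Pt n ε) (μ : Fin n) : ℝ := P.X μ (xc p μ) / Ufun p μ

/-- `Φ = 1 + ∑_μ N_μ / U_μ` -/
def Phi (p : Pt n ε) : ℝ := 1 + ∑ μ, P.N μ (xc p μ) / Ufun p μ

/-- The 1-form `A_(1) = (1/Φ) ∑_μ (N_μ / U_μ) ∑_k A_μ^{(k)} dψ_k`. -/
def A1 (p : Pt n ε) : Form (Idx n ε) 1 :=
  (1 / P.Phi p) • ∑ μ, (P.N μ (xc p μ) / Ufun p μ) • calA p μ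

/-- `e^μ` -/
def e (p : Pt n ε) (μ : Fin n) : Form (Idx n ε) 1 := (1 / √(P.Q p μ)) • dxForm μ

/-- `e^μ̂` -/
def eHat (p : Pt n ε) (μ : Fin n) : Form (Idx n ε) 1 :=
  (P.f μ (xc p μ) * √(P.Q p μ)) • (calA p μ - P.A1 p)

/-- `e^0` (odd dimensions) -/
def e0 (p : Pt n ε) : Form (Idx n ε) 1 :=
  (P.k₁ / ∏ ρ, xc p ρ) • (calA0 p - P.A1 p) + (P.k₂ * ∏ ρ, xc p ρ) • (dpsi n - P.A1 p)

/-- The type A metric. -/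
def metric (p : Pt n ε) : Matrix (Idx n ε) (Idx n ε) ℝ :=
  ∑ μ, (Ufun p μ / P.X μ (xc p μ)) • tsq (dxForm μ)
    + ∑ μ, (P.f μ (xc p μ) ^ 2 * P.X μ (xc p μ) / Ufun p μ) • tsq (calA p μ - P.A1 p)
    + (ε : ℝ) • tsq (P.e0 p)

/-- `∂_μ ln Φ` -/
def dlnPhi (p : Pt n ε) (μ : Fin n) : ℝ := dmu μ (fun y => Real.log (P.Phi y)) p

/-- `F_(2) = ∑_μ (∂_μ ln Φ / f_μ) e^μ ∧ e^μ̂` -/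
def F2 (p : Pt n ε) : Form (Idx n ε) 2 :=
  ∑ μ, (P.dlnPhi p μ / P.f μ (xc p μ)) • wedge (P.e p μ) (P.eHat p μ)

/-- The torsion 3-form of the type A metric; `s` is the function `√Q_0` in odd dimensions. -/
def torsion (s : Pt n ε → ℝ) (p : Pt n ε) : Form (Idx n ε) 3 :=
  ∑ μ, ∑ ν ∈ Finset.univ.erase μ,
    ((2 * xc p μ / (xc p μ ^ 2 - xc p ν ^ 2)
      - P.f ν (xc p ν) / P.f μ (xc p μ)
        * (2 * xc p μ / (xc p μ ^ 2 - xc p ν ^ 2) + P.dlnPhi p μ)) * √(P.Q p ν))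
      • wedge (wedge (P.e p μ) (P.eHat p μ)) (P.eHat p ν)
  + (ε : ℝ) • ∑ μ,
    (2 * s p / xc p μ
      - P.k₁ / (P.f μ (xc p μ) * ∏ ρ, xc p ρ) * (2 / xc p μ + P.dlnPhi p μ)
      - P.k₂ / P.f μ (xc p μ) * P.dlnPhi p μ * ∏ ρ, xc p ρ)
      • wedge (wedge (P.e p μ) (P.eHat p μ)) (P.e0 p)

end TypeAData

end TypeA

/-! ### The solution -/

/-- The free parameters: `m_μ`; `b_k` and `c_k`, of which only `k < n` occur; `a`, `q`; and `c0`,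
the constant `c` of odd dimensions. -/
structure Params (n : ℕ) where
  m : Fin n → ℝ
  b : ℕ → ℝ
  c : ℕ → ℝ
  a : ℝ
  q : ℝ
  c0 : ℝ

namespace Params

variable {n : ℕ} (P : Params n) (ε : ℕ)

/-- `f_μ = 1`, the polynomial (for odd dimensions, Laurent polynomial) functions `X_μ`, `N_μ`,
and `k₁ = √c`, `k₂ = 0`. -/
def typeA : TypeAData n where
  f _ _ := 1
  X μ x := ∑ k ∈ Finset.range n, P.c k * x ^ (2 * k) + P.m μ * x ^ (1 - ε)
    + ε * ((-1) ^ n * P.c0 / x ^ 2)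
  N μ x := ∑ k ∈ Finset.range n, P.b k * x ^ (2 * k) + P.a * P.m μ * x ^ (1 - ε)
  k₁ := √P.c0
  k₂ := 0

/-- The coordinate domain of the solution: the `x_μ²` are distinct, the `Q_μ` and `Φ` positive and,
in odd dimensions, the `x_μ` nonzero. -/
def domain : Set (Pt n ε) :=
  {p | (∀ μ ν, μ ≠ ν → xc p μ ^ 2 ≠ xc p ν ^ 2) ∧ (∀ μ, 0 < (P.typeA ε).Q p μ) ∧
    0 < (P.typeA ε).Phi p ∧ (ε = 1 → ∀ μ, xc p μ ≠ 0)}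

/-- `√Q_0 = √c / ∏_ρ x_ρ` -/
def sqrtQ0 (p : Pt n ε) : ℝ := √P.c0 / ∏ ρ, xc p ρ

/-- The dilaton `φ = ln Φ`. -/
def dilaton (p : Pt n ε) : ℝ := Real.log ((P.typeA ε).Phi p)

/-- The gauge potential `A = q A_(1)`. -/
def gaugeA (p : Pt n ε) : Form (Idx n ε) 1 := P.q • (P.typeA ε).A1 p

/-- `F = q ∑_μ ∂_μ ln Φ e^μ ∧ e^μ̂` -/
def fieldF (p : Pt n ε) : Form (Idx n ε) 2 :=
  P.q • ∑ μ, (P.typeA ε).dlnPhi p μ • wedge ((P.typeA ε).e p μ) ((P.typeA ε).eHat p μ)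

/-- `H = T`, the torsion. -/
def fieldH (p : Pt n ε) : Form (Idx n ε) 3 := (P.typeA ε).torsion (P.sqrtQ0 ε) p

/-- `-(∑_μ ∂_μ ln Φ e^μ ∧ e^μ̂) ∧ (∑_ν √(X_ν/U_ν) e^ν̂ + ε √c / ∏_ρ x_ρ e^0)` -/
def fieldHClosed (p : Pt n ε) : Form (Idx n ε) 3 :=
  -wedge (∑ μ, (P.typeA ε).dlnPhi p μ • wedge ((P.typeA ε).e p μ) ((P.typeA ε).eHat p μ))
    (∑ ν, √((P.typeA ε).Q p ν) • (P.typeA ε).eHat p ν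
      + (ε : ℝ) • P.sqrtQ0 ε p • (P.typeA ε).e0 p)

end Params

/-! ### The charged Kerr–NUT fields -/

section KerrNUT

variable {n ε : ℕ} (m : Fin n → ℝ) (c : ℕ → ℝ) (a q c0 : ℝ)

/-- `1 + a ∑_μ m_μ x_μ^{1-ε} / U_μ` -/
def knPhi (p : Pt n ε) : ℝ := 1 + a * ∑ μ, m μ * xc p μ ^ (1 - ε) / Ufun p μ

/-- `∑_{k<n} c_k x_μ^{2k} + m_μ x_μ^{1-ε} + ε (-1)^n c / x_μ²` -/
def knX (p : Pt n ε) (μ : Fin n) : ℝ :=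
  ∑ k ∈ Finset.range n, c k * xc p μ ^ (2 * k) + m μ * xc p μ ^ (1 - ε)
    + ε * ((-1) ^ n * c0 / xc p μ ^ 2)

/-- `(a / Φ) ∑_μ (m_μ x_μ^{1-ε} / U_μ) ∑_k A_μ^{(k)} dψ_k` -/
def knA1 (p : Pt n ε) : Form (Idx n ε) 1 :=
  (a / knPhi m a p) • ∑ μ, (m μ * xc p μ ^ (1 - ε) / Ufun p μ) • calA p μ

/-- The string frame metric of the charged Kerr–NUT black hole. -/
def knMetric (p : Pt n ε) : Matrix (Idx n ε) (Idx n ε) ℝ :=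
  ∑ μ, (Ufun p μ / knX m c c0 p μ) • tsq (dxForm μ)
    + ∑ μ, (knX m c c0 p μ / Ufun p μ) • tsq (calA p μ - knA1 m a p)
    + (ε * c0 / ∏ ρ, xc p ρ ^ 2) • tsq (calA0 p - knA1 m a p)

/-- `F = q ∑_μ ∂_μ ln Φ dx_μ ∧ (∑_k A_μ^{(k)} dψ_k - A_(1))`; the right-hand factors are
`e^μ ∧ e^μ̂`. -/
def knF (p : Pt n ε) : Form (Idx n ε) 2 :=
  q • ∑ μ, dmu μ (fun y : Pt n ε => Real.log (knPhi m a y)) p •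
    wedge (dxForm μ) (calA p μ - knA1 m a p)

/-- `H = -(∑_μ ∂_μ ln Φ e^μ ∧ e^μ̂) ∧ (∑_ν √(X_ν/U_ν) e^ν̂ + ε (√c / ∏_ρ x_ρ) e^0)`, the
square roots being multiplied out. -/
def knH (p : Pt n ε) : Form (Idx n ε) 3 :=
  -wedge (∑ μ, dmu μ (fun y : Pt n ε => Real.log (knPhi m a y)) p •
      wedge (dxForm μ) (calA p μ - knA1 m a p))
    (∑ ν, (knX m c c0 p ν / Ufun p ν) • (calA p ν - knA1 m a p)
      + (ε * c0 / ∏ ρ, xc p ρ ^ 2) • (calA0 p - knA1 m a p))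

end KerrNUT

end ChargedKerrNUT

end

open ChargedKerrNUT

set_option linter.unusedSectionVars false
set_option linter.unusedSimpArgs false

open scoped ContDiff

noncomputable section

/-! The solution arises by charging a Ricci-flat Kerr–NUT metric along the Killing vector ∂/∂ψ_0.
Let z_a denote the squares x_μ² together with, if ε = 1, one further value 0. Let A_a be the
corresponding covectors on the torus of the ψ_k. The uncharged metric is Σ dx_μ²/Q_μ + G₀ with G₀ =
Σ_a Q_a A_a ⊗ A_a, and all of its components depend on the x_μ only.

Every A_a has ψ_0-component 1, so the squared length of ∂/∂ψ_0 is V = Σ_a Q_a. Lagrange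
interpolation gives V = c_{n-1} + Σ m_μ x_μ^{1-ε}/U_μ, and likewise Φ = 1 + b_{n-1} + a Σ m_μ
x_μ^{1-ε}/U_μ. The relation between the constants therefore says exactly that Φ = a (V + q²). Put v
= G₀(∂/∂ψ_0, ·) and u = A_(1). Then Φ u - a v has constant components, u_0 = 1 - 1/Φ, and ∂_μ u =
(a/Φ)(∂_μ v - ∂_μ V u). The structure `ChargedVacuum` records these facts with the vacuum equations,
and the field equations are derived from it alone.

Charging replaces A_a by A_a - u, that is, dψ_0 by dψ_0 - u. On matrices this is conjugation by 1 -
E with E = e_0 uᵀ, whose inverse is 1 + Φ E. It divides √det g by Φ, so that e^φ √det g keeps its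
vacuum value. Hence all equations, written as divergences with this weight, can be compared with the
vacuum ones. In these terms F = q du and H = -du ∧ (v - V u). The Einstein equation
(`ChargedVacuum.einstein`) has a base block and a torus block. In both of them the vacuum equations
remove the second derivatives of G₀, and the remainder is a multiple of (a/Φ)(V + q²) - 1 = 0. The
equations for F and H follow from the conservation of the vacuum currents G₀⁻¹ ∂v (`divg_momentum`).
The dilaton equation follows after eliminating R by means of the Einstein equation. As Φ u - a v is
constant, B = (1/a) u ∧ (Φ u - a v) is a potential with dB - A ∧ dA = H.

For the vacuum equations (`VacuumFrame`), the derivatives of Q_a and A_a are governed by λ_νa = 2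
x_ν/(x_ν² - z_a). The torus block becomes a bilinear identity in the components of the A_a. Its
off-diagonal terms cancel by partial fractions (`sum_lam_mul_lam`, `quadratic_identity`), and its
diagonal terms are one scalar equation for each index a. With y = x X_μ' - (1 - ε) X_μ the constants
m_μ drop out, so that y is one and the same function of z = x² for all μ. Interpolation shows that Σ
y(z_ν)/U_ν - 2 ε c/∏ z_ν is constant. Its partial derivatives are the scalar equations for the
indices μ, and the sum of these derivatives gives the equation for the extra index. -/

namespace ChargedKerrNUT

/-! ### Wedge products as sums over permutations -/

section WedgeAlgebra

variable {ι : Type} [Fintype ι] [DecidableEq ι]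

open Equiv in
/-- The wedge product as a sum over all permutations. -/
theorem wedge_eq_sum_perm {p q : ℕ} (α : Form ι p) (β : Form ι q) (v : Fin (p + q) → ι → ℝ) :
    ((p.factorial * q.factorial : ℕ) : ℝ) * wedge α β v
      = ∑ σ : Perm (Fin p ⊕ Fin q), ((Perm.sign σ : ℤ) : ℝ) *
        (α (fun i => v (finSumFinEquiv (σ (Sum.inl i)))) *
          β (fun i => v (finSumFinEquiv (σ (Sum.inr i))))) := by
  -- Alternating the tensor product counts every shuffle p! q! times.
  have h := congrArg (fun f => LinearMap.mul' ℝ ℝ (f (fun i => v (finSumFinEquiv i))))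
    (MultilinearMap.domCoprod_alternization_eq α.toAlternatingMap β.toAlternatingMap)
  simp only [MultilinearMap.alternatization_apply, AlternatingMap.smul_apply, map_sum,
    Fintype.card_fin, map_nsmul] at h
  rw [nsmul_eq_mul] at h
  refine Eq.trans h.symm (Finset.sum_congr rfl fun σ _ => ?_)
  rw [Units.smul_def, map_zsmul, zsmul_eq_mul]
  rfl

/-- Bilinearity of the wedge is visible in the sum over permutations once the nonzero factor p! q!
is cancelled. -/
theorem wedge_add_left {p q : ℕ} (α α' : Form ι p) (β : Form ι q) :
    wedge (α + α') β = wedge α β + wedge α' β := by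
  ext v
  have h : ((p.factorial * q.factorial : ℕ) : ℝ) ≠ 0 := by positivity
  apply mul_left_cancel₀ h
  simp only [ContinuousAlternatingMap.add_apply, mul_add, wedge_eq_sum_perm, add_mul,
    Finset.sum_add_distrib]

theorem wedge_add_right {p q : ℕ} (α : Form ι p) (β β' : Form ι q) :
    wedge α (β + β') = wedge α β + wedge α β' := by
  ext v
  have h : ((p.factorial * q.factorial : ℕ) : ℝ) ≠ 0 := by positivity
  apply mul_left_cancel₀ h
  simp only [ContinuousAlternatingMap.add_apply, mul_add, wedge_eq_sum_perm,
    Finset.sum_add_distrib]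

theorem wedge_smul_left {p q : ℕ} (c : ℝ) (α : Form ι p) (β : Form ι q) :
    wedge (c • α) β = c • wedge α β := by
  ext v
  have h : ((p.factorial * q.factorial : ℕ) : ℝ) ≠ 0 := by positivity
  apply mul_left_cancel₀ h
  rw [ContinuousAlternatingMap.smul_apply, smul_eq_mul, mul_left_comm, wedge_eq_sum_perm,
    wedge_eq_sum_perm, Finset.mul_sum]
  refine Finset.sum_congr rfl fun σ _ => ?_
  simp only [ContinuousAlternatingMap.smul_apply, smul_eq_mul]
  ring

theorem wedge_smul_right {p q : ℕ} (c : ℝ) (α : Form ι p) (β : Form ι q) :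
    wedge α (c • β) = c • wedge α β := by
  ext v
  have h : ((p.factorial * q.factorial : ℕ) : ℝ) ≠ 0 := by positivity
  apply mul_left_cancel₀ h
  rw [ContinuousAlternatingMap.smul_apply, smul_eq_mul, mul_left_comm, wedge_eq_sum_perm,
    wedge_eq_sum_perm, Finset.mul_sum]
  refine Finset.sum_congr rfl fun σ _ => ?_
  simp only [ContinuousAlternatingMap.smul_apply, smul_eq_mul]
  ring

/-- The wedge product as a bilinear map. -/
def wedgeₗ (ι : Type) [Fintype ι] [DecidableEq ι] (p q : ℕ) :
    Form ι p →ₗ[ℝ] Form ι q →ₗ[ℝ] Form ι (p + q) :=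
  LinearMap.mk₂ ℝ wedge wedge_add_left wedge_smul_left wedge_add_right wedge_smul_right

theorem wedge_sum_left {p q : ℕ} {κ : Type*} (s : Finset κ) (α : κ → Form ι p) (β : Form ι q) :
    wedge (∑ k ∈ s, α k) β = ∑ k ∈ s, wedge (α k) β :=
  LinearMap.map_sum₂ (wedgeₗ ι p q) s α β

theorem wedge_sum_right {p q : ℕ} {κ : Type*} (s : Finset κ) (α : Form ι p) (β : κ → Form ι q) :
    wedge α (∑ k ∈ s, β k) = ∑ k ∈ s, wedge α (β k) :=
  map_sum (wedgeₗ ι p q α) β s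

/-- `l ∧ β` for a covector `l`. -/
def covWedge {k : ℕ} (l : (ι → ℝ) →ₗ[ℝ] ℝ) (β : (ι → ℝ) [⋀^Fin k]→ₗ[ℝ] ℝ) :
    (ι → ℝ) [⋀^Fin (k + 1)]→ₗ[ℝ] ℝ :=
  AlternatingMap.alternatizeUncurryFin (l.smulRight β)

theorem covWedge_apply {k : ℕ} (l : (ι → ℝ) →ₗ[ℝ] ℝ) (β : (ι → ℝ) [⋀^Fin k]→ₗ[ℝ] ℝ)
    (v : Fin (k + 1) → ι → ℝ) :
    covWedge l β v = ∑ i : Fin (k + 1), (-1) ^ (i : ℕ) * (l (v i) * β (i.removeNth v)) := by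
  simp [covWedge, AlternatingMap.alternatizeUncurryFin_apply]

/-- Antisymmetrising the alternating map `covWedge l β` multiplies it by (k+1)!. Its k+1 summands
contribute equally, because the cycle that brings slot i to the front has sign (-1)^i. Dividing by
k+1 leaves k!. -/
theorem sum_perm_covector_mul {k : ℕ} (l : (ι → ℝ) →ₗ[ℝ] ℝ) (β : (ι → ℝ) [⋀^Fin k]→ₗ[ℝ] ℝ)
    (v : Fin (k + 1) → ι → ℝ) :
    ∑ σ : Equiv.Perm (Fin (k + 1)), ((Equiv.Perm.sign σ : ℤ) : ℝ) *
        (l (v (σ 0)) * β (fun i => v (σ i.succ)))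
      = (k.factorial : ℝ) * covWedge l β v := by
  have h1 : ∑ σ : Equiv.Perm (Fin (k + 1)), ((Equiv.Perm.sign σ : ℤ) : ℝ) *
      covWedge l β (fun i => v (σ i)) = ((k + 1).factorial : ℝ) * covWedge l β v := by
    have : ∀ σ : Equiv.Perm (Fin (k + 1)), ((Equiv.Perm.sign σ : ℤ) : ℝ) *
      covWedge l β (fun i => v (σ i)) = covWedge l β v := by
      intro σ
      have h := (covWedge l β).map_perm v σ
      rw [show (fun i => v (σ i)) = v ∘ σ from rfl, h, Units.smul_def, zsmul_eq_mul, ← mul_assoc]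
      rcases Int.units_eq_one_or (Equiv.Perm.sign σ) with h | h <;> simp [h]
    simp only [this, Finset.sum_const, Finset.card_univ, Fintype.card_perm, Fintype.card_fin,
      nsmul_eq_mul]
  have h2 : ∀ i : Fin (k + 1), ∑ σ : Equiv.Perm (Fin (k + 1)), ((Equiv.Perm.sign σ : ℤ) : ℝ) *
      ((-1) ^ (i : ℕ) * (l (v (σ i)) * β (i.removeNth fun j => v (σ j))))
      = ∑ σ : Equiv.Perm (Fin (k + 1)), ((Equiv.Perm.sign σ : ℤ) : ℝ) *
        (l (v (σ 0)) * β (fun i => v (σ i.succ))) := by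
    intro i
    refine Fintype.sum_equiv (Equiv.mulRight i.cycleRange.symm) _ _ fun σ => ?_
    simp only [Equiv.coe_mulRight, Equiv.Perm.sign_mul, Equiv.Perm.sign_symm, Fin.sign_cycleRange,
      Equiv.Perm.mul_apply, Fin.cycleRange_symm_zero, Fin.cycleRange_symm_succ]
    push_cast
    rw [mul_assoc]
    rfl
  have h3 : ((k + 1 : ℕ) : ℝ) * (∑ σ : Equiv.Perm (Fin (k + 1)), ((Equiv.Perm.sign σ : ℤ) : ℝ) *
        (l (v (σ 0)) * β (fun i => v (σ i.succ)))) = ((k + 1).factorial : ℝ) * covWedge l β v := by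
    rw [← h1]
    simp only [covWedge_apply, Finset.mul_sum]
    rw [Finset.sum_comm]
    simp only [← Finset.mul_sum]
    rw [Finset.sum_congr rfl fun i _ => h2 i]
    simp
  rw [Nat.factorial_succ, Nat.cast_mul, mul_assoc] at h3
  exact mul_left_cancel₀ (by positivity) h3

/-- `sum_perm_covector_mul` is applied twice. The inner antisymmetrisation, over permutations τ of
the slots after the first, is absorbed into the outer one. -/
theorem sum_perm_two_covectors_mul {k : ℕ} (l₁ l₂ : (ι → ℝ) →ₗ[ℝ] ℝ)
    (β : (ι → ℝ) [⋀^Fin k]→ₗ[ℝ] ℝ) (v : Fin (k + 2) → ι → ℝ) :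
    ∑ σ : Equiv.Perm (Fin (k + 2)), ((Equiv.Perm.sign σ : ℤ) : ℝ) *
        (l₁ (v (σ 0)) * (l₂ (v (σ 1)) * β (fun i => v (σ i.succ.succ))))
      = (k.factorial : ℝ) * covWedge l₁ (covWedge l₂ β) v := by
  have h1 := sum_perm_covector_mul l₁ (covWedge l₂ β) v
  have h2 : (k.factorial : ℝ) * ∑ σ : Equiv.Perm (Fin (k + 2)), ((Equiv.Perm.sign σ : ℤ) : ℝ) *
        (l₁ (v (σ 0)) * covWedge l₂ β (fun i => v (σ i.succ)))
      = ((k + 1).factorial : ℝ) * ∑ σ : Equiv.Perm (Fin (k + 2)), ((Equiv.Perm.sign σ : ℤ) : ℝ) *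
        (l₁ (v (σ 0)) * (l₂ (v (σ 1)) * β (fun i => v (σ i.succ.succ)))) := by
    -- `decomposeFin.symm (0, τ)` is τ acting on all slots except 0. Right multiplication by it
    -- permutes the σ and restores the sign of τ.
    have h3 : ∀ τ : Equiv.Perm (Fin (k + 1)), ∑ σ : Equiv.Perm (Fin (k + 2)),
        ((Equiv.Perm.sign σ : ℤ) : ℝ) * (l₁ (v (σ 0)) * (((Equiv.Perm.sign τ : ℤ) : ℝ) *
          (l₂ (v (σ (τ 0).succ)) * β (fun i => v (σ (τ i.succ).succ)))))
        = ∑ σ : Equiv.Perm (Fin (k + 2)), ((Equiv.Perm.sign σ : ℤ) : ℝ) *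
        (l₁ (v (σ 0)) * (l₂ (v (σ 1)) * β (fun i => v (σ i.succ.succ)))) := by
      intro τ
      refine Fintype.sum_equiv (Equiv.mulRight (Equiv.Perm.decomposeFin.symm (0, τ))) _ _
        fun σ => ?_
      have e1 : (Equiv.Perm.decomposeFin.symm (0, τ)) 1 = (τ 0).succ := by
        rw [← Fin.succ_zero_eq_one, Equiv.Perm.decomposeFin_symm_apply_succ]
        simp
      simp only [Equiv.coe_mulRight, Equiv.Perm.sign_mul, Equiv.Perm.decomposeFin.symm_sign,
        Equiv.Perm.mul_apply, Equiv.Perm.decomposeFin_symm_apply_zero,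
        Equiv.Perm.decomposeFin_symm_apply_succ, e1]
      simp
      ring
    have h4 : ∀ σ : Equiv.Perm (Fin (k + 2)), (k.factorial : ℝ) *
        (((Equiv.Perm.sign σ : ℤ) : ℝ) *
          (l₁ (v (σ 0)) * covWedge l₂ β (fun i => v (σ i.succ))))
        = ∑ τ : Equiv.Perm (Fin (k + 1)), ((Equiv.Perm.sign σ : ℤ) : ℝ) *
          (l₁ (v (σ 0)) * (((Equiv.Perm.sign τ : ℤ) : ℝ) *
          (l₂ (v (σ (τ 0).succ)) * β (fun i => v (σ (τ i.succ).succ))))) := by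
      intro σ
      have h5 := sum_perm_covector_mul l₂ β (fun i => v (σ i.succ))
      rw [mul_left_comm, mul_left_comm _ (l₁ _), ← h5]
      simp only [Finset.mul_sum]
    rw [Finset.mul_sum, Finset.sum_congr rfl fun σ _ => h4 σ, Finset.sum_comm,
      Finset.sum_congr rfl fun τ _ => h3 τ]
    simp [Fintype.card_perm]
  rw [h1] at h2
  have : ((k + 1).factorial : ℝ) ≠ 0 := by positivity
  apply mul_left_cancel₀ this
  rw [← h2]
  ring

/-- A 1-form as a covector. -/
def covec (η : Form ι 1) : (ι → ℝ) →ₗ[ℝ] ℝ where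
  toFun x := η ![x]
  map_add' x y := by
    have h := η.toAlternatingMap.map_update_add ![x] 0 x y
    have hu : ∀ z : ι → ℝ, Function.update ![x] 0 z = ![z] := fun z => by
      funext i; fin_cases i; rfl
    rw [hu, hu, hu] at h
    exact h
  map_smul' c x := by
    have h := η.toAlternatingMap.map_update_smul ![x] 0 c x
    have hu : ∀ z : ι → ℝ, Function.update ![x] 0 z = ![z] := fun z => by
      funext i; fin_cases i; rfl
    rw [hu, hu] at h
    exact h

/-- Two enumerations of the slots differ by a permutation, whose sign is all that remains of the
change. This allows the slots of a low-degree factor to be moved to the front. -/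
theorem sum_perm_reindex {X : Type} [Fintype X] [DecidableEq X] {m : ℕ} (e e' : X ≃ Fin m)
    (v : Fin m → ι → ℝ) (f : (X → ι → ℝ) → ℝ) :
    ∑ σ : Equiv.Perm X, ((Equiv.Perm.sign σ : ℤ) : ℝ) * f (fun x => v (e (σ x)))
      = ((Equiv.Perm.sign (e'.symm.trans e) : ℤ) : ℝ) *
        ∑ τ : Equiv.Perm (Fin m), ((Equiv.Perm.sign τ : ℤ) : ℝ) * f (fun x => v (τ (e' x))) := by
  rw [Finset.mul_sum]
  refine Fintype.sum_equiv (Equiv.equivCongr e' e) _ _ fun σ => ?_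
  have h1 : Equiv.equivCongr e' e σ = (e'.symm.trans e) * e'.permCongr σ := by
    ext x; simp
  have h2 : ((Equiv.Perm.sign (e'.symm.trans e) : ℤ) : ℝ) *
      ((Equiv.Perm.sign (e'.symm.trans e) : ℤ) : ℝ) = 1 := by
    rcases Int.units_eq_one_or (Equiv.Perm.sign (e'.symm.trans e)) with h | h <;> simp [h]
  rw [h1, Equiv.Perm.sign_mul, Equiv.Perm.sign_permCongr, Units.val_mul, Int.cast_mul]
  rw [← mul_assoc, ← mul_assoc, h2, one_mul]
  simp

/-- Moving the slot of the 1-form past the k slots of `β` is the rotation `finRotate (k + 1)`, of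
sign (-1)^k. -/
theorem wedge_one_right {k : ℕ} (β : Form ι k) (η : Form ι 1) (v : Fin (k + 1) → ι → ℝ) :
    wedge β η v = (-1) ^ k * covWedge (covec η) β.toAlternatingMap v := by
  have h := wedge_eq_sum_perm β η v
  let e' : Fin k ⊕ Fin 1 ≃ Fin (k + 1) :=
    finSumFinEquiv.trans (finRotate (k + 1))
  have e'l : ∀ i : Fin k, e' (Sum.inl i) = i.succ := fun i => by
    simp only [e', Equiv.trans_apply, finSumFinEquiv_apply_left, finRotate_apply]
    exact Fin.coeSucc_eq_succ
  have e'r : ∀ i : Fin 1, e' (Sum.inr i) = 0 := fun i => by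
    simp only [e', Equiv.trans_apply, finSumFinEquiv_apply_right, finRotate_apply]
    rw [Subsingleton.elim i 0]
    exact Fin.last_add_one k
  rw [sum_perm_reindex finSumFinEquiv e' v
    (fun w => β (fun i => w (Sum.inl i)) * η (fun i => w (Sum.inr i)))] at h
  have hs : Equiv.Perm.sign (e'.symm.trans finSumFinEquiv) = (-1) ^ k := by
    have : e'.symm.trans finSumFinEquiv = (finRotate (k + 1)).symm := by
      ext x; simp [e']
    rw [this, Equiv.Perm.sign_symm, sign_finRotate]
    simp
  have hη : ∀ x : ι → ℝ, η (fun _ => x) = covec η x := fun x => by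
    change η _ = η _
    congr 1
    funext i
    fin_cases i
    rfl
  have h2 := sum_perm_covector_mul (covec η) β.toAlternatingMap v
  simp only [e'l, e'r, hs, hη] at h
  have h3 : ((k.factorial : ℕ) : ℝ) ≠ 0 := by positivity
  apply mul_left_cancel₀ h3
  rw [mul_left_comm, ← h2]
  simp only [Nat.factorial_one, mul_one] at h
  rw [h]
  push_cast
  congr 1
  refine Finset.sum_congr rfl fun σ _ => ?_
  rw [mul_comm (β _)]
  rfl

theorem wedge_one_one (α β : Form ι 1) (x y : ι → ℝ) :
    wedge α β ![x, y] = α ![x] * β ![y] - α ![y] * β ![x] := by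
  rw [wedge_one_right, covWedge_apply, Fin.sum_univ_two]
  have h0 : (0 : Fin 2).removeNth ![x, y] = ![y] := by funext i; fin_cases i; rfl
  have h1 : (1 : Fin 2).removeNth ![x, y] = ![x] := by funext i; fin_cases i; rfl
  rw [h0, h1]
  simp [covec]
  ring

theorem wedge_one_two (η : Form ι 1) (β : Form ι 2) (v : Fin 3 → ι → ℝ) :
    wedge η β v = covWedge (covec η) β.toAlternatingMap v := by
  have h := wedge_eq_sum_perm η β v
  rw [sum_perm_reindex finSumFinEquiv finSumFinEquiv v
    (fun w => η (fun i => w (Sum.inl i)) * β (fun i => w (Sum.inr i)))] at h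
  have hη : ∀ x : ι → ℝ, η (fun _ => x) = covec η x := fun x => by
    change η _ = η _
    congr 1
    funext i
    fin_cases i
    rfl
  have h2 := sum_perm_covector_mul (covec η) β.toAlternatingMap v
  have el : ∀ i : Fin 1, finSumFinEquiv (m := 1) (n := 2) (Sum.inl i) = 0 := fun i => by
    fin_cases i; rfl
  have er : ∀ i : Fin 2, finSumFinEquiv (m := 1) (n := 2) (Sum.inr i) = i.succ := fun i => by
    fin_cases i <;> rfl
  simp only [el, er, hη, Equiv.symm_trans_self, Equiv.Perm.sign_refl] at h
  have h3 : ((Nat.factorial 2 : ℕ) : ℝ) ≠ 0 := by positivity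
  apply mul_left_cancel₀ h3
  rw [← h2]
  simp only [Nat.factorial_one, one_mul] at h
  rw [h]
  simp

/-- A 2-form commutes with every form: its two slots reach the front by two equal rotations, whose
signs cancel. -/
theorem wedge_wedge_one_one {k : ℕ} (β : Form ι k) (η₁ η₂ : Form ι 1)
    (v : Fin (k + 2) → ι → ℝ) :
    wedge β (wedge η₁ η₂) v
      = covWedge (covec η₁) (covWedge (covec η₂) β.toAlternatingMap) v := by
  have h := wedge_eq_sum_perm β (wedge η₁ η₂) v
  let e' : Fin k ⊕ Fin 2 ≃ Fin (k + 2) :=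
    finSumFinEquiv.trans ((finRotate (k + 2)).trans (finRotate (k + 2)))
  have e'l : ∀ i : Fin k, e' (Sum.inl i) = i.succ.succ := fun i => by
    have h1 : finRotate (k + 2) (Fin.castAdd 2 i) = (i.castSucc).succ := by
      rw [finRotate_apply]
      exact Fin.coeSucc_eq_succ (a := i.castSucc)
    simp only [e', Equiv.trans_apply, finSumFinEquiv_apply_left, h1]
    rw [finRotate_apply]
    exact Fin.coeSucc_eq_succ (a := i.succ)
  have h01 : finRotate (k + 2) 0 = 1 := by rw [finRotate_apply]; simp
  have e'0 : e' (Sum.inr 0) = 0 := by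
    have h1 : finRotate (k + 2) (Fin.natAdd k (0 : Fin 2)) = Fin.last (k + 1) := by
      rw [finRotate_apply]
      exact Fin.coeSucc_eq_succ (a := Fin.last k)
    simp only [e', Equiv.trans_apply, finSumFinEquiv_apply_right, h1, finRotate_last]
  have e'1 : e' (Sum.inr 1) = 1 := by
    have h1 : finRotate (k + 2) (Fin.natAdd k (1 : Fin 2)) = 0 := finRotate_last
    simp only [e', Equiv.trans_apply, finSumFinEquiv_apply_right, h1, h01]
  have hs : Equiv.Perm.sign (e'.symm.trans finSumFinEquiv) = 1 := by
    have : e'.symm.trans finSumFinEquiv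
        = (finRotate (k + 2)).symm * (finRotate (k + 2)).symm := by
      ext x; simp [e']
    rw [this, Equiv.Perm.sign_mul, Int.units_mul_self]
  rw [sum_perm_reindex finSumFinEquiv e' v
    (fun w => β (fun i => w (Sum.inl i)) * wedge η₁ η₂ (fun i => w (Sum.inr i)))] at h
  have hw : ∀ w : Fin 2 → ι → ℝ, wedge η₁ η₂ w
      = covec η₁ (w 0) * covec η₂ (w 1) - covec η₁ (w 1) * covec η₂ (w 0) := fun w => by
    have : w = ![w 0, w 1] := by funext i; fin_cases i <;> rfl
    conv_lhs => rw [this]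
    exact wedge_one_one η₁ η₂ _ _
  simp only [e'l, e'0, e'1, hs, hw, Units.val_one, Int.cast_one, one_mul] at h
  have h2 := sum_perm_two_covectors_mul (covec η₁) (covec η₂) β.toAlternatingMap v
  -- Exchanging the first two slots exchanges `η₁` and `η₂` at the cost of a sign. Both terms of `η₁
  -- ∧ η₂` thus contribute equally and cancel the 2!.
  have h4 : ∑ σ : Equiv.Perm (Fin (k + 2)), ((Equiv.Perm.sign σ : ℤ) : ℝ) *
        (covec η₁ (v (σ 1)) * (covec η₂ (v (σ 0)) * β (fun i => v (σ i.succ.succ))))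
      = -((k.factorial : ℝ) *
        covWedge (covec η₁) (covWedge (covec η₂) β.toAlternatingMap) v) := by
    rw [← h2, ← Finset.sum_neg_distrib]
    refine Fintype.sum_equiv (Equiv.mulRight (Equiv.swap 0 1)) _ _ fun σ => ?_
    have h5 : ∀ i : Fin k, Equiv.swap (0 : Fin (k + 2)) 1 i.succ.succ = i.succ.succ := fun i =>
      Equiv.swap_apply_of_ne_of_ne (Fin.succ_ne_zero _) (by
        rw [← Fin.succ_zero_eq_one]
        exact fun h => Fin.succ_ne_zero i (Fin.succ_injective _ h))
    simp only [Equiv.coe_mulRight, Equiv.Perm.sign_mul, Equiv.Perm.mul_apply, Equiv.swap_apply_left,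
      Equiv.swap_apply_right, h5, Equiv.Perm.sign_swap (show (0 : Fin (k + 2)) ≠ 1 by simp)]
    push_cast
    rw [mul_neg_one, neg_mul, neg_neg]
    rfl
  have h3 : ((k.factorial * Nat.factorial 2 : ℕ) : ℝ) ≠ 0 := by positivity
  apply mul_left_cancel₀ h3
  rw [h]
  simp only [mul_sub, Finset.sum_sub_distrib]
  have h6 : ((k.factorial * Nat.factorial 2 : ℕ) : ℝ) *
      covWedge (covec η₁) (covWedge (covec η₂) β.toAlternatingMap) v
      = (k.factorial : ℝ) * covWedge (covec η₁) (covWedge (covec η₂) β.toAlternatingMap) v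
        - -((k.factorial : ℝ) *
        covWedge (covec η₁) (covWedge (covec η₂) β.toAlternatingMap) v) := by
    simp [Nat.factorial]; ring
  rw [h6, ← h4, ← h2]
  congr 1
  · refine Finset.sum_congr rfl fun σ _ => ?_
    rw [mul_left_comm, mul_comm (β _), mul_assoc, mul_assoc]
    rfl
  · refine Finset.sum_congr rfl fun σ _ => ?_
    rw [mul_left_comm, mul_comm (β _), mul_assoc, mul_assoc]

theorem wedge_two_one (α : Form ι 2) (β : Form ι 1) (x y z : ι → ℝ) :
    wedge α β ![x, y, z]
      = α ![x, y] * β ![z] - α ![x, z] * β ![y] + α ![y, z] * β ![x] := by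
  rw [wedge_one_right, covWedge_apply, Fin.sum_univ_three]
  have h0 : (0 : Fin 3).removeNth ![x, y, z] = ![y, z] := by funext i; fin_cases i <;> rfl
  have h1 : (1 : Fin 3).removeNth ![x, y, z] = ![x, z] := by funext i; fin_cases i <;> rfl
  have h2 : (2 : Fin 3).removeNth ![x, y, z] = ![x, y] := by funext i; fin_cases i <;> rfl
  rw [h0, h1, h2]
  simp [covec]
  ring

theorem wedge_one_two_apply (α : Form ι 1) (β : Form ι 2) (x y z : ι → ℝ) :
    wedge α β ![x, y, z]
      = α ![x] * β ![y, z] - α ![y] * β ![x, z] + α ![z] * β ![x, y] := by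
  rw [wedge_one_two, covWedge_apply, Fin.sum_univ_three]
  have h0 : (0 : Fin 3).removeNth ![x, y, z] = ![y, z] := by funext i; fin_cases i <;> rfl
  have h1 : (1 : Fin 3).removeNth ![x, y, z] = ![x, z] := by funext i; fin_cases i <;> rfl
  have h2 : (2 : Fin 3).removeNth ![x, y, z] = ![x, y] := by funext i; fin_cases i <;> rfl
  rw [h0, h1, h2]
  simp [covec]
  ring

end WedgeAlgebra

/-! ### Hodge duals in components: divergences, and the product of *H with F -/

section HodgeCalculus

variable {ι : Type} [Fintype ι] [DecidableEq ι]

theorem form_ext_cvec {k : ℕ} {α β : Form ι k}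
    (h : ∀ i : Fin k → ι, α (fun r => cvec (i r)) = β (fun r => cvec (i r))) : α = β := by
  have h1 : α.toMultilinearMap = β.toMultilinearMap := by
    refine Module.Basis.ext_multilinear (fun _ => Pi.basisFun ℝ ι) fun v => ?_
    simp only [Pi.basisFun_apply]
    exact h v
  ext v
  exact congrArg (fun f => f v) h1

/-- The determinant of `D` vectors of the `D`-dimensional coordinate space. -/
def detForm {D : ℕ} (o : Fin D ≃ ι) : (ι → ℝ) [⋀^Fin D]→ₗ[ℝ] ℝ :=
  (Matrix.detRowAlternating (R := ℝ) (n := Fin D)).compLinearMap (LinearMap.funLeft ℝ ℝ o)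

/-- D + 1 vectors in a D-dimensional space are dependent. The contraction identities
`sum_detForm_one`, `sum_detForm_two` and `sum_detForm_three` are expansions of this vanishing. -/
theorem covWedge_detForm {D : ℕ} (o : Fin D ≃ ι) (l : (ι → ℝ) →ₗ[ℝ] ℝ) :
    covWedge l (detForm o) = 0 := by
  ext v
  refine (covWedge l (detForm o)).map_linearDependent v fun hv => ?_
  have h1 := hv.fintype_card_le_finrank
  rw [Module.finrank_fintype_fun_eq_card, Fintype.card_fin, ← Fintype.card_congr o,
    Fintype.card_fin] at h1
  omega

theorem vol_apply {D : ℕ} {κ : Type} [Fintype κ] [DecidableEq κ] (G : Matrix ι ι ℝ)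
    (e : κ ≃ Fin D) (o : Fin D ≃ ι) (w : κ → ι → ℝ) :
    vol G (e.trans o) w = √G.det * detForm o (fun r => w (e.symm r)) := by
  have h : (Matrix.detRowAlternating (R := ℝ) (n := κ)) (fun r => w r ∘ (e.trans o))
      = (Matrix.detRowAlternating (R := ℝ) (n := Fin D)) (fun r => w (e.symm r) ∘ o) := by
    change Matrix.det (Matrix.of fun r => w r ∘ (e.trans o))
      = Matrix.det (Matrix.of fun r => w (e.symm r) ∘ o)
    rw [← Matrix.det_submatrix_equiv_self e.symm]
    congr 1
    ext r s
    simp [Matrix.submatrix]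
  exact congrArg (fun t => √G.det * t) h

theorem alternatingMap_sum_apply {κ X : Type} [Fintype κ] (s : Finset X)
    (f : X → (ι → ℝ) [⋀^κ]→ₗ[ℝ] ℝ) (w : κ → ι → ℝ) : (∑ x ∈ s, f x) w = ∑ x ∈ s, f x w := by
  classical
  induction s using Finset.induction_on with
  | empty => simp
  | insert a s ha ih => rw [Finset.sum_insert ha, Finset.sum_insert ha, AlternatingMap.add_apply, ih]

theorem hodge_apply {D p q : ℕ} (G : Matrix ι ι ℝ) (o : Fin D ≃ ι) (h : p + q = D)
    (α : Form ι p) (w : Fin q → ι → ℝ) :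
    hodge G o h α w = (p.factorial : ℝ)⁻¹ * ∑ a : Fin p → ι, α (fun r => sharp G (a r)) *
      (√G.det * detForm o (fun r => Sum.elim (fun s => cvec (a s)) w
        (finSumFinEquiv.symm ((finCongr h).symm r)))) := by
  have h1 : hodge G o h α w = (p.factorial : ℝ)⁻¹ • (∑ a : Fin p → ι,
      α (fun r => sharp G (a r)) •
        fillLeft (vol G ((finSumFinEquiv.trans (finCongr h)).trans o)) (fun r => cvec (a r))) w :=
    rfl
  rw [h1, alternatingMap_sum_apply, smul_eq_mul]
  congr 1
  refine Finset.sum_congr rfl fun a _ => ?_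
  rw [AlternatingMap.smul_apply, smul_eq_mul]
  congr 1
  have h2 := vol_apply G (finSumFinEquiv.trans (finCongr h)) o (Sum.elim (fun s => cvec (a s)) w)
  simp only [Equiv.symm_trans_apply] at h2
  rw [← h2]
  rfl

theorem sum_fin_two_pi {f : (Fin 2 → ι) → ℝ} :
    ∑ a : Fin 2 → ι, f a = ∑ a, ∑ b, f ![a, b] := by
  rw [← Fintype.sum_prod_type']
  exact Fintype.sum_equiv (finTwoArrowEquiv ι) _ _ fun a => by
    congr 1; funext i; fin_cases i <;> rfl

theorem sum_fin_three_pi {f : (Fin 3 → ι) → ℝ} :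
    ∑ a : Fin 3 → ι, f a = ∑ a, ∑ b, ∑ c, f ![a, b, c] := by
  rw [← (Fin.consEquiv (fun _ : Fin 3 => ι)).sum_comp, Fintype.sum_prod_type]
  refine Finset.sum_congr rfl fun a _ => ?_
  rw [sum_fin_two_pi]
  rfl

/-- The dual is a combination of the constant forms det(∂_a, ∂_b, ·) with functions as coefficients,
so that exterior differentiation only sees the densities √g α^{ab}. -/
theorem hodge_two_apply {q : ℕ} (G : Matrix ι ι ℝ) (o : Fin (q + 2) ≃ ι) (h : 2 + q = q + 2)
    (α : Form ι 2) (w : Fin q → ι → ℝ) :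
    hodge G o h α w = ∑ a, ∑ b, (1 / 2 * (√G.det * α ![sharp G a, sharp G b])) *
      detForm o (Matrix.vecCons (cvec a) (Matrix.vecCons (cvec b) w)) := by
  rw [hodge_apply, sum_fin_two_pi, Finset.mul_sum]
  refine Finset.sum_congr rfl fun a _ => ?_
  rw [Finset.mul_sum]
  refine Finset.sum_congr rfl fun b _ => ?_
  have h1 : (fun r => Sum.elim (fun s => cvec (![a, b] s)) w
        (finSumFinEquiv.symm ((finCongr h).symm r)))
      = Matrix.vecCons (cvec a) (Matrix.vecCons (cvec b) w) := by
    funext r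
    obtain ⟨x, rfl⟩ : ∃ x, r = finCongr h (finSumFinEquiv x) :=
      ⟨finSumFinEquiv.symm ((finCongr h).symm r), by simp⟩
    rw [Equiv.symm_apply_apply, Equiv.symm_apply_apply]
    rcases x with x | x
    · fin_cases x <;> rfl
    · have : finCongr h (finSumFinEquiv (Sum.inr x)) = x.succ.succ := by
        ext; simp
      rw [this]
      rfl
  have h2 : (fun r => sharp G (![a, b] r)) = ![sharp G a, sharp G b] := by
    funext r; fin_cases r <;> rfl
  rw [h1, h2]
  simp only [Nat.factorial]
  push_cast
  ring

theorem hodge_three_apply {q : ℕ} (G : Matrix ι ι ℝ) (o : Fin (q + 3) ≃ ι) (h : 3 + q = q + 3)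
    (α : Form ι 3) (w : Fin q → ι → ℝ) :
    hodge G o h α w = ∑ a, ∑ b, ∑ c,
      (1 / 6 * (√G.det * α ![sharp G a, sharp G b, sharp G c])) *
      detForm o (Matrix.vecCons (cvec a) (Matrix.vecCons (cvec b) (Matrix.vecCons (cvec c) w))) := by
  rw [hodge_apply, sum_fin_three_pi, Finset.mul_sum]
  refine Finset.sum_congr rfl fun a _ => ?_
  rw [Finset.mul_sum]
  refine Finset.sum_congr rfl fun b _ => ?_
  rw [Finset.mul_sum]
  refine Finset.sum_congr rfl fun c _ => ?_
  have h1 : (fun r => Sum.elim (fun s => cvec (![a, b, c] s)) w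
        (finSumFinEquiv.symm ((finCongr h).symm r)))
      = Matrix.vecCons (cvec a) (Matrix.vecCons (cvec b) (Matrix.vecCons (cvec c) w)) := by
    funext r
    obtain ⟨x, rfl⟩ : ∃ x, r = finCongr h (finSumFinEquiv x) :=
      ⟨finSumFinEquiv.symm ((finCongr h).symm r), by simp⟩
    rw [Equiv.symm_apply_apply, Equiv.symm_apply_apply]
    rcases x with x | x
    · fin_cases x <;> rfl
    · have : finCongr h (finSumFinEquiv (Sum.inr x)) = x.succ.succ.succ := by
        ext; simp
      rw [this]
      rfl
  have h2 : (fun r => sharp G (![a, b, c] r)) = ![sharp G a, sharp G b, sharp G c] := by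
    funext r; fin_cases r <;> rfl
  rw [h1, h2]
  simp only [Nat.factorial]
  push_cast
  ring

theorem removeNth_zero_vecCons {X : Type} {k : ℕ} (a : X) (w : Fin k → X) :
    (0 : Fin (k + 1)).removeNth (Matrix.vecCons a w) = w := by
  funext i; rfl

theorem removeNth_succ_vecCons {X : Type} {k : ℕ} (a : X) (w : Fin (k + 1) → X)
    (i : Fin (k + 1)) :
    i.succ.removeNth (Matrix.vecCons a w) = Matrix.vecCons a (i.removeNth w) := by
  funext j
  refine Fin.cases ?_ (fun j => ?_) j
  · simp [Fin.removeNth]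
  · simp [Fin.removeNth]

/-- This is the expansion of l ∧ det = 0 at the vectors (a, v), with the term containing l(a)
isolated. -/
theorem sum_detForm_one {q : ℕ} (o : Fin (q + 1) ≃ ι) (l : (ι → ℝ) →ₗ[ℝ] ℝ) (a : ι → ℝ)
    (v : Fin (q + 1) → ι → ℝ) :
    ∑ i : Fin (q + 1), (-1) ^ (i : ℕ) *
        (l (v i) * detForm o (Matrix.vecCons a (i.removeNth v)))
      = l a * detForm o v := by
  have h := congrArg (fun f => f (Matrix.vecCons a v)) (covWedge_detForm o l)
  simp only [covWedge_apply, AlternatingMap.zero_apply] at h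
  rw [Fin.sum_univ_succ] at h
  simp only [removeNth_zero_vecCons, removeNth_succ_vecCons, Matrix.cons_val_zero,
    Matrix.cons_val_succ, Fin.val_succ, pow_succ, Fin.val_zero, pow_zero] at h
  simp only [mul_neg, mul_one, neg_mul, Finset.sum_neg_distrib, one_mul] at h
  linarith

/-- The previous identity at the tuple (b, v), with the term containing l(b) isolated. -/
theorem sum_detForm_two {q : ℕ} (o : Fin (q + 2) ≃ ι) (l : (ι → ℝ) →ₗ[ℝ] ℝ) (a b : ι → ℝ)
    (v : Fin (q + 1) → ι → ℝ) :
    ∑ i : Fin (q + 1), (-1) ^ (i : ℕ) *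
        (l (v i) * detForm o (Matrix.vecCons a (Matrix.vecCons b (i.removeNth v))))
      = l b * detForm o (Matrix.vecCons a v) - l a * detForm o (Matrix.vecCons b v) := by
  have h := sum_detForm_one o l a (Matrix.vecCons b v)
  rw [Fin.sum_univ_succ] at h
  simp only [removeNth_zero_vecCons, removeNth_succ_vecCons, Matrix.cons_val_zero,
    Matrix.cons_val_succ, Fin.val_succ, pow_succ, Fin.val_zero, pow_zero] at h
  simp only [mul_neg, mul_one, neg_mul, Finset.sum_neg_distrib, one_mul] at h
  linarith

theorem sum_detForm_three {q : ℕ} (o : Fin (q + 3) ≃ ι) (l : (ι → ℝ) →ₗ[ℝ] ℝ) (a b c : ι → ℝ)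
    (v : Fin (q + 1) → ι → ℝ) :
    ∑ i : Fin (q + 1), (-1) ^ (i : ℕ) *
        (l (v i) * detForm o
          (Matrix.vecCons a (Matrix.vecCons b (Matrix.vecCons c (i.removeNth v)))))
      = l a * detForm o (Matrix.vecCons b (Matrix.vecCons c v))
        - l b * detForm o (Matrix.vecCons a (Matrix.vecCons c v))
        + l c * detForm o (Matrix.vecCons a (Matrix.vecCons b v)) := by
  have h := sum_detForm_two o l a b (Matrix.vecCons c v)
  rw [Fin.sum_univ_succ] at h
  simp only [removeNth_zero_vecCons, removeNth_succ_vecCons, Matrix.cons_val_zero,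
    Matrix.cons_val_succ, Fin.val_succ, pow_succ, Fin.val_zero, pow_zero] at h
  simp only [mul_neg, mul_one, neg_mul, Finset.sum_neg_distrib, one_mul] at h
  linarith

theorem form_two_swap (α : Form ι 2) (x y : ι → ℝ) : α ![y, x] = -α ![x, y] := by
  have h := α.toAlternatingMap.map_swap ![x, y] (show (0 : Fin 2) ≠ 1 by simp)
  have e : (![x, y] ∘ Equiv.swap (0 : Fin 2) 1) = ![y, x] := by
    funext r; fin_cases r <;> rfl
  rw [e] at h
  exact h

theorem form_three_swap₁ (α : Form ι 3) (x y z : ι → ℝ) : α ![y, x, z] = -α ![x, y, z] := by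
  have h := α.toAlternatingMap.map_swap ![x, y, z] (show (0 : Fin 3) ≠ 1 by simp)
  have e : (![x, y, z] ∘ Equiv.swap (0 : Fin 3) 1) = ![y, x, z] := by
    funext r; fin_cases r <;> rfl
  rw [e] at h
  exact h

theorem form_three_swap₂ (α : Form ι 3) (x y z : ι → ℝ) : α ![x, z, y] = -α ![x, y, z] := by
  have h := α.toAlternatingMap.map_swap ![x, y, z] (show (1 : Fin 3) ≠ 2 by simp)
  have e : (![x, y, z] ∘ Equiv.swap (1 : Fin 3) 2) = ![x, z, y] := by
    funext r; fin_cases r <;> rfl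
  rw [e] at h
  exact h

theorem differentiableAt_sum_smul_form {X : Type} [Fintype X] {k : ℕ}
    {c : X → (ι → ℝ) → ℝ} {x : ι → ℝ}
    (hc : ∀ a, DifferentiableAt ℝ (c a) x) (K : X → Form ι k) :
    DifferentiableAt ℝ (fun y => ∑ a, c a y • K a) x :=
  DifferentiableAt.fun_sum fun a _ => (hc a).smul_const (K a)

theorem fderiv_sum_mul_const {X : Type} [Fintype X] {c : X → (ι → ℝ) → ℝ} {x : ι → ℝ}
    (hc : ∀ a, DifferentiableAt ℝ (c a) x) (r : X → ℝ) (w : ι → ℝ) :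
    fderiv ℝ (fun y => ∑ a, c a y * r a) x w = ∑ a, fderiv ℝ (c a) x w * r a := by
  rw [fderiv_fun_sum fun a _ => (hc a).mul_const (r a)]
  simp only [sum_apply]
  refine Finset.sum_congr rfl fun a _ => ?_
  rw [fderiv_mul_const (hc a)]
  simp [mul_comm]

/-- The exterior derivative of `∑ c_a K_a` for constant forms `K_a`. -/
theorem extDeriv_sum_smul {X : Type} [Fintype X] {k : ℕ} {w : (ι → ℝ) → Form ι k}
    {c : X → (ι → ℝ) → ℝ} {x : ι → ℝ}
    (hc : ∀ a, DifferentiableAt ℝ (c a) x) (K : X → Form ι k)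
    (hw : ∀ y, w y = ∑ a, c a y • K a) (v : Fin (k + 1) → ι → ℝ) :
    extDeriv w x v = ∑ a, ∑ i : Fin (k + 1), (-1) ^ (i : ℕ) *
      (fderiv ℝ (c a) x (v i) * K a (i.removeNth v)) := by
  have h0 : w = fun y => ∑ a, c a y • K a := funext hw
  rw [h0, extDeriv_apply (differentiableAt_sum_smul_form hc K), Finset.sum_comm]
  refine Finset.sum_congr rfl fun i _ => ?_
  have h1 : (fun y => (∑ a, c a y • K a) (i.removeNth v))
      = fun y => ∑ a, c a y * K a (i.removeNth v) := by
    funext y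
    rw [ContinuousAlternatingMap.sum_apply]
    rfl
  rw [h1, fderiv_sum_mul_const hc, zsmul_eq_mul, Finset.mul_sum]
  push_cast
  rfl

/-- The codifferential in coordinates: `sum_detForm_two` converts the antisymmetrised derivative of
the densities `T` into two divergences. They agree because `T` is antisymmetric, which uses up the
factor 1/2. -/
theorem extDeriv_hodge_two {q : ℕ} (o : Fin (q + 2) ≃ ι) (h : 2 + q = q + 2)
    (f : (ι → ℝ) → ℝ) (g : (ι → ℝ) → Matrix ι ι ℝ) (α : (ι → ℝ) → Form ι 2) (x : ι → ℝ)
    (T : ι → ι → (ι → ℝ) → ℝ)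
    (hT : ∀ a b y, T a b y = f y * (√(g y).det * α y ![sharp (g y) a, sharp (g y) b]))
    (hd : ∀ a b, DifferentiableAt ℝ (T a b) x) (v : Fin (q + 1) → ι → ℝ) :
    extDeriv (fun y => f y • hodge (g y) o h (α y)) x v
      = ∑ b, -(∑ a, pd a (T a b) x) * detForm o (Matrix.vecCons (cvec b) v) := by
  let K : ι × ι → Form ι q := fun a =>
    (1 / 2 : ℝ) • toForm (((detForm o).curryLeft (cvec a.1)).curryLeft (cvec a.2))
  rw [extDeriv_sum_smul (c := fun a : ι × ι => T a.1 a.2) (fun a => hd _ _) K]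
  · have hsum : ∀ a : ι × ι, ∑ i : Fin (q + 1), (-1) ^ (i : ℕ) *
        (fderiv ℝ (T a.1 a.2) x (v i) * K a (i.removeNth v))
        = 1 / 2 * (pd a.2 (T a.1 a.2) x * detForm o (Matrix.vecCons (cvec a.1) v)
          - pd a.1 (T a.1 a.2) x * detForm o (Matrix.vecCons (cvec a.2) v)) := by
      intro a
      have := sum_detForm_two o (fderiv ℝ (T a.1 a.2) x).toLinearMap (cvec a.1) (cvec a.2) v
      simp only [ContinuousLinearMap.coe_coe] at this
      unfold pd
      rw [← this, Finset.mul_sum]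
      refine Finset.sum_congr rfl fun i _ => ?_
      change (-1) ^ (i : ℕ) * (_ * ((1 / 2 : ℝ) * detForm o
        (Matrix.vecCons (cvec a.1) (Matrix.vecCons (cvec a.2) (i.removeNth v))))) = _
      ring
    have hanti : ∀ a b, pd b (T a b) x = -pd b (T b a) x := by
      intro a b
      have : T a b = fun y => -T b a y := by
        funext y
        rw [hT, hT, form_two_swap]
        ring
      unfold pd
      rw [this, fderiv_fun_neg]
      rfl
    simp only [hsum]
    rw [Fintype.sum_prod_type]
    simp only [mul_sub, Finset.sum_sub_distrib]
    rw [Finset.sum_comm (f := fun a b => 1 / 2 * (pd a (T a b) x *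
      detForm o (Matrix.vecCons (cvec b) v))), ← Finset.sum_sub_distrib]
    refine Finset.sum_congr rfl fun b _ => ?_
    rw [← Finset.sum_sub_distrib, ← Finset.sum_neg_distrib, Finset.sum_mul]
    refine Finset.sum_congr rfl fun a _ => ?_
    rw [hanti b a]
    ring
  · intro y
    ext w
    change f y * hodge (g y) o h (α y) w = _
    rw [hodge_two_apply, ContinuousAlternatingMap.sum_apply, Fintype.sum_prod_type, Finset.mul_sum]
    refine Finset.sum_congr rfl fun a _ => ?_
    rw [Finset.mul_sum]
    refine Finset.sum_congr rfl fun b _ => ?_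
    change _ = T a b y * ((1 / 2 : ℝ) * detForm o
      (Matrix.vecCons (cvec a) (Matrix.vecCons (cvec b) w)))
    rw [hT]
    ring

/-- The exterior derivative produces one divergence of `T` for each of its three indices. By
antisymmetry all three reduce to the one assumed to vanish. -/
theorem extDeriv_hodge_three_eq_zero {q : ℕ} (o : Fin (q + 3) ≃ ι) (h : 3 + q = q + 3)
    (f : (ι → ℝ) → ℝ) (g : (ι → ℝ) → Matrix ι ι ℝ) (α : (ι → ℝ) → Form ι 3) (x : ι → ℝ)
    (T : ι → ι → ι → (ι → ℝ) → ℝ)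
    (hT : ∀ a b c y, T a b c y
      = f y * (√(g y).det * α y ![sharp (g y) a, sharp (g y) b, sharp (g y) c]))
    (hd : ∀ a b c, DifferentiableAt ℝ (T a b c) x)
    (hz : ∀ b c, ∑ a, pd a (T a b c) x = 0) :
    extDeriv (fun y => f y • hodge (g y) o h (α y)) x = 0 := by
  ext v
  let K : ι × ι × ι → Form ι q := fun a => (1 / 6 : ℝ) • toForm
    ((((detForm o).curryLeft (cvec a.1)).curryLeft (cvec a.2.1)).curryLeft (cvec a.2.2))
  rw [extDeriv_sum_smul (c := fun a : ι × ι × ι => T a.1 a.2.1 a.2.2) (fun a => hd _ _ _) K]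
  · have hsum : ∀ a : ι × ι × ι, ∑ i : Fin (q + 1), (-1) ^ (i : ℕ) *
        (fderiv ℝ (T a.1 a.2.1 a.2.2) x (v i) * K a (i.removeNth v))
        = 1 / 6 * (pd a.1 (T a.1 a.2.1 a.2.2) x *
            detForm o (Matrix.vecCons (cvec a.2.1) (Matrix.vecCons (cvec a.2.2) v))
          - pd a.2.1 (T a.1 a.2.1 a.2.2) x *
            detForm o (Matrix.vecCons (cvec a.1) (Matrix.vecCons (cvec a.2.2) v))
          + pd a.2.2 (T a.1 a.2.1 a.2.2) x *
            detForm o (Matrix.vecCons (cvec a.1) (Matrix.vecCons (cvec a.2.1) v))) := by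
      intro a
      have := sum_detForm_three o (fderiv ℝ (T a.1 a.2.1 a.2.2) x).toLinearMap
        (cvec a.1) (cvec a.2.1) (cvec a.2.2) v
      simp only [ContinuousLinearMap.coe_coe] at this
      unfold pd
      rw [← this, Finset.mul_sum]
      refine Finset.sum_congr rfl fun i _ => ?_
      change (-1) ^ (i : ℕ) * (_ * ((1 / 6 : ℝ) * detForm o (Matrix.vecCons (cvec a.1)
        (Matrix.vecCons (cvec a.2.1) (Matrix.vecCons (cvec a.2.2) (i.removeNth v)))))) = _
      ring
    have hanti₁ : ∀ d a b c, pd d (T b a c) x = -pd d (T a b c) x := by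
      intro d a b c
      have : T b a c = fun y => -T a b c y := by
        funext y
        rw [hT, hT, form_three_swap₁]
        ring
      unfold pd
      rw [this, fderiv_fun_neg]
      rfl
    have hanti₂ : ∀ d a b c, pd d (T a c b) x = -pd d (T a b c) x := by
      intro d a b c
      have : T a c b = fun y => -T a b c y := by
        funext y
        rw [hT, hT, form_three_swap₂]
        ring
      unfold pd
      rw [this, fderiv_fun_neg]
      rfl
    have hz₂ : ∀ a c, ∑ b, pd b (T a b c) x = 0 := by
      intro a c
      rw [← neg_eq_zero, ← hz a c, ← Finset.sum_neg_distrib]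
      exact Finset.sum_congr rfl fun b _ => (hanti₁ b a b c).symm
    have hz₃ : ∀ a b, ∑ c, pd c (T a b c) x = 0 := by
      intro a b
      rw [← neg_eq_zero, ← hz₂ a b, ← Finset.sum_neg_distrib]
      exact Finset.sum_congr rfl fun c _ => (hanti₂ c a b c).symm
    simp only [hsum]
    rw [Fintype.sum_prod_type]
    simp only [Fintype.sum_prod_type, mul_sub, mul_add, Finset.sum_sub_distrib,
      Finset.sum_add_distrib]
    have e1 : ∑ a, ∑ b, ∑ c, 1 / 6 * (pd a (T a b c) x *
        detForm o (Matrix.vecCons (cvec b) (Matrix.vecCons (cvec c) v))) = 0 := by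
      rw [Finset.sum_comm]
      refine Finset.sum_eq_zero fun b _ => ?_
      rw [Finset.sum_comm]
      refine Finset.sum_eq_zero fun c _ => ?_
      rw [← Finset.mul_sum, ← Finset.sum_mul, hz, zero_mul, mul_zero]
    have e2 : ∑ a, ∑ b, ∑ c, 1 / 6 * (pd b (T a b c) x *
        detForm o (Matrix.vecCons (cvec a) (Matrix.vecCons (cvec c) v))) = 0 := by
      refine Finset.sum_eq_zero fun a _ => ?_
      rw [Finset.sum_comm]
      refine Finset.sum_eq_zero fun c _ => ?_
      rw [← Finset.mul_sum, ← Finset.sum_mul, hz₂, zero_mul, mul_zero]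
    have e3 : ∑ a, ∑ b, ∑ c, 1 / 6 * (pd c (T a b c) x *
        detForm o (Matrix.vecCons (cvec a) (Matrix.vecCons (cvec b) v))) = 0 := by
      refine Finset.sum_eq_zero fun a _ => Finset.sum_eq_zero fun b _ => ?_
      rw [← Finset.mul_sum, ← Finset.sum_mul, hz₃, zero_mul, mul_zero]
    rw [e1, e2, e3]
    simp
  · intro y
    ext w
    change f y * hodge (g y) o h (α y) w = _
    rw [hodge_three_apply, ContinuousAlternatingMap.sum_apply]
    simp only [Fintype.sum_prod_type]
    rw [Finset.mul_sum]
    refine Finset.sum_congr rfl fun a _ => ?_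
    rw [Finset.mul_sum]
    refine Finset.sum_congr rfl fun b _ => ?_
    rw [Finset.mul_sum]
    refine Finset.sum_congr rfl fun c _ => ?_
    change _ = T a b c y * ((1 / 6 : ℝ) * detForm o
      (Matrix.vecCons (cvec a) (Matrix.vecCons (cvec b) (Matrix.vecCons (cvec c) w))))
    rw [hT]
    ring

/-- Wedging with `l` contracts one index of `α` with `l`. The three terms of `sum_detForm_three`
coincide by antisymmetry, hence the coefficient 1/2 in place of 1/6. -/
theorem covWedge_hodge_three {q : ℕ} (o : Fin (q + 3) ≃ ι) (h : 3 + q = q + 3)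
    (G : Matrix ι ι ℝ) (α : Form ι 3) (l : (ι → ℝ) →ₗ[ℝ] ℝ) (v : Fin (q + 1) → ι → ℝ) :
    covWedge l (hodge G o h α).toAlternatingMap v = ∑ b, ∑ c,
      (1 / 2 * ∑ a, √G.det * α ![sharp G a, sharp G b, sharp G c] * l (cvec a)) *
        detForm o (Matrix.vecCons (cvec b) (Matrix.vecCons (cvec c) v)) := by
  set S : ι → ι → ι → ℝ := fun a b c => √G.det * α ![sharp G a, sharp G b, sharp G c] with hS
  set Δ : ι → ι → ℝ := fun b c =>
    detForm o (Matrix.vecCons (cvec b) (Matrix.vecCons (cvec c) v)) with hΔ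
  have s1 : ∀ a b c, S b a c = -S a b c := fun a b c => by
    simp only [hS]; rw [form_three_swap₁]; ring
  have s2 : ∀ a b c, S a c b = -S a b c := fun a b c => by
    simp only [hS]; rw [form_three_swap₂]; ring
  rw [covWedge_apply]
  have h1 : ∀ i : Fin (q + 1), (-1) ^ (i : ℕ) *
      (l (v i) * (hodge G o h α).toAlternatingMap (i.removeNth v))
      = ∑ a, ∑ b, ∑ c, 1 / 6 * S a b c * ((-1) ^ (i : ℕ) * (l (v i) * detForm o
        (Matrix.vecCons (cvec a) (Matrix.vecCons (cvec b)
          (Matrix.vecCons (cvec c) (i.removeNth v)))))) := by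
    intro i
    change _ * (_ * hodge G o h α _) = _
    rw [hodge_three_apply]
    simp only [Finset.mul_sum]
    refine Finset.sum_congr rfl fun a _ => Finset.sum_congr rfl fun b _ =>
      Finset.sum_congr rfl fun c _ => ?_
    simp only [hS]
    ring
  have h2 : ∀ a b c, ∑ i : Fin (q + 1), 1 / 6 * S a b c * ((-1) ^ (i : ℕ) * (l (v i) * detForm o
        (Matrix.vecCons (cvec a) (Matrix.vecCons (cvec b)
          (Matrix.vecCons (cvec c) (i.removeNth v))))))
      = 1 / 6 * S a b c * l (cvec a) * Δ b c - 1 / 6 * S a b c * l (cvec b) * Δ a c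
        + 1 / 6 * S a b c * l (cvec c) * Δ a b := by
    intro a b c
    rw [← Finset.mul_sum, sum_detForm_three]
    ring
  have h3 : ∑ i : Fin (q + 1), (-1) ^ (i : ℕ) *
      (l (v i) * (hodge G o h α).toAlternatingMap (i.removeNth v))
      = ∑ a, ∑ b, ∑ c, (1 / 6 * S a b c * l (cvec a) * Δ b c
        - 1 / 6 * S a b c * l (cvec b) * Δ a c + 1 / 6 * S a b c * l (cvec c) * Δ a b) := by
    rw [Finset.sum_congr rfl fun i _ => h1 i, Finset.sum_comm]
    refine Finset.sum_congr rfl fun a _ => ?_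
    rw [Finset.sum_comm]
    refine Finset.sum_congr rfl fun b _ => ?_
    rw [Finset.sum_comm]
    exact Finset.sum_congr rfl fun c _ => h2 a b c
  rw [h3]
  simp only [Finset.sum_add_distrib, Finset.sum_sub_distrib]
  have e1 : ∑ a, ∑ b, ∑ c, 1 / 6 * S a b c * l (cvec a) * Δ b c
      = ∑ b, ∑ c, ∑ a, 1 / 6 * S a b c * l (cvec a) * Δ b c := by
    rw [Finset.sum_comm]
    exact Finset.sum_congr rfl fun b _ => Finset.sum_comm
  have e2 : ∑ a, ∑ b, ∑ c, 1 / 6 * S a b c * l (cvec b) * Δ a c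
      = -∑ b, ∑ c, ∑ a, 1 / 6 * S a b c * l (cvec a) * Δ b c := by
    rw [← Finset.sum_neg_distrib]
    refine Finset.sum_congr rfl fun b _ => ?_
    rw [Finset.sum_comm, ← Finset.sum_neg_distrib]
    refine Finset.sum_congr rfl fun c _ => ?_
    rw [← Finset.sum_neg_distrib]
    refine Finset.sum_congr rfl fun a _ => ?_
    rw [s1 a b c]
    ring
  have e3 : ∑ a, ∑ b, ∑ c, 1 / 6 * S a b c * l (cvec c) * Δ a b
      = ∑ b, ∑ c, ∑ a, 1 / 6 * S a b c * l (cvec a) * Δ b c := by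
    refine Finset.sum_congr rfl fun b _ => Finset.sum_congr rfl fun c _ =>
      Finset.sum_congr rfl fun a _ => ?_
    rw [s2 b a c, s1 a b c]
    ring
  rw [e1, e2, e3, sub_neg_eq_add, ← Finset.sum_add_distrib, ← Finset.sum_add_distrib]
  refine Finset.sum_congr rfl fun b _ => ?_
  rw [← Finset.sum_add_distrib, ← Finset.sum_add_distrib]
  refine Finset.sum_congr rfl fun c _ => ?_
  rw [← Finset.sum_add_distrib, ← Finset.sum_add_distrib, Finset.mul_sum, Finset.sum_mul]
  refine Finset.sum_congr rfl fun a _ => ?_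
  ring

/-- Two successive contractions leave one free index `b`. The result is written over the same basis
det(∂_b, ·) as `extDeriv_hodge_two`, so that the two sides of Maxwell's equation can be compared
coefficientwise. -/
theorem wedge_hodge_three {q : ℕ} (o : Fin (q + 3) ≃ ι) (h : 3 + q = q + 3)
    (G : Matrix ι ι ℝ) (α : Form ι 3) (η₁ η₂ : Form ι 1) (v : Fin (q + 2) → ι → ℝ) :
    wedge (hodge G o h α) (wedge η₁ η₂) v = ∑ b,
      (√G.det * ∑ c, ∑ a, α ![sharp G c, sharp G a, sharp G b] *
        (1 / 2 * wedge η₁ η₂ ![cvec c, cvec a])) *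
        detForm o (Matrix.vecCons (cvec b) v) := by
  rw [wedge_wedge_one_one, covWedge_apply]
  set S : ι → ι → ι → ℝ := fun a b c => √G.det * α ![sharp G a, sharp G b, sharp G c] with hS
  have s1 : ∀ a b c, S b a c = -S a b c := fun a b c => by
    simp only [hS]; rw [form_three_swap₁]; ring
  have s2 : ∀ a b c, S a c b = -S a b c := fun a b c => by
    simp only [hS]; rw [form_three_swap₂]; ring
  set l₁ := covec η₁ with hl₁
  set l₂ := covec η₂ with hl₂
  have h1 : ∀ i : Fin (q + 2), (-1) ^ (i : ℕ) *
      (l₁ (v i) * covWedge l₂ (hodge G o h α).toAlternatingMap (i.removeNth v))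
      = ∑ b, ∑ c, (1 / 2 * ∑ a, S a b c * l₂ (cvec a)) * ((-1) ^ (i : ℕ) * (l₁ (v i) * detForm o
        (Matrix.vecCons (cvec b) (Matrix.vecCons (cvec c) (i.removeNth v))))) := by
    intro i
    rw [covWedge_hodge_three]
    simp only [Finset.mul_sum, Finset.sum_mul]
    refine Finset.sum_congr rfl fun a _ => Finset.sum_congr rfl fun b _ =>
      Finset.sum_congr rfl fun c _ => ?_
    simp only [hS]
    ring
  rw [Finset.sum_congr rfl fun i _ => h1 i, Finset.sum_comm]
  have h2 : ∀ b, ∑ i : Fin (q + 2), ∑ c, (1 / 2 * ∑ a, S a b c * l₂ (cvec a)) *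
      ((-1) ^ (i : ℕ) * (l₁ (v i) * detForm o
        (Matrix.vecCons (cvec b) (Matrix.vecCons (cvec c) (i.removeNth v)))))
      = ∑ c, (1 / 2 * ∑ a, S a b c * l₂ (cvec a)) *
        (l₁ (cvec c) * detForm o (Matrix.vecCons (cvec b) v))
        - ∑ c, (1 / 2 * ∑ a, S a b c * l₂ (cvec a)) *
        (l₁ (cvec b) * detForm o (Matrix.vecCons (cvec c) v)) := by
    intro b
    rw [Finset.sum_comm, ← Finset.sum_sub_distrib]
    refine Finset.sum_congr rfl fun c _ => ?_
    rw [← Finset.mul_sum, sum_detForm_two]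
    ring
  rw [Finset.sum_congr rfl fun b _ => h2 b, Finset.sum_sub_distrib]
  rw [Finset.sum_comm (f := fun b c => (1 / 2 * ∑ a, S a b c * l₂ (cvec a)) *
        (l₁ (cvec b) * detForm o (Matrix.vecCons (cvec c) v))), ← Finset.sum_sub_distrib]
  refine Finset.sum_congr rfl fun b _ => ?_
  have h3 : ∑ c, ∑ a, S c a b * (l₁ (cvec c) * l₂ (cvec a))
      = ∑ c, ∑ a, S a b c * l₂ (cvec a) * l₁ (cvec c) := by
    refine Finset.sum_congr rfl fun c _ => Finset.sum_congr rfl fun a _ => ?_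
    rw [s2 a c b, s1 c a b]; ring
  have h4 : ∑ c, ∑ a, S c a b * (l₁ (cvec a) * l₂ (cvec c))
      = -∑ c, ∑ a, S c a b * (l₁ (cvec c) * l₂ (cvec a)) := by
    rw [Finset.sum_comm, ← Finset.sum_neg_distrib]
    refine Finset.sum_congr rfl fun c _ => ?_
    rw [← Finset.sum_neg_distrib]
    refine Finset.sum_congr rfl fun a _ => ?_
    rw [s1 c a b]; ring
  have h5 : √G.det * ∑ c, ∑ a, α ![sharp G c, sharp G a, sharp G b] *
        (1 / 2 * wedge η₁ η₂ ![cvec c, cvec a])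
      = 1 / 2 * (∑ c, ∑ a, S c a b * (l₁ (cvec c) * l₂ (cvec a)))
        - 1 / 2 * ∑ c, ∑ a, S c a b * (l₁ (cvec a) * l₂ (cvec c)) := by
    simp only [Finset.mul_sum]
    rw [← Finset.sum_sub_distrib]
    refine Finset.sum_congr rfl fun c _ => ?_
    rw [← Finset.sum_sub_distrib]
    refine Finset.sum_congr rfl fun a _ => ?_
    rw [wedge_one_one]
    simp only [hS, hl₁, hl₂]
    change _ = 1 / 2 * (_ * (η₁ ![cvec c] * η₂ ![cvec a]))
      - 1 / 2 * (_ * (η₁ ![cvec a] * η₂ ![cvec c]))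
    ring
  rw [h5, h4, h3, ← Finset.sum_sub_distrib]
  have h6 : (1 / 2 * ∑ c, ∑ a, S a b c * l₂ (cvec a) * l₁ (cvec c)
      - 1 / 2 * -∑ c, ∑ a, S a b c * l₂ (cvec a) * l₁ (cvec c)) *
        detForm o (Matrix.vecCons (cvec b) v)
      = ∑ c, (∑ a, S a b c * l₂ (cvec a) * l₁ (cvec c)) *
        detForm o (Matrix.vecCons (cvec b) v) := by
    rw [← Finset.sum_mul]; ring
  rw [h6]
  refine Finset.sum_congr rfl fun c _ => ?_
  have h7 : ∑ a, S a c b * l₂ (cvec a) = -∑ a, S a b c * l₂ (cvec a) := by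
    rw [← Finset.sum_neg_distrib]
    refine Finset.sum_congr rfl fun a _ => ?_
    rw [s2 a b c]; ring
  rw [h7, ← Finset.sum_mul]
  ring

/-- Reduction of Maxwell's equation `d(f *F) = f *H ∧ F` to components. -/
theorem maxwell_of_components {j : ℕ} (o : Fin (j + 3) ≃ ι) (h₂ : 2 + (j + 1) = j + 3)
    (h₃ : 3 + j = j + 3) {X : Type} [Fintype X]
    (f : (ι → ℝ) → ℝ) (g : (ι → ℝ) → Matrix ι ι ℝ) (F : (ι → ℝ) → Form ι 2) (H : Form ι 3)
    (x : ι → ℝ) (T : ι → ι → (ι → ℝ) → ℝ)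
    (hT : ∀ a b y, T a b y = f y * (√(g y).det * F y ![sharp (g y) a, sharp (g y) b]))
    (hd : ∀ a b, DifferentiableAt ℝ (T a b) x) (η₁ η₂ : X → Form ι 1)
    (hF : F x = ∑ s, wedge (η₁ s) (η₂ s))
    (heq : ∀ b, -∑ a, pd a (T a b) x = f x * (√(g x).det * ∑ c, ∑ a,
      H ![sharp (g x) c, sharp (g x) a, sharp (g x) b] * (1 / 2 * F x ![cvec c, cvec a]))) :
    extDeriv (fun y => f y • hodge (g y) o h₂ (F y)) x
      = f x • wedge (hodge (g x) o h₃ H) (F x) := by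
  ext v
  rw [extDeriv_hodge_two (q := j + 1) o h₂ f g F x T hT hd]
  change _ = f x * wedge (hodge (g x) o h₃ H) (F x) v
  have h1 : wedge (hodge (g x) o h₃ H) (F x) v = ∑ b, (√(g x).det * ∑ c, ∑ a,
      H ![sharp (g x) c, sharp (g x) a, sharp (g x) b] * (1 / 2 * F x ![cvec c, cvec a])) *
        detForm o (Matrix.vecCons (cvec b) v) := by
    have h2 : ∀ c a : ι, F x ![cvec c, cvec a]
        = ∑ s, wedge (η₁ s) (η₂ s) ![cvec c, cvec a] := fun c a => by
      rw [hF]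
      exact ContinuousAlternatingMap.sum_apply _ _
    simp only [h2]
    rw [hF, wedge_sum_right, ContinuousAlternatingMap.sum_apply]
    rw [Finset.sum_congr rfl fun s _ => wedge_hodge_three o h₃ (g x) H (η₁ s) (η₂ s) v,
      Finset.sum_comm]
    refine Finset.sum_congr rfl fun b _ => ?_
    rw [← Finset.sum_mul, ← Finset.mul_sum, Finset.sum_comm]
    congr 2
    refine Finset.sum_congr rfl fun c _ => ?_
    rw [Finset.sum_comm]
    refine Finset.sum_congr rfl fun a _ => ?_
    rw [Finset.mul_sum, Finset.mul_sum]
  rw [h1, Finset.mul_sum]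
  refine Finset.sum_congr rfl fun b _ => ?_
  rw [heq b]
  ring

end HodgeCalculus

/-! ### Partial derivatives of functions smooth on an open set -/

section PartialDerivatives

variable {ι : Type} [Fintype ι] [DecidableEq ι]

/-- Smoothness of a function on a set. -/
abbrev SmoothOn (U : Set (ι → ℝ)) (f : (ι → ℝ) → ℝ) : Prop := ContDiffOn ℝ ∞ f U

variable {U : Set (ι → ℝ)} {x : ι → ℝ} {i j : ι} {f f' : (ι → ℝ) → ℝ}

theorem SmoothOn.differentiableAt (hf : SmoothOn U f) (hU : IsOpen U) (hx : x ∈ U) :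
    DifferentiableAt ℝ f x :=
  (hf.contDiffAt (hU.mem_nhds hx)).differentiableAt (by simp)

theorem SmoothOn.pd (hf : SmoothOn U f) (hU : IsOpen U) (i : ι) : SmoothOn U (pd i f) :=
  (hf.fderiv_of_isOpen hU (m := ∞) (by simp)).clm_apply contDiffOn_const

theorem smoothOn_sum {X : Type*} {s : Finset X} {F : X → (ι → ℝ) → ℝ}
    (h : ∀ a ∈ s, SmoothOn U (F a)) : SmoothOn U (fun y => ∑ a ∈ s, F a y) :=
  ContDiffOn.sum h

theorem pd_congr (h : Set.EqOn f f' U) (hU : IsOpen U) (hx : x ∈ U) (i : ι) :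
    pd i f x = pd i f' x := by
  unfold pd
  rw [(h.eventuallyEq_of_mem (hU.mem_nhds hx)).fderiv_eq]

theorem smoothOn_congr (hf : SmoothOn U f) (h : ∀ y ∈ U, f' y = f y) : SmoothOn U f' :=
  hf.congr h

@[simp] theorem pd_const (c : ℝ) : pd i (fun _ => c) x = 0 := by
  simp [pd]

theorem pd_add (hf : DifferentiableAt ℝ f x) (hf' : DifferentiableAt ℝ f' x) :
    pd i (fun y => f y + f' y) x = pd i f x + pd i f' x := by
  unfold pd; rw [fderiv_fun_add hf hf']; rfl

theorem pd_sub (hf : DifferentiableAt ℝ f x) (hf' : DifferentiableAt ℝ f' x) :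
    pd i (fun y => f y - f' y) x = pd i f x - pd i f' x := by
  unfold pd; rw [fderiv_fun_sub hf hf']; rfl

theorem pd_neg : pd i (fun y => -f y) x = -pd i f x := by
  unfold pd; rw [fderiv_fun_neg]; rfl

theorem pd_mul (hf : DifferentiableAt ℝ f x) (hf' : DifferentiableAt ℝ f' x) :
    pd i (fun y => f y * f' y) x = pd i f x * f' x + f x * pd i f' x := by
  unfold pd; rw [fderiv_fun_mul hf hf']; simp; ring

theorem pd_const_mul (c : ℝ) (hf : DifferentiableAt ℝ f x) :
    pd i (fun y => c * f y) x = c * pd i f x := by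
  rw [pd_mul (by fun_prop) hf]; simp

theorem pd_inv (hf : DifferentiableAt ℝ f x) (h0 : f x ≠ 0) :
    pd i (fun y => (f y)⁻¹) x = -pd i f x / f x ^ 2 := by
  unfold pd
  rw [show (fun y => (f y)⁻¹) = (fun t : ℝ => t⁻¹) ∘ f from rfl,
    ((hasDerivAt_inv h0).comp_hasFDerivAt x hf.hasFDerivAt).fderiv]
  simp
  ring

theorem pd_div (hf : DifferentiableAt ℝ f x) (hf' : DifferentiableAt ℝ f' x) (h0 : f' x ≠ 0) :
    pd i (fun y => f y / f' y) x = pd i f x / f' x - f x * pd i f' x / f' x ^ 2 := by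
  simp only [div_eq_mul_inv]
  rw [pd_mul hf (f' := fun y => (f' y)⁻¹) (hf'.inv h0), pd_inv hf' h0]; ring

theorem pd_sum {X : Type*} {s : Finset X} {F : X → (ι → ℝ) → ℝ}
    (h : ∀ a ∈ s, DifferentiableAt ℝ (F a) x) :
    pd i (fun y => ∑ a ∈ s, F a y) x = ∑ a ∈ s, pd i (F a) x := by
  unfold pd; rw [fderiv_fun_sum h]; simp

theorem pd_log (hf : DifferentiableAt ℝ f x) (h0 : f x ≠ 0) :
    pd i (fun y => Real.log (f y)) x = pd i f x / f x := by
  unfold pd; rw [fderiv.log hf h0]; simp; ring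

theorem pd_comm (hf : SmoothOn U f) (hU : IsOpen U) (hx : x ∈ U) :
    pd i (pd j f) x = pd j (pd i f) x := by
  have h1 : ContDiffAt ℝ ∞ f x := hf.contDiffAt (hU.mem_nhds hx)
  have h2 := h1.isSymmSndFDerivAt (by
    rw [minSmoothness_of_isRCLikeNormedField]
    exact WithTop.coe_le_coe.mpr (OrderTop.le_top (2 : ℕ∞)))
  have h3 : DifferentiableAt ℝ (fderiv ℝ f) x :=
    (h1.fderiv_right (m := ∞) (by simp)).differentiableAt (by simp)
  have h4 : ∀ v w : ι → ℝ, fderiv ℝ (fun y => fderiv ℝ f y v) x w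
      = fderiv ℝ (fderiv ℝ f) x w v := by
    intro v w
    rw [fderiv_clm_apply h3 (by fun_prop)]
    simp
  unfold pd
  rw [h4, h4]
  exact h2 _ _

end PartialDerivatives

/-! ### Curvature of block metrics that depend on the base coordinates only -/

section BaseFunctions

variable {α κ : Type} [Fintype α] [DecidableEq α] [Fintype κ] [DecidableEq κ]

/-- Functions of the left coordinates only. -/
def IsBasic (f : (α ⊕ κ → ℝ) → ℝ) : Prop :=
  ∀ x y : α ⊕ κ → ℝ, (∀ μ, x (Sum.inl μ) = y (Sum.inl μ)) → f x = f y

/-- The function is invariant under translation by `y - x`, which has no component along the base.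
-/
theorem IsBasic.fderiv_eq {f : (α ⊕ κ → ℝ) → ℝ} (hf : IsBasic f) {x y : α ⊕ κ → ℝ}
    (h : ∀ μ, x (Sum.inl μ) = y (Sum.inl μ)) : fderiv ℝ f x = fderiv ℝ f y := by
  have h1 : (fun z => f (z + (y - x))) = f := by
    funext z
    refine hf _ _ fun μ => ?_
    simp [h μ]
  have h2 := fderiv_comp_add_right (𝕜 := ℝ) (f := f) (x := x) (y - x)
  rw [h1] at h2
  rw [h2]
  congr 1
  abel

theorem IsBasic.pd {f : (α ⊕ κ → ℝ) → ℝ} (hf : IsBasic f) (i : α ⊕ κ) : IsBasic (pd i f) :=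
  fun x y h => by unfold ChargedKerrNUT.pd; rw [hf.fderiv_eq h]

/-- No differentiability is needed: at a point where it fails, `fderiv` is zero by convention. -/
theorem IsBasic.pd_inr {f : (α ⊕ κ → ℝ) → ℝ} (hf : IsBasic f) (k : κ) (x : α ⊕ κ → ℝ) :
    ChargedKerrNUT.pd (Sum.inr k) f x = 0 := by
  unfold ChargedKerrNUT.pd
  by_cases hd : DifferentiableAt ℝ f x
  · have h1 := hd.hasFDerivAt.hasLineDerivAt (cvec (Sum.inr k))
    have h2 : (fun t : ℝ => f (x + t • cvec (Sum.inr k))) = fun _ => f x := by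
      funext t
      refine hf _ _ fun μ => ?_
      simp [cvec]
    unfold HasLineDerivAt at h1
    rw [h2] at h1
    exact h1.unique (hasDerivAt_const _ _)
  · rw [fderiv_zero_of_not_differentiableAt hd]; rfl

theorem isBasic_const (c : ℝ) : IsBasic (fun _ : α ⊕ κ → ℝ => c) := fun _ _ _ => rfl

theorem IsBasic.mul {f f' : (α ⊕ κ → ℝ) → ℝ} (h : IsBasic f) (h' : IsBasic f') :
    IsBasic (fun y => f y * f' y) := fun x y e => by simp only [h x y e, h' x y e]

theorem IsBasic.div {f f' : (α ⊕ κ → ℝ) → ℝ} (h : IsBasic f) (h' : IsBasic f') :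
    IsBasic (fun y => f y / f' y) := fun x y e => by simp only [h x y e, h' x y e]

theorem IsBasic.sum {X : Type*} {s : Finset X} {F : X → (α ⊕ κ → ℝ) → ℝ}
    (h : ∀ a ∈ s, IsBasic (F a)) : IsBasic (fun y => ∑ a ∈ s, F a y) :=
  fun x y e => Finset.sum_congr rfl fun a ha => h a ha x y e

/-- A metric `∑ h_μ (dx^μ)² + G_ij dψ^i dψ^j` depending on the `x^μ` only; `C` is the inverse
of `G`. -/
structure BlockMetric (U : Set (α ⊕ κ → ℝ)) (g : (α ⊕ κ → ℝ) → Matrix (α ⊕ κ) (α ⊕ κ) ℝ)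
    (h : α → (α ⊕ κ → ℝ) → ℝ) (G C : κ → κ → (α ⊕ κ → ℝ) → ℝ) : Prop where
  isOpen : IsOpen U
  eq_ll : ∀ x ∈ U, ∀ μ ν, g x (Sum.inl μ) (Sum.inl ν) = if μ = ν then h μ x else 0
  eq_lr : ∀ x ∈ U, ∀ μ j, g x (Sum.inl μ) (Sum.inr j) = 0
  eq_rl : ∀ x ∈ U, ∀ i ν, g x (Sum.inr i) (Sum.inl ν) = 0
  eq_rr : ∀ x ∈ U, ∀ i j, g x (Sum.inr i) (Sum.inr j) = G i j x
  smooth_h : ∀ μ, SmoothOn U (h μ)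
  smooth_G : ∀ i j, SmoothOn U (G i j)
  smooth_C : ∀ i j, SmoothOn U (C i j)
  h_ne : ∀ x ∈ U, ∀ μ, h μ x ≠ 0
  G_symm : ∀ x ∈ U, ∀ i j, G i j x = G j i x
  C_symm : ∀ x ∈ U, ∀ i j, C i j x = C j i x
  C_mul : ∀ x ∈ U, ∀ i j, ∑ k, C i k x * G k j x = if i = j then 1 else 0
  basic_h : ∀ μ, IsBasic (h μ)
  basic_G : ∀ i j, IsBasic (G i j)
  basic_C : ∀ i j, IsBasic (C i j)

/-- `∂_ν ln h_μ` -/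
def logDer (h : α → (α ⊕ κ → ℝ) → ℝ) (ν μ : α) (x : α ⊕ κ → ℝ) : ℝ :=
  pd (Sum.inl ν) (h μ) x / h μ x

/-- `∂_μ ln √(det g)` -/
def logVol (h : α → (α ⊕ κ → ℝ) → ℝ) (G C : κ → κ → (α ⊕ κ → ℝ) → ℝ) (μ : α)
    (x : α ⊕ κ → ℝ) : ℝ :=
  1 / 2 * ∑ k, logDer h μ k x + 1 / 2 * ∑ i, ∑ j, C i j x * pd (Sum.inl μ) (G j i) x

namespace BlockMetric

variable {U : Set (α ⊕ κ → ℝ)} {g : (α ⊕ κ → ℝ) → Matrix (α ⊕ κ) (α ⊕ κ) ℝ}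
  {h : α → (α ⊕ κ → ℝ) → ℝ} {G C : κ → κ → (α ⊕ κ → ℝ) → ℝ} {x : α ⊕ κ → ℝ}

theorem left_inv (B : BlockMetric U g h G C) (hx : x ∈ U) :
    Matrix.fromBlocks (Matrix.diagonal fun μ => 1 / h μ x) 0 0
      (Matrix.of fun i j => C i j x) * g x = 1 := by
  have hg : g x = Matrix.fromBlocks (Matrix.diagonal fun μ => h μ x) 0 0
      (Matrix.of fun i j => G i j x) := by
    ext i j
    rcases i with i | i <;> rcases j with j | j
    · rw [B.eq_ll x hx]; simp [Matrix.diagonal_apply]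
    · rw [B.eq_lr x hx]; simp
    · rw [B.eq_rl x hx]; simp
    · rw [B.eq_rr x hx]; simp
  rw [hg, Matrix.fromBlocks_multiply]
  have h1 : (Matrix.diagonal fun μ => 1 / h μ x) * (Matrix.diagonal fun μ => h μ x) = 1 := by
    rw [Matrix.diagonal_mul_diagonal, ← Matrix.diagonal_one]
    congr 1
    funext μ
    exact one_div_mul_cancel (B.h_ne x hx μ)
  have h2 : (Matrix.of fun i j => C i j x) * (Matrix.of fun i j => G i j x) = 1 := by
    ext i j
    rw [Matrix.mul_apply, Matrix.one_apply]
    exact B.C_mul x hx i j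
  rw [h1, h2]
  simp

theorem inv_eq (B : BlockMetric U g h G C) (hx : x ∈ U) :
    (g x)⁻¹ = Matrix.fromBlocks (Matrix.diagonal fun μ => 1 / h μ x) 0 0
      (Matrix.of fun i j => C i j x) :=
  Matrix.inv_eq_left_inv (B.left_inv hx)

theorem isUnit (B : BlockMetric U g h G C) (hx : x ∈ U) : IsUnit (g x) :=
  .of_mul_eq_one_right _ (B.left_inv hx)

theorem inv_ll (B : BlockMetric U g h G C) (hx : x ∈ U) (μ ν : α) :
    (g x)⁻¹ (Sum.inl μ) (Sum.inl ν) = if μ = ν then 1 / h μ x else 0 := by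
  rw [B.inv_eq hx]; simp [Matrix.diagonal_apply]

theorem inv_lr (B : BlockMetric U g h G C) (hx : x ∈ U) (μ : α) (j : κ) :
    (g x)⁻¹ (Sum.inl μ) (Sum.inr j) = 0 := by
  rw [B.inv_eq hx]; simp

theorem inv_rl (B : BlockMetric U g h G C) (hx : x ∈ U) (i : κ) (ν : α) :
    (g x)⁻¹ (Sum.inr i) (Sum.inl ν) = 0 := by
  rw [B.inv_eq hx]; simp

theorem inv_rr (B : BlockMetric U g h G C) (hx : x ∈ U) (i j : κ) :
    (g x)⁻¹ (Sum.inr i) (Sum.inr j) = C i j x := by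
  rw [B.inv_eq hx]; simp

theorem pd_ll (B : BlockMetric U g h G C) (hx : x ∈ U) (i : α ⊕ κ) (μ ν : α) :
    pd i (fun y => g y (Sum.inl μ) (Sum.inl ν)) x = if μ = ν then pd i (h μ) x else 0 := by
  rw [pd_congr (f' := fun y => if μ = ν then h μ y else 0) (fun y hy => B.eq_ll y hy μ ν)
    B.isOpen hx]
  split_ifs
  · rfl
  · simp

theorem pd_lr (B : BlockMetric U g h G C) (hx : x ∈ U) (i : α ⊕ κ) (μ : α) (j : κ) :
    pd i (fun y => g y (Sum.inl μ) (Sum.inr j)) x = 0 := by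
  rw [pd_congr (f' := fun y => 0) (fun y hy => B.eq_lr y hy μ j) B.isOpen hx, pd_const]

theorem pd_rl (B : BlockMetric U g h G C) (hx : x ∈ U) (i : α ⊕ κ) (μ : α) (j : κ) :
    pd i (fun y => g y (Sum.inr j) (Sum.inl μ)) x = 0 := by
  rw [pd_congr (f' := fun y => 0) (fun y hy => B.eq_rl y hy j μ) B.isOpen hx, pd_const]

theorem pd_rr (B : BlockMetric U g h G C) (hx : x ∈ U) (i : α ⊕ κ) (k l : κ) :
    pd i (fun y => g y (Sum.inr k) (Sum.inr l)) x = pd i (G k l) x :=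
  pd_congr (fun y hy => B.eq_rr y hy k l) B.isOpen hx i

/-- The symbols of a diagonal metric, as a sum of three conditionals that remains correct when
indices coincide. Later sums then collapse one Kronecker delta at a time. -/
theorem christoffel_lll (B : BlockMetric U g h G C) (hx : x ∈ U) (μ ν ρ : α) :
    christoffel g (Sum.inl μ) (Sum.inl ν) (Sum.inl ρ) x
      = 1 / 2 * ((if ρ = μ then logDer h ν μ x else 0) + (if ν = μ then logDer h ρ μ x else 0)
        - (if ν = ρ then h ν x / h μ x * logDer h μ ν x else 0)) := by
  have hμ := B.h_ne x hx μ
  have hν := B.h_ne x hx ν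
  simp only [christoffel, Fintype.sum_sum_type, B.inv_ll hx, B.inv_lr hx, B.pd_ll hx, ite_mul,
    zero_mul, Finset.sum_ite_eq, Finset.mem_univ, if_true, Finset.sum_const_zero, add_zero, logDer]
  congr 1
  rw [mul_sub, mul_add]
  congr 1
  · congr 1
    · split_ifs with h1
      · rw [h1]; ring
      · ring
    · split_ifs with h1
      · rw [h1]; ring
      · ring
  · split_ifs with h1
    · field_simp
    · ring

theorem christoffel_llr (B : BlockMetric U g h G C) (hx : x ∈ U) (μ ν : α) (j : κ) :
    christoffel g (Sum.inl μ) (Sum.inl ν) (Sum.inr j) x = 0 := by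
  simp [christoffel, Fintype.sum_sum_type, B.inv_ll hx, B.inv_lr hx, B.pd_ll hx, B.pd_lr hx,
    B.pd_rl hx, (B.basic_h _).pd_inr]

theorem christoffel_lrl (B : BlockMetric U g h G C) (hx : x ∈ U) (μ ν : α) (j : κ) :
    christoffel g (Sum.inl μ) (Sum.inr j) (Sum.inl ν) x = 0 := by
  simp [christoffel, Fintype.sum_sum_type, B.inv_ll hx, B.inv_lr hx, B.pd_ll hx, B.pd_lr hx,
    B.pd_rl hx, (B.basic_h _).pd_inr]

theorem christoffel_lrr (B : BlockMetric U g h G C) (hx : x ∈ U) (μ : α) (i j : κ) :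
    christoffel g (Sum.inl μ) (Sum.inr i) (Sum.inr j) x
      = -(1 / 2) * (pd (Sum.inl μ) (G i j) x / h μ x) := by
  simp [christoffel, Fintype.sum_sum_type, B.inv_ll hx, B.inv_lr hx, B.pd_rr hx, B.pd_rl hx]
  ring

theorem christoffel_rll (B : BlockMetric U g h G C) (hx : x ∈ U) (k : κ) (μ ν : α) :
    christoffel g (Sum.inr k) (Sum.inl μ) (Sum.inl ν) x = 0 := by
  simp [christoffel, Fintype.sum_sum_type, B.inv_rl hx, B.inv_rr hx, B.pd_ll hx, B.pd_lr hx,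
    (B.basic_h _).pd_inr]

theorem christoffel_rlr (B : BlockMetric U g h G C) (hx : x ∈ U) (k : κ) (μ : α) (j : κ) :
    christoffel g (Sum.inr k) (Sum.inl μ) (Sum.inr j) x
      = 1 / 2 * ∑ l, C k l x * pd (Sum.inl μ) (G l j) x := by
  have : ∀ l, pd (Sum.inl μ) (G j l) x = pd (Sum.inl μ) (G l j) x := fun l =>
    pd_congr (fun y hy => B.G_symm y hy j l) B.isOpen hx _
  simp [christoffel, Fintype.sum_sum_type, B.inv_rl hx, B.inv_rr hx, B.pd_rr hx, B.pd_lr hx,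
    B.pd_rl hx, this]

theorem christoffel_rrl (B : BlockMetric U g h G C) (hx : x ∈ U) (k : κ) (μ : α) (j : κ) :
    christoffel g (Sum.inr k) (Sum.inr j) (Sum.inl μ) x
      = 1 / 2 * ∑ l, C k l x * pd (Sum.inl μ) (G l j) x := by
  have : ∀ l, pd (Sum.inl μ) (G j l) x = pd (Sum.inl μ) (G l j) x := fun l =>
    pd_congr (fun y hy => B.G_symm y hy j l) B.isOpen hx _
  simp [christoffel, Fintype.sum_sum_type, B.inv_rl hx, B.inv_rr hx, B.pd_rr hx, B.pd_lr hx,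
    B.pd_rl hx, this]

theorem christoffel_rrr (B : BlockMetric U g h G C) (hx : x ∈ U) (k i j : κ) :
    christoffel g (Sum.inr k) (Sum.inr i) (Sum.inr j) x = 0 := by
  simp [christoffel, Fintype.sum_sum_type, B.inv_rl hx, B.inv_rr hx, B.pd_rr hx,
    (B.basic_G _ _).pd_inr]

theorem basic_logDer (B : BlockMetric U g h G C) (ν μ : α) : IsBasic (logDer h ν μ) :=
  ((B.basic_h μ).pd _).div (B.basic_h μ)

theorem smooth_logDer (B : BlockMetric U g h G C) (ν μ : α) : SmoothOn U (logDer h ν μ) :=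
  ((B.smooth_h μ).pd B.isOpen _).div (B.smooth_h μ) fun x hx => B.h_ne x hx μ

theorem christoffel_trace_inl (B : BlockMetric U g h G C) (hx : x ∈ U) (μ : α) :
    ∑ k, christoffel g k k (Sum.inl μ) x = logVol h G C μ x := by
  rw [Fintype.sum_sum_type]
  simp only [B.christoffel_lll hx, B.christoffel_rrl hx, logVol, Finset.mul_sum]
  congr 1
  refine Finset.sum_congr rfl fun k _ => ?_
  have hk := B.h_ne x hx k
  by_cases e : μ = k
  · subst e; simp [hk]
  · simp [e, Ne.symm e]

theorem christoffel_trace_inl' (B : BlockMetric U g h G C) (hx : x ∈ U) (μ : α) :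
    ∑ k, christoffel g k (Sum.inl μ) k x = logVol h G C μ x := by
  rw [Fintype.sum_sum_type]
  simp only [B.christoffel_lll hx, B.christoffel_rlr hx, logVol, Finset.mul_sum]
  congr 1
  refine Finset.sum_congr rfl fun k _ => ?_
  have hk := B.h_ne x hx k
  by_cases e : μ = k
  · subst e; simp [hk]
  · simp [e]

theorem christoffel_trace_inr (B : BlockMetric U g h G C) (hx : x ∈ U) (j : κ) :
    ∑ k, christoffel g k k (Sum.inr j) x = 0 := by
  rw [Fintype.sum_sum_type]
  simp [B.christoffel_llr hx, B.christoffel_rrr hx]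

/-- The contractions Γ^k_{kl} are isolated, because for a block metric they reduce to `logVol` or to
zero. -/
theorem ricci_split (g : (α ⊕ κ → ℝ) → Matrix (α ⊕ κ) (α ⊕ κ) ℝ) (i j : α ⊕ κ) (x : α ⊕ κ → ℝ) :
    ricci g i j x = ∑ k, pd k (christoffel g k i j) x - ∑ k, pd j (christoffel g k i k) x
      + ∑ l, (∑ k, christoffel g k k l x) * christoffel g l i j x
      - ∑ k, ∑ l, christoffel g k j l x * christoffel g l i k x := by
  simp only [ricci, Finset.sum_sub_distrib, Finset.sum_mul]
  rw [Finset.sum_comm (f := fun k l => christoffel g k k l x * christoffel g l i j x)]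
  ring

/-- Along the Killing directions the derivatives of Γ^k_{ik} vanish. What remains is a divergence
weighted by √det g, and the products of Christoffel symbols, to which the base-torus and torus-base
blocks contribute equally. -/
theorem ricci_rr (B : BlockMetric U g h G C) (hx : x ∈ U) (i j : κ) :
    ricci g (Sum.inr i) (Sum.inr j) x
      = -(1 / 2) * ∑ μ, (pd (Sum.inl μ) (fun y => pd (Sum.inl μ) (G i j) y / h μ y) x
          + logVol h G C μ x * (pd (Sum.inl μ) (G i j) x / h μ x))
        + 1 / 2 * ∑ μ, 1 / h μ x * ∑ k, ∑ l,
          pd (Sum.inl μ) (G i k) x * C k l x * pd (Sum.inl μ) (G l j) x := by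
  have h1 : ∀ μ, pd (Sum.inl μ) (christoffel g (Sum.inl μ) (Sum.inr i) (Sum.inr j)) x
      = -(1 / 2) * pd (Sum.inl μ) (fun y => pd (Sum.inl μ) (G i j) y / h μ y) x := by
    intro μ
    rw [pd_congr (fun y hy => B.christoffel_lrr hy μ i j) B.isOpen hx, pd_const_mul]
    exact SmoothOn.differentiableAt (((B.smooth_G i j).pd B.isOpen _).div (B.smooth_h μ)
      fun x hx => B.h_ne x hx μ) B.isOpen hx
  have h2 : ∀ k, pd (Sum.inr k) (christoffel g (Sum.inr k) (Sum.inr i) (Sum.inr j)) x = 0 := by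
    intro k
    rw [pd_congr (fun y hy => B.christoffel_rrr hy k i j) B.isOpen hx, pd_const]
  have h3 : ∀ k : α, pd (Sum.inr j) (christoffel g (Sum.inl k) (Sum.inr i) (Sum.inl k)) x = 0 := by
    intro k
    rw [pd_congr (fun y hy => B.christoffel_lrl hy k k i) B.isOpen hx, pd_const]
  have h4 : ∀ k, pd (Sum.inr j) (christoffel g (Sum.inr k) (Sum.inr i) (Sum.inr k)) x = 0 := by
    intro k
    rw [pd_congr (fun y hy => B.christoffel_rrr hy k i k) B.isOpen hx, pd_const]
  have hs : ∀ μ, ∀ i j, pd (Sum.inl μ) (G i j) x = pd (Sum.inl μ) (G j i) x := fun μ i j =>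
    pd_congr (fun y hy => B.G_symm y hy i j) B.isOpen hx _
  have h5 : ∑ k, ∑ l, christoffel g k (Sum.inr j) l x * christoffel g l (Sum.inr i) k x
      = -(1 / 2) * ∑ μ, 1 / h μ x * ∑ k, ∑ l,
          pd (Sum.inl μ) (G i k) x * C k l x * pd (Sum.inl μ) (G l j) x := by
    simp only [Fintype.sum_sum_type, B.christoffel_lrl hx, B.christoffel_rrr hx,
      B.christoffel_lrr hx, B.christoffel_rrl hx]
    simp only [mul_zero, Finset.sum_const_zero, zero_add, add_zero]
    rw [Finset.sum_comm (s := (Finset.univ : Finset κ)), ← Finset.sum_add_distrib, Finset.mul_sum]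
    refine Finset.sum_congr rfl fun μ _ => ?_
    have e1 : ∑ k, -(1 / 2) * (pd (Sum.inl μ) (G j k) x / h μ x) *
        (1 / 2 * ∑ l, C k l x * pd (Sum.inl μ) (G l i) x)
        = -(1 / 4) * (1 / h μ x * ∑ k, ∑ l,
          pd (Sum.inl μ) (G i k) x * C k l x * pd (Sum.inl μ) (G l j) x) := by
      simp only [Finset.mul_sum]
      rw [Finset.sum_comm]
      refine Finset.sum_congr rfl fun k _ => Finset.sum_congr rfl fun l _ => ?_
      rw [hs μ i k, hs μ j l, B.C_symm x hx l k]
      ring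
    have e2 : ∑ k, 1 / 2 * (∑ l, C k l x * pd (Sum.inl μ) (G l j) x) *
        (-(1 / 2) * (pd (Sum.inl μ) (G i k) x / h μ x))
        = -(1 / 4) * (1 / h μ x * ∑ k, ∑ l,
          pd (Sum.inl μ) (G i k) x * C k l x * pd (Sum.inl μ) (G l j) x) := by
      simp only [Finset.mul_sum, Finset.sum_mul]
      refine Finset.sum_congr rfl fun k _ => Finset.sum_congr rfl fun l _ => ?_
      ring
    rw [e1, e2]
    ring
  rw [ricci_split, h5]
  simp only [Fintype.sum_sum_type (f := fun k => pd k (christoffel g k (Sum.inr i) (Sum.inr j)) x),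
    Fintype.sum_sum_type (f := fun k => pd (Sum.inr j) (christoffel g k (Sum.inr i) k) x),
    Fintype.sum_sum_type (f := fun l => (∑ k, christoffel g k k l x) *
      christoffel g l (Sum.inr i) (Sum.inr j) x), h1, h2, h3, h4, B.christoffel_trace_inl hx,
    B.christoffel_trace_inr hx, B.christoffel_lrr hx]
  simp only [Finset.sum_const_zero, zero_mul, add_zero, sub_zero, Finset.sum_add_distrib, mul_add,
    Finset.mul_sum]
  rw [sub_eq_add_neg, ← Finset.sum_neg_distrib]
  congr 1
  · congr 1
    refine Finset.sum_congr rfl fun μ _ => ?_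
    ring
  · refine Finset.sum_congr rfl fun μ _ => ?_
    rw [← Finset.sum_neg_distrib]
    refine Finset.sum_congr rfl fun k _ => ?_
    rw [← Finset.sum_neg_distrib]
    refine Finset.sum_congr rfl fun l _ => ?_
    ring

/-- Christoffel symbols with an odd number of torus indices vanish. Every term contains such a
symbol, a torus derivative of a basic function, or a trace with a torus index. -/
theorem ricci_lr (B : BlockMetric U g h G C) (hx : x ∈ U) (ν : α) (j : κ) :
    ricci g (Sum.inl ν) (Sum.inr j) x = 0 := by
  have h1 : ∀ μ, pd (Sum.inl μ) (christoffel g (Sum.inl μ) (Sum.inl ν) (Sum.inr j)) x = 0 := by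
    intro μ
    rw [pd_congr (fun y hy => B.christoffel_llr hy μ ν j) B.isOpen hx, pd_const]
  have hb : ∀ k j, IsBasic fun y => 1 / 2 * ∑ l, C k l y * pd (Sum.inl ν) (G l j) y := fun k j =>
    (isBasic_const _).mul (IsBasic.sum fun l _ => (B.basic_C _ _).mul ((B.basic_G _ _).pd _))
  have h2 : ∀ k, pd (Sum.inr k) (christoffel g (Sum.inr k) (Sum.inl ν) (Sum.inr j)) x = 0 := by
    intro k
    rw [pd_congr (fun y hy => B.christoffel_rlr hy k ν j) B.isOpen hx, (hb k j).pd_inr]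
  have h3 : ∀ k : α, pd (Sum.inr j) (christoffel g (Sum.inl k) (Sum.inl ν) (Sum.inl k)) x = 0 := by
    intro k
    rw [pd_congr (fun y hy => B.christoffel_lll hy k ν k) B.isOpen hx]
    refine IsBasic.pd_inr ?_ j x
    intro y z e
    simp only [B.basic_logDer _ _ y z e, B.basic_h _ y z e]
  have h4 : ∀ k, pd (Sum.inr j) (christoffel g (Sum.inr k) (Sum.inl ν) (Sum.inr k)) x = 0 := by
    intro k
    rw [pd_congr (fun y hy => B.christoffel_rlr hy k ν k) B.isOpen hx, (hb k k).pd_inr]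
  rw [ricci_split]
  simp [Fintype.sum_sum_type, h1, h2, h3, h4, B.christoffel_lrl hx, B.christoffel_llr hx,
    B.christoffel_rrr hx, B.christoffel_rll hx]

theorem ricci_rl (B : BlockMetric U g h G C) (hx : x ∈ U) (ν : α) (j : κ) :
    ricci g (Sum.inr j) (Sum.inl ν) x = 0 := by
  have h1 : ∀ μ, pd (Sum.inl μ) (christoffel g (Sum.inl μ) (Sum.inr j) (Sum.inl ν)) x = 0 := by
    intro μ
    rw [pd_congr (fun y hy => B.christoffel_lrl hy μ ν j) B.isOpen hx, pd_const]
  have hb : ∀ k j, IsBasic fun y => 1 / 2 * ∑ l, C k l y * pd (Sum.inl ν) (G l j) y := fun k j =>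
    (isBasic_const _).mul (IsBasic.sum fun l _ => (B.basic_C _ _).mul ((B.basic_G _ _).pd _))
  have h2 : ∀ k, pd (Sum.inr k) (christoffel g (Sum.inr k) (Sum.inr j) (Sum.inl ν)) x = 0 := by
    intro k
    rw [pd_congr (fun y hy => B.christoffel_rrl hy k ν j) B.isOpen hx, (hb k j).pd_inr]
  have h3 : ∀ k : α, pd (Sum.inl ν) (christoffel g (Sum.inl k) (Sum.inr j) (Sum.inl k)) x = 0 := by
    intro k
    rw [pd_congr (fun y hy => B.christoffel_lrl hy k k j) B.isOpen hx, pd_const]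
  have h4 : ∀ k, pd (Sum.inl ν) (christoffel g (Sum.inr k) (Sum.inr j) (Sum.inr k)) x = 0 := by
    intro k
    rw [pd_congr (fun y hy => B.christoffel_rrr hy k j k) B.isOpen hx, pd_const]
  rw [ricci_split]
  simp [Fintype.sum_sum_type, h1, h2, h3, h4, B.christoffel_lrl hx, B.christoffel_llr hx,
    B.christoffel_rrr hx, B.christoffel_rll hx]

theorem sum_christoffel_lll_mul (B : BlockMetric U g h G C) (hx : x ∈ U) (ν ρ : α) :
    ∑ k, ∑ l, christoffel g (Sum.inl k) (Sum.inl ρ) (Sum.inl l) x *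
        christoffel g (Sum.inl l) (Sum.inl ν) (Sum.inl k) x
      = 1 / 4 * (∑ k, logDer h ρ k x * logDer h ν k x
        + 2 * (logDer h ν ρ x * logDer h ρ ν x)
        - 2 * (if ν = ρ then ∑ k, h ν x / h k x * logDer h k ν x ^ 2 else 0)) := by
  have hρ := B.h_ne x hx ρ
  have hν := B.h_ne x hx ν
  simp only [B.christoffel_lll hx]
  generalize hL : (fun a b => logDer h a b x) = L
  have hL' : ∀ a b, logDer h a b x = L a b := fun a b => by rw [← hL]
  simp only [hL']
  -- The nine products of conditionals are arranged so that each is summable over `k` and `l`; the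
  -- coincidences among `ν`, `ρ`, `k` and `l` are checked case by case.
  have key : ∀ k l : α, 1 / 2 * ((if l = k then L ρ k else 0) + (if ρ = k then L l k else 0)
        - (if ρ = l then h ρ x / h k x * L k ρ else 0)) *
      (1 / 2 * ((if k = l then L ν l else 0) + (if ν = l then L k l else 0)
        - (if ν = k then h ν x / h l x * L l ν else 0)))
      = 1 / 4 * ((if k = l then L ρ k * L ν k else 0)
        + (if k = l then (if ν = l then L ρ ν * L ν ν else 0) else 0)
        - (if k = l then (if ν = l then L ρ ν * L ν ν else 0) else 0)
        + (if k = l then (if ρ = l then L ρ ρ * L ν ρ else 0) else 0)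
        + (if ρ = k then (if ν = l then L ν ρ * L ρ ν else 0) else 0)
        - (if ν = ρ then (if ν = k then h ν x / h l x * L l ν ^ 2 else 0) else 0)
        - (if k = l then (if ρ = l then L ρ ρ * L ν ρ else 0) else 0)
        - (if ν = ρ then (if ν = l then h ν x / h k x * L k ν ^ 2 else 0) else 0)
        + (if ρ = l then (if ν = k then L ν ρ * L ρ ν else 0) else 0)) := by
    intro k l
    by_cases h1 : k = l
    · subst h1
      by_cases h2 : ν = k
      · subst h2
        by_cases h3 : ν = ρ
        · subst h3; simp; field_simp; ring
        · simp [h3, Ne.symm h3]; field_simp; ring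
      · by_cases h3 : ρ = k
        · subst h3
          simp [h2]; field_simp; ring
        · simp [h2, h3]; ring
    · by_cases h2 : ν = k
      · subst h2
        by_cases h3 : ν = ρ
        · subst h3; simp [h1, Ne.symm h1]; ring
        · by_cases h4 : ρ = l
          · subst h4; simp [h3, Ne.symm h3]; field_simp; ring
          · simp [h1, Ne.symm h1, h3, Ne.symm h3, h4]
      · by_cases h3 : ν = l
        · subst h3
          by_cases h4 : ν = ρ
          · subst h4; simp [h1, Ne.symm h1]; ring
          · by_cases h5 : ρ = k
            · subst h5; simp [h4, Ne.symm h4]; ring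
            · simp [h1, Ne.symm h1, h4, Ne.symm h4, h5]
        · simp [h1, Ne.symm h1, h2, h3]
  rw [Finset.sum_congr rfl fun k _ => Finset.sum_congr rfl fun l _ => key k l]
  simp only [← Finset.mul_sum, Finset.sum_add_distrib, Finset.sum_sub_distrib]
  by_cases h1 : ν = ρ
  · subst h1
    simp
    ring
  · simp [h1]
    ring

/-- The torus metric enters only through `logVol` and through the trace of C ∂_ρG C ∂_νG. All the
rest depends on the base metric alone and will not notice the charging. -/
theorem ricci_ll (B : BlockMetric U g h G C) (hx : x ∈ U) (ν ρ : α) :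
    ricci g (Sum.inl ν) (Sum.inl ρ) x
      = 1 / 2 * pd (Sum.inl ρ) (logDer h ν ρ) x + 1 / 2 * pd (Sum.inl ν) (logDer h ρ ν) x
        - pd (Sum.inl ρ) (logVol h G C ν) x
        + 1 / 2 * (logVol h G C ρ x * logDer h ν ρ x + logVol h G C ν x * logDer h ρ ν x)
        - 1 / 4 * (∑ k, logDer h ρ k x * logDer h ν k x
          + 2 * (logDer h ν ρ x * logDer h ρ ν x))
        - 1 / 4 * ∑ k, ∑ l, (∑ a, C k a x * pd (Sum.inl ρ) (G a l) x) *
            (∑ b, C l b x * pd (Sum.inl ν) (G b k) x)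
        + if ν = ρ then
            -(1 / 2) * ∑ k, pd (Sum.inl k) (fun y => h ν y / h k y * logDer h k ν y) x
            - 1 / 2 * ∑ k, logVol h G C k x * (h ν x / h k x * logDer h k ν x)
            + 1 / 2 * ∑ k, h ν x / h k x * logDer h k ν x ^ 2
          else 0 := by
  have d1 : ∀ a b, DifferentiableAt ℝ (logDer h a b) x := fun a b =>
    (B.smooth_logDer a b).differentiableAt B.isOpen hx
  have d2 : ∀ k, DifferentiableAt ℝ (fun y => h ν y / h k y * logDer h k ν y) x := fun k =>
    SmoothOn.differentiableAt (((B.smooth_h ν).div (B.smooth_h k) fun y hy => B.h_ne y hy k).mul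
      (B.smooth_logDer k ν)) B.isOpen hx
  have h1 : ∀ k, pd (Sum.inl k) (christoffel g (Sum.inl k) (Sum.inl ν) (Sum.inl ρ)) x
      = 1 / 2 * (if ρ = k then pd (Sum.inl ρ) (logDer h ν ρ) x else 0)
        + 1 / 2 * (if ν = k then pd (Sum.inl ν) (logDer h ρ ν) x else 0)
        - 1 / 2 * (if ν = ρ then
          pd (Sum.inl k) (fun y => h ν y / h k y * logDer h k ν y) x else 0) := by
    intro k
    rw [pd_congr (fun y hy => B.christoffel_lll hy k ν ρ) B.isOpen hx]
    have e1 : DifferentiableAt ℝ (fun y => if ρ = k then logDer h ν k y else 0) x := by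
      split_ifs
      · exact d1 _ _
      · fun_prop
    have e2 : DifferentiableAt ℝ (fun y => if ν = k then logDer h ρ k y else 0) x := by
      split_ifs
      · exact d1 _ _
      · fun_prop
    have e3 : DifferentiableAt ℝ
        (fun y => if ν = ρ then h ν y / h k y * logDer h k ν y else 0) x := by
      split_ifs
      · exact d2 _
      · fun_prop
    rw [pd_const_mul _ ((e1.fun_add e2).fun_sub e3), pd_sub (e1.fun_add e2) e3, pd_add e1 e2]
    have f1 : pd (Sum.inl k) (fun y => if ρ = k then logDer h ν k y else 0) x
        = if ρ = k then pd (Sum.inl ρ) (logDer h ν ρ) x else 0 := by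
      split_ifs with hh
      · rw [hh]
      · simp
    have f2 : pd (Sum.inl k) (fun y => if ν = k then logDer h ρ k y else 0) x
        = if ν = k then pd (Sum.inl ν) (logDer h ρ ν) x else 0 := by
      split_ifs with hh
      · rw [hh]
      · simp
    have f3 : pd (Sum.inl k) (fun y => if ν = ρ then h ν y / h k y * logDer h k ν y else 0) x
        = if ν = ρ then pd (Sum.inl k) (fun y => h ν y / h k y * logDer h k ν y) x else 0 := by
      split_ifs with hh
      · rfl
      · simp
    rw [f1, f2, f3]
    ring
  have h2 : ∀ k, pd (Sum.inr k) (christoffel g (Sum.inr k) (Sum.inl ν) (Sum.inl ρ)) x = 0 := by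
    intro k
    rw [pd_congr (fun y hy => B.christoffel_rll hy k ν ρ) B.isOpen hx, pd_const]
  have h3 : ∑ k, pd (Sum.inl ρ) (christoffel g k (Sum.inl ν) k) x
      = pd (Sum.inl ρ) (logVol h G C ν) x := by
    rw [← pd_congr (fun y hy => B.christoffel_trace_inl' hy ν) B.isOpen hx, pd_sum]
    intro k _
    rcases k with k | k
    · refine SmoothOn.differentiableAt (U := U) ?_ B.isOpen hx
      refine smoothOn_congr ?_ fun y hy => B.christoffel_lll hy k ν k
      refine contDiffOn_const.mul ?_
      have e1 := B.smooth_logDer ν k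
      have e2 := B.smooth_logDer k k
      have e3 : SmoothOn U (fun y => h ν y / h k y * logDer h k ν y) :=
        ((B.smooth_h ν).div (B.smooth_h k) fun y hy => B.h_ne y hy k).mul (B.smooth_logDer k ν)
      refine ContDiffOn.sub (ContDiffOn.add ?_ ?_) ?_
      · simpa using e1
      · split_ifs
        · exact e2
        · exact contDiffOn_const
      · split_ifs
        · exact e3
        · exact contDiffOn_const
    · refine SmoothOn.differentiableAt (U := U) ?_ B.isOpen hx
      refine smoothOn_congr ?_ fun y hy => B.christoffel_rlr hy k ν k
      exact contDiffOn_const.mul (smoothOn_sum fun l _ =>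
        (B.smooth_C k l).mul ((B.smooth_G l k).pd B.isOpen _))
  have h4 : ∑ k, ∑ l, christoffel g k (Sum.inl ρ) l x * christoffel g l (Sum.inl ν) k x
      = 1 / 4 * (∑ k, logDer h ρ k x * logDer h ν k x
        + 2 * (logDer h ν ρ x * logDer h ρ ν x)
        - 2 * (if ν = ρ then ∑ k, h ν x / h k x * logDer h k ν x ^ 2 else 0))
        + 1 / 4 * ∑ k, ∑ l, (∑ a, C k a x * pd (Sum.inl ρ) (G a l) x) *
            (∑ b, C l b x * pd (Sum.inl ν) (G b k) x) := by
    rw [← B.sum_christoffel_lll_mul hx]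
    simp only [Fintype.sum_sum_type, B.christoffel_llr hx, B.christoffel_rll hx,
      B.christoffel_rlr hx, mul_zero, Finset.sum_const_zero, add_zero, zero_add]
    congr 1
    rw [Finset.mul_sum]
    refine Finset.sum_congr rfl fun k _ => ?_
    rw [Finset.mul_sum]
    refine Finset.sum_congr rfl fun l _ => ?_
    ring
  rw [ricci_split, h3, h4]
  simp only [Fintype.sum_sum_type (f := fun k => pd k (christoffel g k (Sum.inl ν) (Sum.inl ρ)) x),
    Fintype.sum_sum_type (f := fun l => (∑ k, christoffel g k k l x) *
      christoffel g l (Sum.inl ν) (Sum.inl ρ) x), h1, h2, B.christoffel_trace_inl hx,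
    B.christoffel_rll hx, B.christoffel_lll hx]
  have h5 : ∑ l, logVol h G C l x * (1 / 2 * ((if ρ = l then logDer h ν l x else 0)
        + (if ν = l then logDer h ρ l x else 0)
        - (if ν = ρ then h ν x / h l x * logDer h l ν x else 0)))
      = 1 / 2 * (logVol h G C ρ x * logDer h ν ρ x + logVol h G C ν x * logDer h ρ ν x)
        - 1 / 2 * (if ν = ρ then ∑ k, logVol h G C k x * (h ν x / h k x * logDer h k ν x)
          else 0) := by
    by_cases e : ν = ρ
    · simp only [mul_add, mul_sub, Finset.sum_add_distrib, Finset.sum_sub_distrib, mul_ite,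
        mul_zero, Finset.sum_ite_eq, Finset.mem_univ, if_true, if_pos e, Finset.mul_sum]
      congr 1
      · ring
      · exact Finset.sum_congr rfl fun k _ => by ring
    · simp only [mul_add, mul_sub, Finset.sum_add_distrib, Finset.sum_sub_distrib, mul_ite,
        mul_zero, Finset.sum_ite_eq, Finset.mem_univ, if_true, if_neg e, Finset.sum_const_zero]
      ring
  rw [h5]
  simp only [Finset.sum_add_distrib, Finset.sum_sub_distrib, ← Finset.mul_sum, Finset.sum_ite_eq,
    Finset.mem_univ, if_true, mul_zero, Finset.sum_const_zero, add_zero]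
  by_cases e : ν = ρ
  · simp only [if_pos e]
    ring
  · simp only [if_neg e, Finset.sum_const_zero]
    ring

theorem hess_rr (B : BlockMetric U g h G C) (hx : x ∈ U) {φ : (α ⊕ κ → ℝ) → ℝ} (hφ : IsBasic φ)
    (i j : κ) :
    hess g φ (Sum.inr i) (Sum.inr j) x
      = 1 / 2 * ∑ μ, pd (Sum.inl μ) (G i j) x / h μ x * pd (Sum.inl μ) φ x := by
  simp only [hess, (hφ.pd _).pd_inr, Fintype.sum_sum_type, B.christoffel_lrr hx,
    B.christoffel_rrr hx, hφ.pd_inr, mul_zero, Finset.sum_const_zero, add_zero, zero_sub,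
    Finset.mul_sum, ← Finset.sum_neg_distrib]
  exact Finset.sum_congr rfl fun μ _ => by ring

theorem hess_lr (B : BlockMetric U g h G C) (hx : x ∈ U) {φ : (α ⊕ κ → ℝ) → ℝ} (hφ : IsBasic φ)
    (ν : α) (j : κ) : hess g φ (Sum.inl ν) (Sum.inr j) x = 0 := by
  have h1 : pd (Sum.inr j) φ = fun _ => 0 := funext fun y => hφ.pd_inr j y
  simp [hess, h1, Fintype.sum_sum_type, B.christoffel_llr hx, hφ.pd_inr]

theorem hess_rl (B : BlockMetric U g h G C) (hx : x ∈ U) {φ : (α ⊕ κ → ℝ) → ℝ} (hφ : IsBasic φ)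
    (ν : α) (j : κ) : hess g φ (Sum.inr j) (Sum.inl ν) x = 0 := by
  simp [hess, (hφ.pd _).pd_inr, Fintype.sum_sum_type, B.christoffel_lrl hx, hφ.pd_inr]

theorem hess_ll (B : BlockMetric U g h G C) (hx : x ∈ U) (φ : (α ⊕ κ → ℝ) → ℝ) (ν ρ : α) :
    hess g φ (Sum.inl ν) (Sum.inl ρ) x = pd (Sum.inl ν) (pd (Sum.inl ρ) φ) x
      - 1 / 2 * (pd (Sum.inl ρ) φ x * logDer h ν ρ x + pd (Sum.inl ν) φ x * logDer h ρ ν x)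
      + 1 / 2 * (if ν = ρ then ∑ k, pd (Sum.inl k) φ x * (h ν x / h k x * logDer h k ν x)
          else 0) := by
  have h5 : ∑ l, 1 / 2 * ((if ρ = l then logDer h ν l x else 0)
        + (if ν = l then logDer h ρ l x else 0)
        - (if ν = ρ then h ν x / h l x * logDer h l ν x else 0)) * pd (Sum.inl l) φ x
      = 1 / 2 * (pd (Sum.inl ρ) φ x * logDer h ν ρ x + pd (Sum.inl ν) φ x * logDer h ρ ν x)
        - 1 / 2 * (if ν = ρ then ∑ k, pd (Sum.inl k) φ x * (h ν x / h k x * logDer h k ν x)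
          else 0) := by
    by_cases e : ν = ρ
    · simp only [add_mul, sub_mul, mul_add, mul_sub, Finset.sum_add_distrib,
        Finset.sum_sub_distrib, mul_ite, ite_mul, zero_mul,
        mul_zero, Finset.sum_ite_eq, Finset.mem_univ, if_true, if_pos e, Finset.mul_sum]
      congr 1
      · ring
      · exact Finset.sum_congr rfl fun k _ => by ring
    · simp only [add_mul, sub_mul, mul_add, mul_sub, Finset.sum_add_distrib,
        Finset.sum_sub_distrib, mul_ite, ite_mul, zero_mul,
        mul_zero, Finset.sum_ite_eq, Finset.mem_univ, if_true, if_neg e, Finset.sum_const_zero]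
      ring
  rw [hess, Fintype.sum_sum_type]
  simp only [B.christoffel_lll hx, B.christoffel_rll hx, zero_mul, Finset.sum_const_zero, add_zero]
  rw [h5]
  ring

/-- `R_ij - ∇_i ∇_j φ` in the `ψ` directions. -/
theorem ricci_sub_hess_rr (B : BlockMetric U g h G C) (hx : x ∈ U) {φ : (α ⊕ κ → ℝ) → ℝ}
    (hφ : IsBasic φ) (i j : κ) (t : α → (α ⊕ κ → ℝ) → ℝ)
    (ht : ∀ y ∈ U, ∀ μ, logVol h G C μ y = t μ y - pd (Sum.inl μ) φ y) :
    ricci g (Sum.inr i) (Sum.inr j) x - hess g φ (Sum.inr i) (Sum.inr j) x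
      = -(1 / 2) * ∑ μ, (pd (Sum.inl μ) (fun y => pd (Sum.inl μ) (G i j) y / h μ y) x
          + t μ x * (pd (Sum.inl μ) (G i j) x / h μ x))
        + 1 / 2 * ∑ μ, 1 / h μ x * ∑ k, ∑ l,
          pd (Sum.inl μ) (G i k) x * C k l x * pd (Sum.inl μ) (G l j) x := by
  rw [B.ricci_rr hx, B.hess_rr hx hφ]
  simp only [ht x hx, sub_mul]
  simp only [Finset.sum_add_distrib, Finset.sum_sub_distrib]
  have : ∑ μ, pd (Sum.inl μ) (G i j) x / h μ x * pd (Sum.inl μ) φ x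
      = ∑ μ, pd (Sum.inl μ) φ x * (pd (Sum.inl μ) (G i j) x / h μ x) :=
    Finset.sum_congr rfl fun μ _ => mul_comm _ _
  rw [this]
  ring

/-- `R_νρ - ∇_ν ∇_ρ φ` in the `x` directions. -/
theorem ricci_sub_hess_ll (B : BlockMetric U g h G C) (hx : x ∈ U) {φ : (α ⊕ κ → ℝ) → ℝ}
    (hφs : SmoothOn U φ) (ν ρ : α) (t : α → (α ⊕ κ → ℝ) → ℝ)
    (hts : ∀ μ, SmoothOn U (t μ))
    (ht : ∀ y ∈ U, ∀ μ, logVol h G C μ y = t μ y - pd (Sum.inl μ) φ y) :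
    ricci g (Sum.inl ν) (Sum.inl ρ) x - hess g φ (Sum.inl ν) (Sum.inl ρ) x
      = 1 / 2 * pd (Sum.inl ρ) (logDer h ν ρ) x + 1 / 2 * pd (Sum.inl ν) (logDer h ρ ν) x
        - pd (Sum.inl ρ) (t ν) x
        + 1 / 2 * (t ρ x * logDer h ν ρ x + t ν x * logDer h ρ ν x)
        - 1 / 4 * (∑ k, logDer h ρ k x * logDer h ν k x
          + 2 * (logDer h ν ρ x * logDer h ρ ν x))
        - 1 / 4 * ∑ k, ∑ l, (∑ a, C k a x * pd (Sum.inl ρ) (G a l) x) *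
            (∑ b, C l b x * pd (Sum.inl ν) (G b k) x)
        + if ν = ρ then
            -(1 / 2) * ∑ k, pd (Sum.inl k) (fun y => h ν y / h k y * logDer h k ν y) x
            - 1 / 2 * ∑ k, t k x * (h ν x / h k x * logDer h k ν x)
            + 1 / 2 * ∑ k, h ν x / h k x * logDer h k ν x ^ 2
          else 0 := by
  rw [B.ricci_ll hx, B.hess_ll hx φ]
  -- Differentiating `logVol = t - ∂φ` yields the second derivative of φ that occurs in the Hessian,
  -- up to the order of differentiation; the two cancel.
  have h1 : pd (Sum.inl ρ) (logVol h G C ν) x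
      = pd (Sum.inl ρ) (t ν) x - pd (Sum.inl ν) (pd (Sum.inl ρ) φ) x := by
    rw [pd_congr (fun y hy => ht y hy ν) B.isOpen hx,
      pd_sub ((hts ν).differentiableAt B.isOpen hx) ((hφs.pd B.isOpen _).differentiableAt B.isOpen hx),
      pd_comm hφs B.isOpen hx]
  rw [h1]
  by_cases e : ν = ρ
  · simp only [if_pos e, ht x hx, sub_mul, Finset.sum_sub_distrib]
    ring
  · simp only [if_neg e, ht x hx]
    ring

end BlockMetric

end BaseFunctions

/-! ### Differentiability at a point with a prescribed partial derivative -/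

section HasPartialDerivative

variable {ι : Type} [Fintype ι] [DecidableEq ι] {i : ι} {f f' : (ι → ℝ) → ℝ} {d d' : ℝ}
  {x : ι → ℝ}

/-- `f` is differentiable at `x` with `∂_i f = d` there. -/
def HasPd (i : ι) (f : (ι → ℝ) → ℝ) (d : ℝ) (x : ι → ℝ) : Prop :=
  DifferentiableAt ℝ f x ∧ pd i f x = d

theorem SmoothOn.hasPd {U : Set (ι → ℝ)} (hf : SmoothOn U f) (hU : IsOpen U) (hx : x ∈ U)
    (i : ι) : HasPd i f (ChargedKerrNUT.pd i f x) x :=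
  ⟨hf.differentiableAt hU hx, rfl⟩

theorem HasPd.eq (h : HasPd i f d x) : pd i f x = d := h.2

theorem HasPd.congr_val (h : HasPd i f d x) (e : d = d') : HasPd i f d' x := e ▸ h

theorem hasPd_const (c : ℝ) : HasPd i (fun _ => c) 0 x := ⟨by fun_prop, pd_const c⟩

theorem HasPd.add (h : HasPd i f d x) (h' : HasPd i f' d' x) :
    HasPd i (fun y => f y + f' y) (d + d') x :=
  ⟨h.1.fun_add h'.1, by rw [pd_add h.1 h'.1, h.2, h'.2]⟩

theorem HasPd.sub (h : HasPd i f d x) (h' : HasPd i f' d' x) :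
    HasPd i (fun y => f y - f' y) (d - d') x :=
  ⟨h.1.fun_sub h'.1, by rw [pd_sub h.1 h'.1, h.2, h'.2]⟩

theorem HasPd.neg (h : HasPd i f d x) : HasPd i (fun y => -f y) (-d) x :=
  ⟨h.1.fun_neg, by rw [pd_neg, h.2]⟩

theorem HasPd.mul (h : HasPd i f d x) (h' : HasPd i f' d' x) :
    HasPd i (fun y => f y * f' y) (d * f' x + f x * d') x :=
  ⟨h.1.fun_mul h'.1, by rw [pd_mul h.1 h'.1, h.2, h'.2]⟩

theorem HasPd.const_mul (c : ℝ) (h : HasPd i f d x) : HasPd i (fun y => c * f y) (c * d) x :=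
  ⟨h.1.const_mul c, by rw [pd_const_mul c h.1, h.2]⟩

theorem HasPd.div (h : HasPd i f d x) (h' : HasPd i f' d' x) (h0 : f' x ≠ 0) :
    HasPd i (fun y => f y / f' y) (d / f' x - f x * d' / f' x ^ 2) x :=
  ⟨by simpa only [div_eq_mul_inv] using h.1.fun_mul (h'.1.fun_inv h0), by rw [pd_div h.1 h'.1 h0, h.2, h'.2]⟩

theorem HasPd.sum {X : Type*} {s : Finset X} {F : X → (ι → ℝ) → ℝ} {D : X → ℝ}
    (h : ∀ a ∈ s, HasPd i (F a) (D a) x) : HasPd i (fun y => ∑ a ∈ s, F a y) (∑ a ∈ s, D a) x :=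
  ⟨DifferentiableAt.fun_sum fun a ha => (h a ha).1, by
    rw [pd_sum fun a ha => (h a ha).1]; exact Finset.sum_congr rfl fun a ha => (h a ha).2⟩

theorem HasPd.congr_on {U : Set (ι → ℝ)} (h : HasPd i f d x) (hU : IsOpen U) (hx : x ∈ U)
    (e : ∀ y ∈ U, f' y = f y) : HasPd i f' d x :=
  ⟨h.1.congr_of_eventuallyEq (Filter.eventuallyEq_of_mem (hU.mem_nhds hx) e), by
    rw [pd_congr e hU hx, h.2]⟩

end HasPartialDerivative

/-! ### Weighted divergences over the base -/

section Divergence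

variable {α κ : Type} [Fintype α] [DecidableEq α] [Fintype κ] [DecidableEq κ]
  {U : Set (α ⊕ κ → ℝ)} {Q t : α → (α ⊕ κ → ℝ) → ℝ} {x : α ⊕ κ → ℝ}

/-- The divergence `∑ (∂_μ + t_μ) (Q_μ F_μ)`. -/
def divg (Q t : α → (α ⊕ κ → ℝ) → ℝ) (F : α → (α ⊕ κ → ℝ) → ℝ) (x : α ⊕ κ → ℝ) : ℝ :=
  ∑ μ, (pd (Sum.inl μ) (fun y => Q μ y * F μ y) x + t μ x * (Q μ x * F μ x))

theorem divg_congr {F F' : α → (α ⊕ κ → ℝ) → ℝ} (hU : IsOpen U) (hx : x ∈ U)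
    (e : ∀ μ, ∀ y ∈ U, F μ y = F' μ y) : divg Q t F x = divg Q t F' x := by
  unfold divg
  refine Finset.sum_congr rfl fun μ _ => ?_
  rw [pd_congr (f' := fun y => Q μ y * F' μ y) (fun y hy => by simp only [e μ y hy]) hU hx,
    e μ x hx]

theorem divg_add {F F' : α → (α ⊕ κ → ℝ) → ℝ} (hQ : ∀ μ, DifferentiableAt ℝ (Q μ) x)
    (hF : ∀ μ, DifferentiableAt ℝ (F μ) x) (hF' : ∀ μ, DifferentiableAt ℝ (F' μ) x) :
    divg Q t (fun μ y => F μ y + F' μ y) x = divg Q t F x + divg Q t F' x := by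
  unfold divg
  rw [← Finset.sum_add_distrib]
  refine Finset.sum_congr rfl fun μ _ => ?_
  simp only [mul_add]
  rw [pd_add ((hQ μ).fun_mul (hF μ)) ((hQ μ).fun_mul (hF' μ))]
  ring

theorem divg_mul {F : α → (α ⊕ κ → ℝ) → ℝ} {f : (α ⊕ κ → ℝ) → ℝ} {d : α → ℝ}
    (hQ : ∀ μ, DifferentiableAt ℝ (Q μ) x)
    (hF : ∀ μ, DifferentiableAt ℝ (F μ) x) (hf : ∀ μ, HasPd (Sum.inl μ) f (d μ) x) :
    divg Q t (fun μ y => f y * F μ y) x = f x * divg Q t F x + ∑ μ, Q μ x * (d μ * F μ x) := by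
  unfold divg
  rw [Finset.mul_sum, ← Finset.sum_add_distrib]
  refine Finset.sum_congr rfl fun μ _ => ?_
  have h : (fun y => Q μ y * (f y * F μ y)) = fun y => f y * (Q μ y * F μ y) := by
    funext y; ring
  rw [h, pd_mul (hf μ).1 ((hQ μ).fun_mul (hF μ)), (hf μ).2]
  ring

theorem divg_sum {X : Type*} {s : Finset X} {F : X → α → (α ⊕ κ → ℝ) → ℝ}
    (hQ : ∀ μ, DifferentiableAt ℝ (Q μ) x)
    (hF : ∀ a ∈ s, ∀ μ, DifferentiableAt ℝ (F a μ) x) :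
    divg Q t (fun μ y => ∑ a ∈ s, F a μ y) x = ∑ a ∈ s, divg Q t (F a) x := by
  unfold divg
  rw [Finset.sum_comm]
  refine Finset.sum_congr rfl fun μ _ => ?_
  simp only [Finset.mul_sum]
  rw [pd_sum fun a ha => (hQ μ).fun_mul (hF a ha μ), ← Finset.sum_add_distrib]

end Divergence

/-! ### Bilinear forms under the shift of one torus differential -/

section BilinearForm

variable {κ : Type} [Fintype κ]

/-- The bilinear form with matrix `C`. -/
def bil (C : κ → κ → ℝ) (A B : κ → ℝ) : ℝ := ∑ k, ∑ l, A k * C k l * B l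

theorem bil_add_left (C : κ → κ → ℝ) (A A' B : κ → ℝ) :
    bil C (A + A') B = bil C A B + bil C A' B := by
  simp [bil, add_mul, Finset.sum_add_distrib]

theorem bil_add_right (C : κ → κ → ℝ) (A B B' : κ → ℝ) :
    bil C A (B + B') = bil C A B + bil C A B' := by
  simp [bil, mul_add, Finset.sum_add_distrib]

theorem bil_smul_left (C : κ → κ → ℝ) (c : ℝ) (A B : κ → ℝ) :
    bil C (c • A) B = c * bil C A B := by
  simp [bil, Finset.mul_sum, mul_assoc]

theorem bil_smul_right (C : κ → κ → ℝ) (c : ℝ) (A B : κ → ℝ) :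
    bil C A (c • B) = c * bil C A B := by
  simp only [bil, Finset.mul_sum, Pi.smul_apply, smul_eq_mul]
  exact Finset.sum_congr rfl fun k _ => Finset.sum_congr rfl fun l _ => by ring

theorem bil_comm {C : κ → κ → ℝ} (hC : ∀ i j, C i j = C j i) (A B : κ → ℝ) :
    bil C A B = bil C B A := by
  unfold bil
  rw [Finset.sum_comm]
  exact Finset.sum_congr rfl fun k _ => Finset.sum_congr rfl fun l _ => by rw [hC l k]; ring

variable [DecidableEq κ]

/-- The matrix obtained from `C` by the transformation dual to `dψ_o ↦ dψ_o - u`. -/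
def twistInv (C : κ → κ → ℝ) (o : κ) (u : κ → ℝ) (r : ℝ) (i j : κ) : ℝ :=
  C i j + r * ((if i = o then ∑ k, C j k * u k else 0) + (if j = o then ∑ k, C i k * u k else 0))
    + r ^ 2 * (if i = o then (if j = o then bil C u u else 0) else 0)

/-- `twistInv C o u r` is C conjugated by 1 + r e_o uᵀ, so it acts as C on arguments shifted along
`u`. All contractions with the charged inverse metric are computed in this way. -/
theorem bil_twistInv {C : κ → κ → ℝ} (hC : ∀ i j, C i j = C j i) (o : κ) (u : κ → ℝ) (r : ℝ)
    (A B : κ → ℝ) :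
    bil (twistInv C o u r) A B = bil C (A + (r * A o) • u) (B + (r * B o) • u) := by
  have e1 : ∀ A : κ → ℝ, ∑ k, ∑ l, A k * (if k = o then ∑ m, C l m * u m else 0) * B l
      = A o * bil C u B := by
    intro A
    simp only [mul_ite, ite_mul, mul_zero, zero_mul]
    rw [Finset.sum_comm]
    simp only [Finset.sum_ite_eq', Finset.mem_univ, if_true, bil, Finset.mul_sum, Finset.sum_mul]
    rw [Finset.sum_comm]
    exact Finset.sum_congr rfl fun k _ => Finset.sum_congr rfl fun l _ => by
      rw [hC l k]; ring
  have e2 : ∑ k, ∑ l, A k * (if l = o then ∑ m, C k m * u m else 0) * B l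
      = B o * bil C A u := by
    simp only [mul_ite, ite_mul, mul_zero, zero_mul, Finset.sum_ite_eq', Finset.mem_univ, if_true,
      bil, Finset.mul_sum, Finset.sum_mul]
    exact Finset.sum_congr rfl fun k _ => Finset.sum_congr rfl fun l _ => by ring
  have e3 : ∑ k, ∑ l, A k * (if k = o then (if l = o then bil C u u else 0) else 0) * B l
      = A o * B o * bil C u u := by
    simp only [mul_ite, ite_mul, mul_zero, zero_mul]
    rw [Finset.sum_comm]
    simp only [Finset.sum_ite_eq', Finset.mem_univ, if_true]
    ring
  have e4 : bil (twistInv C o u r) A B = bil C A B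
      + r * (∑ k, ∑ l, A k * (if k = o then ∑ m, C l m * u m else 0) * B l)
      + r * (∑ k, ∑ l, A k * (if l = o then ∑ m, C k m * u m else 0) * B l)
      + r ^ 2 * ∑ k, ∑ l, A k * (if k = o then (if l = o then bil C u u else 0) else 0) * B l := by
    simp only [bil, Finset.mul_sum]
    simp only [← Finset.sum_add_distrib]
    refine Finset.sum_congr rfl fun k _ => Finset.sum_congr rfl fun l _ => ?_
    simp only [twistInv, bil]
    ring
  rw [e4, e1, e2, e3]
  simp only [bil_add_left, bil_add_right, bil_smul_left, bil_smul_right]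
  ring

theorem twistInv_symm {C : κ → κ → ℝ} (hC : ∀ i j, C i j = C j i) (o : κ) (u : κ → ℝ) (r : ℝ)
    (i j : κ) : twistInv C o u r i j = twistInv C o u r j i := by
  unfold twistInv
  rw [hC i j]
  split_ifs <;> ring

/-- The components of a tensor after `dψ_o ↦ dψ_o - u`. -/
def twist (X : κ → κ → ℝ) (o : κ) (u : κ → ℝ) (i j : κ) : ℝ :=
  X i j - u i * X o j - X i o * u j + X o o * (u i * u j)

theorem bil_single_left (C : κ → κ → ℝ) (i : κ) (B : κ → ℝ) :
    bil C (Pi.single i 1) B = ∑ l, C i l * B l := by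
  simp [bil, Pi.single_apply]

/-- Contraction of a twisted tensor with the twisted inverse. -/
theorem sum_twistInv_mul_twist {C : κ → κ → ℝ} (hC : ∀ i j, C i j = C j i) (o : κ) (u : κ → ℝ)
    {r : ℝ} (hr : r ≠ 0) (hu : u o = 1 - 1 / r) (X : κ → κ → ℝ) :
    ∑ i, ∑ j, twistInv C o u r i j * twist X o u j i = ∑ i, ∑ j, C i j * X j i := by
  have h1 : ∀ i, ∑ j, twistInv C o u r i j * twist X o u j i
      = bil (twistInv C o u r) (Pi.single i 1) (fun j => twist X o u j i) := fun i => by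
    rw [bil_single_left]
  -- Since u_o = 1 - 1/r, shifting the argument undoes the twist in the first index and leaves the
  -- one in the second.
  have h2 : ∀ i, (fun j => twist X o u j i) + (r * twist X o u o i) • u
      = fun j => X j i - X j o * u i := by
    intro i
    funext j
    simp only [Pi.add_apply, Pi.smul_apply, smul_eq_mul, twist, hu]
    field_simp
    ring
  have h3 : ∀ i, bil (twistInv C o u r) (Pi.single i 1) (fun j => twist X o u j i)
      = bil C (Pi.single i 1) (fun j => X j i - X j o * u i)
        + (if i = o then r * bil C u (fun j => X j i - X j o * u i) else 0) := by
    intro i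
    rw [bil_twistInv hC, h2, bil_add_left, bil_smul_left]
    congr 1
    by_cases e : i = o
    · subst e; simp
    · simp [e]
  have h4 : (fun j => X j o - X j o * u o) = (1 / r) • fun j => X j o := by
    funext j
    simp only [Pi.smul_apply, smul_eq_mul, hu]
    ring
  rw [Finset.sum_congr rfl fun i _ => (h1 i).trans (h3 i), Finset.sum_add_distrib]
  simp only [Finset.sum_ite_eq', Finset.mem_univ, if_true]
  rw [h4, bil_smul_right, ← mul_assoc, mul_one_div_cancel hr, one_mul]
  simp only [bil_single_left, mul_sub, Finset.sum_sub_distrib]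
  have h5 : ∑ i, ∑ j, C i j * (X j o * u i) = bil C u (fun j => X j o) := by
    unfold bil
    exact Finset.sum_congr rfl fun k _ => Finset.sum_congr rfl fun l _ => by ring
  rw [h5]
  ring

end BilinearForm

/-! ### Charging a vacuum metric: the torus block of the Einstein equation -/

section Charging

variable {α κ : Type} [Fintype α] [DecidableEq α] [Fintype κ] [DecidableEq κ]

/-- The part of `R_νρ` that involves the metric `∑ (dx^μ)² / Q_μ` of the base and `t` only. -/
def baseRicci (Q t : α → (α ⊕ κ → ℝ) → ℝ) (ν ρ : α) (x : α ⊕ κ → ℝ) : ℝ :=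
  let h : α → (α ⊕ κ → ℝ) → ℝ := fun μ y => 1 / Q μ y
  1 / 2 * pd (Sum.inl ρ) (logDer h ν ρ) x + 1 / 2 * pd (Sum.inl ν) (logDer h ρ ν) x
    - pd (Sum.inl ρ) (t ν) x
    + 1 / 2 * (t ρ x * logDer h ν ρ x + t ν x * logDer h ρ ν x)
    - 1 / 4 * (∑ k, logDer h ρ k x * logDer h ν k x
      + 2 * (logDer h ν ρ x * logDer h ρ ν x))
    + if ν = ρ then
        -(1 / 2) * ∑ k, pd (Sum.inl k) (fun y => h ν y / h k y * logDer h k ν y) x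
        - 1 / 2 * ∑ k, t k x * (h ν x / h k x * logDer h k ν x)
        + 1 / 2 * ∑ k, h ν x / h k x * logDer h k ν x ^ 2
      else 0

/-- A metric `∑ (dx^μ)² / Q_μ + G₀_ij dψ^i dψ^j` satisfying the vacuum equations, with the Killing
vector `∂/∂ψ^o`, and a potential `u_i dψ^i` by which it can be charged. -/
structure ChargedVacuum (U : Set (α ⊕ κ → ℝ)) (Q t : α → (α ⊕ κ → ℝ) → ℝ)
    (G₀ C₀ : κ → κ → (α ⊕ κ → ℝ) → ℝ) (o : κ) (u : κ → (α ⊕ κ → ℝ) → ℝ)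
    (Φ : (α ⊕ κ → ℝ) → ℝ) (a q : ℝ) : Prop where
  isOpen : IsOpen U
  smooth_Q : ∀ μ, SmoothOn U (Q μ)
  smooth_t : ∀ μ, SmoothOn U (t μ)
  smooth_G : ∀ i j, SmoothOn U (G₀ i j)
  smooth_C : ∀ i j, SmoothOn U (C₀ i j)
  smooth_u : ∀ i, SmoothOn U (u i)
  smooth_Phi : SmoothOn U Φ
  basic_Q : ∀ μ, IsBasic (Q μ)
  basic_G : ∀ i j, IsBasic (G₀ i j)
  basic_C : ∀ i j, IsBasic (C₀ i j)
  basic_u : ∀ i, IsBasic (u i)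
  basic_Phi : IsBasic Φ
  Q_pos : ∀ x ∈ U, ∀ μ, 0 < Q μ x
  G_symm : ∀ x ∈ U, ∀ i j, G₀ i j x = G₀ j i x
  C_symm : ∀ x ∈ U, ∀ i j, C₀ i j x = C₀ j i x
  C_mul : ∀ x ∈ U, ∀ i j, ∑ k, C₀ i k x * G₀ k j x = if i = j then 1 else 0
  vacuum_rr : ∀ x ∈ U, ∀ i j, divg Q t (fun μ => pd (Sum.inl μ) (G₀ i j)) x
    = ∑ μ, Q μ x * bil (fun k l => C₀ k l x) (fun k => pd (Sum.inl μ) (G₀ i k) x)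
      (fun k => pd (Sum.inl μ) (G₀ j k) x)
  vacuum_ll : ∀ x ∈ U, ∀ ν ρ, baseRicci Q t ν ρ x
    = 1 / 4 * ∑ k, ∑ l, (∑ a, C₀ k a x * pd (Sum.inl ρ) (G₀ a l) x) *
        (∑ b, C₀ l b x * pd (Sum.inl ν) (G₀ b k) x)
  vacuum_vol : ∀ x ∈ U, ∀ μ, logVol (fun μ y => 1 / Q μ y) G₀ C₀ μ x = t μ x
  Phi_pos : ∀ x ∈ U, 0 < Φ x
  Phi_eq : ∀ x ∈ U, Φ x = a * (G₀ o o x + q ^ 2)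
  u_eq : ∀ x ∈ U, u o x = 1 - 1 / Φ x
  pd_u : ∀ x ∈ U, ∀ μ i, pd (Sum.inl μ) (u i) x
    = a / Φ x * (pd (Sum.inl μ) (G₀ i o) x - pd (Sum.inl μ) (G₀ o o) x * u i x)

namespace ChargedVacuum

variable {U : Set (α ⊕ κ → ℝ)} {Q t : α → (α ⊕ κ → ℝ) → ℝ}
    {G₀ C₀ : κ → κ → (α ⊕ κ → ℝ) → ℝ} {o : κ} {u : κ → (α ⊕ κ → ℝ) → ℝ}
    {Φ : (α ⊕ κ → ℝ) → ℝ} {a q : ℝ} {x : α ⊕ κ → ℝ}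

theorem a_ne (K : ChargedVacuum U Q t G₀ C₀ o u Φ a q) (hx : x ∈ U) : a ≠ 0 := by
  intro h
  have h1 := K.Phi_pos x hx
  rw [K.Phi_eq x hx, h, zero_mul] at h1
  exact lt_irrefl _ h1

/-- The relation Φ = a (V + q²) in the form in which it closes the Einstein and dilaton equations.
-/
theorem ratio_mul (K : ChargedVacuum U Q t G₀ C₀ o u Φ a q) (hx : x ∈ U) :
    a / Φ x * (G₀ o o x + q ^ 2) = 1 := by
  have h1 := (K.Phi_pos x hx).ne'
  rw [div_mul_eq_mul_div, ← K.Phi_eq x hx, div_self h1]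

theorem hasPd_G (K : ChargedVacuum U Q t G₀ C₀ o u Φ a q) (hx : x ∈ U) (μ : α) (i j : κ) :
    HasPd (Sum.inl μ) (G₀ i j) (pd (Sum.inl μ) (G₀ i j) x) x :=
  (K.smooth_G i j).hasPd K.isOpen hx _

theorem hasPd_u (K : ChargedVacuum U Q t G₀ C₀ o u Φ a q) (hx : x ∈ U) (μ : α) (i : κ) :
    HasPd (Sum.inl μ) (u i)
      (a / Φ x * (pd (Sum.inl μ) (G₀ i o) x - pd (Sum.inl μ) (G₀ o o) x * u i x)) x :=
  ((K.smooth_u i).hasPd K.isOpen hx _).congr_val (K.pd_u x hx μ i)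

theorem hasPd_Phi (K : ChargedVacuum U Q t G₀ C₀ o u Φ a q) (hx : x ∈ U) (μ : α) :
    HasPd (Sum.inl μ) Φ (a * pd (Sum.inl μ) (G₀ o o) x) x :=
  (((K.hasPd_G hx μ o o).add (hasPd_const (q ^ 2))).const_mul a).congr_on K.isOpen hx
    K.Phi_eq |>.congr_val (by ring)

theorem hasPd_ratio (K : ChargedVacuum U Q t G₀ C₀ o u Φ a q) (hx : x ∈ U) (μ : α) :
    HasPd (Sum.inl μ) (fun y => a / Φ y) (-(a / Φ x) ^ 2 * pd (Sum.inl μ) (G₀ o o) x) x :=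
  ((hasPd_const a).div (K.hasPd_Phi hx μ) (K.Phi_pos x hx).ne').congr_val (by ring)

theorem pd_symm (K : ChargedVacuum U Q t G₀ C₀ o u Φ a q) (hx : x ∈ U) (μ : α) (i j : κ) :
    pd (Sum.inl μ) (G₀ i j) x = pd (Sum.inl μ) (G₀ j i) x :=
  pd_congr (fun y hy => K.G_symm y hy i j) K.isOpen hx _

/-- The covector v is the o-th column of `G₀`, hence C₀ v is the o-th basis vector, and pairing with
v picks out a component. -/
theorem bil_right (K : ChargedVacuum U Q t G₀ C₀ o u Φ a q) (hx : x ∈ U) (A : κ → ℝ) :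
    bil (fun k l => C₀ k l x) A (fun k => G₀ k o x) = A o := by
  have h1 : ∀ k, ∑ l, A k * C₀ k l x * G₀ l o x = A k * if k = o then 1 else 0 := fun k => by
    rw [← K.C_mul x hx k o, Finset.mul_sum]
    exact Finset.sum_congr rfl fun l _ => mul_assoc _ _ _
  simp only [bil, h1]
  simp

theorem bil_symm (K : ChargedVacuum U Q t G₀ C₀ o u Φ a q) (hx : x ∈ U) (A B : κ → ℝ) :
    bil (fun k l => C₀ k l x) A B = bil (fun k l => C₀ k l x) B A :=
  bil_comm (K.C_symm x hx) A B

theorem bil_left (K : ChargedVacuum U Q t G₀ C₀ o u Φ a q) (hx : x ∈ U) (A : κ → ℝ) :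
    bil (fun k l => C₀ k l x) (fun k => G₀ k o x) A = A o := by
  rw [K.bil_symm hx, K.bil_right hx]

/-- The charged metric on the torus. -/
def _root_.ChargedKerrNUT.chargedG (G₀ : κ → κ → (α ⊕ κ → ℝ) → ℝ) (o : κ)
    (u : κ → (α ⊕ κ → ℝ) → ℝ) (i j : κ) (y : α ⊕ κ → ℝ) : ℝ :=
  twist (fun i j => G₀ i j y) o (fun i => u i y) i j

/-- The inverse of the charged metric on the torus. -/
def _root_.ChargedKerrNUT.chargedC (C₀ : κ → κ → (α ⊕ κ → ℝ) → ℝ) (o : κ)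
    (u : κ → (α ⊕ κ → ℝ) → ℝ) (Φ : (α ⊕ κ → ℝ) → ℝ) (i j : κ) (y : α ⊕ κ → ℝ) : ℝ :=
  twistInv (fun i j => C₀ i j y) o (fun i => u i y) (Φ y) i j

/-- The covector `v - V u`, where `v_i = G₀_io`, `V = v_o`. -/
def _root_.ChargedKerrNUT.chargedZ (G₀ : κ → κ → (α ⊕ κ → ℝ) → ℝ) (o : κ)
    (u : κ → (α ⊕ κ → ℝ) → ℝ) (i : κ) (y : α ⊕ κ → ℝ) : ℝ := G₀ i o y - G₀ o o y * u i y

/-- `coeffA` and `coeffB` are the coefficients of ∂v and of ∂V = ∂(G₀)_oo in the derivative of the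
charged torus metric, after ∂u has been eliminated. -/
def coeffA (G₀ : κ → κ → (α ⊕ κ → ℝ) → ℝ) (o : κ) (u : κ → (α ⊕ κ → ℝ) → ℝ)
    (Φ : (α ⊕ κ → ℝ) → ℝ) (a : ℝ) (j : κ) (y : α ⊕ κ → ℝ) : ℝ :=
  -(a / Φ y * chargedZ G₀ o u j y) - u j y

def coeffB (G₀ : κ → κ → (α ⊕ κ → ℝ) → ℝ) (o : κ) (u : κ → (α ⊕ κ → ℝ) → ℝ)
    (Φ : (α ⊕ κ → ℝ) → ℝ) (a : ℝ) (i j : κ) (y : α ⊕ κ → ℝ) : ℝ :=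
  a / Φ y * (u i y * G₀ j o y + u j y * G₀ i o y) + u i y * u j y * (1 - 2 * (a / Φ y * G₀ o o y))

theorem hasPd_chargedZ (K : ChargedVacuum U Q t G₀ C₀ o u Φ a q) (hx : x ∈ U) (μ : α) (j : κ) :
    HasPd (Sum.inl μ) (chargedZ G₀ o u j) (pd (Sum.inl μ) (G₀ j o) x
      - (pd (Sum.inl μ) (G₀ o o) x * u j x + G₀ o o x * pd (Sum.inl μ) (u j) x)) x :=
  ((K.hasPd_G hx μ j o).sub ((K.hasPd_G hx μ o o).mul ((K.smooth_u j).hasPd K.isOpen hx _)))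

theorem hasPd_coeffA (K : ChargedVacuum U Q t G₀ C₀ o u Φ a q) (hx : x ∈ U) (μ : α) (j : κ) :
    HasPd (Sum.inl μ) (coeffA G₀ o u Φ a j)
      (-(-(a / Φ x) ^ 2 * pd (Sum.inl μ) (G₀ o o) x * chargedZ G₀ o u j x
        + a / Φ x * (pd (Sum.inl μ) (G₀ j o) x
      - (pd (Sum.inl μ) (G₀ o o) x * u j x + G₀ o o x * pd (Sum.inl μ) (u j) x)))
        - pd (Sum.inl μ) (u j) x) x :=
  ((K.hasPd_ratio hx μ).mul (K.hasPd_chargedZ hx μ j)).neg.sub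
    ((K.smooth_u j).hasPd K.isOpen hx _)

theorem hasPd_coeffB (K : ChargedVacuum U Q t G₀ C₀ o u Φ a q) (hx : x ∈ U) (μ : α) (i j : κ) :
    HasPd (Sum.inl μ) (coeffB G₀ o u Φ a i j)
      (-(a / Φ x) ^ 2 * pd (Sum.inl μ) (G₀ o o) x * (u i x * G₀ j o x + u j x * G₀ i o x)
        + a / Φ x * (pd (Sum.inl μ) (u i) x * G₀ j o x + u i x * pd (Sum.inl μ) (G₀ j o) x
          + (pd (Sum.inl μ) (u j) x * G₀ i o x + u j x * pd (Sum.inl μ) (G₀ i o) x))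
        + ((pd (Sum.inl μ) (u i) x * u j x + u i x * pd (Sum.inl μ) (u j) x)
            * (1 - 2 * (a / Φ x * G₀ o o x))
          + u i x * u j x * (-(2 * (-(a / Φ x) ^ 2 * pd (Sum.inl μ) (G₀ o o) x * G₀ o o x
            + a / Φ x * pd (Sum.inl μ) (G₀ o o) x))))) x := by
  have hu := fun k => (K.smooth_u k).hasPd K.isOpen hx (Sum.inl μ)
  have hG := fun k l => K.hasPd_G hx μ k l
  have hr := K.hasPd_ratio hx μ
  exact ((hr.mul (((hu i).mul (hG j o)).add ((hu j).mul (hG i o)))).add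
    (((hu i).mul (hu j)).mul ((hasPd_const 1).sub ((hr.mul (hG o o)).const_mul 2)))).congr_val
    (by ring)

theorem pd_chargedG (K : ChargedVacuum U Q t G₀ C₀ o u Φ a q) (hx : x ∈ U) (μ : α) (i j : κ) :
    HasPd (Sum.inl μ) (chargedG G₀ o u i j) (pd (Sum.inl μ) (G₀ i j) x
      + coeffA G₀ o u Φ a j x * pd (Sum.inl μ) (G₀ i o) x
      + coeffA G₀ o u Φ a i x * pd (Sum.inl μ) (G₀ j o) x
      + coeffB G₀ o u Φ a i j x * pd (Sum.inl μ) (G₀ o o) x) x := by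
  have hu := fun k => K.hasPd_u hx μ k
  have hG := fun k l => K.hasPd_G hx μ k l
  refine ((((hG i j).sub ((hu i).mul (hG o j))).sub ((hG i o).mul (hu j))).add
    ((hG o o).mul ((hu i).mul (hu j)))).congr_val ?_
  rw [K.pd_symm hx μ o j, K.G_symm x hx o j]
  simp only [coeffA, coeffB, chargedZ]
  ring

/-- `Z = (∂G)_i + Φ (∂G)_io u`. -/
theorem pd_chargedG_add (K : ChargedVacuum U Q t G₀ C₀ o u Φ a q) (hx : x ∈ U) (μ : α) (i : κ) :
    (fun k => pd (Sum.inl μ) (chargedG G₀ o u i k) x)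
        + (Φ x * pd (Sum.inl μ) (chargedG G₀ o u i o) x) • (fun k => u k x)
      = (fun k => pd (Sum.inl μ) (G₀ i k) x)
        + ((-(pd (Sum.inl μ) (u i) x)) • (fun k => G₀ k o x)
        + coeffA G₀ o u Φ a i x • fun k => pd (Sum.inl μ) (G₀ k o) x) := by
  funext k
  have hΦ := (K.Phi_pos x hx).ne'
  simp only [Pi.add_apply, Pi.smul_apply, smul_eq_mul, (K.pd_chargedG hx μ _ _).eq, K.pd_u x hx]
  have e : Φ x * u o x = Φ x - 1 := by rw [K.u_eq x hx]; field_simp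
  simp only [coeffA, coeffB, chargedZ]
  linear_combination (-((1 - a / Φ x * G₀ o o x) * pd (Sum.inl μ) (G₀ i o) x
    - (a / Φ x * G₀ i o x + u i x * (1 - 2 * (a / Φ x * G₀ o o x)))
      * pd (Sum.inl μ) (G₀ o o) x) * u k x) * e

theorem bil_chargedC (K : ChargedVacuum U Q t G₀ C₀ o u Φ a q) (hx : x ∈ U) (A B : κ → ℝ) :
    bil (fun k l => chargedC C₀ o u Φ k l x) A B
      = bil (fun k l => C₀ k l x) (A + (Φ x * A o) • fun k => u k x)
        (B + (Φ x * B o) • fun k => u k x) :=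
  bil_twistInv (K.C_symm x hx) o (fun k => u k x) (Φ x) A B

/-- By `bil_chargedC` and `pd_chargedG_add`, the charged form is C₀ evaluated at ∂G₀ corrected along
v and ∂v. Products with v are evaluated by C₀ v = e_o, and only the vacuum contractions of ∂G₀ and
∂v remain. -/
theorem bil_pd_chargedG (K : ChargedVacuum U Q t G₀ C₀ o u Φ a q) (hx : x ∈ U) (μ : α) (i j : κ) :
    bil (fun k l => chargedC C₀ o u Φ k l x) (fun k => pd (Sum.inl μ) (chargedG G₀ o u i k) x)
        (fun k => pd (Sum.inl μ) (chargedG G₀ o u j k) x)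
      = bil (fun k l => C₀ k l x) (fun k => pd (Sum.inl μ) (G₀ i k) x)
          (fun k => pd (Sum.inl μ) (G₀ j k) x)
        - pd (Sum.inl μ) (u j) x * pd (Sum.inl μ) (G₀ i o) x
        - pd (Sum.inl μ) (u i) x * pd (Sum.inl μ) (G₀ j o) x
        + coeffA G₀ o u Φ a j x * bil (fun k l => C₀ k l x) (fun k => pd (Sum.inl μ) (G₀ i k) x)
          (fun k => pd (Sum.inl μ) (G₀ k o) x)
        + coeffA G₀ o u Φ a i x * bil (fun k l => C₀ k l x) (fun k => pd (Sum.inl μ) (G₀ j k) x)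
          (fun k => pd (Sum.inl μ) (G₀ k o) x)
        + pd (Sum.inl μ) (u i) x * pd (Sum.inl μ) (u j) x * G₀ o o x
        - (pd (Sum.inl μ) (u i) x * coeffA G₀ o u Φ a j x
          + pd (Sum.inl μ) (u j) x * coeffA G₀ o u Φ a i x) * pd (Sum.inl μ) (G₀ o o) x
        + coeffA G₀ o u Φ a i x * coeffA G₀ o u Φ a j x *
          bil (fun k l => C₀ k l x) (fun k => pd (Sum.inl μ) (G₀ k o) x)
            (fun k => pd (Sum.inl μ) (G₀ k o) x) := by
  rw [K.bil_chargedC hx, K.pd_chargedG_add hx, K.pd_chargedG_add hx]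
  simp only [bil_add_left, bil_add_right, bil_smul_left, bil_smul_right, K.bil_right hx,
    K.bil_left hx, Pi.add_apply, Pi.smul_apply, smul_eq_mul]
  rw [K.bil_symm hx (fun k => pd (Sum.inl μ) (G₀ k o) x) (fun k => pd (Sum.inl μ) (G₀ j k) x)]
  ring

/-- The divergence of `∂ G` for the charged metric. -/
theorem divg_chargedG (K : ChargedVacuum U Q t G₀ C₀ o u Φ a q) (hx : x ∈ U) (i j : κ) :
    divg Q t (fun μ => pd (Sum.inl μ) (chargedG G₀ o u i j)) x
      = ∑ μ, Q μ x * (bil (fun k l => C₀ k l x) (fun k => pd (Sum.inl μ) (G₀ i k) x)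
          (fun k => pd (Sum.inl μ) (G₀ j k) x)
        + coeffA G₀ o u Φ a j x * bil (fun k l => C₀ k l x) (fun k => pd (Sum.inl μ) (G₀ i k) x)
          (fun k => pd (Sum.inl μ) (G₀ k o) x)
        + coeffA G₀ o u Φ a i x * bil (fun k l => C₀ k l x) (fun k => pd (Sum.inl μ) (G₀ j k) x)
          (fun k => pd (Sum.inl μ) (G₀ k o) x)
        + coeffB G₀ o u Φ a i j x * bil (fun k l => C₀ k l x)
          (fun k => pd (Sum.inl μ) (G₀ k o) x) (fun k => pd (Sum.inl μ) (G₀ k o) x)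
        + pd (Sum.inl μ) (coeffA G₀ o u Φ a j) x * pd (Sum.inl μ) (G₀ i o) x
        + pd (Sum.inl μ) (coeffA G₀ o u Φ a i) x * pd (Sum.inl μ) (G₀ j o) x
        + pd (Sum.inl μ) (coeffB G₀ o u Φ a i j) x * pd (Sum.inl μ) (G₀ o o) x) := by
  have hQ : ∀ μ, DifferentiableAt ℝ (Q μ) x := fun μ =>
    (K.smooth_Q μ).differentiableAt K.isOpen hx
  have hd : ∀ k l μ, DifferentiableAt ℝ (pd (Sum.inl μ) (G₀ k l)) x := fun k l μ =>
    ((K.smooth_G k l).pd K.isOpen _).differentiableAt K.isOpen hx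
  have hA : ∀ k μ, HasPd (Sum.inl μ) (coeffA G₀ o u Φ a k)
      (pd (Sum.inl μ) (coeffA G₀ o u Φ a k) x) x := fun k μ =>
    ⟨(K.hasPd_coeffA hx μ k).1, rfl⟩
  have hB : ∀ μ, HasPd (Sum.inl μ) (coeffB G₀ o u Φ a i j)
      (pd (Sum.inl μ) (coeffB G₀ o u Φ a i j) x) x := fun μ =>
    ⟨(K.hasPd_coeffB hx μ i j).1, rfl⟩
  have m : ∀ {f f' : (α ⊕ κ → ℝ) → ℝ}, DifferentiableAt ℝ f x → DifferentiableAt ℝ f' x →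
      DifferentiableAt ℝ (fun y => f y * f' y) x := fun h h' => h.fun_mul h'
  rw [divg_congr K.isOpen hx fun μ y hy => (K.pd_chargedG hy μ i j).eq]
  -- The Leibniz rule takes the coefficients out of the divergence. The four remaining divergences
  -- are vacuum ones, so no second derivatives of `G₀` survive.
  rw [divg_add hQ (fun μ => (((hd i j μ).fun_add (m (hA j μ).1 (hd i o μ))).fun_add
      (m (hA i μ).1 (hd j o μ)))) (fun μ => m (hB μ).1 (hd o o μ)),
    divg_add hQ (fun μ => ((hd i j μ).fun_add (m (hA j μ).1 (hd i o μ))))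
      (fun μ => (m (hA i μ).1 (hd j o μ))),
    divg_add hQ (fun μ => (hd i j μ)) (fun μ => (m (hA j μ).1 (hd i o μ))),
    divg_mul hQ (hd i o) (hA j), divg_mul hQ (hd j o) (hA i), divg_mul hQ (hd o o) hB,
    K.vacuum_rr x hx, K.vacuum_rr x hx, K.vacuum_rr x hx, K.vacuum_rr x hx]
  simp only [Finset.mul_sum, ← Finset.sum_add_distrib]
  refine Finset.sum_congr rfl fun μ _ => ?_
  simp only [fun k => K.pd_symm hx μ o k]
  ring

/-- For ∂u the shifted argument of `bil_chargedC` is simply proportional to ∂v, because u_o = 1 -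
1/Φ. In the same way `chargedZ_add` turns v - V u into v. -/
theorem pd_u_add (K : ChargedVacuum U Q t G₀ C₀ o u Φ a q) (hx : x ∈ U) (μ : α) :
    (fun k => pd (Sum.inl μ) (u k) x) + (Φ x * pd (Sum.inl μ) (u o) x) • (fun k => u k x)
      = (a / Φ x) • fun k => pd (Sum.inl μ) (G₀ k o) x := by
  funext k
  have hΦ := (K.Phi_pos x hx).ne'
  simp only [Pi.add_apply, Pi.smul_apply, smul_eq_mul, K.pd_u x hx]
  rw [K.u_eq x hx]
  field_simp
  ring

theorem chargedZ_add (K : ChargedVacuum U Q t G₀ C₀ o u Φ a q) (hx : x ∈ U) :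
    (fun k => chargedZ G₀ o u k x) + (Φ x * chargedZ G₀ o u o x) • (fun k => u k x)
      = fun k => G₀ k o x := by
  funext k
  have hΦ := (K.Phi_pos x hx).ne'
  simp only [Pi.add_apply, Pi.smul_apply, smul_eq_mul, chargedZ]
  rw [K.u_eq x hx]
  field_simp
  ring

theorem bil_pd_u_pd_u (K : ChargedVacuum U Q t G₀ C₀ o u Φ a q) (hx : x ∈ U) (μ ν : α) :
    bil (fun k l => chargedC C₀ o u Φ k l x) (fun k => pd (Sum.inl μ) (u k) x)
        (fun k => pd (Sum.inl ν) (u k) x)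
      = (a / Φ x) ^ 2 * bil (fun k l => C₀ k l x) (fun k => pd (Sum.inl μ) (G₀ k o) x)
        (fun k => pd (Sum.inl ν) (G₀ k o) x) := by
  rw [K.bil_chargedC hx, K.pd_u_add hx, K.pd_u_add hx, bil_smul_left, bil_smul_right]
  ring

theorem bil_pd_u_chargedZ (K : ChargedVacuum U Q t G₀ C₀ o u Φ a q) (hx : x ∈ U) (μ : α) :
    bil (fun k l => chargedC C₀ o u Φ k l x) (fun k => pd (Sum.inl μ) (u k) x)
        (fun k => chargedZ G₀ o u k x)
      = a / Φ x * pd (Sum.inl μ) (G₀ o o) x := by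
  rw [K.bil_chargedC hx, K.pd_u_add hx, K.chargedZ_add hx, bil_smul_left, K.bil_right hx]

theorem bil_chargedZ_pd_u (K : ChargedVacuum U Q t G₀ C₀ o u Φ a q) (hx : x ∈ U) (μ : α) :
    bil (fun k l => chargedC C₀ o u Φ k l x) (fun k => chargedZ G₀ o u k x)
        (fun k => pd (Sum.inl μ) (u k) x)
      = a / Φ x * pd (Sum.inl μ) (G₀ o o) x := by
  rw [K.bil_chargedC hx, K.pd_u_add hx, K.chargedZ_add hx, bil_smul_right, K.bil_left hx]

theorem bil_chargedZ_chargedZ (K : ChargedVacuum U Q t G₀ C₀ o u Φ a q) (hx : x ∈ U) :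
    bil (fun k l => chargedC C₀ o u Φ k l x) (fun k => chargedZ G₀ o u k x)
        (fun k => chargedZ G₀ o u k x) = G₀ o o x := by
  rw [K.bil_chargedC hx, K.chargedZ_add hx, K.bil_right hx]

/-- The Einstein equation in the `ψ` directions. -/
theorem einstein_rr (K : ChargedVacuum U Q t G₀ C₀ o u Φ a q) (hx : x ∈ U) (i j : κ) :
    -(1 / 2) * divg Q t (fun μ => pd (Sum.inl μ) (chargedG G₀ o u i j)) x
      + 1 / 2 * ∑ μ, Q μ x * bil (fun k l => chargedC C₀ o u Φ k l x)
        (fun k => pd (Sum.inl μ) (chargedG G₀ o u i k) x)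
        (fun k => pd (Sum.inl μ) (chargedG G₀ o u j k) x)
      = ∑ μ, Q μ x * (q ^ 2 * (pd (Sum.inl μ) (u i) x * pd (Sum.inl μ) (u j) x)
        + 1 / 2 * (pd (Sum.inl μ) (u i) x * pd (Sum.inl μ) (u j) x * G₀ o o x
          - a / Φ x * pd (Sum.inl μ) (G₀ o o) x * (pd (Sum.inl μ) (u i) x * chargedZ G₀ o u j x
            + pd (Sum.inl μ) (u j) x * chargedZ G₀ o u i x)
          + chargedZ G₀ o u i x * chargedZ G₀ o u j x * ((a / Φ x) ^ 2 *
            bil (fun k l => C₀ k l x) (fun k => pd (Sum.inl μ) (G₀ k o) x)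
              (fun k => pd (Sum.inl μ) (G₀ k o) x)))) := by
  rw [K.divg_chargedG hx]
  simp only [K.bil_pd_chargedG hx, Finset.mul_sum, ← Finset.sum_add_distrib]
  refine Finset.sum_congr rfl fun μ _ => ?_
  simp only [(K.hasPd_coeffA hx μ _).eq, (K.hasPd_coeffB hx μ _ _).eq]
  have hu : ∀ k, pd (Sum.inl μ) (u k) x = a / Φ x * (pd (Sum.inl μ) (G₀ k o) x
    - pd (Sum.inl μ) (G₀ o o) x * u k x) := K.pd_u x hx μ
  have e := K.ratio_mul hx
  simp only [hu, coeffA, coeffB, chargedZ]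
  -- Apart from the formula for ∂u, the two sides differ by a multiple of (a/Φ)(V + q²) - 1.
  linear_combination (-(Q μ x * (a / Φ x)
    * (pd (Sum.inl μ) (G₀ i o) x - pd (Sum.inl μ) (G₀ o o) x * u i x)
    * (pd (Sum.inl μ) (G₀ j o) x - pd (Sum.inl μ) (G₀ o o) x * u j x))) * e

end ChargedVacuum

end Charging

/-! ### The shift as conjugation by a rank-one perturbation of the identity -/

section TwistMatrix

variable {κ : Type} [Fintype κ] [DecidableEq κ]

open Matrix

theorem twist_eq_mul (X : Matrix κ κ ℝ) (o : κ) (u : κ → ℝ) :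
    (Matrix.of fun i j => twist X o u i j)
      = (1 - vecMulVec (Pi.single o 1) u)ᵀ * X * (1 - vecMulVec (Pi.single o 1) u) := by
  ext i j
  simp [transpose_sub, sub_mul, mul_sub, mul_vecMulVec, vecMulVec_mul, vecMulVec_apply, twist,
    transpose_vecMulVec]
  ring

theorem twistInv_eq_mul {C : Matrix κ κ ℝ} (hC : ∀ i j, C i j = C j i) (o : κ) (u : κ → ℝ)
    (r : ℝ) :
    (Matrix.of fun i j => twistInv C o u r i j)
      = (1 + r • vecMulVec (Pi.single o 1) u) * C * (1 + r • vecMulVec (Pi.single o 1) u)ᵀ := by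
  ext i j
  have h1 : ∀ i, ∑ k, u k * C k i = ∑ k, C i k * u k := fun i =>
    Finset.sum_congr rfl fun k _ => by rw [hC k i]; ring
  simp [transpose_add, add_mul, mul_add, mul_vecMulVec, vecMulVec_mul, vecMulVec_apply, twistInv,
    transpose_vecMulVec, vecMul, mulVec, dotProduct, bil, Pi.single_apply, h1]
  have h2 : ∑ x, (∑ k, C x k * u k) * u x = ∑ k, ∑ l, u k * C k l * u l := by
    simp only [Finset.sum_mul]
    exact Finset.sum_congr rfl fun k _ => Finset.sum_congr rfl fun l _ => by ring
  rw [h2]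
  split_ifs <;> ring

/-- For E = e_o uᵀ one has E² = u_o E, and r u_o = r - 1 makes the coefficient of E in the product
vanish. -/
theorem twist_mul_twistInv_aux (o : κ) (u : κ → ℝ) {r : ℝ} (hr : r ≠ 0) (hu : u o = 1 - 1 / r) :
    (1 - vecMulVec (Pi.single o 1) u) * (1 + r • vecMulVec (Pi.single o 1) u)
      = (1 : Matrix κ κ ℝ) := by
  set E := vecMulVec (Pi.single o (1 : ℝ)) u with hE
  have hEE : E * E = (1 - 1 / r) • E := by
    rw [hE, vecMulVec_mul_vecMulVec]
    ext i j
    simp [vecMulVec_apply, hu]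
    ring
  rw [sub_mul, one_mul, mul_add, mul_one, mul_smul_comm, hEE, smul_smul]
  have : r * (1 - 1 / r) = r - 1 := by field_simp
  rw [this, sub_smul, one_smul]
  abel

theorem twistInv_mul_twist {C X : Matrix κ κ ℝ} (hC : ∀ i j, C i j = C j i) (hCX : C * X = 1)
    (o : κ) (u : κ → ℝ) {r : ℝ} (hr : r ≠ 0) (hu : u o = 1 - 1 / r) :
    (Matrix.of fun i j => twistInv C o u r i j) * (Matrix.of fun i j => twist X o u i j) = 1 := by
  have h2 := twist_mul_twistInv_aux o u hr hu
  have h1 := congrArg transpose h2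
  rw [transpose_mul, transpose_one] at h1
  rw [twistInv_eq_mul hC, twist_eq_mul]
  set E := vecMulVec (Pi.single o (1 : ℝ)) u
  calc _ = (1 + r • E) * (C * ((1 + r • E)ᵀ * (1 - E)ᵀ) * X) * (1 - E) := by
        simp only [mul_assoc]
    _ = 1 := by rw [h1, mul_one, hCX, mul_one, mul_eq_one_comm.mp h2]

/-- The trace of `C X C X'` is not affected by twisting. -/
theorem trace_twist {C : Matrix κ κ ℝ} (hC : ∀ i j, C i j = C j i) (o : κ) (u : κ → ℝ)
    {r : ℝ} (hr : r ≠ 0) (hu : u o = 1 - 1 / r) (X X' : Matrix κ κ ℝ) :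
    trace ((Matrix.of fun i j => twistInv C o u r i j) * (Matrix.of fun i j => twist X o u i j) *
      ((Matrix.of fun i j => twistInv C o u r i j) * (Matrix.of fun i j => twist X' o u i j)))
      = trace (C * X * (C * X')) := by
  have h2 := twist_mul_twistInv_aux o u hr hu
  have h1 := congrArg transpose h2
  rw [transpose_mul, transpose_one] at h1
  rw [twistInv_eq_mul hC, twist_eq_mul, twist_eq_mul]
  set E := vecMulVec (Pi.single o (1 : ℝ)) u
  have e1 : ∀ Y : Matrix κ κ ℝ, (1 + r • E) * C * (1 + r • E)ᵀ * ((1 - E)ᵀ * Y * (1 - E))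
      = (1 + r • E) * (C * Y) * (1 - E) := fun Y => by
    calc _ = (1 + r • E) * C * ((1 + r • E)ᵀ * (1 - E)ᵀ) * Y * (1 - E) := by
          simp only [mul_assoc]
      _ = _ := by rw [h1]; simp only [mul_assoc, one_mul]
  rw [e1, e1]
  calc _ = trace ((1 + r • E) * (C * X * ((1 - E) * (1 + r • E)) * (C * X')) * (1 - E)) := by
        simp only [mul_assoc]
    _ = _ := by
        rw [h2, trace_mul_comm, ← mul_assoc, h2, one_mul, mul_one]

/-- The trace of `C X C X'` when `X` is changed by a symmetrized product with `v`, where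
`C v` is the `o`-th basis vector. -/
theorem trace_sub_sym {C : Matrix κ κ ℝ} (hC : ∀ i j, C i j = C j i) (o : κ) (v w w' : κ → ℝ)
    (hv : C *ᵥ v = Pi.single o 1) (r : ℝ) {X X' : Matrix κ κ ℝ} (hX : ∀ i, X i o = w i)
    (hX' : ∀ i, X' i o = w' i) (hXt : ∀ i, X o i = w i) (hX't : ∀ i, X' o i = w' i) :
    trace (C * (X - r • (vecMulVec w v + vecMulVec v w)) *
        (C * (X' - r • (vecMulVec w' v + vecMulVec v w'))))
      = trace (C * X * (C * X')) - 4 * r * (w ⬝ᵥ (C *ᵥ w'))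
        + r ^ 2 * (2 * v o * (w ⬝ᵥ (C *ᵥ w')) + 2 * (w o * w' o)) := by
  have hCt : Cᵀ = C := by ext i j; exact hC j i
  have hv' : v ᵥ* C = Pi.single o 1 := by
    rw [← hv, ← hCt, vecMul_transpose, hCt]
  have e1 : ∀ (Y : Matrix κ κ ℝ) (y : κ → ℝ), C * (Y - r • (vecMulVec y v + vecMulVec v y))
      = C * Y - r • (vecMulVec (C *ᵥ y) v + vecMulVec (Pi.single o 1) y) := fun Y y => by
    rw [mul_sub, mul_smul_comm, mul_add, mul_vecMulVec, mul_vecMulVec, hv]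
  have hXc : X *ᵥ Pi.single o 1 = w := by ext i; simp [hX]
  have hXc' : X' *ᵥ Pi.single o 1 = w' := by ext i; simp [hX']
  have hXr : Pi.single o 1 ᵥ* X = w := by ext i; simp [hXt]
  have hXr' : Pi.single o 1 ᵥ* X' = w' := by ext i; simp [hX't]
  have hs : w' ⬝ᵥ (C *ᵥ w) = w ⬝ᵥ (C *ᵥ w') := by
    rw [dotProduct_mulVec, ← hCt, vecMul_transpose, hCt, dotProduct_comm]
  have hvC : ∀ y : κ → ℝ, v ⬝ᵥ (C *ᵥ y) = y o := fun y => by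
    rw [dotProduct_mulVec, hv', single_one_dotProduct]
  have hvv : v ⬝ᵥ Pi.single o 1 = v o := by simp
  rw [e1, e1]
  -- Every correction term contains a rank-one factor, so its trace is a scalar product; C v = e_o
  -- then reduces each of them to components of `v`, `w`, `w'` and the pairing of `w` with `w'`.
  simp only [sub_mul, mul_sub, smul_mul_assoc, mul_smul_comm, add_mul, mul_add, trace_sub,
    trace_add, trace_smul, smul_eq_mul, vecMulVec_mul, mul_vecMulVec, trace_vecMulVec,
    ← vecMul_vecMul, ← mulVec_mulVec, hv', hXr', hXc]
  have hm : ∀ a b c : κ → ℝ, vecMulVec a b *ᵥ c = (b ⬝ᵥ c) • a := fun a b c => by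
    ext i
    simp only [mulVec, dotProduct, vecMulVec_apply, Pi.smul_apply, smul_eq_mul, Finset.sum_mul]
    exact Finset.sum_congr rfl fun k _ => by ring
  have hsym : ∀ y z, (C *ᵥ y) ⬝ᵥ z = y ⬝ᵥ (C *ᵥ z) := fun y z => by
    rw [dotProduct_mulVec, ← hCt, vecMul_transpose, hCt]
  have e2 : w ᵥ* C = C *ᵥ w := by rw [← hCt, vecMul_transpose, hCt]
  have e3 : Pi.single o 1 ⬝ᵥ ((C *ᵥ w) ᵥ* X') = w ⬝ᵥ (C *ᵥ w') := by
    rw [dotProduct_comm, ← dotProduct_mulVec, hXc', hsym]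
  have e4 : (C *ᵥ (X *ᵥ (C *ᵥ w'))) ⬝ᵥ v = w ⬝ᵥ (C *ᵥ w') := by
    rw [hsym, hv, dotProduct_comm, dotProduct_mulVec, hXr]
  rw [e2, e3, e4]
  simp only [hm, smul_dotProduct, smul_eq_mul, hvC, hvv, hsym, hv]
  simp only [dotProduct_single, single_dotProduct]
  ring

end TwistMatrix

/-! ### The field strengths of the charged solution and their contractions -/

section ChargedFields

variable {α κ : Type} [Fintype α] [DecidableEq α] [Fintype κ] [DecidableEq κ]

theorem dcoord_apply {ι : Type} [Fintype ι] [DecidableEq ι] (i : ι) (v : ι → ℝ) :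
    dcoord i ![v] = v i := rfl

theorem form_sum_apply {ι X : Type} [Fintype ι] {k : ℕ} (s : Finset X) (f : X → Form ι k)
    (v : Fin k → ι → ℝ) : (∑ a ∈ s, f a) v = ∑ a ∈ s, f a v := by
  simp

/-- The 1-form `∑ w_i dψ^i`. -/
def torusForm (w : κ → ℝ) : Form (α ⊕ κ) 1 := ∑ i, w i • dcoord (Sum.inr i)

theorem torusForm_apply (w : κ → ℝ) (v : α ⊕ κ → ℝ) :
    (torusForm w : Form (α ⊕ κ) 1) ![v] = ∑ i, w i * v (Sum.inr i) := by
  simp only [torusForm, form_sum_apply]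
  rfl

/-- The field strength of the potential `q u`. -/
def chargedF (u : κ → (α ⊕ κ → ℝ) → ℝ) (q : ℝ) (x : α ⊕ κ → ℝ) : Form (α ⊕ κ) 2 :=
  ∑ μ, wedge (dcoord (Sum.inl μ)) (torusForm fun i => q * pd (Sum.inl μ) (u i) x)

/-- The 3-form `-du ∧ (v - V u)`. -/
def chargedH (G₀ : κ → κ → (α ⊕ κ → ℝ) → ℝ) (o : κ) (u : κ → (α ⊕ κ → ℝ) → ℝ)
    (x : α ⊕ κ → ℝ) : Form (α ⊕ κ) 3 :=
  -∑ μ, wedge (wedge (dcoord (Sum.inl μ)) (torusForm fun i => pd (Sum.inl μ) (u i) x))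
    (torusForm fun i => chargedZ G₀ o u i x)

theorem chargedF_apply (u : κ → (α ⊕ κ → ℝ) → ℝ) (q : ℝ) (x y z : α ⊕ κ → ℝ) :
    chargedF u q x ![y, z] = ∑ μ,
      (y (Sum.inl μ) * (∑ i, q * pd (Sum.inl μ) (u i) x * z (Sum.inr i))
        - z (Sum.inl μ) * (∑ i, q * pd (Sum.inl μ) (u i) x * y (Sum.inr i))) := by
  simp only [chargedF, form_sum_apply, wedge_one_one, torusForm_apply, dcoord_apply]

theorem chargedH_apply (G₀ : κ → κ → (α ⊕ κ → ℝ) → ℝ) (o : κ) (u : κ → (α ⊕ κ → ℝ) → ℝ)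
    (x y z w : α ⊕ κ → ℝ) :
    chargedH G₀ o u x ![y, z, w] = -∑ μ,
      ((y (Sum.inl μ) * (∑ i, pd (Sum.inl μ) (u i) x * z (Sum.inr i))
          - z (Sum.inl μ) * (∑ i, pd (Sum.inl μ) (u i) x * y (Sum.inr i)))
          * (∑ i, chargedZ G₀ o u i x * w (Sum.inr i))
        - (y (Sum.inl μ) * (∑ i, pd (Sum.inl μ) (u i) x * w (Sum.inr i))
          - w (Sum.inl μ) * (∑ i, pd (Sum.inl μ) (u i) x * y (Sum.inr i)))
          * (∑ i, chargedZ G₀ o u i x * z (Sum.inr i))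
        + (z (Sum.inl μ) * (∑ i, pd (Sum.inl μ) (u i) x * w (Sum.inr i))
          - w (Sum.inl μ) * (∑ i, pd (Sum.inl μ) (u i) x * z (Sum.inr i)))
          * (∑ i, chargedZ G₀ o u i x * y (Sum.inr i))) := by
  simp only [chargedH, ContinuousAlternatingMap.neg_apply, form_sum_apply, wedge_two_one,
    wedge_one_one, torusForm_apply, dcoord_apply]

/-- The components of `chargedH`. -/
def compH (G₀ : κ → κ → (α ⊕ κ → ℝ) → ℝ) (o : κ) (u : κ → (α ⊕ κ → ℝ) → ℝ) (x : α ⊕ κ → ℝ)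
    (μ : α) (i j : κ) : ℝ :=
  pd (Sum.inl μ) (u j) x * chargedZ G₀ o u i x - pd (Sum.inl μ) (u i) x * chargedZ G₀ o u j x

section Components

variable (G₀ : κ → κ → (α ⊕ κ → ℝ) → ℝ) (o : κ) (u : κ → (α ⊕ κ → ℝ) → ℝ) (q : ℝ)
  (x : α ⊕ κ → ℝ) (μ ν ρ : α) (i j k : κ)

@[simp] theorem cvec_inl_inl : (cvec (Sum.inl μ) : α ⊕ κ → ℝ) (Sum.inl ν)
    = if μ = ν then 1 else 0 := by
  simp [cvec, Pi.single_apply, eq_comm]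

@[simp] theorem cvec_inl_inr : (cvec (Sum.inl μ) : α ⊕ κ → ℝ) (Sum.inr i) = 0 := by simp [cvec]

@[simp] theorem cvec_inr_inl : (cvec (Sum.inr i) : α ⊕ κ → ℝ) (Sum.inl ν) = 0 := by simp [cvec]

@[simp] theorem cvec_inr_inr : (cvec (Sum.inr i) : α ⊕ κ → ℝ) (Sum.inr j)
    = if i = j then 1 else 0 := by
  simp [cvec, Pi.single_apply, eq_comm]

theorem chargedF_ll : chargedF u q x ![cvec (Sum.inl μ), cvec (Sum.inl ν)] = 0 := by
  simp [chargedF_apply]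

theorem chargedF_rr : chargedF u q x ![cvec (Sum.inr i), cvec (Sum.inr j)] = 0 := by
  simp [chargedF_apply]

theorem chargedF_lr : chargedF u q x ![cvec (Sum.inl μ), cvec (Sum.inr i)]
    = q * pd (Sum.inl μ) (u i) x := by
  simp [chargedF_apply]

theorem chargedF_rl : chargedF u q x ![cvec (Sum.inr i), cvec (Sum.inl μ)]
    = -(q * pd (Sum.inl μ) (u i) x) := by
  simp [chargedF_apply]

theorem chargedH_lll :
    chargedH G₀ o u x ![cvec (Sum.inl μ), cvec (Sum.inl ν), cvec (Sum.inl ρ)] = 0 := by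
  simp [chargedH_apply]

theorem chargedH_llr :
    chargedH G₀ o u x ![cvec (Sum.inl μ), cvec (Sum.inl ν), cvec (Sum.inr i)] = 0 := by
  simp [chargedH_apply]

theorem chargedH_lrl :
    chargedH G₀ o u x ![cvec (Sum.inl μ), cvec (Sum.inr i), cvec (Sum.inl ν)] = 0 := by
  simp [chargedH_apply]

theorem chargedH_rll :
    chargedH G₀ o u x ![cvec (Sum.inr i), cvec (Sum.inl μ), cvec (Sum.inl ν)] = 0 := by
  simp [chargedH_apply]

theorem chargedH_rrr :
    chargedH G₀ o u x ![cvec (Sum.inr i), cvec (Sum.inr j), cvec (Sum.inr k)] = 0 := by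
  simp [chargedH_apply]

theorem chargedH_lrr :
    chargedH G₀ o u x ![cvec (Sum.inl μ), cvec (Sum.inr i), cvec (Sum.inr j)]
      = compH G₀ o u x μ i j := by
  simp [chargedH_apply, compH]

theorem chargedH_rlr :
    chargedH G₀ o u x ![cvec (Sum.inr i), cvec (Sum.inl μ), cvec (Sum.inr j)]
      = -compH G₀ o u x μ i j := by
  simp [chargedH_apply, compH, Finset.sum_add_distrib]
  ring

theorem chargedH_rrl :
    chargedH G₀ o u x ![cvec (Sum.inr i), cvec (Sum.inr j), cvec (Sum.inl μ)]
      = compH G₀ o u x μ i j := by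
  simp [chargedH_apply, compH, Finset.sum_add_distrib]
  ring

end Components

section Contractions

variable {U : Set (α ⊕ κ → ℝ)} {g : (α ⊕ κ → ℝ) → Matrix (α ⊕ κ) (α ⊕ κ) ℝ}
  {h : α → (α ⊕ κ → ℝ) → ℝ} {G C : κ → κ → (α ⊕ κ → ℝ) → ℝ} {x : α ⊕ κ → ℝ}

theorem mtrace_block (B : BlockMetric U g h G C) (hx : x ∈ U) (S : α ⊕ κ → α ⊕ κ → ℝ) :
    mtrace (g x) S = ∑ μ, 1 / h μ x * S (Sum.inl μ) (Sum.inl μ)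
      + ∑ i, ∑ j, C i j x * S (Sum.inr i) (Sum.inr j) := by
  simp [mtrace, Fintype.sum_sum_type, B.inv_ll hx, B.inv_lr hx, B.inv_rl hx, B.inv_rr hx]

theorem contrF_rr (B : BlockMetric U g h G C) (hx : x ∈ U) (u : κ → (α ⊕ κ → ℝ) → ℝ) (q : ℝ)
    (i j : κ) : contrF (g x) (chargedF u q x) (Sum.inr i) (Sum.inr j)
    = ∑ μ, 1 / h μ x * (q ^ 2 * (pd (Sum.inl μ) (u i) x * pd (Sum.inl μ) (u j) x)) := by
  simp only [contrF, Fintype.sum_sum_type, B.inv_ll hx, B.inv_lr hx, B.inv_rl hx, B.inv_rr hx,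
    chargedF_rr, chargedF_rl]
  simp only [ite_mul, zero_mul, mul_zero, Finset.sum_const_zero, add_zero, Finset.sum_ite_eq,
    Finset.mem_univ, if_true]
  exact Finset.sum_congr rfl fun μ _ => by ring

theorem contrF_lr (B : BlockMetric U g h G C) (hx : x ∈ U) (u : κ → (α ⊕ κ → ℝ) → ℝ) (q : ℝ)
    (ν : α) (j : κ) : contrF (g x) (chargedF u q x) (Sum.inl ν) (Sum.inr j) = 0 := by
  simp [contrF, Fintype.sum_sum_type, B.inv_ll hx, B.inv_lr hx, B.inv_rl hx, B.inv_rr hx,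
    chargedF_rr, chargedF_ll]

theorem contrF_rl (B : BlockMetric U g h G C) (hx : x ∈ U) (u : κ → (α ⊕ κ → ℝ) → ℝ) (q : ℝ)
    (ν : α) (j : κ) : contrF (g x) (chargedF u q x) (Sum.inr j) (Sum.inl ν) = 0 := by
  simp [contrF, Fintype.sum_sum_type, B.inv_ll hx, B.inv_lr hx, B.inv_rl hx, B.inv_rr hx,
    chargedF_rr, chargedF_ll]

theorem contrF_ll (B : BlockMetric U g h G C) (hx : x ∈ U) (u : κ → (α ⊕ κ → ℝ) → ℝ) (q : ℝ)
    (ν ρ : α) : contrF (g x) (chargedF u q x) (Sum.inl ν) (Sum.inl ρ)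
    = q ^ 2 * bil (fun k l => C k l x) (fun k => pd (Sum.inl ν) (u k) x)
        (fun k => pd (Sum.inl ρ) (u k) x) := by
  simp only [contrF, Fintype.sum_sum_type, B.inv_ll hx, B.inv_lr hx, B.inv_rl hx, B.inv_rr hx,
    chargedF_ll, chargedF_lr, bil, Finset.mul_sum]
  simp only [zero_mul, mul_zero, Finset.sum_const_zero, zero_add]
  rw [Finset.sum_comm]
  exact Finset.sum_congr rfl fun μ _ => Finset.sum_congr rfl fun k _ => by
    rw [B.C_symm x hx]; ring

/-- H has exactly one base index. It can occupy either of the two contracted slots, hence the factor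
2. -/
theorem contrH_rr (B : BlockMetric U g h G C) (hx : x ∈ U) (G₀ : κ → κ → (α ⊕ κ → ℝ) → ℝ) (o : κ)
    (u : κ → (α ⊕ κ → ℝ) → ℝ) (i j : κ) :
    contrH (g x) (chargedH G₀ o u x) (Sum.inr i) (Sum.inr j)
    = 2 * ∑ μ, 1 / h μ x * bil (fun k l => C k l x) (compH G₀ o u x μ i)
        (compH G₀ o u x μ j) := by
  simp only [contrH, Fintype.sum_sum_type, B.inv_ll hx, B.inv_lr hx, B.inv_rl hx, B.inv_rr hx,
    chargedH_rrr, chargedH_rlr, chargedH_rrl, chargedH_rll]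
  simp only [ite_mul, zero_mul, mul_zero, Finset.sum_const_zero, add_zero, zero_add,
    Finset.sum_ite_eq, Finset.mem_univ, if_true, mul_ite, two_mul]
  simp only [fun μ => bil_comm (B.C_symm x hx) (compH G₀ o u x μ i)]
  unfold bil
  congr 1
  · refine Finset.sum_congr rfl fun μ _ => ?_
    rw [Finset.mul_sum]
    simp only [Finset.sum_ite_irrel, Finset.sum_const_zero, Finset.sum_ite_eq, Finset.mem_univ,
      if_true, Finset.mul_sum]
    exact Finset.sum_congr rfl fun k _ => Finset.sum_congr rfl fun l _ => by ring
  · rw [Finset.sum_comm]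
    refine Finset.sum_congr rfl fun μ _ => ?_
    rw [Finset.mul_sum]
    simp only [Finset.sum_ite_irrel, Finset.sum_const_zero, Finset.sum_ite_eq, Finset.mem_univ,
      if_true, Finset.mul_sum]
    exact Finset.sum_congr rfl fun k _ => Finset.sum_congr rfl fun l _ => by ring

theorem contrH_lr (B : BlockMetric U g h G C) (hx : x ∈ U) (G₀ : κ → κ → (α ⊕ κ → ℝ) → ℝ) (o : κ)
    (u : κ → (α ⊕ κ → ℝ) → ℝ) (ν : α) (j : κ) :
    contrH (g x) (chargedH G₀ o u x) (Sum.inl ν) (Sum.inr j) = 0 := by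
  simp [contrH, Fintype.sum_sum_type, B.inv_ll hx, B.inv_lr hx, B.inv_rl hx, B.inv_rr hx,
    chargedH_rrr, chargedH_rlr, chargedH_rrl, chargedH_rll, chargedH_lrl, chargedH_llr,
    chargedH_lll]

theorem contrH_rl (B : BlockMetric U g h G C) (hx : x ∈ U) (G₀ : κ → κ → (α ⊕ κ → ℝ) → ℝ) (o : κ)
    (u : κ → (α ⊕ κ → ℝ) → ℝ) (ν : α) (j : κ) :
    contrH (g x) (chargedH G₀ o u x) (Sum.inr j) (Sum.inl ν) = 0 := by
  simp [contrH, Fintype.sum_sum_type, B.inv_ll hx, B.inv_lr hx, B.inv_rl hx, B.inv_rr hx,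
    chargedH_rrr, chargedH_rlr, chargedH_rrl, chargedH_rll, chargedH_lrl, chargedH_llr,
    chargedH_lll]

/-- With the base index ν fixed, H is the wedge (v - V u) ∧ ∂_νu on the torus, so the contraction is
a Gram determinant with respect to `C`. -/
theorem contrH_ll (B : BlockMetric U g h G C) (hx : x ∈ U) (G₀ : κ → κ → (α ⊕ κ → ℝ) → ℝ) (o : κ)
    (u : κ → (α ⊕ κ → ℝ) → ℝ) (ν ρ : α) :
    contrH (g x) (chargedH G₀ o u x) (Sum.inl ν) (Sum.inl ρ)
    = 2 * (bil (fun k l => C k l x) (fun k => pd (Sum.inl ν) (u k) x)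
          (fun k => pd (Sum.inl ρ) (u k) x) * bil (fun k l => C k l x)
          (fun k => chargedZ G₀ o u k x) (fun k => chargedZ G₀ o u k x)
        - bil (fun k l => C k l x) (fun k => pd (Sum.inl ν) (u k) x)
          (fun k => chargedZ G₀ o u k x) * bil (fun k l => C k l x)
          (fun k => pd (Sum.inl ρ) (u k) x) (fun k => chargedZ G₀ o u k x)) := by
  simp only [contrH, Fintype.sum_sum_type, B.inv_ll hx, B.inv_lr hx, B.inv_rl hx, B.inv_rr hx,
    chargedH_lll, chargedH_llr, chargedH_lrl, chargedH_lrr]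
  simp only [ite_mul, zero_mul, mul_zero, Finset.sum_const_zero, add_zero, zero_add]
  set p := fun k => pd (Sum.inl ν) (u k) x
  set p' := fun k => pd (Sum.inl ρ) (u k) x
  set z := fun k => chargedZ G₀ o u k x
  set c := fun k l => C k l x with hc
  have hcs : ∀ k l, c k l = c l k := B.C_symm x hx
  have prod : ∀ A A' D D' : κ → ℝ, ∑ k, ∑ l, ∑ k', ∑ l', C k k' x * C l l' x *
      (A k' * D l') * (A' k * D' l) = bil c A A' * bil c D D' := by
    intro A A' D D'
    have e : ∀ A A' : κ → ℝ, bil c A A' = ∑ k, ∑ k', A k' * C k k' x * A' k := fun A A' => by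
      unfold bil
      rw [Finset.sum_comm]
      exact Finset.sum_congr rfl fun k _ => Finset.sum_congr rfl fun l _ => by rw [hcs]
    rw [e, e, Finset.sum_mul_sum]
    refine Finset.sum_congr rfl fun k _ => Finset.sum_congr rfl fun l _ => ?_
    rw [Finset.sum_mul_sum]
    exact Finset.sum_congr rfl fun k' _ => Finset.sum_congr rfl fun l' _ => by ring
  have split : ∀ k l k' l', C k k' x * C l l' x * compH G₀ o u x ν k' l' * compH G₀ o u x ρ k l
      = C k k' x * C l l' x * (z k' * p l') * (z k * p' l)
        - C k k' x * C l l' x * (z k' * p l') * (p' k * z l)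
        - C k k' x * C l l' x * (p k' * z l') * (z k * p' l)
        + C k k' x * C l l' x * (p k' * z l') * (p' k * z l) := by
    intro k l k' l'
    simp only [compH, p, p', z]
    ring
  simp only [split, Finset.sum_add_distrib, Finset.sum_sub_distrib, prod]
  rw [bil_comm hcs z p']
  ring

end Contractions

end ChargedFields

/-! ### Einstein and dilaton equations of the charged fields -/

section ChargedEinstein

variable {α κ : Type} [Fintype α] [DecidableEq α] [Fintype κ] [DecidableEq κ]

namespace ChargedVacuum

variable {U : Set (α ⊕ κ → ℝ)} {Q t : α → (α ⊕ κ → ℝ) → ℝ}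
    {G₀ C₀ : κ → κ → (α ⊕ κ → ℝ) → ℝ} {o : κ} {u : κ → (α ⊕ κ → ℝ) → ℝ}
    {Φ : (α ⊕ κ → ℝ) → ℝ} {a q : ℝ} {x : α ⊕ κ → ℝ}
    {g : (α ⊕ κ → ℝ) → Matrix (α ⊕ κ) (α ⊕ κ) ℝ}

theorem basic_chargedG (K : ChargedVacuum U Q t G₀ C₀ o u Φ a q) (i j : κ) :
    IsBasic (chargedG G₀ o u i j) := fun x y e => by
  simp only [chargedG, twist, K.basic_G _ _ x y e, K.basic_u _ x y e]

theorem basic_chargedC (K : ChargedVacuum U Q t G₀ C₀ o u Φ a q) (i j : κ) :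
    IsBasic (chargedC C₀ o u Φ i j) := fun x y e => by
  simp only [chargedC, twistInv, bil, K.basic_C _ _ x y e, K.basic_u _ x y e, K.basic_Phi x y e]

theorem smooth_chargedG (K : ChargedVacuum U Q t G₀ C₀ o u Φ a q) (i j : κ) :
    SmoothOn U (chargedG G₀ o u i j) :=
  (((K.smooth_G i j).sub ((K.smooth_u i).mul (K.smooth_G o j))).sub
    ((K.smooth_G i o).mul (K.smooth_u j))).add
    ((K.smooth_G o o).mul ((K.smooth_u i).mul (K.smooth_u j)))

theorem smooth_chargedC (K : ChargedVacuum U Q t G₀ C₀ o u Φ a q) (i j : κ) :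
    SmoothOn U (chargedC C₀ o u Φ i j) := by
  have hs : ∀ i, SmoothOn U fun y => ∑ k, C₀ i k y * u k y := fun i =>
    smoothOn_sum fun k _ => (K.smooth_C i k).mul (K.smooth_u k)
  have hb : SmoothOn U fun y => ∑ k, ∑ l, u k y * C₀ k l y * u l y :=
    smoothOn_sum fun k _ => smoothOn_sum fun l _ =>
      ((K.smooth_u k).mul (K.smooth_C k l)).mul (K.smooth_u l)
  have h0 : SmoothOn U fun _ => (0 : ℝ) := contDiffOn_const
  unfold chargedC twistInv bil
  refine ((K.smooth_C i j).add (K.smooth_Phi.mul (ContDiffOn.add ?_ ?_))).add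
    ((K.smooth_Phi.pow 2).mul ?_) <;> split_ifs
  exacts [hs j, h0, hs i, h0, hb, h0, h0]

theorem smooth_ratio (K : ChargedVacuum U Q t G₀ C₀ o u Φ a q) : SmoothOn U fun y => a / Φ y :=
  contDiffOn_const.div K.smooth_Phi fun y hy => (K.Phi_pos y hy).ne'

theorem smooth_log (K : ChargedVacuum U Q t G₀ C₀ o u Φ a q) :
    SmoothOn U fun y => Real.log (Φ y) :=
  K.smooth_Phi.log fun y hy => (K.Phi_pos y hy).ne'

theorem basic_log (K : ChargedVacuum U Q t G₀ C₀ o u Φ a q) :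
    IsBasic fun y => Real.log (Φ y) := fun x y e => by
  simp only [K.basic_Phi x y e]

theorem pd_log_Phi (K : ChargedVacuum U Q t G₀ C₀ o u Φ a q) (hx : x ∈ U) (μ : α) :
    pd (Sum.inl μ) (fun y => Real.log (Φ y)) x = a / Φ x * pd (Sum.inl μ) (G₀ o o) x := by
  rw [pd_log (K.smooth_Phi.differentiableAt K.isOpen hx) (K.Phi_pos x hx).ne',
    (K.hasPd_Phi hx μ).eq]
  ring

theorem chargedG_symm (K : ChargedVacuum U Q t G₀ C₀ o u Φ a q) (hx : x ∈ U) (i j : κ) :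
    chargedG G₀ o u i j x = chargedG G₀ o u j i x := by
  simp only [chargedG, twist]
  rw [K.G_symm x hx i j, K.G_symm x hx o j, K.G_symm x hx o i]
  ring

theorem blockMetric (K : ChargedVacuum U Q t G₀ C₀ o u Φ a q)
    (h_ll : ∀ x ∈ U, ∀ μ ν, g x (Sum.inl μ) (Sum.inl ν) = if μ = ν then 1 / Q μ x else 0)
    (h_lr : ∀ x ∈ U, ∀ μ j, g x (Sum.inl μ) (Sum.inr j) = 0)
    (h_rl : ∀ x ∈ U, ∀ i ν, g x (Sum.inr i) (Sum.inl ν) = 0)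
    (h_rr : ∀ x ∈ U, ∀ i j, g x (Sum.inr i) (Sum.inr j) = chargedG G₀ o u i j x) :
    BlockMetric U g (fun μ y => 1 / Q μ y) (chargedG G₀ o u) (chargedC C₀ o u Φ) where
  isOpen := K.isOpen
  eq_ll := h_ll
  eq_lr := h_lr
  eq_rl := h_rl
  eq_rr := h_rr
  smooth_h μ := contDiffOn_const.div (K.smooth_Q μ) fun y hy => (K.Q_pos y hy μ).ne'
  smooth_G := K.smooth_chargedG
  smooth_C := K.smooth_chargedC
  h_ne x hx μ := (one_div_pos.mpr (K.Q_pos x hx μ)).ne'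
  G_symm x hx i j := K.chargedG_symm hx i j
  C_symm x hx i j := twistInv_symm (K.C_symm x hx) o (fun i => u i x) (Φ x) i j
  C_mul x hx i j := by
    have h1 : (Matrix.of fun i j => C₀ i j x) * (Matrix.of fun i j => G₀ i j x) = 1 := by
      ext i j
      rw [Matrix.mul_apply, Matrix.one_apply]
      exact K.C_mul x hx i j
    have h2 := twistInv_mul_twist (C := Matrix.of fun i j => C₀ i j x) (K.C_symm x hx) h1 o
      (fun i => u i x) (K.Phi_pos x hx).ne' (K.u_eq x hx)
    have h3 := congrFun (congrFun h2 i) j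
    rw [Matrix.mul_apply, Matrix.one_apply] at h3
    exact h3
  basic_h μ := (isBasic_const 1).div (K.basic_Q μ)
  basic_G := K.basic_chargedG
  basic_C := K.basic_chargedC

/-- Expressing ∂u through ∂v shows that differentiating the shift only adds a symmetrised product of
∂v with v. The twist can thus be removed from any trace. -/
theorem pd_chargedG_eq_twist (K : ChargedVacuum U Q t G₀ C₀ o u Φ a q) (hx : x ∈ U) (μ : α)
    (i j : κ) : pd (Sum.inl μ) (chargedG G₀ o u i j) x
      = twist (fun i j => pd (Sum.inl μ) (G₀ i j) x
        - a / Φ x * (pd (Sum.inl μ) (G₀ i o) x * G₀ j o x + G₀ i o x * pd (Sum.inl μ) (G₀ j o) x))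
          o (fun i => u i x) i j := by
  rw [(K.pd_chargedG hx μ i j).eq]
  simp only [coeffA, coeffB, chargedZ, twist, K.pd_symm hx μ o j]
  ring

/-- The shift has determinant 1 - u_o = 1/Φ. Infinitesimally, the twist drops out of the trace of C
∂G, and C₀ v = e_o evaluates the symmetrised correction to -2 ∂ ln Φ, of which `logVol` takes one
half. -/
theorem logVol_charged (K : ChargedVacuum U Q t G₀ C₀ o u Φ a q) (hx : x ∈ U) (μ : α) :
    logVol (fun μ y => 1 / Q μ y) (chargedG G₀ o u) (chargedC C₀ o u Φ) μ x
      = t μ x - pd (Sum.inl μ) (fun y => Real.log (Φ y)) x := by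
  rw [← K.vacuum_vol x hx, logVol, logVol, K.pd_log_Phi hx]
  have h1 := sum_twistInv_mul_twist (C := fun i j => C₀ i j x) (K.C_symm x hx) o (fun i => u i x)
    (K.Phi_pos x hx).ne' (K.u_eq x hx) (fun i j => pd (Sum.inl μ) (G₀ i j) x
        - a / Φ x * (pd (Sum.inl μ) (G₀ i o) x * G₀ j o x + G₀ i o x * pd (Sum.inl μ) (G₀ j o) x))
  have h2 : ∑ i, ∑ j, chargedC C₀ o u Φ i j x * pd (Sum.inl μ) (chargedG G₀ o u j i) x
      = ∑ i, ∑ j, C₀ i j x * pd (Sum.inl μ) (G₀ j i) x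
        - 2 * (a / Φ x * pd (Sum.inl μ) (G₀ o o) x) := by
    simp only [K.pd_chargedG_eq_twist hx]
    refine h1.trans ?_
    have e1 : ∑ i, ∑ j, C₀ i j x * (a / Φ x * (pd (Sum.inl μ) (G₀ j o) x * G₀ i o x))
        = a / Φ x * pd (Sum.inl μ) (G₀ o o) x := by
      rw [← K.bil_left hx (fun k => pd (Sum.inl μ) (G₀ k o) x), bil]
      simp only [Finset.mul_sum]
      exact Finset.sum_congr rfl fun i _ => Finset.sum_congr rfl fun j _ => by ring
    have e2 : ∑ i, ∑ j, C₀ i j x * (a / Φ x * (G₀ j o x * pd (Sum.inl μ) (G₀ i o) x))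
        = a / Φ x * pd (Sum.inl μ) (G₀ o o) x := by
      rw [← K.bil_right hx (fun k => pd (Sum.inl μ) (G₀ k o) x), bil]
      simp only [Finset.mul_sum]
      exact Finset.sum_congr rfl fun i _ => Finset.sum_congr rfl fun j _ => by ring
    simp only [mul_sub, mul_add, Finset.sum_sub_distrib, Finset.sum_add_distrib, e1, e2]
    ring
  rw [h2]
  ring

/-- `trace_twist` removes the conjugation. What remains is the change of the vacuum trace under a
symmetrised product with v, given by `trace_sub_sym`. -/
theorem trace_charged (K : ChargedVacuum U Q t G₀ C₀ o u Φ a q) (hx : x ∈ U) (ν ρ : α) :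
    ∑ k, ∑ l, (∑ b, chargedC C₀ o u Φ k b x * pd (Sum.inl ρ) (chargedG G₀ o u b l) x) *
        (∑ b, chargedC C₀ o u Φ l b x * pd (Sum.inl ν) (chargedG G₀ o u b k) x)
      = ∑ k, ∑ l, (∑ b, C₀ k b x * pd (Sum.inl ρ) (G₀ b l) x) *
          (∑ b, C₀ l b x * pd (Sum.inl ν) (G₀ b k) x)
        - 4 * (a / Φ x) * bil (fun k l => C₀ k l x) (fun k => pd (Sum.inl ν) (G₀ k o) x)
            (fun k => pd (Sum.inl ρ) (G₀ k o) x)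
        + (a / Φ x) ^ 2 * (2 * G₀ o o x *
            bil (fun k l => C₀ k l x) (fun k => pd (Sum.inl ν) (G₀ k o) x)
            (fun k => pd (Sum.inl ρ) (G₀ k o) x)
          + 2 * (pd (Sum.inl ν) (G₀ o o) x * pd (Sum.inl ρ) (G₀ o o) x)) := by
  set C : Matrix κ κ ℝ := Matrix.of fun i j => C₀ i j x with hC
  let D : α → Matrix κ κ ℝ := fun μ => Matrix.of fun i j => pd (Sum.inl μ) (G₀ i j) x
  let v : κ → ℝ := fun i => G₀ i o x
  let w : α → κ → ℝ := fun μ i => pd (Sum.inl μ) (G₀ i o) x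
  let Y : α → Matrix κ κ ℝ := fun μ =>
    D μ - (a / Φ x) • (Matrix.vecMulVec (w μ) v + Matrix.vecMulVec v (w μ))
  have hCs : ∀ i j, C i j = C j i := K.C_symm x hx
  have h1 : ∀ (A A' B B' : Matrix κ κ ℝ), Matrix.trace (A * B * (A' * B'))
      = ∑ k, ∑ l, (∑ b, A k b * B b l) * (∑ b, A' l b * B' b k) := fun A A' B B' => by
    simp only [Matrix.trace, Matrix.diag, Matrix.mul_apply]
  have h2 := trace_twist (C := C) hCs o (fun i => u i x) (K.Phi_pos x hx).ne' (K.u_eq x hx)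
    (Y ρ) (Y ν)
  have hv : C.mulVec v = Pi.single o 1 := by
    funext i
    rw [Pi.single_apply]
    exact K.C_mul x hx i o
  have h3 := trace_sub_sym (C := C) hCs o v (w ρ) (w ν) hv (a / Φ x) (X := D ρ) (X' := D ν)
    (fun i => rfl) (fun i => rfl) (fun i => K.pd_symm hx ρ o i) (fun i => K.pd_symm hx ν o i)
  have h4 : w ρ ⬝ᵥ C.mulVec (w ν) = bil (fun k l => C₀ k l x) (w ν) (w ρ) := by
    rw [K.bil_symm hx]
    simp only [dotProduct, Matrix.mulVec, bil, Finset.mul_sum]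
    exact Finset.sum_congr rfl fun i _ => Finset.sum_congr rfl fun j _ => (mul_assoc _ _ _).symm
  rw [h1, h1, h4, mul_comm (w ρ o)] at h3
  rw [h1, h1] at h2
  have h5 : ∀ μ i j, pd (Sum.inl μ) (chargedG G₀ o u i j) x
      = (Matrix.of fun i j => twist (Y μ) o (fun i => u i x) i j) i j := fun μ i j =>
    K.pd_chargedG_eq_twist hx μ i j
  simp only [h5]
  exact h2.trans h3

theorem bil_compH (K : ChargedVacuum U Q t G₀ C₀ o u Φ a q) (hx : x ∈ U) (μ : α) (i j : κ) :
    bil (fun k l => chargedC C₀ o u Φ k l x) (compH G₀ o u x μ i) (compH G₀ o u x μ j)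
      = pd (Sum.inl μ) (u i) x * pd (Sum.inl μ) (u j) x * G₀ o o x
          - a / Φ x * pd (Sum.inl μ) (G₀ o o) x * (pd (Sum.inl μ) (u i) x * chargedZ G₀ o u j x
            + pd (Sum.inl μ) (u j) x * chargedZ G₀ o u i x)
          + chargedZ G₀ o u i x * chargedZ G₀ o u j x * ((a / Φ x) ^ 2 *
            bil (fun k l => C₀ k l x) (fun k => pd (Sum.inl μ) (G₀ k o) x)
              (fun k => pd (Sum.inl μ) (G₀ k o) x)) := by
  have h : ∀ i, compH G₀ o u x μ i = (chargedZ G₀ o u i x) • (fun k => pd (Sum.inl μ) (u k) x)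
      + (-(pd (Sum.inl μ) (u i) x)) • (fun k => chargedZ G₀ o u k x) := fun i => by
    funext j
    simp only [compH, Pi.add_apply, Pi.smul_apply, smul_eq_mul]
    ring
  rw [h, h]
  simp only [bil_add_left, bil_add_right, bil_smul_left, bil_smul_right, K.bil_pd_u_pd_u hx,
    K.bil_pd_u_chargedZ hx, K.bil_chargedZ_pd_u hx, K.bil_chargedZ_chargedZ hx]
  ring

/-- The mixed blocks vanish termwise and the torus block is `einstein_rr`. In the base block the
vacuum equation removes the base curvature, and only the change of the trace has to be balanced by F
and H. -/
theorem einstein (K : ChargedVacuum U Q t G₀ C₀ o u Φ a q)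
    (B : BlockMetric U g (fun μ y => 1 / Q μ y) (chargedG G₀ o u) (chargedC C₀ o u Φ))
    (hx : x ∈ U) (i j : α ⊕ κ) :
    ricci g i j x - hess g (fun y => Real.log (Φ y)) i j x - contrF (g x) (chargedF u q x) i j
      - (1 / 4) * contrH (g x) (chargedH G₀ o u x) i j = 0 := by
  have hv := fun y hy μ => K.logVol_charged (x := y) hy μ
  rcases i with ν | i <;> rcases j with ρ | j
  · rw [B.ricci_sub_hess_ll hx K.smooth_log ν ρ t K.smooth_t hv, contrF_ll B hx, contrH_ll B hx,
      K.trace_charged hx, K.bil_pd_u_pd_u hx, K.bil_pd_u_chargedZ hx, K.bil_pd_u_chargedZ hx,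
      K.bil_chargedZ_chargedZ hx]
    have h1 := K.vacuum_ll x hx ν ρ
    simp only [baseRicci] at h1
    -- Write τ for the C₀-pairing of ∂_νv and ∂_ρv. The trace supplies (a/Φ) τ, and together with F
    -- and H it loses (a/Φ)² (V + q²) τ; the terms in ∂_νV ∂_ρV cancel between the trace and H.
    linear_combination h1 - (a / Φ x * bil (fun k l => C₀ k l x)
      (fun k => pd (Sum.inl ν) (G₀ k o) x) (fun k => pd (Sum.inl ρ) (G₀ k o) x)) * K.ratio_mul hx
  · rw [B.ricci_lr hx, B.hess_lr hx K.basic_log, contrF_lr B hx, contrH_lr B hx]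
    ring
  · rw [B.ricci_rl hx, B.hess_rl hx K.basic_log, contrF_rl B hx, contrH_rl B hx]
    ring
  · rw [B.ricci_sub_hess_rr hx K.basic_log i j t hv, contrF_rr B hx, contrH_rr B hx]
    simp only [K.bil_compH hx, div_div_eq_mul_div, div_one, one_div_one_div,
      one_mul]
    have h1 := K.einstein_rr hx i j
    have h2 : divg Q t (fun μ => pd (Sum.inl μ) (chargedG G₀ o u i j)) x
        = ∑ μ, (pd (Sum.inl μ) (fun y => pd (Sum.inl μ) (chargedG G₀ o u i j) y * Q μ y) x
          + t μ x * (pd (Sum.inl μ) (chargedG G₀ o u i j) x * Q μ x)) := by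
      simp only [divg, mul_comm]
    have h3 : ∀ μ, ∑ k, ∑ l, pd (Sum.inl μ) (chargedG G₀ o u i k) x * chargedC C₀ o u Φ k l x *
          pd (Sum.inl μ) (chargedG G₀ o u l j) x
        = bil (fun k l => chargedC C₀ o u Φ k l x)
        (fun k => pd (Sum.inl μ) (chargedG G₀ o u i k) x)
        (fun k => pd (Sum.inl μ) (chargedG G₀ o u j k) x) := fun μ => by
      unfold bil
      refine Finset.sum_congr rfl fun k _ => Finset.sum_congr rfl fun l _ => ?_
      rw [pd_congr (fun y hy => K.chargedG_symm hy l j) K.isOpen hx]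
    simp only [h3]
    rw [← h2, h1]
    simp only [Finset.mul_sum, ← Finset.sum_sub_distrib]
    exact Finset.sum_eq_zero fun μ _ => by ring

/-- The Laplacian of a function of the `x^μ`. -/
theorem _root_.ChargedKerrNUT.BlockMetric.mtrace_hess {h : α → (α ⊕ κ → ℝ) → ℝ}
    {G C : κ → κ → (α ⊕ κ → ℝ) → ℝ} (B : BlockMetric U g h G C) (hx : x ∈ U)
    {φ : (α ⊕ κ → ℝ) → ℝ} (hφ : IsBasic φ) (hφs : SmoothOn U φ) :
    mtrace (g x) (fun i j => hess g φ i j x)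
      = divg (fun μ y => 1 / h μ y) (logVol h G C) (fun μ => pd (Sum.inl μ) φ) x := by
  rw [mtrace_block B hx]
  simp only [B.hess_rr hx hφ, B.hess_ll hx φ, if_true, divg, logVol]
  have d1 : ∀ μ, pd (Sum.inl μ) (fun y => 1 / h μ y * pd (Sum.inl μ) φ y) x
      = -(logDer h μ μ x / h μ x) * pd (Sum.inl μ) φ x
        + 1 / h μ x * pd (Sum.inl μ) (pd (Sum.inl μ) φ) x := by
    intro μ
    have hh := (B.smooth_h μ).hasPd B.isOpen hx (Sum.inl μ)
    have hp := (hφs.pd B.isOpen (Sum.inl μ)).hasPd B.isOpen hx (Sum.inl μ)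
    rw [(((hasPd_const 1).div hh (B.h_ne x hx μ)).mul hp).eq]
    simp only [logDer]
    field_simp [B.h_ne x hx μ]
    ring
  simp only [d1]
  have e1 : ∑ μ, 1 / h μ x * (1 / 2 * ∑ k, pd (Sum.inl k) φ x * (h μ x / h k x * logDer h k μ x))
      = ∑ μ, 1 / 2 * (∑ k, logDer h μ k x) * (1 / h μ x * pd (Sum.inl μ) φ x) := by
    simp only [Finset.mul_sum, Finset.sum_mul]
    rw [Finset.sum_comm]
    refine Finset.sum_congr rfl fun μ _ => Finset.sum_congr rfl fun k _ => ?_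
    have := B.h_ne x hx k
    field_simp
  have e2 : ∑ i, ∑ j, C i j x * (1 / 2 * ∑ μ, pd (Sum.inl μ) (G i j) x / h μ x *
        pd (Sum.inl μ) φ x)
      = ∑ μ, (1 / 2 * ∑ i, ∑ j, C i j x * pd (Sum.inl μ) (G j i) x) *
        (1 / h μ x * pd (Sum.inl μ) φ x) := by
    simp only [Finset.mul_sum, Finset.sum_mul]
    rw [Finset.sum_comm (s := (Finset.univ : Finset α))]
    refine Finset.sum_congr rfl fun i _ => ?_
    rw [Finset.sum_comm]
    refine Finset.sum_congr rfl fun μ _ => Finset.sum_congr rfl fun j _ => ?_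
    rw [pd_congr (fun y hy => B.G_symm y hy i j) B.isOpen hx]
    ring
  rw [e2]
  simp only [mul_add, mul_sub, add_mul, Finset.sum_add_distrib, Finset.sum_sub_distrib, e1]
  have e3 : ∑ μ, 1 / h μ x * (1 / 2 * (pd (Sum.inl μ) φ x * logDer h μ μ x))
      = ∑ μ, 1 / 2 * (logDer h μ μ x / h μ x * pd (Sum.inl μ) φ x) :=
    Finset.sum_congr rfl fun μ _ => by ring
  simp only [e3, neg_mul, Finset.sum_neg_distrib, ← Finset.mul_sum]
  ring

/-- The dilaton equation; the scalar curvature is eliminated by the Einstein equation. -/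
theorem dilaton (K : ChargedVacuum U Q t G₀ C₀ o u Φ a q)
    (B : BlockMetric U g (fun μ y => 1 / Q μ y) (chargedG G₀ o u) (chargedC C₀ o u Φ))
    (hx : x ∈ U) :
    mtrace (g x) (fun i j => pd i (fun y => Real.log (Φ y)) x * pd j (fun y => Real.log (Φ y)) x)
      + 2 * mtrace (g x) (fun i j => hess g (fun y => Real.log (Φ y)) i j x)
      + (1 / 2) * mtrace (g x) (contrF (g x) (chargedF u q x))
      + (1 / 12) * mtrace (g x) (contrH (g x) (chargedH G₀ o u x))
      - mtrace (g x) (fun i j => ricci g i j x) = 0 := by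
  set τ : α → ℝ := fun μ => bil (fun k l => C₀ k l x) (fun k => pd (Sum.inl μ) (G₀ k o) x)
      (fun k => pd (Sum.inl μ) (G₀ k o) x) with hτ
  have hR : mtrace (g x) (fun i j => ricci g i j x)
      = mtrace (g x) (fun i j => hess g (fun y => Real.log (Φ y)) i j x)
        + mtrace (g x) (contrF (g x) (chargedF u q x))
        + 1 / 4 * mtrace (g x) (contrH (g x) (chargedH G₀ o u x)) := by
    simp only [mtrace, Finset.mul_sum, ← Finset.sum_add_distrib]
    refine Finset.sum_congr rfl fun i _ => Finset.sum_congr rfl fun j _ => ?_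
    linear_combination ((g x)⁻¹ i j) * K.einstein B hx i j
  have hF : mtrace (g x) (contrF (g x) (chargedF u q x))
      = ∑ μ, Q μ x * (2 * (q ^ 2 * ((a / Φ x) ^ 2 * τ μ))) := by
    rw [mtrace_block B hx]
    have e : ∑ i, ∑ j, chargedC C₀ o u Φ i j x *
          contrF (g x) (chargedF u q x) (Sum.inr i) (Sum.inr j)
        = ∑ μ, Q μ x * (q ^ 2 * bil (fun k l => chargedC C₀ o u Φ k l x)
          (fun k => pd (Sum.inl μ) (u k) x) (fun k => pd (Sum.inl μ) (u k) x)) := by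
      simp only [contrF_rr B hx, bil, Finset.mul_sum]
      rw [Finset.sum_comm (s := (Finset.univ : Finset α))]
      refine Finset.sum_congr rfl fun i _ => ?_
      rw [Finset.sum_comm]
      refine Finset.sum_congr rfl fun μ _ => Finset.sum_congr rfl fun j _ => ?_
      rw [one_div_one_div]
      ring
    rw [e]
    simp only [contrF_ll B hx, K.bil_pd_u_pd_u hx, one_div_one_div, ← Finset.sum_add_distrib]
    exact Finset.sum_congr rfl fun μ _ => by ring
  have hH : mtrace (g x) (contrH (g x) (chargedH G₀ o u x))
      = ∑ μ, Q μ x * (6 * ((a / Φ x) ^ 2 *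
        (τ μ * G₀ o o x - pd (Sum.inl μ) (G₀ o o) x ^ 2))) := by
    rw [mtrace_block B hx]
    have e : ∑ i, ∑ j, chargedC C₀ o u Φ i j x *
          contrH (g x) (chargedH G₀ o u x) (Sum.inr i) (Sum.inr j)
        = ∑ μ, Q μ x * (4 * ((a / Φ x) ^ 2 *
        (τ μ * G₀ o o x - pd (Sum.inl μ) (G₀ o o) x ^ 2))) := by
      have e1 : ∀ μ, ∑ i, ∑ j, chargedC C₀ o u Φ i j x *
          bil (fun k l => chargedC C₀ o u Φ k l x) (compH G₀ o u x μ i) (compH G₀ o u x μ j)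
          = 2 * ((a / Φ x) ^ 2 * (τ μ * G₀ o o x - pd (Sum.inl μ) (G₀ o o) x ^ 2)) := by
        intro μ
        have e2 : ∀ A A' : κ → ℝ, ∑ i, ∑ j, chargedC C₀ o u Φ i j x * (A i * A' j)
            = bil (fun k l => chargedC C₀ o u Φ k l x) A A' := fun A A' => by
          unfold bil
          exact Finset.sum_congr rfl fun i _ => Finset.sum_congr rfl fun j _ => by ring
        have e3 : ∀ i j, chargedC C₀ o u Φ i j x * bil (fun k l => chargedC C₀ o u Φ k l x)
              (compH G₀ o u x μ i) (compH G₀ o u x μ j)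
            = G₀ o o x * (chargedC C₀ o u Φ i j x *
                (pd (Sum.inl μ) (u i) x * pd (Sum.inl μ) (u j) x))
              - a / Φ x * pd (Sum.inl μ) (G₀ o o) x * (chargedC C₀ o u Φ i j x *
                (pd (Sum.inl μ) (u i) x * chargedZ G₀ o u j x))
              - a / Φ x * pd (Sum.inl μ) (G₀ o o) x * (chargedC C₀ o u Φ i j x *
                (chargedZ G₀ o u i x * pd (Sum.inl μ) (u j) x))
              + (a / Φ x) ^ 2 * τ μ * (chargedC C₀ o u Φ i j x *
                (chargedZ G₀ o u i x * chargedZ G₀ o u j x)) := fun i j => by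
          rw [K.bil_compH hx]
          ring
        simp only [e3, Finset.sum_add_distrib, Finset.sum_sub_distrib, ← Finset.mul_sum, e2]
        rw [K.bil_pd_u_pd_u hx,
          K.bil_pd_u_chargedZ hx, K.bil_chargedZ_pd_u hx, K.bil_chargedZ_chargedZ hx]
        ring
      have e4 : ∀ i j, chargedC C₀ o u Φ i j x *
          contrH (g x) (chargedH G₀ o u x) (Sum.inr i) (Sum.inr j)
          = ∑ μ, 2 * Q μ x * (chargedC C₀ o u Φ i j x *
          bil (fun k l => chargedC C₀ o u Φ k l x) (compH G₀ o u x μ i)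
            (compH G₀ o u x μ j)) := fun i j => by
        rw [contrH_rr B hx, Finset.mul_sum, Finset.mul_sum]
        refine Finset.sum_congr rfl fun μ _ => ?_
        rw [one_div_one_div]
        ring
      calc _ = ∑ μ, ∑ i, ∑ j, 2 * Q μ x * (chargedC C₀ o u Φ i j x *
          bil (fun k l => chargedC C₀ o u Φ k l x) (compH G₀ o u x μ i)
            (compH G₀ o u x μ j)) := by
            simp only [e4]
            rw [Finset.sum_comm (s := (Finset.univ : Finset α))]
            exact Finset.sum_congr rfl fun i _ => Finset.sum_comm
        _ = _ := by
            simp only [← Finset.mul_sum, e1]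
            exact Finset.sum_congr rfl fun μ _ => by ring
    rw [e]
    simp only [contrH_ll B hx, K.bil_pd_u_pd_u hx, K.bil_pd_u_chargedZ hx,
      K.bil_chargedZ_chargedZ hx, one_div_one_div, ← Finset.sum_add_distrib]
    exact Finset.sum_congr rfl fun μ _ => by ring
  -- Because `logVol = t - ∂φ`, the Laplacian of φ is the vacuum-weighted divergence of ∂φ minus
  -- (∇φ)². The sum with (∇φ)² is that divergence, which the vacuum equation for V evaluates.
  have hL : mtrace (g x) (fun i j => pd i (fun y => Real.log (Φ y)) x *
        pd j (fun y => Real.log (Φ y)) x)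
      + mtrace (g x) (fun i j => hess g (fun y => Real.log (Φ y)) i j x)
      = ∑ μ, Q μ x * (a / Φ x * τ μ - (a / Φ x * pd (Sum.inl μ) (G₀ o o) x) ^ 2) := by
    have e1 : mtrace (g x) (fun i j => pd i (fun y => Real.log (Φ y)) x *
        pd j (fun y => Real.log (Φ y)) x)
        = ∑ μ, Q μ x * (a / Φ x * pd (Sum.inl μ) (G₀ o o) x) ^ 2 := by
      rw [mtrace_block B hx]
      simp only [K.basic_log.pd_inr, mul_zero, Finset.sum_const_zero, add_zero, K.pd_log_Phi hx,
        one_div_one_div]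
      exact Finset.sum_congr rfl fun μ _ => by ring
    have hQ : ∀ μ, DifferentiableAt ℝ (Q μ) x := fun μ =>
      (K.smooth_Q μ).differentiableAt K.isOpen hx
    have e2 : divg Q t (fun μ => pd (Sum.inl μ) (fun y => Real.log (Φ y))) x
        = a / Φ x * ∑ μ, Q μ x * τ μ
          - ∑ μ, Q μ x * (a / Φ x * pd (Sum.inl μ) (G₀ o o) x) ^ 2 := by
      rw [divg_congr K.isOpen hx fun μ y hy => K.pd_log_Phi hy μ, divg_mul hQ
        (fun μ => ((K.smooth_G o o).pd K.isOpen _).differentiableAt K.isOpen hx)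
        (K.hasPd_ratio hx), K.vacuum_rr x hx, sub_eq_add_neg, ← Finset.sum_neg_distrib]
      simp only [hτ, K.pd_symm hx _ o]
      congr 1
      exact Finset.sum_congr rfl fun μ _ => by ring
    have e3 : divg (fun μ y => 1 / (1 / Q μ y)) (logVol (fun μ y => 1 / Q μ y)
          (chargedG G₀ o u) (chargedC C₀ o u Φ)) (fun μ => pd (Sum.inl μ)
          (fun y => Real.log (Φ y))) x
        = divg Q t (fun μ => pd (Sum.inl μ) (fun y => Real.log (Φ y))) x
          - ∑ μ, Q μ x * (a / Φ x * pd (Sum.inl μ) (G₀ o o) x) ^ 2 := by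
      simp only [divg, one_div_one_div, K.logVol_charged hx, ← Finset.sum_sub_distrib,
        K.pd_log_Phi hx]
      exact Finset.sum_congr rfl fun μ _ => by ring
    rw [e1, B.mtrace_hess hx K.basic_log K.smooth_log, e3, e2]
    rw [Finset.mul_sum, ← Finset.sum_sub_distrib, ← Finset.sum_sub_distrib,
      ← Finset.sum_add_distrib]
    exact Finset.sum_congr rfl fun μ _ => by ring
  rw [hR]
  -- This is what the dilaton equation becomes when R is replaced by the trace of the Einstein
  -- equation.
  have hfin : mtrace (g x) (fun i j => pd i (fun y => Real.log (Φ y)) x *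
        pd j (fun y => Real.log (Φ y)) x)
      + mtrace (g x) (fun i j => hess g (fun y => Real.log (Φ y)) i j x)
      - 1 / 2 * mtrace (g x) (contrF (g x) (chargedF u q x))
      - 1 / 6 * mtrace (g x) (contrH (g x) (chargedH G₀ o u x)) = 0 := by
    rw [hL, hF, hH, Finset.mul_sum, Finset.mul_sum, ← Finset.sum_sub_distrib,
      ← Finset.sum_sub_distrib]
    refine Finset.sum_eq_zero fun μ _ => ?_
    linear_combination (-(Q μ x * (a / Φ x) * τ μ)) * K.ratio_mul hx
  linear_combination hfin

end ChargedVacuum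

end ChargedEinstein

/-! ### Derivatives of products, square roots and determinants -/

section Jacobi

variable {ι : Type} [Fintype ι] [DecidableEq ι] {i : ι} {f f' : (ι → ℝ) → ℝ} {d d' : ℝ}
  {x : ι → ℝ}

theorem HasPd.prod {X : Type*} [DecidableEq X] {s : Finset X} {F : X → (ι → ℝ) → ℝ} {D : X → ℝ}
    (h : ∀ a ∈ s, HasPd i (F a) (D a) x) :
    HasPd i (fun y => ∏ a ∈ s, F a y) (∑ a ∈ s, (∏ b ∈ s.erase a, F b x) * D a) x := by
  have h1 := HasFDerivAt.finsetProd (u := s) (g := F) (x := x)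
    fun a ha => (h a ha).1.hasFDerivAt
  refine ⟨h1.differentiableAt, ?_⟩
  unfold pd
  rw [h1.fderiv]
  simp only [FunLike.coe_sum, Finset.sum_apply, smul_apply, smul_eq_mul]
  exact Finset.sum_congr rfl fun a ha => by rw [← (h a ha).2]; rfl

theorem HasPd.sqrt (h : HasPd i f d x) (h0 : 0 < f x) :
    HasPd i (fun y => √(f y)) (d / (2 * √(f x))) x := by
  have h1 := h.1.hasFDerivAt.sqrt h0.ne'
  refine ⟨h1.differentiableAt, ?_⟩
  unfold pd
  rw [h1.fderiv, ← h.2]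
  simp [pd]
  ring

/-- Jacobi's formula. -/
theorem hasPd_det {κ : Type} [Fintype κ] [DecidableEq κ] {M : (ι → ℝ) → Matrix κ κ ℝ}
    {M' : Matrix κ κ ℝ} (h : ∀ k l, HasPd i (fun y => M y k l) (M' k l) x) (h0 : (M x).det ≠ 0) :
    HasPd i (fun y => (M y).det) ((M x).det * ∑ k, ∑ l, (M x)⁻¹ k l * M' l k) x := by
  have h1 : HasPd i (fun y => (M y).det) (∑ σ : Equiv.Perm κ, ((Equiv.Perm.sign σ : ℤ) : ℝ) *
      ∑ k, (∏ l ∈ Finset.univ.erase k, M x (σ l) l) * M' (σ k) k) x := by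
    simp only [Matrix.det_apply']
    exact HasPd.sum fun σ _ => (HasPd.prod fun k _ => h (σ k) k).const_mul _
  refine h1.congr_val ?_
  -- Differentiating only the k-th column yields the determinant with that column replaced, which
  -- Cramer's rule expresses through the inverse.
  have h2 : ∀ k, ∑ σ : Equiv.Perm κ, ((Equiv.Perm.sign σ : ℤ) : ℝ) *
      ((∏ l ∈ Finset.univ.erase k, M x (σ l) l) * M' (σ k) k)
      = (M x).det * ∑ l, (M x)⁻¹ k l * M' l k := by
    intro k
    have h3 : (M x).cramer (fun l => M' l k) k = (M x).det * ∑ l, (M x)⁻¹ k l * M' l k := by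
      rw [Matrix.cramer_eq_adjugate_mulVec, Matrix.mulVec, dotProduct, Matrix.inv_def,
        Finset.mul_sum]
      refine Finset.sum_congr rfl fun l _ => ?_
      rw [Matrix.smul_apply, Ring.inverse_eq_inv', smul_eq_mul]
      field_simp
    rw [← h3, Matrix.cramer_apply, Matrix.det_apply']
    refine Finset.sum_congr rfl fun σ _ => ?_
    congr 1
    rw [← Finset.mul_prod_erase _ _ (Finset.mem_univ k), mul_comm]
    congr 1
    · simp
    · refine Finset.prod_congr rfl fun l hl => ?_
      rw [Matrix.updateCol_ne (Finset.ne_of_mem_erase hl)]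
  simp only [Finset.mul_sum] at h2 ⊢
  rw [Finset.sum_comm]
  exact Finset.sum_congr rfl fun k _ => h2 k

end Jacobi

/-! ### The density √det g and weighted coordinate divergences -/

section Weight

variable {α κ : Type} [Fintype α] [DecidableEq α] [Fintype κ] [DecidableEq κ]
  {U : Set (α ⊕ κ → ℝ)} {g : (α ⊕ κ → ℝ) → Matrix (α ⊕ κ) (α ⊕ κ) ℝ}
  {h : α → (α ⊕ κ → ℝ) → ℝ} {G C : κ → κ → (α ⊕ κ → ℝ) → ℝ} {x : α ⊕ κ → ℝ}

theorem BlockMetric.smooth_inv (B : BlockMetric U g h G C) (i j : α ⊕ κ) :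
    SmoothOn U fun y => (g y)⁻¹ i j := by
  have h0 : SmoothOn U fun _ => (0 : ℝ) := contDiffOn_const
  rcases i with i | i <;> rcases j with j | j
  · refine smoothOn_congr (f := fun y => if i = j then 1 / h i y else 0) ?_
      fun y hy => B.inv_ll hy i j
    split_ifs
    · exact contDiffOn_const.div (B.smooth_h i) fun y hy => B.h_ne y hy i
    · exact h0
  · exact smoothOn_congr h0 fun y hy => B.inv_lr hy i j
  · exact smoothOn_congr h0 fun y hy => B.inv_rl hy i j
  · exact smoothOn_congr (B.smooth_C i j) fun y hy => B.inv_rr hy i j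

theorem BlockMetric.smooth (B : BlockMetric U g h G C) (i j : α ⊕ κ) :
    SmoothOn U fun y => g y i j := by
  have h0 : SmoothOn U fun _ => (0 : ℝ) := contDiffOn_const
  rcases i with i | i <;> rcases j with j | j
  · refine smoothOn_congr (f := fun y => if i = j then h i y else 0) ?_
      fun y hy => B.eq_ll y hy i j
    split_ifs
    · exact B.smooth_h i
    · exact h0
  · exact smoothOn_congr h0 fun y hy => B.eq_lr y hy i j
  · exact smoothOn_congr h0 fun y hy => B.eq_rl y hy i j
  · exact smoothOn_congr (B.smooth_G i j) fun y hy => B.eq_rr y hy i j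

theorem BlockMetric.smooth_sqrt_det (B : BlockMetric U g h G C) (hg : ∀ y ∈ U, 0 < (g y).det) :
    SmoothOn U fun y => √(g y).det := by
  have h1 : SmoothOn U fun y => (g y).det := by
    simp only [Matrix.det_apply']
    exact smoothOn_sum fun σ _ => contDiffOn_const.mul (contDiffOn_prod fun i _ => B.smooth _ _)
  exact ContDiffOn.sqrt h1 fun y hy => (hg y hy).ne'

/-- By Jacobi's formula the trace of g⁻¹ ∂g is the logarithmic derivative of det g, and `logVol` is
half of that trace. -/
theorem BlockMetric.hasPd_sqrt_det (B : BlockMetric U g h G C) (hg : ∀ y ∈ U, 0 < (g y).det)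
    (hx : x ∈ U) (μ : α) :
    HasPd (Sum.inl μ) (fun y => √(g y).det) (logVol h G C μ x * √(g x).det) x := by
  have h1 : HasPd (Sum.inl μ) (fun y => (g y).det) _ x :=
    hasPd_det (M' := Matrix.of fun i j => pd (Sum.inl μ) (fun y => g y i j) x)
      (fun i j => (B.smooth i j).hasPd B.isOpen hx _) (hg x hx).ne'
  refine (h1.sqrt (hg x hx)).congr_val ?_
  have h2 : ∑ k, ∑ l, (g x)⁻¹ k l * pd (Sum.inl μ) (fun y => g y l k) x
      = 2 * logVol h G C μ x := by
    simp only [Fintype.sum_sum_type, B.inv_ll hx, B.inv_lr hx, B.inv_rl hx, B.inv_rr hx,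
      B.pd_ll hx, B.pd_rr hx]
    simp [logVol, logDer, div_eq_inv_mul]
    ring
  simp only [Matrix.of_apply, h2]
  have h3 : √(g x).det ≠ 0 := (Real.sqrt_pos.mpr (hg x hx)).ne'
  have h4 : (g x).det = √(g x).det * √(g x).det := (Real.mul_self_sqrt (hg x hx).le).symm
  rw [div_eq_iff (by positivity)]
  linear_combination (2 * logVol h G C μ x) * h4

/-- A density w with ∂_μ w = t_μ w factors out of a coordinate divergence and leaves the weighted
divergence `divg`. -/
theorem sum_pd_weight_mul {Q t : α → (α ⊕ κ → ℝ) → ℝ} {F : α → (α ⊕ κ → ℝ) → ℝ}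
    {w : (α ⊕ κ → ℝ) → ℝ} (hQ : ∀ μ, DifferentiableAt ℝ (Q μ) x)
    (hF : ∀ μ, DifferentiableAt ℝ (F μ) x) (hw : ∀ μ, HasPd (Sum.inl μ) w (t μ x * w x) x) :
    ∑ μ, pd (Sum.inl μ) (fun y => w y * (Q μ y * F μ y)) x = w x * divg Q t F x := by
  unfold divg
  rw [Finset.mul_sum]
  refine Finset.sum_congr rfl fun μ _ => ?_
  rw [pd_mul (hw μ).1 ((hQ μ).fun_mul (hF μ)), (hw μ).2]
  ring

end Weight

/-! ### Maxwell and Kalb–Ramond equations -/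

section ChargedMaxwell

variable {α κ : Type} [Fintype α] [DecidableEq α] [Fintype κ] [DecidableEq κ]

namespace ChargedVacuum

variable {U : Set (α ⊕ κ → ℝ)} {Q t : α → (α ⊕ κ → ℝ) → ℝ}
    {G₀ C₀ : κ → κ → (α ⊕ κ → ℝ) → ℝ} {o : κ} {u : κ → (α ⊕ κ → ℝ) → ℝ}
    {Φ : (α ⊕ κ → ℝ) → ℝ} {a q : ℝ} {x : α ⊕ κ → ℝ}
    {g : (α ⊕ κ → ℝ) → Matrix (α ⊕ κ) (α ⊕ κ) ℝ}

/-- The vectors `C₀ ∂_μ v`. -/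
def momentum (G₀ C₀ : κ → κ → (α ⊕ κ → ℝ) → ℝ) (o : κ) (μ : α) (i : κ) (y : α ⊕ κ → ℝ) : ℝ :=
  ∑ k, C₀ i k y * pd (Sum.inl μ) (G₀ k o) y

theorem smooth_momentum (K : ChargedVacuum U Q t G₀ C₀ o u Φ a q) (μ : α) (i : κ) :
    SmoothOn U (momentum G₀ C₀ o μ i) :=
  smoothOn_sum fun k _ => (K.smooth_C i k).mul ((K.smooth_G k o).pd K.isOpen _)

theorem sum_G_mul_momentum (K : ChargedVacuum U Q t G₀ C₀ o u Φ a q) (hx : x ∈ U) (μ : α) (i : κ) :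
    ∑ j, G₀ i j x * momentum G₀ C₀ o μ j x = pd (Sum.inl μ) (G₀ i o) x := by
  have h1 : (Matrix.of fun i j => C₀ i j x) * (Matrix.of fun i j => G₀ i j x) = 1 := by
    ext i j
    rw [Matrix.mul_apply, Matrix.one_apply]
    exact K.C_mul x hx i j
  have h2 : (Matrix.of fun i j => G₀ i j x).mulVec ((Matrix.of fun i j => C₀ i j x).mulVec
      (fun k => pd (Sum.inl μ) (G₀ k o) x)) = fun k => pd (Sum.inl μ) (G₀ k o) x := by
    rw [Matrix.mulVec_mulVec, mul_eq_one_comm.mp h1, Matrix.one_mulVec]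
  exact congrFun h2 i

theorem sum_pd_mul_momentum (μ ν : α) (i : κ) :
    ∑ j, pd (Sum.inl ν) (G₀ i j) x * momentum G₀ C₀ o μ j x
      = bil (fun k l => C₀ k l x) (fun k => pd (Sum.inl ν) (G₀ i k) x)
        (fun k => pd (Sum.inl μ) (G₀ k o) x) := by
  simp only [momentum, bil, Finset.mul_sum, mul_assoc]

/-- The currents `C₀ ∂v` are conserved. -/
theorem divg_momentum (K : ChargedVacuum U Q t G₀ C₀ o u Φ a q) (hx : x ∈ U) (i : κ) :
    divg Q t (fun μ => momentum G₀ C₀ o μ i) x = 0 := by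
  have hQ : ∀ μ, DifferentiableAt ℝ (Q μ) x := fun μ =>
    (K.smooth_Q μ).differentiableAt K.isOpen hx
  have hp : ∀ μ i, DifferentiableAt ℝ (momentum G₀ C₀ o μ i) x := fun μ i =>
    (K.smooth_momentum μ i).differentiableAt K.isOpen hx
  have h1 : ∀ i, ∑ j, G₀ i j x * divg Q t (fun μ => momentum G₀ C₀ o μ j) x = 0 := by
    intro i
    -- Insert ∂v = G₀ p, where p is `momentum`, into the vacuum equation for v. The Leibniz term ∂G₀
    -- p is exactly the right-hand side, so G₀ annihilates the divergence of p.
    have h2 := K.vacuum_rr x hx i o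
    rw [divg_congr (F' := fun μ y => ∑ j, G₀ i j y * momentum G₀ C₀ o μ j y) K.isOpen hx
      fun μ y hy => (K.sum_G_mul_momentum hy μ i).symm,
      divg_sum hQ fun j _ μ =>
        ((K.smooth_G i j).differentiableAt K.isOpen hx).fun_mul (hp μ j)] at h2
    simp only [divg_mul hQ (fun μ => hp μ _) (fun μ => K.hasPd_G hx μ i _)] at h2
    rw [Finset.sum_add_distrib, Finset.sum_comm] at h2
    simp only [← Finset.mul_sum, sum_pd_mul_momentum, K.pd_symm hx _ o] at h2
    linarith
  have h3 := congrArg ((Matrix.of fun i j => C₀ i j x).mulVec) (funext h1 :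
    (Matrix.of fun i j => G₀ i j x).mulVec
      (fun j => divg Q t (fun μ => momentum G₀ C₀ o μ j) x) = fun _ => 0)
  have h4 : (Matrix.of fun i j => C₀ i j x) * (Matrix.of fun i j => G₀ i j x) = 1 := by
    ext i j
    rw [Matrix.mul_apply, Matrix.one_apply]
    exact K.C_mul x hx i j
  rw [Matrix.mulVec_mulVec, h4, Matrix.one_mulVec] at h3
  have h5 := congrFun h3 i
  simpa [Matrix.mulVec, dotProduct] using h5

/-- The field strength with its torus index raised by the charged metric. -/
def current (G₀ C₀ : κ → κ → (α ⊕ κ → ℝ) → ℝ) (o : κ) (u : κ → (α ⊕ κ → ℝ) → ℝ)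
    (Φ : (α ⊕ κ → ℝ) → ℝ) (a : ℝ) (μ : α) (i : κ) (y : α ⊕ κ → ℝ) : ℝ :=
  a / Φ y * momentum G₀ C₀ o μ i y
    + (if i = o then a else 0) * ∑ k, u k y * momentum G₀ C₀ o μ k y

theorem sum_chargedC_mul (K : ChargedVacuum U Q t G₀ C₀ o u Φ a q) (hx : x ∈ U) (i : κ)
    (A : κ → ℝ) : ∑ j, chargedC C₀ o u Φ i j x * A j
      = bil (fun k l => C₀ k l x) (Pi.single i 1) (A + (Φ x * A o) • fun k => u k x)
        + (if i = o then Φ x else 0) * bil (fun k l => C₀ k l x) (fun k => u k x)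
          (A + (Φ x * A o) • fun k => u k x) := by
  rw [← bil_single_left (fun k l => chargedC C₀ o u Φ k l x), K.bil_chargedC hx, bil_add_left,
    bil_smul_left, Pi.single_apply]
  simp only [eq_comm (a := o)]
  split_ifs <;> simp

theorem sum_chargedC_mul_pd_u (K : ChargedVacuum U Q t G₀ C₀ o u Φ a q) (hx : x ∈ U) (μ : α)
    (i : κ) : ∑ j, chargedC C₀ o u Φ i j x * pd (Sum.inl μ) (u j) x
      = current G₀ C₀ o u Φ a μ i x := by
  have hΦ := (K.Phi_pos x hx).ne'
  have h1 : bil (fun k l => C₀ k l x) (fun k => u k x) (fun k => pd (Sum.inl μ) (G₀ k o) x)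
      = ∑ k, u k x * momentum G₀ C₀ o μ k x := by
    simp only [bil, momentum, Finset.mul_sum, mul_assoc]
  rw [K.sum_chargedC_mul hx, K.pd_u_add hx, bil_smul_right, bil_smul_right, bil_single_left, h1,
    current, momentum]
  split_ifs
  · field_simp
  · ring

/-- In the charged metric the o-th column is (1 - u_o)(v - V u) = (v - V u)/Φ. Raising the index of
v - V u therefore gives Φ times the Killing vector. -/
theorem sum_chargedC_mul_chargedZ (K : ChargedVacuum U Q t G₀ C₀ o u Φ a q) (hx : x ∈ U)
    (i : κ) : ∑ j, chargedC C₀ o u Φ i j x * chargedZ G₀ o u j x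
      = if i = o then Φ x else 0 := by
  have hΦ := (K.Phi_pos x hx).ne'
  rw [K.sum_chargedC_mul hx, K.chargedZ_add hx, K.bil_right hx, K.bil_right hx, K.u_eq x hx,
    Pi.single_apply]
  by_cases e : i = o
  · subst e
    simp only [if_true]
    field_simp
    ring
  · simp [e, Ne.symm e]

/-- The divergence of the current. -/
theorem divg_current (K : ChargedVacuum U Q t G₀ C₀ o u Φ a q) (hx : x ∈ U) (i : κ) :
    divg Q t (fun μ => current G₀ C₀ o u Φ a μ i) x
      = ∑ μ, Q μ x * ((if i = o then Φ x else 0) * ((a / Φ x) ^ 2 *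
          bil (fun k l => C₀ k l x) (fun k => pd (Sum.inl μ) (G₀ k o) x)
              (fun k => pd (Sum.inl μ) (G₀ k o) x))
        - a / Φ x * pd (Sum.inl μ) (G₀ o o) x * current G₀ C₀ o u Φ a μ i x) := by
  have hQ : ∀ μ, DifferentiableAt ℝ (Q μ) x := fun μ =>
    (K.smooth_Q μ).differentiableAt K.isOpen hx
  have hp : ∀ i μ, DifferentiableAt ℝ (momentum G₀ C₀ o μ i) x := fun i μ =>
    (K.smooth_momentum μ i).differentiableAt K.isOpen hx
  have hu : ∀ k, DifferentiableAt ℝ (u k) x := fun k =>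
    (K.smooth_u k).differentiableAt K.isOpen hx
  have hs : ∀ μ, DifferentiableAt ℝ (fun y => ∑ k, u k y * momentum G₀ C₀ o μ k y) x := fun μ =>
    DifferentiableAt.fun_sum fun k _ => (hu k).fun_mul (hp k μ)
  -- The currents `momentum` being conserved, only the derivatives of `u` contribute.
  have h1 : divg Q t (fun μ y => ∑ k, u k y * momentum G₀ C₀ o μ k y) x
      = ∑ μ, Q μ x * ∑ k, pd (Sum.inl μ) (u k) x * momentum G₀ C₀ o μ k x := by
    rw [divg_sum hQ fun k _ μ => (hu k).fun_mul (hp k μ)]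
    simp only [divg_mul hQ (hp _) (fun μ => (K.smooth_u _).hasPd K.isOpen hx (Sum.inl μ)),
      K.divg_momentum hx, mul_zero, zero_add, Finset.mul_sum]
    exact Finset.sum_comm
  have h2 : ∀ μ, ∑ k, pd (Sum.inl μ) (u k) x * momentum G₀ C₀ o μ k x
      = a / Φ x * (bil (fun k l => C₀ k l x) (fun k => pd (Sum.inl μ) (G₀ k o) x)
              (fun k => pd (Sum.inl μ) (G₀ k o) x)
        - pd (Sum.inl μ) (G₀ o o) x * ∑ k, u k x * momentum G₀ C₀ o μ k x) := by
    intro μ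
    have h3 : bil (fun k l => C₀ k l x) (fun k => pd (Sum.inl μ) (G₀ k o) x)
        (fun k => pd (Sum.inl μ) (G₀ k o) x)
        = ∑ k, pd (Sum.inl μ) (G₀ k o) x * momentum G₀ C₀ o μ k x := by
      simp only [bil, momentum, Finset.mul_sum, mul_assoc]
    rw [h3, Finset.mul_sum, ← Finset.sum_sub_distrib, Finset.mul_sum]
    exact Finset.sum_congr rfl fun k _ => by rw [K.pd_u x hx]; ring
  have h4 : ∀ μ, DifferentiableAt ℝ (fun y => a / Φ y * momentum G₀ C₀ o μ i y) x := fun μ =>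
    (K.smooth_ratio.differentiableAt K.isOpen hx).fun_mul (hp i μ)
  unfold current
  rw [divg_add hQ h4 (fun μ => (hs μ).const_mul _), divg_mul hQ (hp i) (K.hasPd_ratio hx),
    K.divg_momentum hx, divg_mul hQ hs (fun μ => hasPd_const _), h1]
  simp only [mul_zero, zero_add, zero_mul, Finset.sum_const_zero, add_zero, h2]
  rw [Finset.mul_sum, ← Finset.sum_add_distrib]
  refine Finset.sum_congr rfl fun μ _ => ?_
  have hΦ := (K.Phi_pos x hx).ne'
  generalize ∑ k, u k x * momentum G₀ C₀ o μ k x = s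
  split_ifs
  · field_simp
    ring
  · ring

theorem chargedF_sharp_ll (B : BlockMetric U g (fun μ y => 1 / Q μ y) (chargedG G₀ o u)
    (chargedC C₀ o u Φ)) (hx : x ∈ U) (μ ν : α) :
    chargedF u q x ![sharp (g x) (Sum.inl μ), sharp (g x) (Sum.inl ν)] = 0 := by
  simp [chargedF_apply, sharp, B.inv_lr hx]

theorem chargedF_sharp_lr (K : ChargedVacuum U Q t G₀ C₀ o u Φ a q)
    (B : BlockMetric U g (fun μ y => 1 / Q μ y) (chargedG G₀ o u)
    (chargedC C₀ o u Φ)) (hx : x ∈ U) (μ : α) (i : κ) :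
    chargedF u q x ![sharp (g x) (Sum.inl μ), sharp (g x) (Sum.inr i)]
      = Q μ x * (q * current G₀ C₀ o u Φ a μ i x) := by
  rw [← K.sum_chargedC_mul_pd_u hx, chargedF_apply]
  simp only [sharp, B.inv_ll hx, B.inv_lr hx, B.inv_rl hx, B.inv_rr hx, one_div_one_div, ite_mul,
    zero_mul, mul_zero, Finset.sum_const_zero, sub_zero, Finset.sum_ite_eq, Finset.mem_univ,
    if_true]
  simp only [Finset.mul_sum]
  exact Finset.sum_congr rfl fun k _ => by ring

theorem chargedH_sharp_llr (B : BlockMetric U g (fun μ y => 1 / Q μ y) (chargedG G₀ o u)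
    (chargedC C₀ o u Φ)) (hx : x ∈ U) (μ ν : α) (v : α ⊕ κ → ℝ) :
    chargedH G₀ o u x ![sharp (g x) (Sum.inl μ), sharp (g x) (Sum.inl ν), v] = 0 := by
  simp [chargedH_apply, sharp, B.inv_lr hx]

theorem chargedH_sharp_lrl (B : BlockMetric U g (fun μ y => 1 / Q μ y) (chargedG G₀ o u)
    (chargedC C₀ o u Φ)) (hx : x ∈ U) (μ ν : α) (v : α ⊕ κ → ℝ) :
    chargedH G₀ o u x ![sharp (g x) (Sum.inl μ), v, sharp (g x) (Sum.inl ν)] = 0 := by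
  rw [form_three_swap₂, chargedH_sharp_llr B hx, neg_zero]

theorem chargedH_sharp_rll (B : BlockMetric U g (fun μ y => 1 / Q μ y) (chargedG G₀ o u)
    (chargedC C₀ o u Φ)) (hx : x ∈ U) (μ ν : α) (v : α ⊕ κ → ℝ) :
    chargedH G₀ o u x ![v, sharp (g x) (Sum.inl μ), sharp (g x) (Sum.inl ν)] = 0 := by
  rw [form_three_swap₁, chargedH_sharp_lrl B hx, neg_zero]

theorem chargedH_sharp_lrr (K : ChargedVacuum U Q t G₀ C₀ o u Φ a q)
    (B : BlockMetric U g (fun μ y => 1 / Q μ y) (chargedG G₀ o u)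
    (chargedC C₀ o u Φ)) (hx : x ∈ U) (μ : α) (i j : κ) :
    chargedH G₀ o u x ![sharp (g x) (Sum.inl μ), sharp (g x) (Sum.inr i), sharp (g x) (Sum.inr j)]
      = Q μ x * ((if i = o then Φ x else 0) * current G₀ C₀ o u Φ a μ j x
        - current G₀ C₀ o u Φ a μ i x * if j = o then Φ x else 0) := by
  have h1 := K.sum_chargedC_mul_pd_u hx
  have h2 := K.sum_chargedC_mul_chargedZ hx
  rw [← h1, ← h1, ← h2, ← h2, chargedH_apply]
  simp only [sharp, B.inv_ll hx, B.inv_lr hx, B.inv_rl hx, B.inv_rr hx, one_div_one_div, ite_mul,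
    zero_mul, mul_zero, Finset.sum_const_zero, sub_zero, sub_self, add_zero]
  simp only [← ite_sub_ite, sub_zero, Finset.sum_ite_eq, Finset.mem_univ, if_true,
    Finset.sum_sub_distrib]
  simp only [mul_comm (chargedC _ _ _ _ _ _ _)]
  ring

/-- The weight `e^φ √(det g)`. -/
theorem hasPd_weight (K : ChargedVacuum U Q t G₀ C₀ o u Φ a q)
    (B : BlockMetric U g (fun μ y => 1 / Q μ y) (chargedG G₀ o u) (chargedC C₀ o u Φ))
    (hg : ∀ y ∈ U, 0 < (g y).det) (hx : x ∈ U) (μ : α) :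
    HasPd (Sum.inl μ) (fun y => Real.exp (Real.log (Φ y)) * √(g y).det)
      (t μ x * (Real.exp (Real.log (Φ x)) * √(g x).det)) x := by
  have h1 : HasPd (Sum.inl μ) (fun y => Real.exp (Real.log (Φ y)))
      (a * pd (Sum.inl μ) (G₀ o o) x) x :=
    (K.hasPd_Phi hx μ).congr_on K.isOpen hx fun y hy => Real.exp_log (K.Phi_pos y hy)
  refine (h1.mul (B.hasPd_sqrt_det hg hx μ)).congr_val ?_
  have hΦ := (K.Phi_pos x hx).ne'
  -- The derivative of e^φ = Φ cancels the term -∂ ln Φ in the logarithmic derivative of √det g, so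
  -- the weight has the vacuum derivative `t`.
  rw [K.logVol_charged hx, K.pd_log_Phi hx, Real.exp_log (K.Phi_pos x hx)]
  field_simp
  ring

theorem smooth_weight (K : ChargedVacuum U Q t G₀ C₀ o u Φ a q)
    (B : BlockMetric U g (fun μ y => 1 / Q μ y) (chargedG G₀ o u) (chargedC C₀ o u Φ))
    (hg : ∀ y ∈ U, 0 < (g y).det) :
    SmoothOn U fun y => Real.exp (Real.log (Φ y)) * √(g y).det :=
  (smoothOn_congr K.smooth_Phi fun y hy => Real.exp_log (K.Phi_pos y hy)).mul
    (B.smooth_sqrt_det hg)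

theorem smooth_chargedF_sharp (K : ChargedVacuum U Q t G₀ C₀ o u Φ a q)
    (B : BlockMetric U g (fun μ y => 1 / Q μ y) (chargedG G₀ o u) (chargedC C₀ o u Φ))
    (b c : α ⊕ κ) : SmoothOn U fun y => chargedF u q y ![sharp (g y) b, sharp (g y) c] := by
  simp only [chargedF_apply]
  have h1 : ∀ μ b, SmoothOn U fun y => ∑ i, q * pd (Sum.inl μ) (u i) y * sharp (g y) b (Sum.inr i) :=
    fun μ b => smoothOn_sum fun i _ =>
      (contDiffOn_const.mul ((K.smooth_u i).pd K.isOpen _)).mul (B.smooth_inv b _)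
  exact smoothOn_sum fun μ _ => ((B.smooth_inv b _).mul (h1 μ c)).sub
    ((B.smooth_inv c _).mul (h1 μ b))

theorem smooth_chargedZ (K : ChargedVacuum U Q t G₀ C₀ o u Φ a q) (i : κ) :
    SmoothOn U (chargedZ G₀ o u i) :=
  (K.smooth_G i o).sub ((K.smooth_G o o).mul (K.smooth_u i))

theorem smooth_chargedH_sharp (K : ChargedVacuum U Q t G₀ C₀ o u Φ a q)
    (B : BlockMetric U g (fun μ y => 1 / Q μ y) (chargedG G₀ o u) (chargedC C₀ o u Φ))
    (b c d : α ⊕ κ) :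
    SmoothOn U fun y => chargedH G₀ o u y ![sharp (g y) b, sharp (g y) c, sharp (g y) d] := by
  simp only [chargedH_apply]
  have h1 : ∀ μ b, SmoothOn U fun y => ∑ i, pd (Sum.inl μ) (u i) y * sharp (g y) b (Sum.inr i) :=
    fun μ b => smoothOn_sum fun i _ => ((K.smooth_u i).pd K.isOpen _).mul (B.smooth_inv b _)
  have h2 : ∀ b, SmoothOn U fun y => ∑ i, chargedZ G₀ o u i y * sharp (g y) b (Sum.inr i) :=
    fun b => smoothOn_sum fun i _ => (K.smooth_chargedZ i).mul (B.smooth_inv b _)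
  have h3 : ∀ μ b c, SmoothOn U fun y =>
      sharp (g y) b (Sum.inl μ) * (∑ i, pd (Sum.inl μ) (u i) y * sharp (g y) c (Sum.inr i))
        - sharp (g y) c (Sum.inl μ) * ∑ i, pd (Sum.inl μ) (u i) y * sharp (g y) b (Sum.inr i) :=
    fun μ b c => ((B.smooth_inv b _).mul (h1 μ c)).sub ((B.smooth_inv c _).mul (h1 μ b))
  exact (smoothOn_sum fun μ _ => (((h3 μ b c).mul (h2 d)).sub ((h3 μ b d).mul (h2 c))).add
    ((h3 μ c d).mul (h2 b))).neg

theorem basic_chargedF (K : ChargedVacuum U Q t G₀ C₀ o u Φ a q) {x y : α ⊕ κ → ℝ}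
    (e : ∀ μ, x (Sum.inl μ) = y (Sum.inl μ)) : chargedF u q x = chargedF u q y := by
  simp only [chargedF, fun μ i => (K.basic_u i).pd (Sum.inl μ) x y e]

theorem basic_chargedH (K : ChargedVacuum U Q t G₀ C₀ o u Φ a q) {x y : α ⊕ κ → ℝ}
    (e : ∀ μ, x (Sum.inl μ) = y (Sum.inl μ)) : chargedH G₀ o u x = chargedH G₀ o u y := by
  simp only [chargedH, chargedZ, fun μ i => (K.basic_u i).pd (Sum.inl μ) x y e,
    fun i => K.basic_u i x y e, fun i j => K.basic_G i j x y e]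

/-- The components of the Maxwell equation. -/
theorem maxwell_components (K : ChargedVacuum U Q t G₀ C₀ o u Φ a q)
    (B : BlockMetric U g (fun μ y => 1 / Q μ y) (chargedG G₀ o u) (chargedC C₀ o u Φ))
    (hg : ∀ y ∈ U, 0 < (g y).det)
    (hgb : ∀ y z, (∀ μ, y (Sum.inl μ) = z (Sum.inl μ)) → g y = g z) (hx : x ∈ U) (b : α ⊕ κ) :
    -∑ c, pd c (fun y => Real.exp (Real.log (Φ y)) * (√(g y).det *
        chargedF u q y ![sharp (g y) c, sharp (g y) b])) x
      = Real.exp (Real.log (Φ x)) * (√(g x).det * ∑ c, ∑ d,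
        chargedH G₀ o u x ![sharp (g x) c, sharp (g x) d, sharp (g x) b] *
          (1 / 2 * chargedF u q x ![cvec c, cvec d])) := by
  have hbasic : ∀ c, IsBasic (fun y => Real.exp (Real.log (Φ y)) * (√(g y).det *
        chargedF u q y ![sharp (g y) c, sharp (g y) b])) := fun c y z e => by
    simp only [hgb y z e, K.basic_Phi y z e, K.basic_chargedF e]
  rw [Fintype.sum_sum_type]
  simp only [(hbasic _).pd_inr, Finset.sum_const_zero, add_zero]
  -- F and H each have exactly one base leg. With a free base index both sides vanish, and only a
  -- torus index is of interest.
  rcases b with ν | i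
  · have h1 : ∀ μ, pd (Sum.inl μ) (fun y => Real.exp (Real.log (Φ y)) * (√(g y).det *
        chargedF u q y ![sharp (g y) (Sum.inl μ), sharp (g y) (Sum.inl ν)])) x = 0 := fun μ => by
      rw [pd_congr (f' := fun _ => 0) (fun y hy => by
        simp only [chargedF_sharp_ll B hy, mul_zero]) K.isOpen hx, pd_const]
    simp [h1, Fintype.sum_sum_type, chargedF_ll, chargedF_rr, chargedH_sharp_lrl B hx,
      chargedH_sharp_rll B hx]
  · have h1 : ∀ μ, pd (Sum.inl μ) (fun y => Real.exp (Real.log (Φ y)) * (√(g y).det *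
        chargedF u q y ![sharp (g y) (Sum.inl μ), sharp (g y) (Sum.inr i)])) x
        = pd (Sum.inl μ) (fun y => (Real.exp (Real.log (Φ y)) * √(g y).det) *
          (Q μ y * (q * current G₀ C₀ o u Φ a μ i y))) x := fun μ =>
      pd_congr (fun y hy => by simp only [K.chargedF_sharp_lr B hy]; ring) K.isOpen hx _
    have hQ : ∀ μ, DifferentiableAt ℝ (Q μ) x := fun μ =>
      (K.smooth_Q μ).differentiableAt K.isOpen hx
    have hc : ∀ μ, DifferentiableAt ℝ (current G₀ C₀ o u Φ a μ i) x := fun μ =>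
      SmoothOn.differentiableAt ((K.smooth_ratio.mul (K.smooth_momentum μ i)).add
        (contDiffOn_const.mul (smoothOn_sum fun k _ => (K.smooth_u k).mul
          (K.smooth_momentum μ k)))) K.isOpen hx
    simp only [h1]
    rw [sum_pd_weight_mul hQ (fun μ => (hc μ).const_mul q) (fun μ => K.hasPd_weight B hg hx μ),
      divg_mul hQ hc (fun μ => hasPd_const q), K.divg_current hx]
    simp only [zero_mul, mul_zero, Finset.sum_const_zero, add_zero, Fintype.sum_sum_type,
      chargedF_ll, chargedF_rr, chargedF_lr, chargedF_rl, zero_add]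
    have h2 : ∀ μ k, chargedH G₀ o u x ![sharp (g x) (Sum.inr k), sharp (g x) (Sum.inl μ),
        sharp (g x) (Sum.inr i)] = -chargedH G₀ o u x ![sharp (g x) (Sum.inl μ),
        sharp (g x) (Sum.inr k), sharp (g x) (Sum.inr i)] := fun μ k => form_three_swap₁ _ _ _ _
    simp only [h2, K.chargedH_sharp_lrr B hx]
    rw [Finset.sum_comm (s := (Finset.univ : Finset κ)), ← Finset.sum_add_distrib,
      Finset.mul_sum]
    simp only [← Finset.sum_add_distrib]
    -- The current is ∂u with its index raised, so this contraction is the squared norm of ∂_μ u in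
    -- the charged inverse metric.
    have h3 : ∀ μ, ∑ k, current G₀ C₀ o u Φ a μ k x * pd (Sum.inl μ) (u k) x
        = (a / Φ x) ^ 2 * bil (fun k l => C₀ k l x) (fun k => pd (Sum.inl μ) (G₀ k o) x)
              (fun k => pd (Sum.inl μ) (G₀ k o) x) := fun μ => by
      rw [← K.bil_pd_u_pd_u hx]
      simp only [← K.sum_chargedC_mul_pd_u hx, bil, Finset.sum_mul]
      exact Finset.sum_congr rfl fun k _ => Finset.sum_congr rfl fun l _ => by ring
    have h4 : ∀ μ, Φ x * pd (Sum.inl μ) (u o) x = a / Φ x * pd (Sum.inl μ) (G₀ o o) x :=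
      fun μ => by
        have hΦ := (K.Phi_pos x hx).ne'
        rw [K.pd_u x hx, K.u_eq x hx]
        field_simp
        ring
    have h5 : ∀ μ, ∑ k, (Q μ x * ((if k = o then Φ x else 0) * current G₀ C₀ o u Φ a μ i x -
          current G₀ C₀ o u Φ a μ k x * if i = o then Φ x else 0) *
          (1 / 2 * (q * pd (Sum.inl μ) (u k) x)) +
        -(Q μ x * ((if k = o then Φ x else 0) * current G₀ C₀ o u Φ a μ i x -
          current G₀ C₀ o u Φ a μ k x * if i = o then Φ x else 0)) *
          (1 / 2 * -(q * pd (Sum.inl μ) (u k) x)))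
        = Q μ x * q * (current G₀ C₀ o u Φ a μ i x * (a / Φ x * pd (Sum.inl μ) (G₀ o o) x)
          - (if i = o then Φ x else 0) * ((a / Φ x) ^ 2 *
            bil (fun k l => C₀ k l x) (fun k => pd (Sum.inl μ) (G₀ k o) x)
              (fun k => pd (Sum.inl μ) (G₀ k o) x))) := by
      intro μ
      rw [← h3, ← h4]
      have e : ∑ k, (if k = o then Φ x else 0) * pd (Sum.inl μ) (u k) x
          = Φ x * pd (Sum.inl μ) (u o) x := by simp
      rw [← e, mul_sub, Finset.mul_sum, Finset.mul_sum, Finset.mul_sum, Finset.mul_sum,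
        ← Finset.sum_sub_distrib]
      exact Finset.sum_congr rfl fun k _ => by ring
    simp only [h5]
    rw [← mul_assoc, ← mul_neg, ← Finset.sum_neg_distrib]
    congr 1
    exact Finset.sum_congr rfl fun μ _ => by ring

/-- The Maxwell equation. -/
theorem maxwell (K : ChargedVacuum U Q t G₀ C₀ o u Φ a q)
    (B : BlockMetric U g (fun μ y => 1 / Q μ y) (chargedG G₀ o u) (chargedC C₀ o u Φ))
    (hg : ∀ y ∈ U, 0 < (g y).det)
    (hgb : ∀ y z, (∀ μ, y (Sum.inl μ) = z (Sum.inl μ)) → g y = g z) (hx : x ∈ U) {D : ℕ}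
    (e : Fin D ≃ α ⊕ κ) (j : ℕ) (h₂ : 2 + (j + 1) = D) (h₃ : 3 + j = D) :
    extDeriv (fun y => Real.exp (Real.log (Φ y)) • hodge (g y) e h₂ (chargedF u q y)) x
      = Real.exp (Real.log (Φ x)) • wedge (hodge (g x) e h₃ (chargedH G₀ o u x))
        (chargedF u q x) := by
  obtain rfl : D = j + 3 := by omega
  refine maxwell_of_components e h₂ h₃ (fun y => Real.exp (Real.log (Φ y))) g (chargedF u q)
    (chargedH G₀ o u x) x (fun c b y => Real.exp (Real.log (Φ y)) * (√(g y).det *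
        chargedF u q y ![sharp (g y) c, sharp (g y) b])) (fun c b y => rfl) (fun c b => ?_)
    _ _ rfl (K.maxwell_components B hg hgb hx)
  have h1 := (K.smooth_weight B hg).mul (K.smooth_chargedF_sharp B c b)
  refine (smoothOn_congr h1 fun y _ => ?_).differentiableAt K.isOpen hx
  ring

theorem _root_.ChargedKerrNUT.form_eq_zero_of_lt {ι : Type} [Fintype ι] {k : ℕ}
    (h : Fintype.card ι < k) (β : Form ι k) : β = 0 := by
  ext v
  refine β.toAlternatingMap.map_linearDependent v fun hv => ?_
  have := hv.fintype_card_le_finrank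
  simp at this
  omega

/-- The Maxwell equation in dimension two. -/
theorem maxwell_two (K : ChargedVacuum U Q t G₀ C₀ o u Φ a q)
    (B : BlockMetric U g (fun μ y => 1 / Q μ y) (chargedG G₀ o u) (chargedC C₀ o u Φ))
    (hg : ∀ y ∈ U, 0 < (g y).det)
    (hgb : ∀ y z, (∀ μ, y (Sum.inl μ) = z (Sum.inl μ)) → g y = g z) (hx : x ∈ U) {D : ℕ}
    (e : Fin D ≃ α ⊕ κ) (h₂ : 2 + 0 = D) :
    extDeriv (fun y => Real.exp (Real.log (Φ y)) • hodge (g y) e h₂ (chargedF u q y)) x = 0 := by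
  obtain rfl : D = 0 + 2 := by omega
  ext v
  rw [extDeriv_hodge_two e h₂ (fun y => Real.exp (Real.log (Φ y))) g (chargedF u q) x
    (fun c b y => Real.exp (Real.log (Φ y)) * (√(g y).det *
        chargedF u q y ![sharp (g y) c, sharp (g y) b])) (fun c b y => rfl) (fun c b => ?_) v]
  · have h0 : chargedH G₀ o u x = 0 := form_eq_zero_of_lt (by
      rw [← Fintype.card_congr e, Fintype.card_fin]; norm_num) _
    refine Finset.sum_eq_zero fun b _ => ?_
    rw [K.maxwell_components B hg hgb hx, h0]
    simp
  · have h1 := (K.smooth_weight B hg).mul (K.smooth_chargedF_sharp B c b)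
    refine (smoothOn_congr h1 fun y _ => ?_).differentiableAt K.isOpen hx
    ring

/-- The equation of motion of `B`. -/
theorem kalbRamond (K : ChargedVacuum U Q t G₀ C₀ o u Φ a q)
    (B : BlockMetric U g (fun μ y => 1 / Q μ y) (chargedG G₀ o u) (chargedC C₀ o u Φ))
    (hg : ∀ y ∈ U, 0 < (g y).det)
    (hgb : ∀ y z, (∀ μ, y (Sum.inl μ) = z (Sum.inl μ)) → g y = g z) (hx : x ∈ U) {D : ℕ}
    (e : Fin D ≃ α ⊕ κ) (j : ℕ) (h₃ : 3 + j = D) :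
    extDeriv (fun y => Real.exp (Real.log (Φ y)) • hodge (g y) e h₃ (chargedH G₀ o u y)) x
      = 0 := by
  obtain rfl : D = j + 3 := by omega
  refine extDeriv_hodge_three_eq_zero e h₃ (fun y => Real.exp (Real.log (Φ y))) g
    (chargedH G₀ o u) x (fun c b d y => Real.exp (Real.log (Φ y)) * (√(g y).det *
        chargedH G₀ o u y ![sharp (g y) c, sharp (g y) b, sharp (g y) d]))
    (fun c b d y => rfl) (fun c b d => ?_) (fun b d => ?_)
  · have h1 := (K.smooth_weight B hg).mul (K.smooth_chargedH_sharp B c b d)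
    refine (smoothOn_congr h1 fun y _ => ?_).differentiableAt K.isOpen hx
    ring
  · have hbasic : ∀ c, IsBasic (fun y => Real.exp (Real.log (Φ y)) * (√(g y).det *
        chargedH G₀ o u y ![sharp (g y) c, sharp (g y) b, sharp (g y) d])) := fun c y z e => by
      simp only [hgb y z e, K.basic_Phi y z e, K.basic_chargedH e]
    rw [Fintype.sum_sum_type]
    simp only [(hbasic _).pd_inr, Finset.sum_const_zero, add_zero]
    rcases b with ν | i
    · refine Finset.sum_eq_zero fun μ _ => ?_
      rw [pd_congr (f' := fun _ => 0) (fun y hy => by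
        simp only [chargedH_sharp_llr B hy, mul_zero]) K.isOpen hx, pd_const]
    rcases d with ν | k
    · refine Finset.sum_eq_zero fun μ _ => ?_
      rw [pd_congr (f' := fun _ => 0) (fun y hy => by
        simp only [chargedH_sharp_lrl B hy, mul_zero]) K.isOpen hx, pd_const]
    have hQ : ∀ μ, DifferentiableAt ℝ (Q μ) x := fun μ =>
      (K.smooth_Q μ).differentiableAt K.isOpen hx
    have hp : ∀ i μ, DifferentiableAt ℝ (momentum G₀ C₀ o μ i) x := fun i μ =>
      (K.smooth_momentum μ i).differentiableAt K.isOpen hx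
    -- All dependence on Φ other than through the weight disappears: the raised components of H are
    -- Q_μ times a combination of the conserved vacuum currents with constant coefficients.
    have h1 : ∀ μ, pd (Sum.inl μ) (fun y => Real.exp (Real.log (Φ y)) * (√(g y).det *
        chargedH G₀ o u y ![sharp (g y) (Sum.inl μ), sharp (g y) (Sum.inr i),
          sharp (g y) (Sum.inr k)])) x
        = pd (Sum.inl μ) (fun y => (Real.exp (Real.log (Φ y)) * √(g y).det) *
          (Q μ y * ((if i = o then a else 0) * momentum G₀ C₀ o μ k y
            + (if k = o then -a else 0) * momentum G₀ C₀ o μ i y))) x := fun μ =>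
      pd_congr (fun y hy => by
        have hΦ := (K.Phi_pos y hy).ne'
        simp only [K.chargedH_sharp_lrr B hy, current]
        rw [← mul_assoc]
        congr 2
        split_ifs with h1 h2
        · subst h1; subst h2; field_simp; ring
        · field_simp; ring
        · field_simp; ring
        · ring) K.isOpen hx _
    simp only [h1]
    rw [sum_pd_weight_mul hQ (fun μ => ((hp k μ).const_mul _).fun_add ((hp i μ).const_mul _))
      (fun μ => K.hasPd_weight B hg hx μ),
      divg_add hQ (fun μ => (hp k μ).const_mul _) (fun μ => (hp i μ).const_mul _),
      divg_mul hQ (hp k) (fun μ => hasPd_const _), divg_mul hQ (hp i) (fun μ => hasPd_const _),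
      K.divg_momentum hx, K.divg_momentum hx]
    simp

end ChargedVacuum

end ChargedMaxwell

/-! ### Potentials of the field strengths, and assembly of the solution -/

section Potentials

variable {α κ : Type} [Fintype α] [DecidableEq α] [Fintype κ] [DecidableEq κ]

/-- The potential of the 3-form. -/
def chargedB (G₀ : κ → κ → (α ⊕ κ → ℝ) → ℝ) (o : κ) (u : κ → (α ⊕ κ → ℝ) → ℝ)
    (Φ : (α ⊕ κ → ℝ) → ℝ) (a : ℝ) (y : α ⊕ κ → ℝ) : Form (α ⊕ κ) 2 :=
  ∑ k : κ × κ, (1 / a * (u k.1 y * (Φ y * u k.2 y - a * G₀ k.2 o y))) •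
    wedge (dcoord (Sum.inr k.1)) (dcoord (Sum.inr k.2))

theorem form_ext_two {ι : Type} [Fintype ι] [DecidableEq ι] {β β' : Form ι 2}
    (h : ∀ i j, β ![cvec i, cvec j] = β' ![cvec i, cvec j]) : β = β' := by
  refine form_ext_cvec fun i => ?_
  have e : (fun r => cvec (i r)) = ![cvec (i 0), cvec (i 1)] := by
    funext r; fin_cases r <;> rfl
  rw [e, h]

theorem form_ext_three {ι : Type} [Fintype ι] [DecidableEq ι] {β β' : Form ι 3}
    (h : ∀ i j k, β ![cvec i, cvec j, cvec k] = β' ![cvec i, cvec j, cvec k]) : β = β' := by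
  refine form_ext_cvec fun i => ?_
  have e : (fun r => cvec (i r)) = ![cvec (i 0), cvec (i 1), cvec (i 2)] := by
    funext r; fin_cases r <;> rfl
  rw [e, h]

namespace ChargedVacuum

variable {U : Set (α ⊕ κ → ℝ)} {Q t : α → (α ⊕ κ → ℝ) → ℝ}
    {G₀ C₀ : κ → κ → (α ⊕ κ → ℝ) → ℝ} {o : κ} {u : κ → (α ⊕ κ → ℝ) → ℝ}
    {Φ : (α ⊕ κ → ℝ) → ℝ} {a q : ℝ} {x : α ⊕ κ → ℝ}
    {g : (α ⊕ κ → ℝ) → Matrix (α ⊕ κ) (α ⊕ κ) ℝ}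

theorem extDeriv_torusForm {w : κ → (α ⊕ κ → ℝ) → ℝ} (hw : ∀ i, DifferentiableAt ℝ (w i) x)
    (y z : α ⊕ κ → ℝ) :
    extDeriv (fun y => (torusForm (fun i => w i y) : Form (α ⊕ κ) 1)) x ![y, z]
      = ∑ k, (fderiv ℝ (w k) x y * z (Sum.inr k) - fderiv ℝ (w k) x z * y (Sum.inr k)) := by
  rw [extDeriv_sum_smul (w := fun y => torusForm fun i => w i y) (c := w) hw (fun i => dcoord (Sum.inr i)) (fun y => rfl)]
  refine Finset.sum_congr rfl fun k _ => ?_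
  rw [Fin.sum_univ_two]
  have h0 : (0 : Fin 2).removeNth ![y, z] = ![z] := by funext i; fin_cases i; rfl
  have h1 : (1 : Fin 2).removeNth ![y, z] = ![y] := by funext i; fin_cases i; rfl
  rw [h0, h1, dcoord_apply, dcoord_apply]
  simp
  ring

/-- The components `∑ ∂_c u_k dψ^k(d)`. -/
def duComp (u : κ → (α ⊕ κ → ℝ) → ℝ) (x : α ⊕ κ → ℝ) (c d : α ⊕ κ) : ℝ :=
  ∑ k, pd c (u k) x * (cvec d : α ⊕ κ → ℝ) (Sum.inr k)

/-- As `u` depends on the base only, the sum over base directions is already its full differential.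
-/
theorem sum_cvec_mul (K : ChargedVacuum U Q t G₀ C₀ o u Φ a q) (c d : α ⊕ κ) :
    ∑ μ, (cvec c : α ⊕ κ → ℝ) (Sum.inl μ) *
        (∑ i, pd (Sum.inl μ) (u i) x * (cvec d : α ⊕ κ → ℝ) (Sum.inr i))
      = duComp u x c d := by
  rcases c with μ | k
  · simp [duComp]
  · simp [duComp, (K.basic_u _).pd_inr]

/-- `F = dA`. -/
theorem chargedF_eq (K : ChargedVacuum U Q t G₀ C₀ o u Φ a q) (hx : x ∈ U) :
    chargedF u q x = extDeriv (fun y => q • (torusForm (fun i => u i y) : Form (α ⊕ κ) 1)) x := by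
  have h0 : (fun y => q • (torusForm (fun i => u i y) : Form (α ⊕ κ) 1))
      = fun y => torusForm (fun i => q * u i y) := by
    funext y
    simp only [torusForm, Finset.smul_sum, smul_smul]
  refine form_ext_two fun c d => ?_
  have hu : ∀ i, DifferentiableAt ℝ (u i) x := fun i =>
    (K.smooth_u i).differentiableAt K.isOpen hx
  rw [h0, extDeriv_torusForm fun i => (hu i).const_mul q]
  have h1 : ∀ k c, fderiv ℝ (fun y => q * u k y) x (cvec c) = q * pd c (u k) x := fun k c =>
    pd_const_mul q (hu k)
  rw [chargedF_apply]
  simp only [h1, Finset.sum_sub_distrib, mul_assoc, ← Finset.mul_sum]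
  simp only [mul_left_comm _ q, ← Finset.mul_sum, K.sum_cvec_mul]
  rfl

/-- The covector Φ u - a v has locally constant components, so that differentiating `chargedB` only
affects its factor `u`. As a form, `chargedB` is just -u ∧ v, since u ∧ u = 0. -/
theorem pd_closed (K : ChargedVacuum U Q t G₀ C₀ o u Φ a q) (hx : x ∈ U) (c : α ⊕ κ) (i : κ) :
    HasPd c (fun y => Φ y * u i y - a * G₀ i o y) 0 x := by
  rcases c with μ | k
  · refine (((K.hasPd_Phi hx μ).mul (K.hasPd_u hx μ i)).sub
      ((K.hasPd_G hx μ i o).const_mul a)).congr_val ?_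
    have hΦ := (K.Phi_pos x hx).ne'
    field_simp
    ring
  · have h : SmoothOn U fun y => Φ y * u i y - a * G₀ i o y :=
      (K.smooth_Phi.mul (K.smooth_u i)).sub (contDiffOn_const.mul (K.smooth_G i o))
    refine ⟨h.differentiableAt K.isOpen hx, IsBasic.pd_inr (fun y z e => ?_) k x⟩
    simp only [K.basic_Phi y z e, K.basic_u i y z e, K.basic_G i o y z e]

/-- `H = dB - A ∧ dA`. -/
theorem chargedH_eq (K : ChargedVacuum U Q t G₀ C₀ o u Φ a q) (hx : x ∈ U) :
    chargedH G₀ o u x = extDeriv (chargedB G₀ o u Φ a) x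
      - wedge (q • (torusForm (fun i => u i x) : Form (α ⊕ κ) 1))
        (extDeriv (fun y => q • (torusForm (fun i => u i y) : Form (α ⊕ κ) 1)) x) := by
  have ha := K.a_ne hx
  refine form_ext_three fun c d e => ?_
  rw [ContinuousAlternatingMap.sub_apply, ← K.chargedF_eq hx, wedge_one_two_apply]
  have hF : ∀ c d, chargedF u q x ![cvec c, cvec d] = q * (duComp u x c d - duComp u x d c) := by
    intro c d
    rw [chargedF_apply]
    simp only [Finset.sum_sub_distrib, mul_assoc, ← Finset.mul_sum]
    simp only [mul_left_comm _ q, ← Finset.mul_sum, K.sum_cvec_mul]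
    ring
  have hA : ∀ c, (q • (torusForm (fun i => u i x) : Form (α ⊕ κ) 1)) ![cvec c]
      = q * ∑ i, u i x * (cvec c : α ⊕ κ → ℝ) (Sum.inr i) := fun c => by
    rw [ContinuousAlternatingMap.smul_apply, torusForm_apply, smul_eq_mul]
  have hcoef : ∀ (c : α ⊕ κ) (k : κ × κ), HasPd c
      (fun y => 1 / a * (u k.1 y * (Φ y * u k.2 y - a * G₀ k.2 o y)))
      (1 / a * (pd c (u k.1) x * (Φ x * u k.2 x - a * G₀ k.2 o x))) x := fun c k =>
    ((((K.smooth_u k.1).hasPd K.isOpen hx c).mul (K.pd_closed hx c k.2)).const_mul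
      (1 / a)).congr_val (by ring)
  -- By Φ = a (V + q²) the constant covector is a (q² u - (v - V u)). In dB its first part cancels
  -- against A ∧ dA, and its second part yields H.
  have hS : ∀ c, ∑ l, (Φ x * u l x - a * G₀ l o x) * (cvec c : α ⊕ κ → ℝ) (Sum.inr l)
      = a * (q ^ 2 * (∑ i, u i x * (cvec c : α ⊕ κ → ℝ) (Sum.inr i))
        - ∑ i, chargedZ G₀ o u i x * (cvec c : α ⊕ κ → ℝ) (Sum.inr i)) := fun c => by
    rw [Finset.mul_sum, ← Finset.sum_sub_distrib, Finset.mul_sum]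
    refine Finset.sum_congr rfl fun i _ => ?_
    rw [K.Phi_eq x hx, chargedZ]
    ring
  have hterm : ∀ c d e, ∑ k : κ × κ, fderiv ℝ (fun y => 1 / a * (u k.1 y *
      (Φ y * u k.2 y - a * G₀ k.2 o y))) x (cvec c) *
        wedge (dcoord (Sum.inr k.1)) (dcoord (Sum.inr k.2)) ![cvec d, cvec e]
      = duComp u x c d * (q ^ 2 * (∑ i, u i x * (cvec e : α ⊕ κ → ℝ) (Sum.inr i))
        - ∑ i, chargedZ G₀ o u i x * (cvec e : α ⊕ κ → ℝ) (Sum.inr i))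
        - duComp u x c e * (q ^ 2 * (∑ i, u i x * (cvec d : α ⊕ κ → ℝ) (Sum.inr i))
        - ∑ i, chargedZ G₀ o u i x * (cvec d : α ⊕ κ → ℝ) (Sum.inr i)) := by
    intro c d e
    have e1 : ∀ r, (q ^ 2 * (∑ i, u i x * (cvec r : α ⊕ κ → ℝ) (Sum.inr i))
        - ∑ i, chargedZ G₀ o u i x * (cvec r : α ⊕ κ → ℝ) (Sum.inr i))
        = 1 / a * ∑ l, (Φ x * u l x - a * G₀ l o x) * (cvec r : α ⊕ κ → ℝ) (Sum.inr l) :=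
      fun r => by rw [hS]; field_simp
    have e2 : ∀ (c : α ⊕ κ) (k : κ × κ), fderiv ℝ (fun y => 1 / a * (u k.1 y *
        (Φ y * u k.2 y - a * G₀ k.2 o y))) x (cvec c)
        = 1 / a * (pd c (u k.1) x * (Φ x * u k.2 x - a * G₀ k.2 o x)) := fun c k => (hcoef c k).eq
    simp only [e2]
    rw [e1, e1, Fintype.sum_prod_type, duComp, duComp, Finset.sum_mul, Finset.sum_mul,
      ← Finset.sum_sub_distrib]
    refine Finset.sum_congr rfl fun k _ => ?_
    rw [Finset.mul_sum, Finset.mul_sum, Finset.mul_sum, Finset.mul_sum, ← Finset.sum_sub_distrib]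
    refine Finset.sum_congr rfl fun l _ => ?_
    rw [wedge_one_one, dcoord_apply, dcoord_apply, dcoord_apply, dcoord_apply]
    ring
  rw [extDeriv_sum_smul (w := chargedB G₀ o u Φ a) (c := fun (k : κ × κ) y => 1 / a * (u k.1 y *
      (Φ y * u k.2 y - a * G₀ k.2 o y))) (fun k => (hcoef c k).1)
    (fun k => wedge (dcoord (Sum.inr k.1)) (dcoord (Sum.inr k.2))) (fun y => rfl),
    Finset.sum_comm, Fin.sum_univ_three]
  have h0 : (0 : Fin 3).removeNth ![(cvec c : α ⊕ κ → ℝ), cvec d, cvec e] = ![cvec d, cvec e] := by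
    funext i; fin_cases i <;> rfl
  have h1 : (1 : Fin 3).removeNth ![(cvec c : α ⊕ κ → ℝ), cvec d, cvec e] = ![cvec c, cvec e] := by
    funext i; fin_cases i <;> rfl
  have h2 : (2 : Fin 3).removeNth ![(cvec c : α ⊕ κ → ℝ), cvec d, cvec e] = ![cvec c, cvec d] := by
    funext i; fin_cases i <;> rfl
  simp only [h0, h1, h2, ← Finset.mul_sum]
  have v0 : (![(cvec c : α ⊕ κ → ℝ), cvec d, cvec e] : Fin 3 → α ⊕ κ → ℝ) 0 = cvec c := rfl
  have v1 : (![(cvec c : α ⊕ κ → ℝ), cvec d, cvec e] : Fin 3 → α ⊕ κ → ℝ) 1 = cvec d := rfl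
  have v2 : (![(cvec c : α ⊕ κ → ℝ), cvec d, cvec e] : Fin 3 → α ⊕ κ → ℝ) 2 = cvec e := rfl
  simp only [v0, v1, v2, hterm, hF, hA]
  have hH : ∀ c d e, ∑ μ : α, ((cvec c : α ⊕ κ → ℝ) (Sum.inl μ) *
        (∑ i, pd (Sum.inl μ) (u i) x * (cvec d : α ⊕ κ → ℝ) (Sum.inr i))
      - (cvec d : α ⊕ κ → ℝ) (Sum.inl μ) *
        (∑ i, pd (Sum.inl μ) (u i) x * (cvec c : α ⊕ κ → ℝ) (Sum.inr i))) *
        (∑ i, chargedZ G₀ o u i x * (cvec e : α ⊕ κ → ℝ) (Sum.inr i))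
      = (duComp u x c d - duComp u x d c) *
        (∑ i, chargedZ G₀ o u i x * (cvec e : α ⊕ κ → ℝ) (Sum.inr i)) := fun c d e => by
    rw [← Finset.sum_mul, Finset.sum_sub_distrib, K.sum_cvec_mul, K.sum_cvec_mul]
  rw [chargedH_apply, Finset.sum_add_distrib, Finset.sum_sub_distrib, hH, hH, hH]
  simp only [Fin.val_zero, Fin.val_one, Fin.val_two, pow_zero, pow_one]
  ring

/-- The charged fields solve the equations of abelian heterotic supergravity. -/
theorem solvesHeterotic (K : ChargedVacuum U Q t G₀ C₀ o u Φ a q)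
    (B : BlockMetric U g (fun μ y => 1 / Q μ y) (chargedG G₀ o u) (chargedC C₀ o u Φ))
    (hg : ∀ y ∈ U, (g y).PosDef)
    (hgb : ∀ y z, (∀ μ, y (Sum.inl μ) = z (Sum.inl μ)) → g y = g z) {D : ℕ}
    (e : Fin D ≃ α ⊕ κ) {F : (α ⊕ κ → ℝ) → Form (α ⊕ κ) 2} {H : (α ⊕ κ → ℝ) → Form (α ⊕ κ) 3}
    (hF : ∀ y ∈ U, F y = chargedF u q y) (hH : ∀ y ∈ U, H y = chargedH G₀ o u y) :
    SolvesHeterotic e U g (fun y => Real.log (Φ y))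
      (fun y => q • (torusForm (fun i => u i y) : Form (α ⊕ κ) 1))
      (chargedB G₀ o u Φ a) F H where
  isOpen := K.isOpen
  smooth_g := B.smooth
  smooth_phi := K.smooth_log
  smooth_A := by
    unfold torusForm
    have h : ∀ i : κ, ContDiffOn ℝ ∞
        (fun y => u i y • (dcoord (Sum.inr i) : Form (α ⊕ κ) 1)) U := fun i =>
      ContDiffOn.smul (K.smooth_u i) contDiffOn_const
    exact ContDiffOn.const_smul q (ContDiffOn.sum fun i _ => h i)
  smooth_B := by
    unfold chargedB
    have h : ∀ k : κ × κ, SmoothOn U fun y =>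
        1 / a * (u k.1 y * (Φ y * u k.2 y - a * G₀ k.2 o y)) := fun k =>
      contDiffOn_const.mul ((K.smooth_u k.1).mul
        ((K.smooth_Phi.mul (K.smooth_u k.2)).sub (contDiffOn_const.mul (K.smooth_G k.2 o))))
    have h' : ∀ k : κ × κ, ContDiffOn ℝ ∞ (fun y =>
        (1 / a * (u k.1 y * (Φ y * u k.2 y - a * G₀ k.2 o y))) •
          (wedge (dcoord (Sum.inr k.1)) (dcoord (Sum.inr k.2)) : Form (α ⊕ κ) 2)) U := fun k =>
      ContDiffOn.smul (h k) contDiffOn_const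
    exact ContDiffOn.sum fun k _ => h' k
  posDef := hg
  F_eq x hx := (hF x hx).trans (K.chargedF_eq hx)
  H_eq x hx := (hH x hx).trans (K.chargedH_eq hx)
  einstein x hx i j := by
    rw [hF x hx, hH x hx]
    exact K.einstein B hx i j
  maxwell x hx j h₂ h₃ := by
    rw [hF x hx, hH x hx, ← K.maxwell B (fun y hy => (hg y hy).det_pos) hgb hx e j h₂ h₃]
    refine Filter.EventuallyEq.extDeriv_eq
      (Filter.eventuallyEq_of_mem (K.isOpen.mem_nhds hx) fun y hy => ?_)
    simp only [hF y hy]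
  maxwell_two x hx h₂ := by
    rw [← K.maxwell_two B (fun y hy => (hg y hy).det_pos) hgb hx e h₂]
    refine Filter.EventuallyEq.extDeriv_eq
      (Filter.eventuallyEq_of_mem (K.isOpen.mem_nhds hx) fun y hy => ?_)
    simp only [hF y hy]
  kalbRamond x hx j h₃ := by
    rw [← K.kalbRamond B (fun y hy => (hg y hy).det_pos) hgb hx e j h₃]
    refine Filter.EventuallyEq.extDeriv_eq
      (Filter.eventuallyEq_of_mem (K.isOpen.mem_nhds hx) fun y hy => ?_)
    simp only [hH y hy]
  dilaton x hx := by
    rw [hF x hx, hH x hx]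
    exact K.dilaton B hx

end ChargedVacuum

end Potentials

/-! ### Partial fractions in the squares of the coordinates -/

section Frames

variable {α β κ : Type} [Fintype α] [DecidableEq α] [Fintype β] [DecidableEq β]
  [Subsingleton β] [Fintype κ] [DecidableEq κ]

/-- The squares of the coordinates, and zero for the extra frame index. -/
def zsq (y : α ⊕ κ → ℝ) : α ⊕ β → ℝ := Sum.elim (fun ν => y (Sum.inl ν) ^ 2) fun _ => 0

/-- `2 / (x_ν² - z_a)` -/
def rho (ν : α) (a : α ⊕ β) (y : α ⊕ κ → ℝ) : ℝ := 2 / (y (Sum.inl ν) ^ 2 - zsq y a)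

/-- `2 x_ν / (x_ν² - z_a)` -/
def lam (ν : α) (a : α ⊕ β) (y : α ⊕ κ → ℝ) : ℝ := y (Sum.inl ν) * rho ν a y

/-- `∂_ν ln √(det g)` plus `∂_ν φ`. -/
def volDer (α β κ : Type) [Fintype α] [DecidableEq α] [Fintype β] [Fintype κ] (ν : α)
    (y : α ⊕ κ → ℝ) : ℝ :=
  ∑ σ : α, lam ν (Sum.inl σ : α ⊕ β) y + ∑ _b : β, 1 / y (Sum.inl ν)

@[simp] theorem zsq_inl (y : α ⊕ κ → ℝ) (ν : α) :
    zsq y (Sum.inl ν : α ⊕ β) = y (Sum.inl ν) ^ 2 := rfl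

@[simp] theorem zsq_inr (y : α ⊕ κ → ℝ) (b : β) : zsq y (Sum.inr b : α ⊕ β) = 0 := rfl

-- Here 2/0 = 0. Thanks to this convention sums of `rho` and `lam` may run over all frame indices
-- without excluding ν.
@[simp] theorem rho_self (ν : α) (y : α ⊕ κ → ℝ) : rho ν (Sum.inl ν : α ⊕ β) y = 0 := by
  simp [rho]

@[simp] theorem lam_self (ν : α) (y : α ⊕ κ → ℝ) : lam ν (Sum.inl ν : α ⊕ β) y = 0 := by
  simp [lam]

theorem rho_swap (μ ν : α) (y : α ⊕ κ → ℝ) :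
    rho ν (Sum.inl μ : α ⊕ β) y = -rho μ (Sum.inl ν : α ⊕ β) y := by
  simp only [rho, zsq_inl]
  rw [← neg_sub, div_neg]

section Distinct

variable {y : α ⊕ κ → ℝ} (h : Function.Injective (zsq y : α ⊕ β → ℝ))

theorem zsq_sub_ne (h : Function.Injective (zsq y : α ⊕ β → ℝ)) {ν : α} {a : α ⊕ β}
    (e : a ≠ Sum.inl ν) : y (Sum.inl ν) ^ 2 - zsq y a ≠ 0 := fun h0 =>
  e (h ((sub_eq_zero.mp h0).symm.trans rfl))

theorem coord_ne_zero (h : Function.Injective (zsq y : α ⊕ β → ℝ)) (b : β) (ν : α) :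
    y (Sum.inl ν) ≠ 0 := fun h0 => by
  have := zsq_sub_ne h (ν := ν) (a := Sum.inr b) (by simp)
  rw [h0] at this
  simp at this

/-- With z = x² this is four times Σ z/∏(z - z') over three nodes, which vanishes by Lagrange
interpolation since z has degree one. -/
theorem lam_mul_lam_cycle (h : Function.Injective (zsq y : α ⊕ β → ℝ)) {μ ρ σ : α} (h1 : μ ≠ ρ)
    (h2 : σ ≠ μ) (h3 : σ ≠ ρ) :
    lam σ (Sum.inl μ : α ⊕ β) y * lam σ (Sum.inl ρ : α ⊕ β) y
      + lam μ (Sum.inl σ : α ⊕ β) y * lam μ (Sum.inl ρ : α ⊕ β) y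
      + lam ρ (Sum.inl σ : α ⊕ β) y * lam ρ (Sum.inl μ : α ⊕ β) y = 0 := by
  have e1 := zsq_sub_ne h (ν := μ) (a := Sum.inl ρ) (by simpa using h1.symm)
  have e2 := zsq_sub_ne h (ν := σ) (a := Sum.inl μ) (by simpa using h2.symm)
  have e3 := zsq_sub_ne h (ν := σ) (a := Sum.inl ρ) (by simpa using h3.symm)
  rw [lam, lam, lam, lam, lam, lam, rho_swap σ μ, rho_swap σ ρ, rho_swap μ ρ]
  simp only [rho, zsq_inl] at *
  field_simp
  ring

/-- After removal of the common factor x_μ x_ρ this is the partial fraction decomposition of 1/((z_ρ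
- z_σ)(z_μ - z_σ)). -/
theorem lam_mul_lam_off (h : Function.Injective (zsq y : α ⊕ β → ℝ)) {μ ρ σ : α} (h1 : μ ≠ ρ)
    (h2 : σ ≠ μ) (h3 : σ ≠ ρ) :
    lam ρ (Sum.inl σ : α ⊕ β) y * lam μ (Sum.inl ρ : α ⊕ β) y
      + lam μ (Sum.inl σ : α ⊕ β) y * lam ρ (Sum.inl μ : α ⊕ β) y
      = lam ρ (Sum.inl σ : α ⊕ β) y * lam μ (Sum.inl σ : α ⊕ β) y := by
  have e1 := zsq_sub_ne h (ν := μ) (a := Sum.inl ρ) (by simpa using h1.symm)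
  have e2 := zsq_sub_ne h (ν := σ) (a := Sum.inl μ) (by simpa using h2.symm)
  have e3 := zsq_sub_ne h (ν := σ) (a := Sum.inl ρ) (by simpa using h3.symm)
  rw [lam, lam, lam, lam, rho_swap σ μ, rho_swap σ ρ, rho_swap μ ρ]
  simp only [rho, zsq_inl] at *
  field_simp
  ring

theorem lam_sq_sub (h : Function.Injective (zsq y : α ⊕ β → ℝ)) (μ ν : α) :
    lam μ (Sum.inl ν : α ⊕ β) y ^ 2 - lam ν (Sum.inl μ : α ⊕ β) y ^ 2
      = 2 * rho μ (Sum.inl ν : α ⊕ β) y := by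
  by_cases e : μ = ν
  · subst e; simp
  have e1 := zsq_sub_ne h (ν := μ) (a := Sum.inl ν) (by simpa using Ne.symm e)
  rw [lam, lam, rho_swap μ ν]
  simp only [rho, zsq_inl] at *
  field_simp

theorem lam_inr (h : Function.Injective (zsq y : α ⊕ β → ℝ)) (b : β) (ν : α) :
    lam ν (Sum.inr b : α ⊕ β) y = 2 / y (Sum.inl ν) := by
  have := coord_ne_zero h b ν
  simp only [lam, rho, zsq_inr]
  field_simp
  ring

theorem rho_inr (b : β) (ν : α) :
    rho ν (Sum.inr b : α ⊕ β) y = 2 / y (Sum.inl ν) ^ 2 := by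
  simp only [rho, zsq_inr, sub_zero]

theorem inv_mul_lam (h : Function.Injective (zsq y : α ⊕ β → ℝ)) (b : β) (ν : α) (a : α ⊕ β) :
    1 / y (Sum.inl ν) * lam ν a y = rho ν a y := by
  have := coord_ne_zero h b ν
  simp only [lam]
  field_simp

/-- `∑_ν λ_νa λ_νb` off the diagonal, in terms of the quantities `w`. -/
def wAux (β : Type) [Fintype β] (y : α ⊕ κ → ℝ) (a b : α ⊕ β) : ℝ :=
  Sum.elim (fun ν => volDer α β κ ν y * lam ν b y + rho ν b y - lam ν b y ^ 2) (fun _ => 0) a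

/-- For a ≠ b, `lam_mul_lam_cycle` and the 1/x terms of `volDer` redistribute the sum into a part
attached to a and a part attached to b. This splitting makes the cross terms cancel in
`quadratic_identity`. -/
theorem sum_lam_mul_lam (h : Function.Injective (zsq y : α ⊕ β → ℝ)) (a b : α ⊕ β) :
    ∑ ν, lam ν a y * lam ν b y
      = (if a = b then ∑ ν, lam ν a y ^ 2 else 0) - wAux β y a b - wAux β y b a := by
  by_cases e : a = b
  · subst e
    have : wAux β y a a = 0 := by
      rcases a with ν | b <;> simp [wAux]
    simp only [if_true, this, sub_zero, sq]
  rw [if_neg e]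
  have hl : ∀ (μ : α) (b : β), ∑ ν, lam ν (Sum.inl μ : α ⊕ β) y * lam ν (Sum.inr b : α ⊕ β) y
      = 0 - wAux β y (Sum.inl μ : α ⊕ β) (Sum.inr b) - wAux β y (Sum.inr b : α ⊕ β) (Sum.inl μ) := by
    intro μ b
    simp only [wAux, Sum.elim_inl, Sum.elim_inr, volDer, add_mul, Finset.sum_mul,
      inv_mul_lam h b]
    have h1 : ∑ σ, lam σ (Sum.inl μ : α ⊕ β) y * lam σ (Sum.inr b : α ⊕ β) y
        = -∑ σ, lam μ (Sum.inl σ : α ⊕ β) y * lam μ (Sum.inr b : α ⊕ β) y := by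
      rw [← Finset.sum_neg_distrib]
      refine Finset.sum_congr rfl fun σ _ => ?_
      have h1 := coord_ne_zero h b σ
      have h2 := coord_ne_zero h b μ
      rw [lam_inr h, lam_inr h, lam, lam, rho_swap μ σ]
      field_simp
    have h3 : ∑ _b' : β, rho μ (Sum.inr b : α ⊕ β) y = rho μ (Sum.inr b : α ⊕ β) y := by
      rw [Fintype.sum_subsingleton _ b]
    rw [h1, h3, lam_inr h, rho_inr]
    ring
  rcases a with μ | b₁ <;> rcases b with ρ | b₂
  · have e' : μ ≠ ρ := fun h => e (by rw [h])
    simp only [wAux, Sum.elim_inl, volDer, add_mul, Finset.sum_mul]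
    have h1 : ∑ _b : β, 1 / y (Sum.inl μ) * lam μ (Sum.inl ρ : α ⊕ β) y
        = ∑ _b : β, rho μ (Sum.inl ρ : α ⊕ β) y :=
      Finset.sum_congr rfl fun b _ => inv_mul_lam h b _ _
    have h2 : ∑ _b : β, 1 / y (Sum.inl ρ) * lam ρ (Sum.inl μ : α ⊕ β) y
        = -∑ _b : β, rho μ (Sum.inl ρ : α ⊕ β) y := by
      rw [← Finset.sum_neg_distrib]
      exact Finset.sum_congr rfl fun b _ => by rw [inv_mul_lam h b, rho_swap μ ρ]
    have h3 : ∑ σ, lam σ (Sum.inl μ : α ⊕ β) y * lam σ (Sum.inl ρ : α ⊕ β) y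
        = lam ρ (Sum.inl μ : α ⊕ β) y ^ 2 + lam μ (Sum.inl ρ : α ⊕ β) y ^ 2
          - ∑ σ, lam μ (Sum.inl σ : α ⊕ β) y * lam μ (Sum.inl ρ : α ⊕ β) y
          - ∑ σ, lam ρ (Sum.inl σ : α ⊕ β) y * lam ρ (Sum.inl μ : α ⊕ β) y := by
      have h4 : lam ρ (Sum.inl μ : α ⊕ β) y ^ 2 + lam μ (Sum.inl ρ : α ⊕ β) y ^ 2
          = ∑ σ : α, ((if σ = μ then lam ρ (Sum.inl μ : α ⊕ β) y ^ 2 else 0)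
            + (if σ = ρ then lam μ (Sum.inl ρ : α ⊕ β) y ^ 2 else 0)) := by
        simp [Finset.sum_add_distrib]
      rw [h4, ← Finset.sum_sub_distrib, ← Finset.sum_sub_distrib]
      refine Finset.sum_congr rfl fun σ _ => ?_
      by_cases h5 : σ = μ
      · subst h5
        rw [if_pos rfl, if_neg e']
        simp
        ring
      by_cases h6 : σ = ρ
      · subst h6
        rw [if_pos rfl, if_neg h5]
        simp
        ring
      rw [if_neg h5, if_neg h6]
      linear_combination lam_mul_lam_cycle h e' h5 h6
    rw [h1, h2, h3, rho_swap μ ρ]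
    ring
  · exact hl μ b₂
  · rw [← sub_right_comm, ← hl ρ b₁]
    exact Finset.sum_congr rfl fun ν _ => mul_comm _ _
  · exact absurd (by rw [Subsingleton.elim b₁ b₂]) e

end Distinct

end Frames

theorem hasPd_coord {ι : Type} [Fintype ι] [DecidableEq ι] (i j : ι) (x : ι → ℝ) :
    HasPd i (fun y => y j) (if j = i then 1 else 0) x := by
  refine ⟨by fun_prop, ?_⟩
  unfold pd
  rw [show (fun y : ι → ℝ => y j) = ContinuousLinearMap.proj (R := ℝ) (φ := fun _ => ℝ) j from rfl,
    ContinuousLinearMap.fderiv]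
  simp [cvec, Pi.single_apply]

/-! ### Frames of Kerr–NUT type and their derivatives -/

section VacuumFrames

variable {α β κ : Type} [Fintype α] [DecidableEq α] [Fintype β] [DecidableEq β]
  [Subsingleton β] [Fintype κ] [DecidableEq κ]

/-- A metric `∑ (dx^ν)² / Q_ν + ∑_a Q_a A_a²` of Kerr–NUT type, with a covector `A_a` on the torus
for each `ν : α` and possibly a further one (`β`), and the basis `E` dual to `A`. -/
structure VacuumFrame (U : Set (α ⊕ κ → ℝ)) (Q : α ⊕ β → (α ⊕ κ → ℝ) → ℝ)
    (A : α ⊕ β → κ → (α ⊕ κ → ℝ) → ℝ) (E : κ → α ⊕ β → (α ⊕ κ → ℝ) → ℝ) : Prop where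
  isOpen : IsOpen U
  injective : ∀ x ∈ U, Function.Injective (zsq x : α ⊕ β → ℝ)
  smooth_Q : ∀ a, SmoothOn U (Q a)
  smooth_A : ∀ a k, SmoothOn U (A a k)
  smooth_E : ∀ k a, SmoothOn U (E k a)
  basic_Q : ∀ a, IsBasic (Q a)
  basic_A : ∀ a k, IsBasic (A a k)
  basic_E : ∀ k a, IsBasic (E k a)
  Q_pos : ∀ x ∈ U, ∀ a, 0 < Q a x
  pd_Q : ∀ x ∈ U, ∀ ν a, a ≠ Sum.inl ν → pd (Sum.inl ν) (Q a) x = -(lam ν a x * Q a x)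
  pd_A : ∀ x ∈ U, ∀ ν a k, pd (Sum.inl ν) (A a k) x = lam ν a x * (A a k x - A (Sum.inl ν) k x)
  dual : ∀ x ∈ U, ∀ a b, ∑ k, A a k x * E k b x = if a = b then 1 else 0
  dual' : ∀ x ∈ U, ∀ k l, ∑ a, E k a x * A a l x = if k = l then 1 else 0
  vacuum_inl : ∀ x ∈ U, ∀ μ : α,
    volDer α β κ μ x * pd (Sum.inl μ) (Q (Sum.inl μ)) x
      + pd (Sum.inl μ) (pd (Sum.inl μ) (Q (Sum.inl μ))) x + ∑ a, lam μ a x ^ 2 * Q a x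
      + ∑ ν, ((pd (Sum.inl ν) (Q (Sum.inl ν)) x + volDer α β κ ν x * Q (Sum.inl ν) x)
          * lam ν (Sum.inl μ : α ⊕ β) x + Q (Sum.inl ν) x * rho ν (Sum.inl μ : α ⊕ β) x
          - Q (Sum.inl ν) x * lam ν (Sum.inl μ : α ⊕ β) x ^ 2)
      - Q (Sum.inl μ) x * ∑ ν, lam ν (Sum.inl μ : α ⊕ β) x ^ 2 = 0
  vacuum_inr : ∀ x ∈ U, ∀ b : β,
    ∑ ν, ((pd (Sum.inl ν) (Q (Sum.inl ν)) x + volDer α β κ ν x * Q (Sum.inl ν) x)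
          * lam ν (Sum.inr b : α ⊕ β) x + Q (Sum.inl ν) x * rho ν (Sum.inr b : α ⊕ β) x
          - Q (Sum.inl ν) x * lam ν (Sum.inr b : α ⊕ β) x ^ 2)
      = Q (Sum.inr b) x * ∑ ν, lam ν (Sum.inr b : α ⊕ β) x ^ 2

theorem hasPd_zsq (τ : α) (a : α ⊕ β) (x : α ⊕ κ → ℝ) :
    HasPd (Sum.inl τ) (fun y : α ⊕ κ → ℝ => zsq y a)
      (if a = Sum.inl τ then 2 * x (Sum.inl τ) else 0) x := by
  rcases a with ν | b
  · have h := (hasPd_coord (Sum.inl τ) (Sum.inl ν : α ⊕ κ) x).mul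
      (hasPd_coord (Sum.inl τ) (Sum.inl ν : α ⊕ κ) x)
    simp only [zsq_inl, sq]
    refine h.congr_val ?_
    by_cases e : ν = τ
    · subst e; simp; ring
    · simp [e]
  · simpa using hasPd_const (i := (Sum.inl τ : α ⊕ κ)) (x := x) 0

theorem hasPd_lam {x : α ⊕ κ → ℝ} (h : Function.Injective (zsq x : α ⊕ β → ℝ)) (ν : α)
    (a : α ⊕ β) : HasPd (Sum.inl ν) (lam ν a : (α ⊕ κ → ℝ) → ℝ) (rho ν a x - lam ν a x ^ 2) x := by
  by_cases e : a = Sum.inl ν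
  · subst e
    rw [rho_self, lam_self]
    have : (lam ν (Sum.inl ν : α ⊕ β) : (α ⊕ κ → ℝ) → ℝ) = fun _ => 0 := by
      funext y; exact lam_self ν y
    rw [this]
    exact (hasPd_const 0).congr_val (by ring)
  have h0 := zsq_sub_ne h e
  have h1 := (hasPd_coord (Sum.inl ν) (Sum.inl ν : α ⊕ κ) x).mul ((hasPd_const 2).div
    ((hasPd_zsq ν (Sum.inl ν : α ⊕ β) x).sub (hasPd_zsq ν a x)) h0)
  refine HasPd.congr_val h1 ?_
  simp only [if_true, if_neg e, lam, rho, zsq_inl]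
  field_simp
  ring

theorem hasPd_lam_of_ne {x : α ⊕ κ → ℝ} (h : Function.Injective (zsq x : α ⊕ β → ℝ)) {τ ν : α}
    (e : τ ≠ ν) (a : α ⊕ β) : HasPd (Sum.inl τ) (lam ν a : (α ⊕ κ → ℝ) → ℝ)
      (if a = Sum.inl τ then -(lam ν a x * lam τ (Sum.inl ν : α ⊕ β) x) else 0) x := by
  by_cases e1 : a = Sum.inl ν
  · subst e1
    have : (lam ν (Sum.inl ν : α ⊕ β) : (α ⊕ κ → ℝ) → ℝ) = fun _ => 0 := by
      funext y; exact lam_self ν y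
    rw [this]
    exact (hasPd_const 0).congr_val (by simp)
  have h0 := zsq_sub_ne h e1
  have h1 := (hasPd_coord (Sum.inl τ) (Sum.inl ν : α ⊕ κ) x).mul ((hasPd_const 2).div
    ((hasPd_zsq τ (Sum.inl ν : α ⊕ β) x).sub (hasPd_zsq τ a x)) h0)
  refine HasPd.congr_val h1 ?_
  have e' : ν ≠ τ := Ne.symm e
  by_cases e2 : a = Sum.inl τ
  · subst e2
    rw [if_pos rfl, lam, lam, rho_swap ν τ]
    simp only [Sum.inl.injEq, e', if_false, if_true, rho, zsq_inl] at *
    field_simp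
    ring
  · simp [e2, e']

theorem hasPd_volDer {x : α ⊕ κ → ℝ} (h : Function.Injective (zsq x : α ⊕ β → ℝ)) (ν : α) :
    HasPd (Sum.inl ν) (volDer α β κ ν)
      (∑ σ, (rho ν (Sum.inl σ : α ⊕ β) x - lam ν (Sum.inl σ : α ⊕ β) x ^ 2)
        - 1 / 4 * ∑ b, lam ν (Sum.inr b : α ⊕ β) x ^ 2) x := by
  refine ((HasPd.sum fun σ _ => hasPd_lam h ν _).add (HasPd.sum fun b _ =>
    (hasPd_const 1).div (hasPd_coord (Sum.inl ν) (Sum.inl ν : α ⊕ κ) x)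
      (coord_ne_zero h b ν))).congr_val ?_
  rw [Finset.mul_sum, sub_eq_add_neg _ (∑ b, 1 / 4 * _), ← Finset.sum_neg_distrib]
  congr 1
  refine Finset.sum_congr rfl fun b _ => ?_
  have := coord_ne_zero h b ν
  rw [lam_inr h, if_pos rfl]
  field_simp
  ring

theorem hasPd_volDer_of_ne {x : α ⊕ κ → ℝ} (h : Function.Injective (zsq x : α ⊕ β → ℝ)) {τ ν : α}
    (e : τ ≠ ν) : HasPd (Sum.inl τ) (volDer α β κ ν)
      (-(lam ν (Sum.inl τ : α ⊕ β) x * lam τ (Sum.inl ν : α ⊕ β) x)) x := by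
  refine ((HasPd.sum fun σ _ => hasPd_lam_of_ne h e _).add (HasPd.sum fun b _ =>
    (hasPd_const 1).div (hasPd_coord (Sum.inl τ) (Sum.inl ν : α ⊕ κ) x)
      (coord_ne_zero h b ν))).congr_val ?_
  simp [Ne.symm e]

theorem smoothOn_lam {U : Set (α ⊕ κ → ℝ)}
    (h : ∀ x ∈ U, Function.Injective (zsq x : α ⊕ β → ℝ)) (ν : α) (a : α ⊕ β) :
    SmoothOn U (lam ν a) := by
  by_cases e : a = Sum.inl ν
  · subst e
    exact smoothOn_congr (f := fun _ => 0) contDiffOn_const fun y _ => lam_self ν y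
  have h1 : SmoothOn U fun y : α ⊕ κ → ℝ => zsq y a := by
    rcases a with μ | b
    · exact ContDiff.contDiffOn (ContDiff.pow (by fun_prop) 2)
    · exact contDiffOn_const
  exact ContDiffOn.mul (by fun_prop) (contDiffOn_const.div (ContDiffOn.sub (by fun_prop) h1)
    fun y hy => zsq_sub_ne (h y hy) e)

theorem smoothOn_volDer {U : Set (α ⊕ κ → ℝ)}
    (h : ∀ x ∈ U, Function.Injective (zsq x : α ⊕ β → ℝ)) (ν : α) :
    SmoothOn U (volDer α β κ ν) :=
  (smoothOn_sum fun _ _ => smoothOn_lam h ν _).add (smoothOn_sum fun b _ =>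
    contDiffOn_const.div (by fun_prop) fun y hy => coord_ne_zero (h y hy) b ν)

/-- `G_ij = ∑_a Q_a A_a A_a` -/
def frameG (Q : α ⊕ β → (α ⊕ κ → ℝ) → ℝ) (A : α ⊕ β → κ → (α ⊕ κ → ℝ) → ℝ) (i j : κ)
    (y : α ⊕ κ → ℝ) : ℝ := ∑ a, Q a y * (A a i y * A a j y)

/-- The inverse of `G`. -/
def frameC (Q : α ⊕ β → (α ⊕ κ → ℝ) → ℝ) (E : κ → α ⊕ β → (α ⊕ κ → ℝ) → ℝ) (i j : κ)
    (y : α ⊕ κ → ℝ) : ℝ := ∑ a, E i a y * E j a y / Q a y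

namespace VacuumFrame

variable {U : Set (α ⊕ κ → ℝ)} {Q : α ⊕ β → (α ⊕ κ → ℝ) → ℝ}
    {A : α ⊕ β → κ → (α ⊕ κ → ℝ) → ℝ} {E : κ → α ⊕ β → (α ⊕ κ → ℝ) → ℝ} {x : α ⊕ κ → ℝ}

theorem hasPd_Q (K : VacuumFrame U Q A E) (hx : x ∈ U) (ν : α) (a : α ⊕ β) :
    HasPd (Sum.inl ν) (Q a) ((if a = Sum.inl ν then pd (Sum.inl ν) (Q (Sum.inl ν)) x else 0)
      - lam ν a x * Q a x) x := by
  refine ((K.smooth_Q a).hasPd K.isOpen hx _).congr_val ?_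
  by_cases e : a = Sum.inl ν
  · subst e; simp
  · rw [K.pd_Q x hx ν a e, if_neg e]; ring

theorem hasPd_A (K : VacuumFrame U Q A E) (hx : x ∈ U) (ν : α) (a : α ⊕ β) (k : κ) :
    HasPd (Sum.inl ν) (A a k) (lam ν a x * (A a k x - A (Sum.inl ν) k x)) x :=
  ((K.smooth_A a k).hasPd K.isOpen hx _).congr_val (K.pd_A x hx ν a k)

/-- `dQ_ν - ∑_a λ_νa Q_a`, the derivative of `∑ Q_a`. -/
def sumDer (Q : α ⊕ β → (α ⊕ κ → ℝ) → ℝ) (ν : α) (y : α ⊕ κ → ℝ) : ℝ :=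
  pd (Sum.inl ν) (Q (Sum.inl ν)) y - ∑ a, lam ν a y * Q a y

/-- In the product rule -A_a A_a + (A_a - A_ν) A_a + A_a (A_a - A_ν) equals (A_a - A_ν)(A_a - A_ν) -
A_ν A_ν. The last products are collected into `sumDer`. -/
theorem hasPd_G (K : VacuumFrame U Q A E) (hx : x ∈ U) (ν : α) (i j : κ) :
    HasPd (Sum.inl ν) (frameG Q A i j)
      (∑ a, lam ν a x * Q a x * ((A a i x - A (Sum.inl ν) i x) * (A a j x - A (Sum.inl ν) j x))
        + sumDer Q ν x * (A (Sum.inl ν) i x * A (Sum.inl ν) j x)) x := by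
  refine (HasPd.sum fun a _ => (K.hasPd_Q hx ν a).mul
    ((K.hasPd_A hx ν a i).mul (K.hasPd_A hx ν a j))).congr_val ?_
  have h1 : pd (Sum.inl ν) (Q (Sum.inl ν)) x * (A (Sum.inl ν) i x * A (Sum.inl ν) j x)
      = ∑ a, (if a = Sum.inl ν then pd (Sum.inl ν) (Q (Sum.inl ν)) x else 0)
        * (A a i x * A a j x) := by simp
  rw [sumDer, sub_mul, h1, Finset.sum_mul, ← Finset.sum_sub_distrib, ← Finset.sum_add_distrib]
  exact Finset.sum_congr rfl fun a _ => by ring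

theorem hasPd_pd_G (K : VacuumFrame U Q A E) (hx : x ∈ U) (ν : α) (i j : κ) :
    HasPd (Sum.inl ν) (pd (Sum.inl ν) (frameG Q A i j))
      (∑ a, rho ν a x * Q a x * ((A a i x - A (Sum.inl ν) i x) * (A a j x - A (Sum.inl ν) j x))
        + (pd (Sum.inl ν) (pd (Sum.inl ν) (Q (Sum.inl ν))) x
          - ∑ a, (rho ν a x - 2 * lam ν a x ^ 2) * Q a x)
          * (A (Sum.inl ν) i x * A (Sum.inl ν) j x)) x := by
  have hl := fun a => (hasPd_lam (K.injective x hx) ν a).mul (K.hasPd_Q hx ν a)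
  have hw := fun a k => (K.hasPd_A hx ν a k).sub (K.hasPd_A hx ν (Sum.inl ν) k)
  have hV := (((K.smooth_Q (Sum.inl ν)).pd K.isOpen (Sum.inl ν)).hasPd K.isOpen hx
    (Sum.inl ν)).sub (HasPd.sum fun a (_ : a ∈ Finset.univ) => hl a)
  refine (((HasPd.sum fun a _ => (hl a).mul ((hw a i).mul (hw a j))).add
    (hV.mul ((K.hasPd_A hx ν (Sum.inl ν) i).mul (K.hasPd_A hx ν (Sum.inl ν) j)))).congr_on
      K.isOpen hx fun y hy => (K.hasPd_G hy ν i j).eq).congr_val ?_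
  have h0 : ∀ a : α ⊕ β, lam ν a x * (if a = Sum.inl ν then pd (Sum.inl ν) (Q (Sum.inl ν)) x else 0)
      = 0 := by
    intro a
    split_ifs with e
    · subst e; simp
    · simp
  simp only [lam_self, zero_mul, mul_zero, add_zero, sub_zero, mul_sub, h0, zero_sub]
  congr 1
  · exact Finset.sum_congr rfl fun a _ => by ring
  · congr 2
    exact Finset.sum_congr rfl fun a _ => by ring

/-- Duality of A and E makes the A_a orthogonal for the inverse metric, so contractions become sums
over the single index a. -/
theorem bil_A (K : VacuumFrame U Q A E) (hx : x ∈ U) (a b : α ⊕ β) :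
    bil (fun k l => frameC Q E k l x) (fun k => A a k x) (fun k => A b k x)
      = if a = b then 1 / Q a x else 0 := by
  have h1 : bil (fun k l => frameC Q E k l x) (fun k => A a k x) (fun k => A b k x)
      = ∑ c, (∑ k, A a k x * E k c x) * (∑ l, A b l x * E l c x) / Q c x := by
    simp only [bil, frameC, Finset.mul_sum, Finset.sum_mul, Finset.sum_div]
    conv_rhs => rw [Finset.sum_comm]
    refine (Finset.sum_comm).trans ?_
    refine Finset.sum_congr rfl fun l _ => ?_
    conv_rhs => rw [Finset.sum_comm]
    exact Finset.sum_congr rfl fun k _ => Finset.sum_congr rfl fun c _ => by ring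
  rw [h1]
  simp only [K.dual x hx]
  by_cases e : a = b
  · subst e; simp [-Fintype.sum_sum_type, ite_div]
  · rw [if_neg e]
    refine Finset.sum_eq_zero fun c _ => ?_
    by_cases e1 : a = c
    · subst e1; simp [Ne.symm e]
    · simp [e1]

theorem C_mul (K : VacuumFrame U Q A E) (hx : x ∈ U) (i j : κ) :
    ∑ k, frameC Q E i k x * frameG Q A k j x = if i = j then 1 else 0 := by
  have h1 : ∑ k, frameC Q E i k x * frameG Q A k j x
      = ∑ c, ∑ a, E i c x / Q c x * Q a x * A a j x * ∑ k, A a k x * E k c x := by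
    simp only [frameC, frameG, Finset.mul_sum, Finset.sum_mul]
    rw [Finset.sum_comm]
    conv_lhs => enter [2, a]; rw [Finset.sum_comm]
    rw [Finset.sum_comm]
    exact Finset.sum_congr rfl fun c _ => Finset.sum_congr rfl fun a _ =>
      Finset.sum_congr rfl fun k _ => by ring
  rw [h1, ← K.dual' x hx i j]
  refine Finset.sum_congr rfl fun c _ => ?_
  simp only [K.dual x hx]
  have := (K.Q_pos x hx c).ne'
  simp only [mul_ite, mul_one, mul_zero, Finset.sum_ite_eq', Finset.mem_univ, if_true]
  field_simp

end VacuumFrame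

end VacuumFrames

/-! ### The vacuum equation on the torus, and the traces of C ∂G -/

section VacuumFrames

variable {α β κ : Type} [Fintype α] [DecidableEq α] [Fintype β] [DecidableEq β]
  [Subsingleton β] [Fintype κ] [DecidableEq κ]

namespace VacuumFrame

variable {U : Set (α ⊕ κ → ℝ)} {Q : α ⊕ β → (α ⊕ κ → ℝ) → ℝ}
    {A : α ⊕ β → κ → (α ⊕ κ → ℝ) → ℝ} {E : κ → α ⊕ β → (α ⊕ κ → ℝ) → ℝ} {x : α ⊕ κ → ℝ}

/-- The component of `∂_ν G` along `A_ν`, with the sign changed. -/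
def derY (Q : α ⊕ β → (α ⊕ κ → ℝ) → ℝ) (x : α ⊕ κ → ℝ) (ν : α) (f : α ⊕ β → ℝ) : ℝ :=
  ∑ a, lam ν a x * Q a x * f a - pd (Sum.inl ν) (Q (Sum.inl ν)) x * f (Sum.inl ν)

theorem pd_G_eq (K : VacuumFrame U Q A E) (hx : x ∈ U) (ν : α) (i : κ) :
    (fun j => pd (Sum.inl ν) (frameG Q A i j) x)
      = ∑ a, (lam ν a x * Q a x * (A a i x - A (Sum.inl ν) i x)) • (fun j => A a j x)
        + (-derY Q x ν fun a => A a i x) • fun j => A (Sum.inl ν) j x := by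
  funext j
  simp only [Pi.add_apply, Pi.smul_apply, Finset.sum_apply, smul_eq_mul, (K.hasPd_G hx ν i j).eq,
    derY, sumDer, neg_sub, sub_mul, Finset.sum_mul]
  rw [← sub_eq_zero]
  have h : ∀ a b c d e f : ℝ, a + (b - c) - (d + (e - f)) = (a - c - d + f) + (b - e) := by
    intros; ring
  rw [h, ← Finset.sum_sub_distrib, ← Finset.sum_sub_distrib, ← Finset.sum_add_distrib,
    Finset.sum_eq_zero fun a _ => by ring]
  ring

theorem bil_sum_left (C : κ → κ → ℝ) {X : Type*} (s : Finset X) (f : X → κ → ℝ) (B : κ → ℝ) :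
    bil C (∑ a ∈ s, f a) B = ∑ a ∈ s, bil C (f a) B := by
  classical
  induction s using Finset.induction_on with
  | empty => simp [bil]
  | insert a s ha ih => rw [Finset.sum_insert ha, Finset.sum_insert ha, bil_add_left, ih]

theorem C_symm (i j : κ) (y : α ⊕ κ → ℝ) : frameC Q E i j y = frameC Q E j i y :=
  Finset.sum_congr rfl fun a _ => by rw [mul_comm (E i a y)]

theorem bil_pd_G_A (K : VacuumFrame U Q A E) (hx : x ∈ U) (ν : α) (i : κ) (b : α ⊕ β) :
    bil (fun k l => frameC Q E k l x) (fun j => pd (Sum.inl ν) (frameG Q A i j) x)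
        (fun k => A b k x)
      = lam ν b x * (A b i x - A (Sum.inl ν) i x)
        + if Sum.inl ν = b then -(derY Q x ν fun a => A a i x) / Q b x else 0 := by
  have h0 := (K.Q_pos x hx b).ne'
  rw [K.pd_G_eq hx, bil_add_left, bil_smul_left, bil_sum_left, K.bil_A hx]
  simp only [bil_smul_left, K.bil_A hx, mul_ite, mul_zero, Finset.sum_ite_eq', Finset.mem_univ,
    if_true]
  congr 1
  · field_simp
  · split_ifs with e
    · rw [e]; ring
    · ring

/-- In the orthogonal basis A_a only squares of components survive. The component along A_ν, which
carries ∂Q_ν, is kept apart as `derY`. -/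
theorem bil_pd_G_pd_G (K : VacuumFrame U Q A E) (hx : x ∈ U) (ν : α) (i j : κ) :
    Q (Sum.inl ν) x * bil (fun k l => frameC Q E k l x)
        (fun k => pd (Sum.inl ν) (frameG Q A i k) x) (fun k => pd (Sum.inl ν) (frameG Q A j k) x)
      = ∑ a, Q (Sum.inl ν) x * lam ν a x ^ 2 * Q a x *
          ((A a i x - A (Sum.inl ν) i x) * (A a j x - A (Sum.inl ν) j x))
        + derY Q x ν (fun a => A a i x) * derY Q x ν (fun a => A a j x) := by
  have h0 := (K.Q_pos x hx (Sum.inl ν)).ne'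
  conv_lhs => rw [K.pd_G_eq hx ν i]
  rw [bil_add_left, bil_smul_left, bil_sum_left]
  have h1 : ∀ a, bil (fun k l => frameC Q E k l x) (fun k => A a k x)
      (fun k => pd (Sum.inl ν) (frameG Q A j k) x) = lam ν a x * (A a j x - A (Sum.inl ν) j x)
        + if Sum.inl ν = a then -(derY Q x ν fun a => A a j x) / Q a x else 0 := fun a => by
    rw [bil_comm (fun i j => C_symm i j x), K.bil_pd_G_A hx]
  simp only [bil_smul_left, h1]
  rw [mul_add, Finset.mul_sum]
  congr 1
  · refine Finset.sum_congr rfl fun a _ => ?_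
    by_cases e : Sum.inl ν = a
    · subst e; simp
    · rw [if_neg e]; ring
  · simp
    field_simp

/-- The torus equation is viewed as a bilinear form in the frame components `f` and `g`. The
products f_a g_b with a ≠ b cancel by `sum_lam_mul_lam`; the coefficients of f_a g_a are the two
scalar hypotheses, for base indices and for the extra index. -/
theorem quadratic_identity {dQ ddQ : α → ℝ} {q : α ⊕ β → ℝ}
    (h : Function.Injective (zsq x : α ⊕ β → ℝ))
    (e_inl : ∀ μ : α, volDer α β κ μ x * dQ μ + ddQ μ + ∑ a, lam μ a x ^ 2 * q a
      + ∑ ν, ((dQ ν + volDer α β κ ν x * q (Sum.inl ν)) * lam ν (Sum.inl μ : α ⊕ β) x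
          + q (Sum.inl ν) * rho ν (Sum.inl μ : α ⊕ β) x
          - q (Sum.inl ν) * lam ν (Sum.inl μ : α ⊕ β) x ^ 2)
      - q (Sum.inl μ) * ∑ ν, lam ν (Sum.inl μ : α ⊕ β) x ^ 2 = 0)
    (e_inr : ∀ b : β, ∑ ν, ((dQ ν + volDer α β κ ν x * q (Sum.inl ν))
          * lam ν (Sum.inr b : α ⊕ β) x + q (Sum.inl ν) * rho ν (Sum.inr b : α ⊕ β) x
          - q (Sum.inl ν) * lam ν (Sum.inr b : α ⊕ β) x ^ 2)
      = q (Sum.inr b) * ∑ ν, lam ν (Sum.inr b : α ⊕ β) x ^ 2) (f g : α ⊕ β → ℝ) :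
    ∑ ν, (∑ a, ((dQ ν + volDer α β κ ν x * q (Sum.inl ν)) * lam ν a x + q (Sum.inl ν) * rho ν a x
          - q (Sum.inl ν) * lam ν a x ^ 2) * q a
          * ((f a - f (Sum.inl ν)) * (g a - g (Sum.inl ν)))
        + ((dQ ν + volDer α β κ ν x * q (Sum.inl ν)) * (dQ ν - ∑ a, lam ν a x * q a)
          + q (Sum.inl ν) * (ddQ ν - ∑ a, (rho ν a x - 2 * lam ν a x ^ 2) * q a))
          * (f (Sum.inl ν) * g (Sum.inl ν))
        - (∑ a, lam ν a x * q a * f a - dQ ν * f (Sum.inl ν))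
          * (∑ a, lam ν a x * q a * g a - dQ ν * g (Sum.inl ν))) = 0 := by
  set c : α → α ⊕ β → ℝ := fun ν a => ((dQ ν + volDer α β κ ν x * q (Sum.inl ν)) * lam ν a x
    + q (Sum.inl ν) * rho ν a x - q (Sum.inl ν) * lam ν a x ^ 2) with hc
  have h1 : ∀ ν, (∑ a, c ν a * q a * ((f a - f (Sum.inl ν)) * (g a - g (Sum.inl ν)))
        + ((dQ ν + volDer α β κ ν x * q (Sum.inl ν)) * (dQ ν - ∑ a, lam ν a x * q a)
          + q (Sum.inl ν) * (ddQ ν - ∑ a, (rho ν a x - 2 * lam ν a x ^ 2) * q a))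
          * (f (Sum.inl ν) * g (Sum.inl ν))
        - (∑ a, lam ν a x * q a * f a - dQ ν * f (Sum.inl ν))
          * (∑ a, lam ν a x * q a * g a - dQ ν * g (Sum.inl ν)))
      = ∑ a, c ν a * (q a * (f a * g a))
        + q (Sum.inl ν) * (volDer α β κ ν x * dQ ν + ddQ ν + ∑ a, lam ν a x ^ 2 * q a)
          * (f (Sum.inl ν) * g (Sum.inl ν))
        - ∑ b, wAux β x (Sum.inl ν) b * (q (Sum.inl ν) * f (Sum.inl ν) * (q b * g b)
          + q b * f b * (q (Sum.inl ν) * g (Sum.inl ν)))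
        - ∑ a, ∑ b, lam ν a x * lam ν b x * (q a * f a * (q b * g b)) := by
    intro ν
    have e1 : ∑ a, ∑ b, lam ν a x * lam ν b x * (q a * f a * (q b * g b))
        = (∑ a, lam ν a x * q a * f a) * ∑ a, lam ν a x * q a * g a := by
      rw [Finset.sum_mul_sum]
      exact Finset.sum_congr rfl fun a _ => Finset.sum_congr rfl fun b _ => by ring
    rw [e1]
    set F := f (Sum.inl ν)
    set G := g (Sum.inl ν)
    set q0 := q (Sum.inl ν)
    set D := dQ ν + volDer α β κ ν x * q0
    have e2 : ∑ a, c ν a * q a * ((f a - F) * (g a - G))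
        = ∑ a, c ν a * (q a * (f a * g a))
          - ∑ b, wAux β x (Sum.inl ν) b * (q0 * F * (q b * g b) + q b * f b * (q0 * G))
          - dQ ν * F * (∑ a, lam ν a x * q a * g a) - dQ ν * G * (∑ a, lam ν a x * q a * f a)
          + F * G * (D * ∑ a, lam ν a x * q a
            + q0 * ∑ a, (rho ν a x - 2 * lam ν a x ^ 2) * q a
            + q0 * ∑ a, lam ν a x ^ 2 * q a) := by
      simp only [Finset.mul_sum, ← Finset.sum_add_distrib, ← Finset.sum_sub_distrib]
      refine Finset.sum_congr rfl fun a _ => ?_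
      simp only [hc, wAux, Sum.elim_inl]
      ring
    rw [e2]
    ring
  rw [Finset.sum_congr rfl fun ν _ => h1 ν]
  simp only [Finset.sum_add_distrib, Finset.sum_sub_distrib]
  have h2 : ∑ ν, ∑ a, ∑ b, lam ν a x * lam ν b x * (q a * f a * (q b * g b))
      = ∑ a, (∑ ν, lam ν a x ^ 2) * (q a * f a * (q a * g a))
        - ∑ ν, ∑ b, wAux β x (Sum.inl ν) b * (q (Sum.inl ν) * f (Sum.inl ν) * (q b * g b)
          + q b * f b * (q (Sum.inl ν) * g (Sum.inl ν))) := by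
    have e1 : ∑ ν, ∑ b, wAux β x (Sum.inl ν) b * (q (Sum.inl ν) * f (Sum.inl ν) * (q b * g b)
          + q b * f b * (q (Sum.inl ν) * g (Sum.inl ν)))
        = ∑ a, ∑ b, wAux β x a b * (q a * f a * (q b * g b) + q b * f b * (q a * g a)) := by
      rw [Fintype.sum_sum_type]
      simp [wAux]
    have e2 : ∑ a, ∑ b, wAux β x a b * (q a * f a * (q b * g b) + q b * f b * (q a * g a))
        = ∑ a, ∑ b, (wAux β x a b + wAux β x b a) * (q a * f a * (q b * g b)) := by
      simp only [mul_add, add_mul, Finset.sum_add_distrib]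
      congr 1
      exact Finset.sum_comm
    rw [e1, e2, Finset.sum_comm]
    conv_lhs => enter [2, a]; rw [Finset.sum_comm]
    simp only [← Finset.sum_mul, sum_lam_mul_lam h]
    rw [← Finset.sum_sub_distrib]
    refine Finset.sum_congr rfl fun a _ => ?_
    have e3 : (∑ ν, lam ν a x ^ 2) * (q a * f a * (q a * g a))
        = ∑ b, (if a = b then ∑ ν, lam ν a x ^ 2 else 0) * (q a * f a * (q b * g b)) := by
      simp [-Fintype.sum_sum_type]
    rw [e3, ← Finset.sum_sub_distrib]
    exact Finset.sum_congr rfl fun b _ => by ring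
  rw [h2, Finset.sum_comm]
  simp only [← Finset.sum_mul]
  rw [Fintype.sum_sum_type, Fintype.sum_sum_type]
  have h3 : ∑ b : β, (∑ ν, c ν (Sum.inr b)) * (q (Sum.inr b) * (f (Sum.inr b) * g (Sum.inr b)))
      = ∑ b : β, (∑ ν, lam ν (Sum.inr b : α ⊕ β) x ^ 2)
        * (q (Sum.inr b) * f (Sum.inr b) * (q (Sum.inr b) * g (Sum.inr b))) :=
    Finset.sum_congr rfl fun b _ => by rw [e_inr b]; ring
  have h4 : ∑ μ : α, (∑ ν, c ν (Sum.inl μ)) * (q (Sum.inl μ) * (f (Sum.inl μ) * g (Sum.inl μ)))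
      + ∑ ν, q (Sum.inl ν) * (volDer α β κ ν x * dQ ν + ddQ ν + ∑ a, lam ν a x ^ 2 * q a)
          * (f (Sum.inl ν) * g (Sum.inl ν))
      = ∑ μ : α, (∑ ν, lam ν (Sum.inl μ : α ⊕ β) x ^ 2)
        * (q (Sum.inl μ) * f (Sum.inl μ) * (q (Sum.inl μ) * g (Sum.inl μ))) := by
    rw [← Finset.sum_add_distrib]
    refine Finset.sum_congr rfl fun μ _ => ?_
    linear_combination q (Sum.inl μ) * (f (Sum.inl μ) * g (Sum.inl μ)) * e_inl μ
  rw [h3]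
  linear_combination h4

theorem vacuum_rr (K : VacuumFrame U Q A E) (hx : x ∈ U) (i j : κ) :
    divg (fun μ => Q (Sum.inl μ)) (volDer α β κ) (fun μ => pd (Sum.inl μ) (frameG Q A i j)) x
      = ∑ μ, Q (Sum.inl μ) x * bil (fun k l => frameC Q E k l x)
        (fun k => pd (Sum.inl μ) (frameG Q A i k) x)
        (fun k => pd (Sum.inl μ) (frameG Q A j k) x) := by
  rw [← sub_eq_zero, divg, ← Finset.sum_sub_distrib,
    ← quadratic_identity (K.injective x hx) (K.vacuum_inl x hx) (K.vacuum_inr x hx)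
      (fun a => A a i x) (fun a => A a j x)]
  refine Finset.sum_congr rfl fun ν _ => ?_
  rw [K.bil_pd_G_pd_G hx, (((K.smooth_Q (Sum.inl ν)).hasPd K.isOpen hx _).mul
    (K.hasPd_pd_G hx ν i j)).eq, (K.hasPd_G hx ν i j).eq, sumDer, derY, derY]
  set D := pd (Sum.inl ν) (Q (Sum.inl ν)) x
  set F := A (Sum.inl ν) i x
  set G := A (Sum.inl ν) j x
  have e : ∑ a, ((D + volDer α β κ ν x * Q (Sum.inl ν) x) * lam ν a x + Q (Sum.inl ν) x * rho ν a x
          - Q (Sum.inl ν) x * lam ν a x ^ 2) * Q a x * ((A a i x - F) * (A a j x - G))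
      = (D + volDer α β κ ν x * Q (Sum.inl ν) x) *
          ∑ a, lam ν a x * Q a x * ((A a i x - F) * (A a j x - G))
        + Q (Sum.inl ν) x * ∑ a, rho ν a x * Q a x * ((A a i x - F) * (A a j x - G))
        - ∑ a, Q (Sum.inl ν) x * lam ν a x ^ 2 * Q a x * ((A a i x - F) * (A a j x - G)) := by
    simp only [Finset.mul_sum, ← Finset.sum_add_distrib, ← Finset.sum_sub_distrib]
    exact Finset.sum_congr rfl fun a _ => by ring
  rw [e]
  ring

/-- The contraction of `C X` with `∂_ν G`. -/
theorem sum_C_pd_G (K : VacuumFrame U Q A E) (hx : x ∈ U) (ν : α) (X : κ → κ → ℝ)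
    (hX : ∀ k l, X k l = X l k) :
    ∑ k, ∑ l, X k l * pd (Sum.inl ν) (frameG Q A k l) x
      = ∑ a, lam ν a x * Q a x * (bil X (fun k => A a k x) (fun k => A a k x)
          - 2 * bil X (fun k => A a k x) (fun k => A (Sum.inl ν) k x))
        + pd (Sum.inl ν) (Q (Sum.inl ν)) x
          * bil X (fun k => A (Sum.inl ν) k x) (fun k => A (Sum.inl ν) k x) := by
  have h1 : ∀ a b, bil X (fun k => A a k x) (fun k => A b k x)
      = ∑ k, ∑ l, X k l * (A a k x * A b l x) := fun a b =>
    Finset.sum_congr rfl fun k _ => Finset.sum_congr rfl fun l _ => by ring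
  have h2 : ∀ a, ∑ k, ∑ l, X k l * ((A a k x - A (Sum.inl ν) k x) * (A a l x - A (Sum.inl ν) l x))
      = bil X (fun k => A a k x) (fun k => A a k x)
        - 2 * bil X (fun k => A a k x) (fun k => A (Sum.inl ν) k x)
        + bil X (fun k => A (Sum.inl ν) k x) (fun k => A (Sum.inl ν) k x) := by
    intro a
    have h3 := bil_comm hX (fun k => A a k x) (fun k => A (Sum.inl ν) k x)
    rw [two_mul]
    nth_rw 2 [h3]
    simp only [h1, ← Finset.sum_sub_distrib, ← Finset.sum_add_distrib]
    exact Finset.sum_congr rfl fun k _ => Finset.sum_congr rfl fun l _ => by ring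
  have h4 : ∑ k, ∑ l, X k l * pd (Sum.inl ν) (frameG Q A k l) x
      = ∑ a, lam ν a x * Q a x *
          (∑ k, ∑ l, X k l * ((A a k x - A (Sum.inl ν) k x) * (A a l x - A (Sum.inl ν) l x)))
        + sumDer Q ν x * ∑ k, ∑ l, X k l * (A (Sum.inl ν) k x * A (Sum.inl ν) l x) := by
    simp only [Finset.mul_sum]
    conv_rhs => arg 1; rw [Finset.sum_comm]
    rw [← Finset.sum_add_distrib]
    refine Finset.sum_congr rfl fun k _ => ?_
    conv_rhs => arg 1; rw [Finset.sum_comm]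
    rw [← Finset.sum_add_distrib]
    refine Finset.sum_congr rfl fun l _ => ?_
    rw [(K.hasPd_G hx ν k l).eq, mul_add, Finset.mul_sum]
    congr 1
    · exact Finset.sum_congr rfl fun a _ => by ring
    · ring
  rw [h4]
  simp only [h2, ← h1, sumDer, mul_add, Finset.sum_add_distrib, ← Finset.sum_mul]
  ring

theorem logDer_inv (K : VacuumFrame U Q A E) (hx : x ∈ U) (ν μ : α) :
    logDer (fun μ y => 1 / Q (Sum.inl μ) y) ν μ x = lam ν (Sum.inl μ : α ⊕ β) x
      - if μ = ν then pd (Sum.inl ν) (Q (Sum.inl ν)) x / Q (Sum.inl ν) x else 0 := by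
  have h0 := (K.Q_pos x hx (Sum.inl μ)).ne'
  rw [logDer, ((hasPd_const 1).div (K.hasPd_Q hx ν (Sum.inl μ)) h0).eq]
  by_cases e : μ = ν
  · subst e
    simp only [if_true, lam_self]
    field_simp
    ring
  · have e' : (Sum.inl μ : α ⊕ β) ≠ Sum.inl ν := by simpa using e
    rw [if_neg e, if_neg e']
    field_simp
    ring

/-- The trace of C ∂_μG is Σ_a λ_μa + ∂_μQ_μ/Q_μ, and the last term cancels against the base factor
dx_μ²/Q_μ. Thus the volume derivative does not involve the functions Q_a. -/
theorem vacuum_vol (K : VacuumFrame U Q A E) (hx : x ∈ U) (μ : α) :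
    logVol (fun μ y => 1 / Q (Sum.inl μ) y) (frameG Q A) (frameC Q E) μ x
      = volDer α β κ μ x := by
  have h := K.injective x hx
  have h1 := K.sum_C_pd_G hx μ (fun k l => frameC Q E k l x) fun k l => C_symm k l x
  simp only [K.bil_A hx] at h1
  have h2 : ∀ a, lam μ a x * Q a x * ((if True then 1 / Q a x else 0)
      - 2 * if a = Sum.inl μ then 1 / Q a x else 0) = lam μ a x := by
    intro a
    have := (K.Q_pos x hx a).ne'
    by_cases e : a = Sum.inl μ
    · subst e; simp
    · rw [if_neg e, if_true]; field_simp; ring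
  have h3 : ∑ i, ∑ j, frameC Q E i j x * pd (Sum.inl μ) (frameG Q A j i) x
      = ∑ a : α ⊕ β, lam μ a x + pd (Sum.inl μ) (Q (Sum.inl μ)) x / Q (Sum.inl μ) x := by
    rw [Finset.sum_congr rfl fun a _ => h2 a, if_true, mul_one_div] at h1
    rw [← h1]
    refine Finset.sum_congr rfl fun i _ => Finset.sum_congr rfl fun j _ => ?_
    rw [(K.hasPd_G hx μ i j).eq, (K.hasPd_G hx μ j i).eq]
    congr 2
    · exact Finset.sum_congr rfl fun a _ => by ring
    · ring
  rw [logVol, h3, Finset.sum_congr rfl fun k _ => K.logDer_inv hx μ k, Fintype.sum_sum_type, volDer,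
    Finset.sum_sub_distrib]
  have h4 : ∑ b : β, lam μ (Sum.inr b : α ⊕ β) x = 2 * ∑ _b : β, 1 / x (Sum.inl μ) := by
    rw [Finset.mul_sum]
    exact Finset.sum_congr rfl fun b _ => by rw [lam_inr h]; ring
  rw [h4]
  simp only [Finset.sum_ite_eq', Finset.mem_univ, if_true]
  ring

/-- The contraction of `C ∂_ρ G C` with two of the `A`. -/
theorem bil_C_pd_G_C (K : VacuumFrame U Q A E) (hx : x ∈ U) (ρ : α) (a b : α ⊕ β) :
    bil (fun k l => ∑ c, ∑ d, frameC Q E k c x * pd (Sum.inl ρ) (frameG Q A c d) x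
        * frameC Q E d l x) (fun k => A a k x) (fun k => A b k x)
      = (lam ρ b x * ((if a = b then 1 else 0) - if a = Sum.inl ρ then 1 else 0)
        - (if Sum.inl ρ = b then 1 / Q b x else 0) * (lam ρ a x * Q a x
          - if a = Sum.inl ρ then pd (Sum.inl ρ) (Q (Sum.inl ρ)) x else 0)) / Q a x := by
  have h1 : bil (fun k l => ∑ c, ∑ d, frameC Q E k c x * pd (Sum.inl ρ) (frameG Q A c d) x
        * frameC Q E d l x) (fun k => A a k x) (fun k => A b k x)
      = ∑ c, (∑ k, A a k x * frameC Q E k c x) * bil (fun k l => frameC Q E k l x)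
        (fun j => pd (Sum.inl ρ) (frameG Q A c j) x) (fun k => A b k x) := by
    simp only [bil, Finset.mul_sum, Finset.sum_mul]
    conv_lhs => enter [2, k]; rw [Finset.sum_comm]
    rw [Finset.sum_comm]
    refine Finset.sum_congr rfl fun c _ => ?_
    conv_lhs => enter [2, k]; rw [Finset.sum_comm]
    conv_rhs => enter [2, d]; rw [Finset.sum_comm]
    rw [Finset.sum_comm]
    exact Finset.sum_congr rfl fun d _ => Finset.sum_congr rfl fun k _ =>
      Finset.sum_congr rfl fun l _ => by ring
  have h2 : ∀ c, ∑ k, A a k x * frameC Q E k c x = E c a x / Q a x := by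
    intro c
    simp only [frameC, Finset.mul_sum]
    rw [Finset.sum_comm]
    have : ∀ d, ∑ k, A a k x * (E k d x * E c d x / Q d x)
        = (if a = d then 1 else 0) * (E c d x / Q d x) := fun d => by
      rw [← K.dual x hx, Finset.sum_mul]
      exact Finset.sum_congr rfl fun k _ => by ring
    simp only [this]
    simp [-Fintype.sum_sum_type]
  have h3 : ∀ a b, ∑ c, E c a x * A b c x = if a = b then 1 else 0 := fun a b => by
    rw [Finset.sum_congr rfl fun c _ => mul_comm (E c a x) _, K.dual x hx]
    simp only [eq_comm]
  rw [h1]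
  have h4 : ∀ c, (∑ k, A a k x * frameC Q E k c x) * bil (fun k l => frameC Q E k l x)
        (fun j => pd (Sum.inl ρ) (frameG Q A c j) x) (fun k => A b k x)
      = (lam ρ b x * (E c a x * A b c x - E c a x * A (Sum.inl ρ) c x)
        - (if Sum.inl ρ = b then 1 / Q b x else 0) * (∑ d, lam ρ d x * Q d x * (E c a x * A d c x)
          - pd (Sum.inl ρ) (Q (Sum.inl ρ)) x * (E c a x * A (Sum.inl ρ) c x))) / Q a x := by
    intro c
    have e1 : ∑ d, lam ρ d x * Q d x * (E c a x * A d c x)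
        = E c a x * ∑ d, lam ρ d x * Q d x * A d c x := by
      rw [Finset.mul_sum]; exact Finset.sum_congr rfl fun d _ => by ring
    rw [h2, K.bil_pd_G_A hx, derY, e1]
    split_ifs <;> ring
  simp only [h4]
  rw [← Finset.sum_div, Finset.sum_sub_distrib, ← Finset.mul_sum, ← Finset.mul_sum,
    Finset.sum_sub_distrib, Finset.sum_sub_distrib, ← Finset.mul_sum, Finset.sum_comm]
  simp only [← Finset.mul_sum, h3]
  simp [-Fintype.sum_sum_type]

/-- The symmetric matrix X = C ∂_ρG C is contracted with ∂_νG by `sum_C_pd_G`; its values on the A_a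
are those of `bil_C_pd_G_C`. -/
theorem trace_pd_G (K : VacuumFrame U Q A E) (hx : x ∈ U) (ν ρ : α) :
    ∑ k, ∑ l, (∑ a, frameC Q E k a x * pd (Sum.inl ρ) (frameG Q A a l) x)
        * (∑ b, frameC Q E l b x * pd (Sum.inl ν) (frameG Q A b k) x)
      = ∑ a : α ⊕ β, lam ν a x * lam ρ a x
        + if ν = ρ then (pd (Sum.inl ν) (Q (Sum.inl ν)) x / Q (Sum.inl ν) x) ^ 2
            + 2 * ∑ a, lam ν a x ^ 2 * Q a x / Q (Sum.inl ν) x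
          else lam ν (Sum.inl ρ : α ⊕ β) x * (pd (Sum.inl ρ) (Q (Sum.inl ρ)) x / Q (Sum.inl ρ) x)
            + lam ρ (Sum.inl ν : α ⊕ β) x * (pd (Sum.inl ν) (Q (Sum.inl ν)) x / Q (Sum.inl ν) x)
            + 2 * (lam ν (Sum.inl ρ : α ⊕ β) x * lam ρ (Sum.inl ν : α ⊕ β) x) := by
  have hG : ∀ τ k l, pd (Sum.inl τ) (frameG Q A k l) x = pd (Sum.inl τ) (frameG Q A l k) x := by
    intro τ k l
    have : frameG Q A k l = frameG Q A l k := by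
      funext y
      exact Finset.sum_congr rfl fun a _ => by ring
    rw [this]
  have h1 := K.sum_C_pd_G hx ν (fun k l => ∑ c, ∑ d, frameC Q E k c x
    * pd (Sum.inl ρ) (frameG Q A c d) x * frameC Q E d l x) fun k l => by
      rw [Finset.sum_comm]
      refine Finset.sum_congr rfl fun c _ => Finset.sum_congr rfl fun d _ => ?_
      rw [hG ρ d c, C_symm k d, C_symm c l]
      ring
  have h2 : ∑ k, ∑ l, (∑ a, frameC Q E k a x * pd (Sum.inl ρ) (frameG Q A a l) x)
        * (∑ b, frameC Q E l b x * pd (Sum.inl ν) (frameG Q A b k) x)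
      = ∑ k, ∑ l, (∑ c, ∑ d, frameC Q E k c x
        * pd (Sum.inl ρ) (frameG Q A c d) x * frameC Q E d l x)
        * pd (Sum.inl ν) (frameG Q A k l) x := by
    simp only [Finset.mul_sum, Finset.sum_mul]
    refine Finset.sum_congr rfl fun k _ => ?_
    rw [Finset.sum_comm]
    refine Finset.sum_congr rfl fun l _ => ?_
    rw [Finset.sum_comm]
    refine Finset.sum_congr rfl fun c _ => Finset.sum_congr rfl fun d _ => ?_
    rw [hG ν l k]
    ring
  rw [h2, h1]
  simp only [K.bil_C_pd_G_C hx]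
  have hQ := fun a => (K.Q_pos x hx a).ne'
  by_cases e : ν = ρ
  · subst e
    simp only [if_true]
    rw [← add_assoc, add_right_comm]
    congr 1
    · rw [Finset.mul_sum, ← Finset.sum_add_distrib]
      refine Finset.sum_congr rfl fun a _ => ?_
      have := hQ a
      have := hQ (Sum.inl ν)
      by_cases e : a = Sum.inl ν
      · subst e; simp
      · simp only [if_neg e, if_neg (Ne.symm e), if_true]
        field_simp
        ring
    · have := hQ (Sum.inl ν)
      simp only [if_true, lam_self]
      field_simp
      ring
  · rw [if_neg e]
    have h3 : ∀ a, lam ν a x * Q a x *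
        ((lam ρ a x * ((if True then 1 else 0) - if a = Sum.inl ρ then 1 else 0)
          - (if Sum.inl ρ = a then 1 / Q a x else 0) * (lam ρ a x * Q a x
            - if a = Sum.inl ρ then pd (Sum.inl ρ) (Q (Sum.inl ρ)) x else 0)) / Q a x
        - 2 * ((lam ρ (Sum.inl ν : α ⊕ β) x * ((if a = Sum.inl ν then 1 else 0)
            - if a = Sum.inl ρ then 1 else 0)
          - (if Sum.inl ρ = (Sum.inl ν : α ⊕ β) then 1 / Q (Sum.inl ν) x else 0)
            * (lam ρ a x * Q a x
            - if a = Sum.inl ρ then pd (Sum.inl ρ) (Q (Sum.inl ρ)) x else 0)) / Q a x))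
        = lam ν a x * lam ρ a x + if a = Sum.inl ρ then lam ν a x
          * (pd (Sum.inl ρ) (Q (Sum.inl ρ)) x / Q (Sum.inl ρ) x)
          + 2 * (lam ν a x * lam ρ (Sum.inl ν : α ⊕ β) x) else 0 := by
      intro a
      have := hQ a
      have e' : (Sum.inl ρ : α ⊕ β) ≠ Sum.inl ν := by simpa using Ne.symm e
      simp only [if_neg e', zero_mul, sub_zero, if_true]
      by_cases e1 : a = Sum.inl ρ
      · subst e1
        simp only [if_true, if_neg e', lam_self]
        field_simp
        ring
      · simp only [if_neg e1, if_neg (Ne.symm e1), zero_mul, sub_zero, mul_one, add_zero]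
        by_cases e2 : a = Sum.inl ν
        · subst e2; simp
        · rw [if_neg e2]; field_simp; ring
    rw [Finset.sum_congr rfl fun a _ => h3 a, Finset.sum_add_distrib, Finset.sum_ite_eq',
      if_pos (Finset.mem_univ _)]
    have e1 : (Sum.inl ν : α ⊕ β) ≠ Sum.inl ρ := by simpa using e
    simp only [if_neg e1, if_neg e1.symm, if_true, zero_mul, sub_zero, mul_one]
    ring

end VacuumFrame

end VacuumFrames

/-! ### The vacuum equation on the base -/

section VacuumFrames

variable {α β κ : Type} [Fintype α] [DecidableEq α] [Fintype β] [DecidableEq β]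
  [Subsingleton β] [Fintype κ] [DecidableEq κ]

namespace VacuumFrame

variable {U : Set (α ⊕ κ → ℝ)} {Q : α ⊕ β → (α ⊕ κ → ℝ) → ℝ}
    {A : α ⊕ β → κ → (α ⊕ κ → ℝ) → ℝ} {E : κ → α ⊕ β → (α ⊕ κ → ℝ) → ℝ} {x : α ⊕ κ → ℝ}

theorem hasPd_logDer_of_ne (K : VacuumFrame U Q A E) (hx : x ∈ U) {ν ρ : α} (e : ρ ≠ ν) :
    HasPd (Sum.inl ρ) (logDer (fun μ y => 1 / Q (Sum.inl μ) y) ν ρ)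
      (-(lam ν (Sum.inl ρ : α ⊕ β) x * lam ρ (Sum.inl ν : α ⊕ β) x)) x :=
  ((hasPd_lam_of_ne (K.injective x hx) e (Sum.inl ρ)).congr_on K.isOpen hx fun y hy => by
    rw [K.logDer_inv hy, if_neg e, sub_zero]).congr_val (by rw [if_pos rfl])

theorem hasPd_logDer (K : VacuumFrame U Q A E) (hx : x ∈ U) (ν : α) :
    HasPd (Sum.inl ν) (logDer (fun μ y => 1 / Q (Sum.inl μ) y) ν ν)
      ((pd (Sum.inl ν) (Q (Sum.inl ν)) x / Q (Sum.inl ν) x) ^ 2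
        - pd (Sum.inl ν) (pd (Sum.inl ν) (Q (Sum.inl ν))) x / Q (Sum.inl ν) x) x := by
  have h0 := (K.Q_pos x hx (Sum.inl ν)).ne'
  refine (((((K.smooth_Q (Sum.inl ν)).pd K.isOpen (Sum.inl ν)).hasPd K.isOpen hx (Sum.inl ν)).div
    ((K.smooth_Q (Sum.inl ν)).hasPd K.isOpen hx (Sum.inl ν)) h0).neg.congr_on K.isOpen hx
      fun y hy => by rw [K.logDer_inv hy, if_pos rfl, lam_self, zero_sub]).congr_val ?_
  field_simp
  ring

theorem hasPd_mul_logDer (K : VacuumFrame U Q A E) (hx : x ∈ U) {ν k : α} (e : ν ≠ k) :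
    HasPd (Sum.inl k) (fun y => 1 / Q (Sum.inl ν) y / (1 / Q (Sum.inl k) y)
        * logDer (fun μ y => 1 / Q (Sum.inl μ) y) k ν y)
      ((pd (Sum.inl k) (Q (Sum.inl k)) x * lam k (Sum.inl ν : α ⊕ β) x
        + Q (Sum.inl k) x * rho k (Sum.inl ν : α ⊕ β) x) / Q (Sum.inl ν) x) x := by
  have h0 := (K.Q_pos x hx (Sum.inl ν)).ne'
  refine (((((K.smooth_Q (Sum.inl k)).hasPd K.isOpen hx (Sum.inl k)).mul
    (hasPd_lam (K.injective x hx) k (Sum.inl ν))).div (K.hasPd_Q hx k (Sum.inl ν)) h0).congr_on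
    K.isOpen hx fun y hy => ?_).congr_val ?_
  · have h1 := (K.Q_pos y hy (Sum.inl ν)).ne'
    have h2 := (K.Q_pos y hy (Sum.inl k)).ne'
    rw [K.logDer_inv hy, if_neg e, sub_zero]
    field_simp
  · have e' : (Sum.inl ν : α ⊕ β) ≠ Sum.inl k := by simpa using e
    rw [if_neg e']
    field_simp
    ring

/-- Off the diagonal all derivatives of the Q_a cancel. The remainder is an identity between the λ,
a consequence of `lam_mul_lam_off`; the scalar vacuum equations play no part. -/
theorem vacuum_ll_of_ne (K : VacuumFrame U Q A E) (hx : x ∈ U) {ν ρ : α} (e : ν ≠ ρ) :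
    baseRicci (fun μ => Q (Sum.inl μ)) (volDer α β κ) ν ρ x
      = 1 / 4 * ∑ k, ∑ l, (∑ a, frameC Q E k a x * pd (Sum.inl ρ) (frameG Q A a l) x)
        * (∑ b, frameC Q E l b x * pd (Sum.inl ν) (frameG Q A b k) x) := by
  have h := K.injective x hx
  rw [K.trace_pd_G hx, if_neg e]
  simp only [baseRicci]
  rw [if_neg e, (K.hasPd_logDer_of_ne hx e.symm).eq, (K.hasPd_logDer_of_ne hx e).eq,
    (hasPd_volDer_of_ne h e.symm).eq]
  simp only [K.logDer_inv hx, if_neg e, if_neg e.symm, sub_zero]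
  set lνρ := lam ν (Sum.inl ρ : α ⊕ β) x with hνρ
  set lρν := lam ρ (Sum.inl ν : α ⊕ β) x with hρν
  set dν := pd (Sum.inl ν) (Q (Sum.inl ν)) x / Q (Sum.inl ν) x
  set dρ := pd (Sum.inl ρ) (Q (Sum.inl ρ)) x / Q (Sum.inl ρ) x
  have h1 : ∑ k, (lam ρ (Sum.inl k : α ⊕ β) x - if k = ρ then dρ else 0)
        * (lam ν (Sum.inl k : α ⊕ β) x - if k = ν then dν else 0)
      = ∑ k, lam ν (Sum.inl k : α ⊕ β) x * lam ρ (Sum.inl k : α ⊕ β) x - dρ * lνρ - dν * lρν := by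
    have e1 : dρ * lνρ = ∑ k, if k = ρ then dρ * lam ν (Sum.inl k : α ⊕ β) x else 0 := by simp [hνρ]
    have e2 : dν * lρν = ∑ k, if k = ν then dν * lam ρ (Sum.inl k : α ⊕ β) x else 0 := by simp [hρν]
    rw [e1, e2, ← Finset.sum_sub_distrib, ← Finset.sum_sub_distrib]
    refine Finset.sum_congr rfl fun k _ => ?_
    by_cases h1 : k = ρ
    · subst h1; rw [if_pos rfl, if_neg (Ne.symm e)]; simp [Ne.symm e]
    · rw [if_neg h1, if_neg h1]
      by_cases h2 : k = ν
      · subst h2; simp; ring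
      · rw [if_neg h2, if_neg h2]; ring
  have h2 : volDer α β κ ρ x * lνρ + volDer α β κ ν x * lρν
      = ∑ k, lam ν (Sum.inl k : α ⊕ β) x * lam ρ (Sum.inl k : α ⊕ β) x + 2 * (lνρ * lρν)
        + 1 / 2 * ∑ b, lam ν (Sum.inr b : α ⊕ β) x * lam ρ (Sum.inr b : α ⊕ β) x := by
    have e1 : 2 * (lνρ * lρν) = ∑ k, ((if k = ρ then lνρ * lρν else 0)
        + if k = ν then lνρ * lρν else 0) := by
      simp [Finset.sum_add_distrib]
      ring
    have e3 : ∑ _b : β, 1 / x (Sum.inl ρ) * lνρ + ∑ _b : β, 1 / x (Sum.inl ν) * lρν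
        = 1 / 2 * ∑ b, lam ν (Sum.inr b : α ⊕ β) x * lam ρ (Sum.inr b : α ⊕ β) x := by
      rw [Finset.mul_sum, ← Finset.sum_add_distrib]
      refine Finset.sum_congr rfl fun b _ => ?_
      have h1 := coord_ne_zero h b ρ
      have h2 := coord_ne_zero h b ν
      have h3 := zsq_sub_ne h (ν := ν) (a := Sum.inl ρ) (by simpa using e.symm)
      rw [lam_inr h, lam_inr h, hνρ, hρν, lam, lam, rho_swap ν ρ]
      simp only [rho, zsq_inl] at *
      field_simp
      ring
    have e4 : ∑ σ, lam ρ (Sum.inl σ : α ⊕ β) x * lνρ + ∑ σ, lam ν (Sum.inl σ : α ⊕ β) x * lρν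
        = ∑ k, lam ν (Sum.inl k : α ⊕ β) x * lam ρ (Sum.inl k : α ⊕ β) x + 2 * (lνρ * lρν) := by
      rw [e1, ← Finset.sum_add_distrib, ← Finset.sum_add_distrib]
      refine Finset.sum_congr rfl fun k _ => ?_
      by_cases h1 : k = ρ
      · subst h1; rw [if_pos rfl, if_neg (Ne.symm e)]; simp [hρν, hνρ, mul_comm]
      · rw [if_neg h1]
        by_cases h2 : k = ν
        · subst h2; simp [hρν, hνρ, mul_comm]
        · rw [if_neg h2]
          linear_combination lam_mul_lam_off h e h2 h1
    rw [← e3, ← e4]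
    simp only [volDer, add_mul, Finset.sum_mul]
    ring
  rw [h1, Fintype.sum_sum_type]
  linear_combination 1 / 2 * h2

/-- The diagonal component is a multiple of `vacuum_inl`, once `lam_sq_sub` has been used to trade
λ_kν² for λ_νk². -/
theorem vacuum_ll_self (K : VacuumFrame U Q A E) (hx : x ∈ U) (ν : α) :
    baseRicci (fun μ => Q (Sum.inl μ)) (volDer α β κ) ν ν x
      = 1 / 4 * ∑ k, ∑ l, (∑ a, frameC Q E k a x * pd (Sum.inl ν) (frameG Q A a l) x)
        * (∑ b, frameC Q E l b x * pd (Sum.inl ν) (frameG Q A b k) x) := by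
  have h := K.injective x hx
  have hQ := fun a => (K.Q_pos x hx a).ne'
  have h0 := hQ (Sum.inl ν)
  rw [K.trace_pd_G hx, if_pos rfl]
  simp only [baseRicci, if_true]
  rw [(K.hasPd_logDer hx ν).eq, (hasPd_volDer h ν).eq]
  -- The generic formulas hold for `k ≠ ν`; the term `k = ν`, in which ∂Q_ν appears, is corrected by
  -- hand.
  have hs : ∀ f f' : α → ℝ, (∀ k, k ≠ ν → f k = f' k) → ∑ k, f k = ∑ k, f' k - f' ν + f ν := by
    intro f f' h
    rw [← Finset.add_sum_erase _ f (Finset.mem_univ ν),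
      ← Finset.add_sum_erase _ f' (Finset.mem_univ ν),
      Finset.sum_congr rfl fun k hk => h k (Finset.ne_of_mem_erase hk)]
    ring
  have h1 : ∑ k, pd (Sum.inl k) (fun y => 1 / Q (Sum.inl ν) y / (1 / Q (Sum.inl k) y)
        * logDer (fun μ y => 1 / Q (Sum.inl μ) y) k ν y) x
      = ∑ k, (pd (Sum.inl k) (Q (Sum.inl k)) x * lam k (Sum.inl ν : α ⊕ β) x
        + Q (Sum.inl k) x * rho k (Sum.inl ν : α ⊕ β) x) / Q (Sum.inl ν) x
        + ((pd (Sum.inl ν) (Q (Sum.inl ν)) x / Q (Sum.inl ν) x) ^ 2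
        - pd (Sum.inl ν) (pd (Sum.inl ν) (Q (Sum.inl ν))) x / Q (Sum.inl ν) x) := by
    rw [hs _ _ fun k hk => (K.hasPd_mul_logDer hx hk.symm).eq]
    have e : pd (Sum.inl ν) (fun y => 1 / Q (Sum.inl ν) y / (1 / Q (Sum.inl ν) y)
        * logDer (fun μ y => 1 / Q (Sum.inl μ) y) ν ν y) x = _ :=
      ((K.hasPd_logDer hx ν).congr_on K.isOpen hx fun y hy => by
        have := (K.Q_pos y hy (Sum.inl ν)).ne'
        field_simp).eq
    rw [e]
    simp
  have h2 : ∑ k, volDer α β κ k x * (1 / Q (Sum.inl ν) x / (1 / Q (Sum.inl k) x)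
        * logDer (fun μ y => 1 / Q (Sum.inl μ) y) k ν x)
      = ∑ k, volDer α β κ k x * (Q (Sum.inl k) x * lam k (Sum.inl ν : α ⊕ β) x)
          / Q (Sum.inl ν) x
        - volDer α β κ ν x * (pd (Sum.inl ν) (Q (Sum.inl ν)) x / Q (Sum.inl ν) x) := by
    rw [hs _ (fun k => volDer α β κ k x * (Q (Sum.inl k) x * lam k (Sum.inl ν : α ⊕ β) x)
          / Q (Sum.inl ν) x) fun k hk => by
      have := hQ (Sum.inl k)
      rw [K.logDer_inv hx, if_neg hk.symm]
      field_simp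
      ring]
    rw [K.logDer_inv hx, if_pos rfl, lam_self]
    field_simp
    ring
  have h3 : ∑ k, 1 / Q (Sum.inl ν) x / (1 / Q (Sum.inl k) x)
        * logDer (fun μ y => 1 / Q (Sum.inl μ) y) k ν x ^ 2
      = ∑ k, Q (Sum.inl k) x * lam k (Sum.inl ν : α ⊕ β) x ^ 2 / Q (Sum.inl ν) x
        + (pd (Sum.inl ν) (Q (Sum.inl ν)) x / Q (Sum.inl ν) x) ^ 2 := by
    rw [hs _ (fun k => Q (Sum.inl k) x * lam k (Sum.inl ν : α ⊕ β) x ^ 2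
          / Q (Sum.inl ν) x) fun k hk => by
      have := hQ (Sum.inl k)
      rw [K.logDer_inv hx, if_neg hk.symm]
      field_simp
      ring]
    rw [K.logDer_inv hx, if_pos rfl, lam_self]
    field_simp
    ring
  have h4 : ∑ k, logDer (fun μ y => 1 / Q (Sum.inl μ) y) ν k x
        * logDer (fun μ y => 1 / Q (Sum.inl μ) y) ν k x
      = ∑ k, lam ν (Sum.inl k : α ⊕ β) x ^ 2
        + (pd (Sum.inl ν) (Q (Sum.inl ν)) x / Q (Sum.inl ν) x) ^ 2 := by
    rw [hs _ (fun k => lam ν (Sum.inl k : α ⊕ β) x ^ 2) fun k hk => by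
      rw [K.logDer_inv hx, if_neg hk]
      ring]
    rw [K.logDer_inv hx, if_pos rfl, lam_self]
    ring
  rw [h1, h2, h3, h4, K.logDer_inv hx, if_pos rfl, lam_self]
  have h5 : ∑ k, lam k (Sum.inl ν : α ⊕ β) x ^ 2
      = ∑ k, lam ν (Sum.inl k : α ⊕ β) x ^ 2 - 2 * ∑ k, rho ν (Sum.inl k : α ⊕ β) x := by
    rw [Finset.mul_sum, ← Finset.sum_sub_distrib]
    exact Finset.sum_congr rfl fun k _ => by linear_combination -lam_sq_sub h ν k
  have h6 := K.vacuum_inl x hx ν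
  rw [h5] at h6
  have h7 : ∑ k, ((pd (Sum.inl k) (Q (Sum.inl k)) x + volDer α β κ k x * Q (Sum.inl k) x)
          * lam k (Sum.inl ν : α ⊕ β) x + Q (Sum.inl k) x * rho k (Sum.inl ν : α ⊕ β) x
          - Q (Sum.inl k) x * lam k (Sum.inl ν : α ⊕ β) x ^ 2)
      = ∑ k, (pd (Sum.inl k) (Q (Sum.inl k)) x * lam k (Sum.inl ν : α ⊕ β) x
        + Q (Sum.inl k) x * rho k (Sum.inl ν : α ⊕ β) x)
        + ∑ k, volDer α β κ k x * (Q (Sum.inl k) x * lam k (Sum.inl ν : α ⊕ β) x)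
        - ∑ k, Q (Sum.inl k) x * lam k (Sum.inl ν : α ⊕ β) x ^ 2 := by
    rw [← Finset.sum_add_distrib, ← Finset.sum_sub_distrib]
    exact Finset.sum_congr rfl fun k _ => by ring
  have h8 : ∑ a : α ⊕ β, lam ν a x * lam ν a x = ∑ k, lam ν (Sum.inl k : α ⊕ β) x ^ 2
      + ∑ b, lam ν (Sum.inr b : α ⊕ β) x ^ 2 := by
    rw [Fintype.sum_sum_type]
    simp only [sq]
  rw [h7] at h6
  rw [h8, Finset.sum_sub_distrib]
  simp only [← Finset.sum_div]
  generalize ∑ k, volDer α β κ k x * (Q (Sum.inl k) x * lam k (Sum.inl ν : α ⊕ β) x) = S at h6 ⊢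
  field_simp
  linear_combination -4 * Q (Sum.inl ν) x * h6

/-- As A_a has o-component 1, the differences A_a - A_μ have no o-component. Hence ∂_μv is a
multiple of A_μ and ∂_μV is the same multiple of 1, which converts the assumption on ∂u into the
form used for charging. -/
theorem chargedVacuum (K : VacuumFrame U Q A E) {o : κ} (hA : ∀ a y, y ∈ U → A a o y = 1)
    {u : κ → (α ⊕ κ → ℝ) → ℝ} {Φ : (α ⊕ κ → ℝ) → ℝ} {a q : ℝ}
    (smooth_u : ∀ i, SmoothOn U (u i)) (smooth_Phi : SmoothOn U Φ) (basic_u : ∀ i, IsBasic (u i))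
    (basic_Phi : IsBasic Φ) (Phi_pos : ∀ x ∈ U, 0 < Φ x)
    (Phi_eq : ∀ x ∈ U, Φ x = a * (∑ b, Q b x + q ^ 2))
    (u_eq : ∀ x ∈ U, u o x = 1 - 1 / Φ x)
    (pd_u : ∀ x ∈ U, ∀ μ i, pd (Sum.inl μ) (u i) x
      = pd (Sum.inl μ) Φ x / Φ x * (A (Sum.inl μ) i x - u i x)) :
    ChargedVacuum U (fun μ => Q (Sum.inl μ)) (volDer α β κ) (frameG Q A) (frameC Q E) o u Φ a q := by
  have hG : ∀ y ∈ U, frameG Q A o o y = ∑ b, Q b y := fun y hy =>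
    Finset.sum_congr rfl fun b _ => by rw [hA b y hy]; ring
  have hpdG : ∀ x ∈ U, ∀ μ i, pd (Sum.inl μ) (frameG Q A i o) x
      = sumDer Q μ x * A (Sum.inl μ) i x := fun x hx μ i => by
    rw [(K.hasPd_G hx μ i o).eq]
    simp only [hA _ x hx, sub_self, mul_zero, Finset.sum_const_zero, mul_one, zero_add]
  have hpdPhi : ∀ x ∈ U, ∀ μ, pd (Sum.inl μ) Φ x = a * sumDer Q μ x := fun x hx μ => by
    have h1 := ((K.hasPd_G hx μ o o).add (hasPd_const (q ^ 2))).const_mul a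
    rw [(h1.congr_on K.isOpen hx fun y hy => by rw [Phi_eq y hy, hG y hy]).eq,
      ← (K.hasPd_G hx μ o o).eq, hpdG x hx, hA _ x hx]
    ring
  exact
  { isOpen := K.isOpen
    smooth_Q := fun μ => K.smooth_Q _
    smooth_t := smoothOn_volDer K.injective
    smooth_G := fun i j => smoothOn_sum fun a _ =>
      (K.smooth_Q a).mul ((K.smooth_A a i).mul (K.smooth_A a j))
    smooth_C := fun i j => smoothOn_sum fun a _ =>
      ((K.smooth_E i a).mul (K.smooth_E j a)).div (K.smooth_Q a) fun y hy => (K.Q_pos y hy a).ne'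
    smooth_u := smooth_u
    smooth_Phi := smooth_Phi
    basic_Q := fun μ => K.basic_Q _
    basic_G := fun i j => IsBasic.sum fun a _ =>
      (K.basic_Q a).mul ((K.basic_A a i).mul (K.basic_A a j))
    basic_C := fun i j => IsBasic.sum fun a _ =>
      ((K.basic_E i a).mul (K.basic_E j a)).div (K.basic_Q a)
    basic_u := basic_u
    basic_Phi := basic_Phi
    Q_pos := fun x hx μ => K.Q_pos x hx _
    G_symm := fun x hx i j => Finset.sum_congr rfl fun a _ => by ring
    C_symm := fun x hx i j => C_symm i j x
    C_mul := fun x hx => K.C_mul hx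
    vacuum_rr := fun x hx => K.vacuum_rr hx
    vacuum_ll := fun x hx ν ρ => by
      by_cases e : ν = ρ
      · subst e; exact K.vacuum_ll_self hx ν
      · exact K.vacuum_ll_of_ne hx e
    vacuum_vol := fun x hx => K.vacuum_vol hx
    Phi_pos := Phi_pos
    Phi_eq := fun x hx => by rw [Phi_eq x hx, hG x hx]
    u_eq := u_eq
    pd_u := fun x hx μ i => by
      rw [pd_u x hx, hpdPhi x hx, hpdG x hx, hpdG x hx, hA _ x hx]
      ring }

end VacuumFrame

end VacuumFrames

/-! ### Elementary symmetric polynomials and Lagrange interpolation -/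

section Interpolation

variable {I : Type} [Fintype I] [DecidableEq I]

/-- The elementary symmetric polynomials of the `z b`, `b ∈ S`. -/
def esym (z : I → ℝ) (S : Finset I) (k : ℕ) : ℝ := ∑ s ∈ S.powersetCard k, ∏ b ∈ s, z b

/-- `∏_{b ≠ a} (z_a - z_b)` -/
def vand (z : I → ℝ) (a : I) : ℝ := ∏ b ∈ Finset.univ.erase a, (z a - z b)

theorem vand_ne_zero {z : I → ℝ} (h : Function.Injective z) (a : I) : vand z a ≠ 0 :=
  Finset.prod_ne_zero_iff.mpr fun _ hb =>
    sub_ne_zero.mpr fun e => (Finset.ne_of_mem_erase hb).symm (h e)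

theorem esym_zero (z : I → ℝ) (S : Finset I) : esym z S 0 = 1 := by simp [esym]

theorem esym_insert {z : I → ℝ} {S : Finset I} {a : I} (ha : a ∉ S) (k : ℕ) :
    esym z (insert a S) (k + 1) = esym z S (k + 1) + z a * esym z S k := by
  have h1 : ∀ s ∈ S.powersetCard k, a ∉ s := fun s hs h => ha ((Finset.mem_powersetCard.mp hs).1 h)
  unfold esym
  rw [Finset.powersetCard_succ_insert ha, Finset.sum_union]
  · congr 1
    rw [Finset.sum_image, Finset.mul_sum]
    · exact Finset.sum_congr rfl fun s hs => by rw [Finset.prod_insert (h1 s hs)]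
    · intro s hs t ht e
      rw [← Finset.erase_insert (h1 s hs), e, Finset.erase_insert (h1 t ht)]
  · rw [Finset.disjoint_left]
    intro s hs ht
    obtain ⟨t, -, rfl⟩ := Finset.mem_image.mp ht
    exact ha ((Finset.mem_powersetCard.mp hs).1 (Finset.mem_insert_self _ _))

theorem sum_esym_mul_pow (z : I → ℝ) (S : Finset I) (t : ℝ) :
    ∑ k ∈ Finset.range (S.card + 1), (-1) ^ k * esym z S k * t ^ (S.card - k)
      = ∏ b ∈ S, (t - z b) := by
  have h1 : ∏ b ∈ S, (t - z b) = ∏ b ∈ S, (-1 * z b + t) :=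
    Finset.prod_congr rfl fun b _ => by ring
  rw [h1, Finset.prod_add, Finset.sum_powerset]
  refine Finset.sum_congr rfl fun k _ => ?_
  rw [esym, Finset.mul_sum, Finset.sum_mul]
  refine Finset.sum_congr rfl fun s hs => ?_
  obtain ⟨h2, h3⟩ := Finset.mem_powersetCard.mp hs
  rw [Finset.prod_mul_distrib, Finset.prod_const, Finset.prod_const, Finset.card_sdiff_of_subset h2,
    h3]

/-- By Vieta's formula the sum is ∏_{c≠a}(z_b - z_c) divided by ∏_{c≠b}(z_b - z_c). -/
theorem dual_aux {z : I → ℝ} (h : Function.Injective z) {N : ℕ} (hN : Fintype.card I = N)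
    (a b : I) :
    ∑ k : Fin N, esym z (Finset.univ.erase a) k * ((-1) ^ (k : ℕ) * z b ^ (N - 1 - k) / vand z b)
      = if a = b then 1 else 0 := by
  have hc : (Finset.univ.erase a).card + 1 = N := by
    rw [Finset.card_erase_add_one (Finset.mem_univ a), Finset.card_univ, hN]
  have h1 := sum_esym_mul_pow z (Finset.univ.erase a) (z b)
  rw [hc, Finset.sum_range, show (Finset.univ.erase a).card = N - 1 by omega] at h1
  have h2 : ∑ k : Fin N, esym z (Finset.univ.erase a) k
        * ((-1) ^ (k : ℕ) * z b ^ (N - 1 - k) / vand z b)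
      = (∏ c ∈ Finset.univ.erase a, (z b - z c)) / vand z b := by
    rw [← h1, Finset.sum_div]
    refine Finset.sum_congr rfl fun k _ => ?_
    ring
  rw [h2]
  split_ifs with e
  · subst e
    exact div_self (vand_ne_zero h a)
  · rw [Finset.prod_eq_zero (Finset.mem_erase.mpr ⟨Ne.symm e, Finset.mem_univ b⟩) (sub_self _),
      zero_div]

/-- For square matrices a right inverse is a left inverse. -/
theorem dual_aux' {z : I → ℝ} (h : Function.Injective z) {N : ℕ} (hN : Fintype.card I = N)
    (k l : Fin N) :
    ∑ a, ((-1) ^ (k : ℕ) * z a ^ (N - 1 - k) / vand z a) * esym z (Finset.univ.erase a) l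
      = if k = l then 1 else 0 := by
  have h1 : (Matrix.of fun (a : I) (k : Fin N) => esym z (Finset.univ.erase a) k) *
      (Matrix.of fun (k : Fin N) (a : I) => (-1) ^ (k : ℕ) * z a ^ (N - 1 - k) / vand z a) = 1 := by
    ext a b
    rw [Matrix.mul_apply, Matrix.one_apply]
    exact dual_aux h hN a b
  have h2 := congrFun (congrFun ((Matrix.mul_eq_one_comm_of_card_eq _ _ _
    (show Fintype.card I = Fintype.card (Fin N) by rw [hN, Fintype.card_fin])).mp h1) k) l
  rwa [Matrix.mul_apply, Matrix.one_apply] at h2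

/-- Lagrange interpolation of monomials. -/
theorem sum_pow_div_vand {z : I → ℝ} (h : Function.Injective z) {j : ℕ}
    (hj : j < Fintype.card I) :
    ∑ a, z a ^ j / vand z a = if j + 1 = Fintype.card I then 1 else 0 := by
  set N := Fintype.card I with hN
  -- The symmetric polynomial of degree 0 is 1, so the column l = 0 of the duality concerns pure
  -- powers; k = N - 1 - j produces the exponent j.
  have h1 := dual_aux' h hN.symm ⟨N - 1 - j, by omega⟩ ⟨0, by omega⟩
  have h2 : N - 1 - (N - 1 - j) = j := by omega
  simp only [esym_zero, mul_one, h2, mul_div_assoc, ← Finset.mul_sum, Fin.mk.injEq] at h1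
  by_cases e : j + 1 = N
  · have e' : N - 1 - j = 0 := by omega
    rw [if_pos e]
    simpa [e'] using h1
  · rw [if_neg e]
    rw [if_neg (by omega)] at h1
    exact (mul_eq_zero.mp h1).resolve_left (pow_ne_zero _ (by norm_num))

theorem HasPd.comp {ι : Type} [Fintype ι] [DecidableEq ι] {i : ι} {f : (ι → ℝ) → ℝ} {d e : ℝ}
    {x : ι → ℝ} {φ : ℝ → ℝ} (hφ : HasDerivAt φ e (f x)) (hf : HasPd i f d x) :
    HasPd i (fun y => φ (f y)) (e * d) x := by
  have h := hφ.comp_hasFDerivAt x hf.1.hasFDerivAt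
  refine ⟨h.differentiableAt, ?_⟩
  unfold pd
  rw [show (fun y => φ (f y)) = φ ∘ f from rfl, h.fderiv, ← hf.2]
  rfl

theorem hasPd_vand_comp {ι : Type} [Fintype ι] [DecidableEq ι] {i : ι} {x : ι → ℝ}
    {F : I → (ι → ℝ) → ℝ} {D : I → ℝ} (hF : ∀ b, HasPd i (F b) (D b) x)
    (h : Function.Injective fun b => F b x) (ν : I) :
    HasPd i (fun y => vand (fun b => F b y) ν)
      (vand (fun b => F b x) ν * ∑ b, (D ν - D b) / (F ν x - F b x)) x := by
  refine (HasPd.prod fun b _ => (hF ν).sub (hF b)).congr_val ?_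
  rw [← Finset.add_sum_erase _ _ (Finset.mem_univ ν), sub_self, zero_div, zero_add, Finset.mul_sum]
  refine Finset.sum_congr rfl fun b hb => ?_
  have : F ν x - F b x ≠ 0 := sub_ne_zero.mpr fun e => (Finset.ne_of_mem_erase hb).symm (h e)
  rw [vand, ← Finset.mul_prod_erase _ _ hb]
  field_simp

/-- Only z_μ moves, at speed `d`: for ν = μ every factor z_ν - z_b with b ≠ μ varies, otherwise just
the one with b = μ. The term b = ν is 0/0 = 0. -/
theorem sum_ite_sub_div (z : I → ℝ) (μ ν : I) (d : ℝ) :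
    ∑ b, ((if ν = μ then d else 0) - (if b = μ then d else 0)) / (z ν - z b)
      = if ν = μ then ∑ a, d / (z μ - z a) else d / (z μ - z ν) := by
  split_ifs with e
  · subst e
    refine Finset.sum_congr rfl fun b _ => ?_
    split_ifs with e'
    · rw [e']; simp
    · rw [sub_zero]
  · rw [Finset.sum_eq_single μ (fun b _ hb => by simp [hb]) (by simp), if_pos rfl,
      ← neg_sub (z μ), div_neg, zero_sub, neg_div, neg_neg]

theorem hasPd_vand {z : I → ℝ} (h : Function.Injective z) (μ ν : I) :
    HasPd μ (fun w => vand w ν) (vand z ν * if ν = μ then ∑ a, 1 / (z μ - z a)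
      else 1 / (z μ - z ν)) z :=
  (hasPd_vand_comp (F := fun b w => w b) (fun b => hasPd_coord μ b z) h ν).congr_val
    (by rw [sum_ite_sub_div])

/-- The derivative of an identity for `∑ f(z_ν) / ∏_{b ≠ ν} (z_ν - z_b)`. -/
theorem sum_div_vand_deriv {f : ℝ → ℝ} {f' : I → ℝ} {r : (I → ℝ) → ℝ} {d K : ℝ} {z : I → ℝ}
    {V : Set (I → ℝ)} (hV : IsOpen V) (hz : z ∈ V) (h : Function.Injective z)
    (hf : ∀ ν, HasDerivAt f (f' ν) (z ν)) {μ : I} (hr : HasPd μ r d z)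
    (hK : ∀ w ∈ V, ∑ ν, f (w ν) / vand w ν + r w = K) :
    f' μ / vand z μ - ∑ ν, 1 / (z μ - z ν) * (f (z μ) / vand z μ + f (z ν) / vand z ν) + d = 0 := by
  have h1 : HasPd μ (fun w => ∑ ν, f (w ν) / vand w ν + r w) _ z :=
    (HasPd.sum fun ν _ => (HasPd.comp (hf ν) (hasPd_coord μ ν z)).div (hasPd_vand h μ ν)
      (vand_ne_zero h ν)).add hr
  have h2 := (h1.congr_on hV hz fun w hw => (hK w hw).symm).eq
  rw [pd_const] at h2
  rw [h2]
  congr 1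
  have e1 : f' μ / vand z μ = ∑ ν, if ν = μ then f' ν / vand z ν else 0 := by simp
  have e2 : ∑ ν, 1 / (z μ - z ν) * (f (z μ) / vand z μ + f (z ν) / vand z ν)
      = ∑ ν, ((if ν = μ then (∑ a, 1 / (z μ - z a)) * (f (z μ) / vand z μ) else 0)
        + 1 / (z μ - z ν) * (f (z ν) / vand z ν)) := by
    simp only [mul_add, Finset.sum_add_distrib, ← Finset.sum_mul]
    simp
  rw [e1, e2, ← Finset.sum_sub_distrib]
  refine Finset.sum_congr rfl fun ν _ => ?_
  have h3 := vand_ne_zero h ν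
  by_cases e : ν = μ
  · subst e
    simp only [if_true, sub_self, div_zero, zero_mul, add_zero]
    field_simp
  · simp only [if_neg e]
    field_simp
    ring

end Interpolation

/-! ### The Kerr–NUT covectors and the reduction of the vacuum equations -/

section KerrNUTFrames

variable {α β κ : Type} [Fintype α] [DecidableEq α] [Fintype β] [DecidableEq β]
  [Subsingleton β] [Fintype κ] [DecidableEq κ] {x : α ⊕ κ → ℝ}

/-- The squares of the coordinates. -/
def sqs (y : α ⊕ κ → ℝ) (ν : α) : ℝ := y (Sum.inl ν) ^ 2

theorem injective_sqs (h : Function.Injective (zsq x : α ⊕ β → ℝ)) : Function.Injective (sqs x) :=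
  fun _ _ e => Sum.inl_injective (h e)

theorem hasPd_vand_sqs (h : Function.Injective (zsq x : α ⊕ β → ℝ)) (τ μ : α) :
    HasPd (Sum.inl τ) (fun y : α ⊕ κ → ℝ => vand (sqs y) μ) (vand (sqs x) μ *
      if μ = τ then ∑ σ, lam τ (Sum.inl σ : α ⊕ β) x else lam τ (Sum.inl μ : α ⊕ β) x) x := by
  have h1 : ∀ b, HasPd (Sum.inl τ) (fun y : α ⊕ κ → ℝ => sqs y b)
      (if b = τ then 2 * x (Sum.inl τ) else 0) x := fun b => by
    simpa [sqs] using hasPd_zsq τ (Sum.inl b : α ⊕ β) x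
  refine (hasPd_vand_comp h1 (injective_sqs h) μ).congr_val ?_
  rw [sum_ite_sub_div]
  have h2 : ∀ σ, 2 * x (Sum.inl τ) / (sqs x τ - sqs x σ) = lam τ (Sum.inl σ : α ⊕ β) x :=
    fun σ => by simp only [lam, rho, sqs, zsq_inl]; ring
  simp only [h2]

theorem hasPd_esym_of_notMem {τ : α} {S : Finset (α ⊕ β)} (hS : Sum.inl τ ∉ S) (k : ℕ) :
    HasPd (Sum.inl τ) (fun y : α ⊕ κ → ℝ => esym (zsq y) S k) 0 x := by
  refine (HasPd.sum fun s hs => HasPd.prod (D := fun _ => 0) fun a ha =>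
    (hasPd_zsq τ a x).congr_val (if_neg fun e => hS ?_)).congr_val (by simp)
  exact e ▸ (Finset.mem_powersetCard.mp hs).1 ha

/-- The components of the covectors `A_a`. -/
def frameA (a : α ⊕ β) (k : ℕ) (y : α ⊕ κ → ℝ) : ℝ := esym (zsq y) (Finset.univ.erase a) k

/-- For a ≠ τ let S omit both nodes. Then A_a^{(k+1)} = e_{k+1}(S) + z_τ e_k(S) is affine in z_τ,
while A_a^{(k+1)} - A_τ^{(k+1)} = (z_τ - z_a) e_k(S). -/
theorem hasPd_frameA (h : Function.Injective (zsq x : α ⊕ β → ℝ)) (τ : α) (a : α ⊕ β) (k : ℕ) :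
    HasPd (Sum.inl τ) (frameA a k : (α ⊕ κ → ℝ) → ℝ)
      (lam τ a x * (frameA a k x - frameA (Sum.inl τ : α ⊕ β) k x)) x := by
  by_cases e : a = Sum.inl τ
  · subst e
    exact (hasPd_esym_of_notMem (Finset.notMem_erase _ _) k).congr_val (by simp)
  rcases k with _ | k
  · simp only [frameA, esym_zero, sub_self, mul_zero]
    have : (frameA a 0 : (α ⊕ κ → ℝ) → ℝ) = fun _ => 1 := by
      funext y; exact esym_zero _ _
    rw [this]
    exact hasPd_const 1
  set S := (Finset.univ.erase a).erase (Sum.inl τ : α ⊕ β) with hS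
  have h1 : Finset.univ.erase a = insert (Sum.inl τ) S :=
    (Finset.insert_erase (Finset.mem_erase.mpr ⟨Ne.symm e, Finset.mem_univ _⟩)).symm
  have h2 : Finset.univ.erase (Sum.inl τ : α ⊕ β) = insert a S := by
    rw [hS, Finset.erase_right_comm]
    exact (Finset.insert_erase (Finset.mem_erase.mpr ⟨e, Finset.mem_univ _⟩)).symm
  have n1 : (Sum.inl τ : α ⊕ β) ∉ S := by simp [hS]
  have n2 : a ∉ S := by simp [hS]
  have h3 : (frameA a (k + 1) : (α ⊕ κ → ℝ) → ℝ) = fun y => esym (zsq y) S (k + 1)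
      + zsq y (Sum.inl τ : α ⊕ β) * esym (zsq y) S k := by
    funext y
    rw [frameA, h1, esym_insert n1]
  have h4 := (hasPd_esym_of_notMem n1 (k + 1) (x := x)).add
    ((hasPd_zsq τ (Sum.inl τ : α ⊕ β) x).mul (hasPd_esym_of_notMem n1 k))
  rw [h3]
  refine h4.congr_val ?_
  have h5 := zsq_sub_ne h e
  rw [frameA, h2, esym_insert n2, if_pos rfl, lam, rho]
  simp only [zsq_inl]
  field_simp
  ring

variable {X X' X'' : α → ℝ → ℝ}

theorem hasPd_quot (h : Function.Injective (zsq x : α ⊕ β → ℝ)) {τ μ : α} {d : ℝ}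
    (hX : HasDerivAt (X μ) d (x (Sum.inl μ))) :
    HasPd (Sum.inl τ) (fun y : α ⊕ κ → ℝ => X μ (y (Sum.inl μ)) / vand (sqs y) μ)
      (if μ = τ then (d - (∑ σ, lam μ (Sum.inl σ : α ⊕ β) x) * X μ (x (Sum.inl μ)))
          / vand (sqs x) μ
        else -(lam τ (Sum.inl μ : α ⊕ β) x * (X μ (x (Sum.inl μ)) / vand (sqs x) μ))) x := by
  have h0 := vand_ne_zero (injective_sqs h) μ
  refine (((HasPd.comp hX (hasPd_coord (Sum.inl τ) (Sum.inl μ) x)).div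
    (hasPd_vand_sqs h τ μ) h0)).congr_val ?_
  by_cases e : μ = τ
  · subst e
    simp only [if_true]
    field_simp
  · simp only [Sum.inl.injEq, if_neg e]
    field_simp
    ring

theorem hasPd_quot_snd (h : Function.Injective (zsq x : α ⊕ β → ℝ)) {μ : α}
    (hX : HasDerivAt (X μ) (X' μ (x (Sum.inl μ))) (x (Sum.inl μ)))
    (hX' : HasDerivAt (X' μ) (X'' μ (x (Sum.inl μ))) (x (Sum.inl μ))) :
    HasPd (Sum.inl μ) (fun y : α ⊕ κ → ℝ => (X' μ (y (Sum.inl μ))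
        - (∑ σ, lam μ (Sum.inl σ : α ⊕ β) y) * X μ (y (Sum.inl μ))) / vand (sqs y) μ)
      ((X'' μ (x (Sum.inl μ)) - 2 * (∑ σ, lam μ (Sum.inl σ : α ⊕ β) x) * X' μ (x (Sum.inl μ))
        + ((∑ σ, lam μ (Sum.inl σ : α ⊕ β) x) ^ 2
          - ∑ σ, (rho μ (Sum.inl σ : α ⊕ β) x - lam μ (Sum.inl σ : α ⊕ β) x ^ 2))
          * X μ (x (Sum.inl μ))) / vand (sqs x) μ) x := by
  have h0 := vand_ne_zero (injective_sqs h) μ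
  have hc := hasPd_coord (Sum.inl μ) (Sum.inl μ : α ⊕ κ) x
  refine (((HasPd.comp hX' hc).sub ((HasPd.sum fun σ _ => hasPd_lam h μ (Sum.inl σ)).mul
    (HasPd.comp hX hc))).div (hasPd_vand_sqs h μ μ) h0).congr_val ?_
  simp only [if_true]
  field_simp
  ring

/-- The functions `Q_a`. -/
def frameQ (β : Type) (X : α → ℝ → ℝ) (q₀ : (α ⊕ κ → ℝ) → ℝ) (a : α ⊕ β) (y : α ⊕ κ → ℝ) : ℝ :=
  Sum.elim (fun μ => X μ (y (Sum.inl μ)) / vand (sqs y) μ) (fun _ => q₀ y) a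

/-- Here R = X'/U, s = X''/U and q' = X/U. All terms quadratic in λ cancel, and what is left is
linear and involves only (x X' - (1 - ε) X)/U, with ε the number of extra indices. -/
theorem vacuum_inl_of {q : β → ℝ} {R q' : α → ℝ} {s : ℝ}
    (h : Function.Injective (zsq x : α ⊕ β → ℝ)) (μ : α)
    (e : s + ∑ _b : β, 1 / x (Sum.inl μ) * R μ
      - ∑ ν, rho μ (Sum.inl ν : α ⊕ β) x * (x (Sum.inl μ) * R μ - (1 - Fintype.card β) * q' μ
        + (x (Sum.inl ν) * R ν - (1 - Fintype.card β) * q' ν))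
      + ∑ b, lam μ (Sum.inr b : α ⊕ β) x ^ 2 * q b = 0) :
    volDer α β κ μ x * (R μ - (∑ σ, lam μ (Sum.inl σ : α ⊕ β) x) * q' μ)
      + (s - 2 * (∑ σ, lam μ (Sum.inl σ : α ⊕ β) x) * R μ
        + ((∑ σ, lam μ (Sum.inl σ : α ⊕ β) x) ^ 2
          - ∑ σ, (rho μ (Sum.inl σ : α ⊕ β) x - lam μ (Sum.inl σ : α ⊕ β) x ^ 2)) * q' μ)
      + (∑ ν, lam μ (Sum.inl ν : α ⊕ β) x ^ 2 * q' ν + ∑ b, lam μ (Sum.inr b : α ⊕ β) x ^ 2 * q b)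
      + ∑ ν, ((R ν - (∑ σ, lam ν (Sum.inl σ : α ⊕ β) x) * q' ν + volDer α β κ ν x * q' ν)
          * lam ν (Sum.inl μ : α ⊕ β) x + q' ν * rho ν (Sum.inl μ : α ⊕ β) x
          - q' ν * lam ν (Sum.inl μ : α ⊕ β) x ^ 2)
      - q' μ * ∑ ν, lam ν (Sum.inl μ : α ⊕ β) x ^ 2 = 0 := by
  have h1 : ∀ ν σ, (∑ _b : β, 1 / x (Sum.inl ν)) * lam ν (Sum.inl σ : α ⊕ β) x
      = Fintype.card β * rho ν (Sum.inl σ : α ⊕ β) x := by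
    intro ν σ
    rw [Finset.sum_mul, Finset.sum_congr rfl fun b _ => inv_mul_lam h b ν (Sum.inl σ)]
    simp
  have h2 : (∑ _b : β, 1 / x (Sum.inl μ)) * ∑ σ, lam μ (Sum.inl σ : α ⊕ β) x
      = ∑ σ, Fintype.card β * rho μ (Sum.inl σ : α ⊕ β) x := by
    rw [Finset.mul_sum]
    exact Finset.sum_congr rfl fun σ _ => h1 μ σ
  have h3 : -(R μ * ∑ σ, lam μ (Sum.inl σ : α ⊕ β) x)
      - q' μ * ∑ σ, Fintype.card β * rho μ (Sum.inl σ : α ⊕ β) x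
      - q' μ * ∑ σ, (rho μ (Sum.inl σ : α ⊕ β) x - lam μ (Sum.inl σ : α ⊕ β) x ^ 2)
      + ∑ ν, lam μ (Sum.inl ν : α ⊕ β) x ^ 2 * q' ν
      + ∑ ν, ((R ν - (∑ σ, lam ν (Sum.inl σ : α ⊕ β) x) * q' ν + volDer α β κ ν x * q' ν)
          * lam ν (Sum.inl μ : α ⊕ β) x + q' ν * rho ν (Sum.inl μ : α ⊕ β) x
          - q' ν * lam ν (Sum.inl μ : α ⊕ β) x ^ 2)
      - q' μ * ∑ ν, lam ν (Sum.inl μ : α ⊕ β) x ^ 2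
      = -∑ ν, rho μ (Sum.inl ν : α ⊕ β) x * (x (Sum.inl μ) * R μ - (1 - Fintype.card β) * q' μ
        + (x (Sum.inl ν) * R ν - (1 - Fintype.card β) * q' ν)) := by
    simp only [Finset.mul_sum, ← Finset.sum_neg_distrib, ← Finset.sum_add_distrib,
      ← Finset.sum_sub_distrib]
    refine Finset.sum_congr rfl fun ν _ => ?_
    have e1 : lam ν (Sum.inl μ : α ⊕ β) x = -(x (Sum.inl ν) * rho μ (Sum.inl ν : α ⊕ β) x) := by
      rw [lam, rho_swap]; ring
    have e2 : lam μ (Sum.inl ν : α ⊕ β) x = x (Sum.inl μ) * rho μ (Sum.inl ν : α ⊕ β) x := rfl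
    have e3 := lam_sq_sub h μ ν
    have e4 := h1 ν μ
    rw [rho_swap μ ν] at e4 ⊢
    rw [volDer]
    linear_combination R ν * e1 - R μ * e2 + (q' μ + q' ν) * e3 + q' ν * e4
  rw [volDer] at *
  rw [← Finset.sum_mul] at e
  linear_combination e + h3 - q' μ * h2

/-- For the extra index λ = 2/x and ρ = 2/x², so the terms with q' combine to (2 + 2 - 4)/x² = 0. -/
theorem vacuum_inr_of {q : ℝ} {R q' : α → ℝ} (h : Function.Injective (zsq x : α ⊕ β → ℝ)) (b : β)
    (e : ∑ ν, lam ν (Sum.inr b : α ⊕ β) x * R ν = q * ∑ ν, lam ν (Sum.inr b : α ⊕ β) x ^ 2) :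
    ∑ ν, ((R ν - (∑ σ, lam ν (Sum.inl σ : α ⊕ β) x) * q' ν + volDer α β κ ν x * q' ν)
          * lam ν (Sum.inr b : α ⊕ β) x + q' ν * rho ν (Sum.inr b : α ⊕ β) x
          - q' ν * lam ν (Sum.inr b : α ⊕ β) x ^ 2)
      = q * ∑ ν, lam ν (Sum.inr b : α ⊕ β) x ^ 2 := by
  rw [← e]
  refine Finset.sum_congr rfl fun ν _ => ?_
  have h1 : ∑ _b : β, 1 / x (Sum.inl ν) = 1 / x (Sum.inl ν) := by
    rw [Fintype.sum_subsingleton _ b]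
  have h2 := coord_ne_zero h b ν
  rw [volDer, h1, lam_inr h, rho_inr]
  field_simp
  ring

end KerrNUTFrames

/-! ### Lagrange sums of polynomials and of the reciprocal -/

section Lagrange

variable {I : Type} [Fintype I] [DecidableEq I]

theorem vand_eq_prod_ite (z : I → ℝ) (a : I) :
    vand z a = ∏ b, if b = a then 1 else z a - z b := by
  rw [← Finset.mul_prod_erase _ _ (Finset.mem_univ a), if_pos rfl, one_mul]
  exact Finset.prod_congr rfl fun b hb => by rw [if_neg (Finset.ne_of_mem_erase hb)]

/-- Adjoin the node 0 and interpolate the constant 1: the sum over all nodes vanishes, as there are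
at least two of them, and the node 0 contributes the right-hand side. -/
theorem sum_inv_div_vand [Nonempty I] {z : I → ℝ} (h : Function.Injective z) (h0 : ∀ a, z a ≠ 0) :
    ∑ a, 1 / z a / vand z a = -((-1) ^ Fintype.card I / ∏ a, z a) := by
  set w : Option I → ℝ := fun a => a.elim 0 z
  have hw : Function.Injective w := by
    rintro (_ | a) (_ | b) e
    · rfl
    · exact absurd e.symm (h0 b)
    · exact absurd e (h0 a)
    · exact congrArg some (h e)
  have h1 := sum_pow_div_vand hw (j := 0) (by simp)
  rw [Fintype.sum_option, if_neg (by simp [Fintype.card_ne_zero.symm])] at h1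
  have h2 : ∀ a, vand w (some a) = z a * vand z a := fun a => by
    rw [vand_eq_prod_ite, vand_eq_prod_ite, Fintype.prod_option]
    simp [w]
  have h3 : vand w none = (-1) ^ Fintype.card I * ∏ a, z a := by
    rw [vand_eq_prod_ite, Fintype.prod_option]
    simp [w, Finset.prod_neg]
  simp only [h2, h3, pow_zero] at h1
  have h4 : ((-1 : ℝ) ^ Fintype.card I) * (-1) ^ Fintype.card I = 1 := by
    rw [← mul_pow]; simp
  have h5 : (-1 : ℝ) ^ Fintype.card I ≠ 0 := pow_ne_zero _ (by norm_num)
  have h6 : ∏ a, z a ≠ 0 := Finset.prod_ne_zero_iff.mpr fun a _ => h0 a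
  have h7 : 1 / ((-1) ^ Fintype.card I * ∏ a, z a) = (-1) ^ Fintype.card I / ∏ a, z a := by
    field_simp
    linear_combination -h4
  rw [h7] at h1
  simp only [div_div]
  linear_combination h1

theorem sum_poly_div_vand {z : I → ℝ} (h : Function.Injective z) {n : ℕ} (hn : Fintype.card I = n)
    (hn1 : 1 ≤ n) (a : ℕ → ℝ) :
    ∑ ν, (∑ k ∈ Finset.range n, a k * z ν ^ k) / vand z ν = a (n - 1) := by
  have h1 : ∀ k ∈ Finset.range n, ∑ ν, a k * z ν ^ k / vand z ν = if n - 1 = k then a k else 0 := by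
    intro k hk
    have hk' := Finset.mem_range.mp hk
    simp only [mul_div_assoc]
    rw [← Finset.mul_sum, sum_pow_div_vand h (by omega)]
    by_cases e : n - 1 = k
    · rw [if_pos (by omega), if_pos e, mul_one]
    · rw [if_neg (by omega), if_neg e, mul_zero]
  simp only [Finset.sum_div]
  rw [Finset.sum_comm, Finset.sum_congr rfl h1, Finset.sum_ite_eq,
    if_pos (Finset.mem_range.mpr (by omega))]

theorem sum_poly_deriv_div_vand {z : I → ℝ} (h : Function.Injective z) {n : ℕ}
    (hn : Fintype.card I = n) (a : ℕ → ℝ) :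
    ∑ ν, (∑ k ∈ Finset.range n, a k * (k * z ν ^ (k - 1))) / vand z ν = 0 := by
  simp only [Finset.sum_div]
  rw [Finset.sum_comm]
  refine Finset.sum_eq_zero fun k hk => ?_
  have hk' := Finset.mem_range.mp hk
  rcases k with _ | k
  · simp
  · have h1 := sum_pow_div_vand h (j := k) (by omega)
    rw [if_neg (by omega)] at h1
    have h2 : ∀ ν, a (k + 1) * (((k + 1 : ℕ) : ℝ) * z ν ^ (k + 1 - 1)) / vand z ν
        = a (k + 1) * ((k + 1 : ℕ) : ℝ) * (z ν ^ k / vand z ν) := fun ν => by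
      rw [Nat.add_sub_cancel]; ring
    rw [Finset.sum_congr rfl fun ν _ => h2 ν, ← Finset.mul_sum, h1, mul_zero]

end Lagrange

/-! ### The functions X_μ and their differential identities -/

namespace Params

variable {n : ℕ} (P : Params n) (ε : ℕ)

/-- The derivative of `X_μ`. -/
def dX (μ : Fin n) (x : ℝ) : ℝ :=
  ∑ k ∈ Finset.range n, P.c k * (2 * k * x ^ (2 * k - 1)) + P.m μ * (1 - ε)
    - ε * (2 * ((-1) ^ n * P.c0) / x ^ 3)

/-- The second derivative of `X_μ`. -/
def ddX (x : ℝ) : ℝ :=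
  ∑ k ∈ Finset.range n, P.c k * (2 * k * ((2 * k - 1) * x ^ (2 * k - 2)))
    + ε * (6 * ((-1) ^ n * P.c0) / x ^ 4)

/-- `x X' - (1 - ε) X` in terms of `z = x²`. -/
def yfun (z : ℝ) : ℝ :=
  ∑ k ∈ Finset.range n, P.c k * (2 * k - 1 + ε) * z ^ k - ε * (2 * ((-1) ^ n * P.c0) / z)

/-- The derivative of `yfun`. -/
def dyfun (z : ℝ) : ℝ :=
  ∑ k ∈ Finset.range n, P.c k * (2 * k - 1 + ε) * (k * z ^ (k - 1))
    + ε * (2 * ((-1) ^ n * P.c0) / z ^ 2)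

variable {ε} {x : ℝ}

theorem hasDerivAt_X (hε : ε = 0 ∨ ε = 1) (hx : ε = 1 → x ≠ 0) (μ : Fin n) :
    HasDerivAt ((P.typeA ε).X μ) (P.dX ε μ x) x := by
  have h1 : HasDerivAt (fun x : ℝ => ∑ k ∈ Finset.range n, P.c k * x ^ (2 * k))
      (∑ k ∈ Finset.range n, P.c k * (2 * k * x ^ (2 * k - 1))) x :=
    HasDerivAt.fun_sum fun k _ => by
      simpa using (hasDerivAt_pow (2 * k) x).const_mul (P.c k)
  rcases hε with rfl | rfl
  · refine ((h1.add ((hasDerivAt_id x).const_mul (P.m μ))).congr_deriv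
      ?_).congr_of_eventuallyEq (Filter.Eventually.of_forall fun y => ?_)
    · simp [dX]
    · simp [typeA]
  · have h2 := (hasDerivAt_const x ((-1) ^ n * P.c0)).div (hasDerivAt_pow 2 x)
      (pow_ne_zero 2 (hx rfl))
    have h3 := (h1.add (hasDerivAt_const x (P.m μ))).add h2
    have h4 := hx rfl
    refine (h3.congr_deriv ?_).congr_of_eventuallyEq (Filter.Eventually.of_forall fun y => ?_)
    · simp only [dX]
      generalize (∑ k ∈ Finset.range n, P.c k * (2 * (k : ℝ) * x ^ (2 * k - 1))) = S
      simp
      field_simp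
      ring
    · simp [typeA]

theorem hasDerivAt_dX (hε : ε = 0 ∨ ε = 1) (hx : ε = 1 → x ≠ 0) (μ : Fin n) :
    HasDerivAt (P.dX ε μ) (P.ddX ε x) x := by
  have h1 : HasDerivAt (fun x : ℝ => ∑ k ∈ Finset.range n, P.c k * (2 * k * x ^ (2 * k - 1)))
      (∑ k ∈ Finset.range n, P.c k * (2 * k * ((2 * k - 1) * x ^ (2 * k - 2)))) x :=
    HasDerivAt.fun_sum fun k _ => by
      refine (((hasDerivAt_pow (2 * k - 1) x).const_mul (2 * k : ℝ)).const_mul (P.c k)).congr_deriv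
        ?_
      rcases k with _ | k
      · simp
      · rw [show 2 * (k + 1) - 1 = 2 * k + 1 by omega, show 2 * (k + 1) - 2 = 2 * k by omega,
          Nat.add_sub_cancel]
        push_cast
        ring
  rcases hε with rfl | rfl
  · refine ((h1.add (hasDerivAt_const x (P.m μ))).congr_deriv ?_).congr_of_eventuallyEq
      (Filter.Eventually.of_forall fun y => ?_)
    · simp [ddX]
    · simp [dX]
  · have h2 := (hasDerivAt_const x (2 * ((-1) ^ n * P.c0))).div (hasDerivAt_pow 3 x)
      (pow_ne_zero 3 (hx rfl))
    have h4 := hx rfl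
    refine ((h1.sub h2).congr_deriv ?_).congr_of_eventuallyEq
      (Filter.Eventually.of_forall fun y => ?_)
    · simp only [ddX]
      generalize (∑ k ∈ Finset.range n, P.c k * (2 * (k : ℝ) * ((2 * k - 1) * x ^ (2 * k - 2)))) = S
      simp
      field_simp
      ring
    · simp [dX]

theorem hasDerivAt_yfun (hε : ε = 0 ∨ ε = 1) (hx : ε = 1 → x ≠ 0) :
    HasDerivAt (P.yfun ε) (P.dyfun ε x) x := by
  have h1 : HasDerivAt (fun x : ℝ => ∑ k ∈ Finset.range n, P.c k * (2 * k - 1 + ε) * x ^ k)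
      (∑ k ∈ Finset.range n, P.c k * (2 * k - 1 + ε) * (k * x ^ (k - 1))) x :=
    HasDerivAt.fun_sum fun k _ => (hasDerivAt_pow k x).const_mul _
  rcases hε with rfl | rfl
  · refine (h1.congr_deriv ?_).congr_of_eventuallyEq (Filter.Eventually.of_forall fun y => ?_)
    · simp [dyfun]
    · simp [yfun]
  · have h2 := (hasDerivAt_const x (2 * ((-1) ^ n * P.c0))).div (hasDerivAt_id x) (hx rfl)
    have h4 := hx rfl
    refine ((h1.sub h2).congr_deriv ?_).congr_of_eventuallyEq
      (Filter.Eventually.of_forall fun y => ?_)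
    · simp only [dyfun]
      generalize (∑ k ∈ Finset.range n, P.c k * (2 * (k : ℝ) - 1 + (1 : ℕ)) * (k * x ^ (k - 1))) = S
      simp
      field_simp
      ring
    · simp [yfun]

/-- The operator x d/dx - (1 - ε) annihilates m_μ x^{1-ε}. The result is a function of x² that no
longer depends on μ, as interpolation requires. -/
theorem mul_dX_sub (hε : ε = 0 ∨ ε = 1) (hx : ε = 1 → x ≠ 0) (μ : Fin n) :
    x * P.dX ε μ x - (1 - ε) * (P.typeA ε).X μ x = P.yfun ε (x ^ 2) := by
  have h1 : x * ∑ k ∈ Finset.range n, P.c k * (2 * k * x ^ (2 * k - 1))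
      = ∑ k ∈ Finset.range n, P.c k * (2 * k) * (x ^ 2) ^ k := by
    rw [Finset.mul_sum]
    refine Finset.sum_congr rfl fun k _ => ?_
    rcases k with _ | k
    · simp
    · rw [show 2 * (k + 1) - 1 = 2 * k + 1 by omega, ← pow_mul]
      ring
  have h2 : P.yfun ε (x ^ 2) = ∑ k ∈ Finset.range n, P.c k * (2 * k) * (x ^ 2) ^ k
      - (1 - ε) * ∑ k ∈ Finset.range n, P.c k * x ^ (2 * k)
      - ε * (2 * ((-1) ^ n * P.c0) / x ^ 2) := by
    rw [yfun, Finset.mul_sum, ← Finset.sum_sub_distrib]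
    congr 1
    exact Finset.sum_congr rfl fun k _ => by rw [pow_mul]; ring
  rw [h2, ← h1]
  rcases hε with rfl | rfl
  · simp [dX, typeA]; ring
  · have h4 := hx rfl
    simp only [dX, typeA]
    generalize (∑ k ∈ Finset.range n, P.c k * (2 * (k : ℝ) * x ^ (2 * k - 1))) = S
    simp
    field_simp

theorem inv_mul_sum (hx : x ≠ 0) :
    1 / x * ∑ k ∈ Finset.range n, P.c k * (2 * k * x ^ (2 * k - 1))
      = ∑ k ∈ Finset.range n, P.c k * (2 * (k * (x ^ 2) ^ (k - 1))) := by
  rw [Finset.mul_sum]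
  refine Finset.sum_congr rfl fun k _ => ?_
  rcases k with _ | k
  · simp
  · rw [show 2 * (k + 1) - 1 = 2 * k + 1 by omega, Nat.add_sub_cancel, ← pow_mul, pow_succ]
    field_simp

/-- The poles of X'/x and of y'(x²) cancel. The remainder is the derivative, at x², of a polynomial
of degree below n, whose Lagrange sum is zero. -/
theorem inv_mul_dX_add (hx : x ≠ 0) (μ : Fin n) :
    1 / x * P.dX 1 μ x + P.dyfun 1 (x ^ 2)
      = ∑ k ∈ Finset.range n, P.c k * (2 * k + 2) * (k * (x ^ 2) ^ (k - 1)) := by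
  have h1 : ∑ k ∈ Finset.range n, P.c k * (2 * k + 2) * (k * (x ^ 2) ^ (k - 1))
      = 1 / x * ∑ k ∈ Finset.range n, P.c k * (2 * k * x ^ (2 * k - 1))
        + ∑ k ∈ Finset.range n, P.c k * (2 * k - 1 + (1 : ℕ)) * (k * (x ^ 2) ^ (k - 1)) := by
    rw [P.inv_mul_sum hx, ← Finset.sum_add_distrib]
    exact Finset.sum_congr rfl fun k _ => by push_cast; ring
  rw [h1, dX, dyfun]
  generalize (∑ k ∈ Finset.range n, P.c k * (2 * (k : ℝ) * x ^ (2 * k - 1))) = S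
  generalize (∑ k ∈ Finset.range n, P.c k * (2 * (k : ℝ) - 1 + (1 : ℕ)) * (k * (x ^ 2) ^ (k - 1)))
    = S'
  simp
  field_simp
  ring

/-- Differentiating y(x²) = x X' - (1 - ε) X with respect to x gives 2 x y' = x X'' + ε X'; this is
that identity divided by x. -/
theorem ddX_add (hε : ε = 0 ∨ ε = 1) (hx : ε = 1 → x ≠ 0) (μ : Fin n) :
    P.ddX ε x + ε * (1 / x * P.dX ε μ x) = 2 * P.dyfun ε (x ^ 2) := by
  have h1 : ∀ k : ℕ, 2 * k * ((2 * k - 1) * x ^ (2 * k - 2))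
      = 2 * (2 * k - 1) * (k * (x ^ 2) ^ (k - 1)) := fun k => by
    rcases k with _ | k
    · simp
    · rw [show 2 * (k + 1) - 2 = 2 * k by omega, Nat.add_sub_cancel, pow_mul]
      ring
  rcases hε with rfl | rfl
  · simp only [ddX, dyfun, h1, mul_add, Finset.mul_sum]
    simp only [Nat.cast_zero, zero_mul, mul_zero, add_zero]
    exact Finset.sum_congr rfl fun k _ => by ring
  · have h4 := hx rfl
    have h3 := P.inv_mul_sum h4
    have h5 : ∑ k ∈ Finset.range n, P.c k * (2 * k * ((2 * k - 1) * x ^ (2 * k - 2)))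
        + ∑ k ∈ Finset.range n, P.c k * (2 * (k * (x ^ 2) ^ (k - 1)))
        = 2 * ∑ k ∈ Finset.range n, P.c k * (2 * k - 1 + (1 : ℕ)) * (k * (x ^ 2) ^ (k - 1)) := by
      rw [Finset.mul_sum, ← Finset.sum_add_distrib]
      exact Finset.sum_congr rfl fun k _ => by rw [h1]; push_cast; ring
    rw [← h3] at h5
    simp only [ddX, dX, dyfun]
    rw [mul_add 2, ← h5]
    generalize (∑ k ∈ Finset.range n, P.c k * (2 * (k : ℝ) * x ^ (2 * k - 1))) = S
    generalize (∑ k ∈ Finset.range n, P.c k * (2 * (k : ℝ) * ((2 * k - 1) * x ^ (2 * k - 2)))) = S'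
    simp
    field_simp
    ring

variable {z : Fin n → ℝ}

/-- The sign (-1)^n in X_μ cancels the one in `sum_inv_div_vand`. Of the polynomial part only the
top coefficient survives. -/
theorem sum_yfun_div_vand (hε : ε = 0 ∨ ε = 1) (hn : 1 ≤ n) (h : Function.Injective z) (h0 : ε = 1 → ∀ ν, z ν ≠ 0) :
    ∑ ν, P.yfun ε (z ν) / vand z ν + -(2 * ε * P.c0) / ∏ ν, z ν
      = P.c (n - 1) * (2 * (n - 1 : ℕ) - 1 + ε) := by
  have : Nonempty (Fin n) := ⟨⟨0, hn⟩⟩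
  rw [← sum_poly_div_vand h (Fintype.card_fin n) hn fun k => P.c k * (2 * k - 1 + ε)]
  rcases hε with rfl | rfl
  · simp [yfun]
  · have h1 := sum_inv_div_vand h (h0 rfl)
    rw [Fintype.card_fin] at h1
    have h2 : ∀ ν, P.yfun 1 (z ν) / vand z ν
        = (∑ k ∈ Finset.range n, P.c k * (2 * k - 1 + (1 : ℕ)) * z ν ^ k) / vand z ν
          - 2 * ((-1) ^ n * P.c0) * (1 / z ν / vand z ν) := fun ν => by
      rw [yfun]; push_cast; ring
    have h4 : ((-1 : ℝ) ^ n) * (-1) ^ n = 1 := by rw [← mul_pow]; simp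
    rw [Finset.sum_congr rfl fun ν _ => h2 ν, Finset.sum_sub_distrib, ← Finset.mul_sum, h1]
    push_cast
    linear_combination 2 * P.c0 / (∏ ν, z ν) * h4

/-- The derivative with respect to z_μ of the identity `sum_yfun_div_vand`, which holds on an open
set of nodes and has a constant right-hand side. -/
theorem deriv_identity (hε : ε = 0 ∨ ε = 1) (hn : 1 ≤ n) (h : Function.Injective z) (h0 : ε = 1 → ∀ ν, z ν ≠ 0) (μ : Fin n) :
    P.dyfun ε (z μ) / vand z μ - ∑ ν, 1 / (z μ - z ν) * (P.yfun ε (z μ) / vand z μ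
      + P.yfun ε (z ν) / vand z ν) + 2 * ε * P.c0 / (z μ * ∏ ν, z ν) = 0 := by
  have hV : IsOpen {w : Fin n → ℝ | Function.Injective w ∧ (ε = 1 → ∀ ν, w ν ≠ 0)} := by
    have e1 : {w : Fin n → ℝ | Function.Injective w ∧ (ε = 1 → ∀ ν, w ν ≠ 0)}
        = {w | ∀ a b, a ≠ b → w a ≠ w b} ∩ {w | ε = 1 → ∀ ν, w ν ≠ 0} := by
      ext w
      refine and_congr_left fun _ => ⟨fun h a b e e' => e (h e'), fun h a b e => ?_⟩
      by_contra e'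
      exact h a b e' e
    rw [e1]
    refine IsOpen.inter ?_ ?_
    · simp only [Set.ofPred_forall]
      exact isOpen_iInter_of_finite fun a => isOpen_iInter_of_finite fun b =>
        isOpen_iInter_of_finite fun _ => isOpen_ne_fun (continuous_apply a) (continuous_apply b)
    · simp only [Set.ofPred_forall]
      exact isOpen_iInter_of_finite fun _ => isOpen_iInter_of_finite fun a =>
        isOpen_ne_fun (continuous_apply a) continuous_const
  refine sum_div_vand_deriv (d := 2 * ε * P.c0 / (z μ * ∏ ν, z ν)) hV ⟨h, h0⟩ h
    (fun ν => P.hasDerivAt_yfun hε fun e => h0 e ν) (r := fun w => -(2 * ε * P.c0) / ∏ ν, w ν) ?_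
    fun w hw => P.sum_yfun_div_vand hε hn hw.1 hw.2
  rcases hε with rfl | rfl
  · simpa using hasPd_const (i := μ) (x := z) 0
  · have h1 : ∏ ν, z ν ≠ 0 := Finset.prod_ne_zero_iff.mpr fun ν _ => h0 rfl ν
    refine ((hasPd_const _).div (HasPd.prod fun ν _ => hasPd_coord μ ν z) h1).congr_val ?_
    have h2 : ∑ a, (∏ b ∈ Finset.univ.erase a, z b) * (if a = μ then 1 else 0)
        = (∏ ν, z ν) / z μ := by
      have := h0 rfl μ
      simp
      rw [← Finset.mul_prod_erase _ _ (Finset.mem_univ μ)]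
      field_simp
    rw [h2]
    have := h0 rfl μ
    field_simp
    ring

/-- `deriv_identity` is summed over μ, which evaluates Σ y'(z_ν)/U_ν. By `inv_mul_dX_add` the same
sum is minus that of X'/(x U). -/
theorem sum_dX_div_vand {x : Fin n → ℝ} (hn : 1 ≤ n) (h : Function.Injective fun ν => x ν ^ 2)
    (h0 : ∀ ν, x ν ≠ 0) :
    ∑ ν, 1 / x ν * P.dX 1 ν (x ν) / vand (fun ν => x ν ^ 2) ν
      = 2 * (P.c0 / ∏ ν, x ν ^ 2) * ∑ ν, 1 / x ν ^ 2 := by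
  set z : Fin n → ℝ := fun ν => x ν ^ 2 with hz
  have h1 := Finset.sum_congr rfl fun μ (_ : μ ∈ Finset.univ) =>
    P.deriv_identity (Or.inr rfl) hn h (fun _ ν => pow_ne_zero 2 (h0 ν)) μ
  -- The summand is antisymmetric in μ and ν, as z_μ - z_ν changes sign and the bracket is
  -- symmetric.
  have h2 : ∑ μ, ∑ ν, 1 / (z μ - z ν) * (P.yfun 1 (z μ) / vand z μ + P.yfun 1 (z ν) / vand z ν)
      = 0 := by
    have e : ∀ S : ℝ, S = -S → S = 0 := fun S e => by linarith
    apply e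
    conv_lhs => rw [Finset.sum_comm]
    simp only [← Finset.sum_neg_distrib]
    refine Finset.sum_congr rfl fun μ _ => Finset.sum_congr rfl fun ν _ => ?_
    rw [← neg_sub (z μ), div_neg, add_comm]
    ring
  have h3 := sum_poly_deriv_div_vand h (Fintype.card_fin n) fun k => P.c k * (2 * k + 2)
  have h5 : ∑ ν, (1 / x ν * P.dX 1 ν (x ν) + P.dyfun 1 (z ν)) / vand z ν = 0 := by
    rw [← h3]
    exact Finset.sum_congr rfl fun ν _ => by rw [P.inv_mul_dX_add (h0 ν)]
  simp only [add_div, Finset.sum_add_distrib] at h5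
  rw [Finset.sum_add_distrib, Finset.sum_sub_distrib, h2, Finset.sum_const_zero] at h1
  have h4 : ∑ μ, 2 * ((1 : ℕ) : ℝ) * P.c0 / (z μ * ∏ ν, z ν)
      = 2 * (P.c0 / ∏ ν, z ν) * ∑ ν, 1 / x ν ^ 2 := by
    rw [Finset.mul_sum]
    refine Finset.sum_congr rfl fun ν _ => ?_
    push_cast
    rw [hz]
    ring
  rw [h4] at h1
  linear_combination h5 - h1

end Params

/-! ### Smoothness and base dependence of the frame data -/

section Smoothness

variable {α β κ : Type} [Fintype α] [DecidableEq α] [Fintype β] [DecidableEq β]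
  [Fintype κ] [DecidableEq κ]

theorem contDiff_zsq (a : α ⊕ β) : ContDiff ℝ ∞ fun y : α ⊕ κ → ℝ => zsq y a := by
  rcases a with μ | b
  · exact (contDiff_apply ℝ ℝ (Sum.inl μ : α ⊕ κ)).pow 2
  · exact contDiff_const

theorem contDiff_vand_sqs (μ : α) : ContDiff ℝ ∞ fun y : α ⊕ κ → ℝ => vand (sqs y) μ :=
  contDiff_prod fun _ _ => ((contDiff_apply ℝ ℝ (Sum.inl _ : α ⊕ κ)).pow 2).sub
    ((contDiff_apply ℝ ℝ (Sum.inl _ : α ⊕ κ)).pow 2)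

theorem contDiff_frameA (a : α ⊕ β) (k : ℕ) :
    ContDiff ℝ ∞ (frameA a k : (α ⊕ κ → ℝ) → ℝ) :=
  ContDiff.sum fun _ _ => contDiff_prod fun _ _ => contDiff_zsq _

/-- The components of the vectors dual to the `A_a`. -/
def frameE (N k : ℕ) (a : α ⊕ β) (y : α ⊕ κ → ℝ) : ℝ :=
  (-1) ^ k * zsq y a ^ (N - 1 - k) / vand (zsq y) a

theorem smoothOn_frameE {U : Set (α ⊕ κ → ℝ)}
    (h : ∀ x ∈ U, Function.Injective (zsq x : α ⊕ β → ℝ)) (N k : ℕ) (a : α ⊕ β) :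
    SmoothOn U (frameE N k a) :=
  ContDiffOn.div (contDiff_const.mul ((contDiff_zsq a).pow _)).contDiffOn
    (contDiff_prod fun _ _ => (contDiff_zsq _).sub (contDiff_zsq _)).contDiffOn
    fun y hy => vand_ne_zero (h y hy) a

theorem zsq_congr {x y : α ⊕ κ → ℝ} (h : ∀ μ, x (Sum.inl μ) = y (Sum.inl μ)) :
    (zsq x : α ⊕ β → ℝ) = zsq y := by
  funext a
  rcases a with μ | b
  · exact congrArg (· ^ 2) (h μ)
  · rfl

theorem sqs_congr {x y : α ⊕ κ → ℝ} (h : ∀ μ, x (Sum.inl μ) = y (Sum.inl μ)) :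
    sqs x = sqs y := by
  funext μ
  simp [sqs, h]

end Smoothness

/-- The points with distinct `x_μ²`, nonzero in odd dimensions. -/
def regular (n ε : ℕ) : Set (Pt n ε) :=
  {p | (∀ μ ν, μ ≠ ν → xc p μ ^ 2 ≠ xc p ν ^ 2) ∧ (ε = 1 → ∀ μ, xc p μ ≠ 0)}

/-! ### The open set on which the frame nodes are distinct -/

section Regular

variable {n ε : ℕ}

theorem isOpen_regular : IsOpen (regular n ε) := by
  have hc : ∀ μ : Fin n, Continuous fun p : Pt n ε => xc p μ := fun μ => continuous_apply _
  refine IsOpen.inter ?_ ?_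
  · change IsOpen {p : Pt n ε | ∀ μ ν, μ ≠ ν → xc p μ ^ 2 ≠ xc p ν ^ 2}
    simp only [Set.ofPred_forall]
    exact isOpen_iInter_of_finite fun a => isOpen_iInter_of_finite fun b =>
      isOpen_iInter_of_finite fun _ => isOpen_ne_fun ((hc a).pow 2) ((hc b).pow 2)
  · change IsOpen {p : Pt n ε | ε = 1 → ∀ μ, xc p μ ≠ 0}
    simp only [Set.ofPred_forall]
    exact isOpen_iInter_of_finite fun _ => isOpen_iInter_of_finite fun a =>
      isOpen_ne_fun (hc a) continuous_const

theorem subsingleton_fin (hε : ε = 0 ∨ ε = 1) : Subsingleton (Fin ε) := by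
  rcases hε with rfl | rfl <;> infer_instance

theorem injective_of_regular (hε : ε = 0 ∨ ε = 1) {p : Pt n ε} (hp : p ∈ regular n ε) :
    Function.Injective (zsq p : Fin n ⊕ Fin ε → ℝ) := by
  have := subsingleton_fin hε
  have h0 : ∀ (μ : Fin n) (_ : Fin ε), p (Sum.inl μ) ^ 2 ≠ 0 := fun μ b => by
    refine pow_ne_zero 2 (hp.2 ?_ μ)
    rcases hε with rfl | rfl
    · exact b.elim0
    · rfl
  rintro (μ | b) (ν | b') h
  · by_contra e
    exact hp.1 μ ν (fun e' => e (by rw [e'])) h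
  · exact absurd h (h0 μ b')
  · exact absurd h.symm (h0 ν b)
  · rw [Subsingleton.elim b b']

end Regular

/-! ### The Kerr–NUT data form a vacuum frame on the domain -/

namespace Params

variable {n ε : ℕ} (P : Params n)

/-- `Q_0 = c / ∏_ρ x_ρ²` -/
def q₀ (p : Pt n ε) : ℝ := P.c0 / ∏ ρ, xc p ρ ^ 2

/-- The functions `Q_a`. -/
abbrev fQ : Fin n ⊕ Fin ε → Pt n ε → ℝ := frameQ (Fin ε) (P.typeA ε).X P.q₀

theorem smooth_X (hε : ε = 0 ∨ ε = 1) (μ : Fin n) :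
    SmoothOn (regular n ε) fun y => (P.typeA ε).X μ (y (Sum.inl μ)) := by
  have hc : ContDiff ℝ ∞ fun y : Pt n ε => y (Sum.inl μ) := contDiff_apply ℝ ℝ _
  have h1 : ContDiff ℝ ∞ fun y : Pt n ε => ∑ k ∈ Finset.range n, P.c k * y (Sum.inl μ) ^ (2 * k)
      + P.m μ * y (Sum.inl μ) ^ (1 - ε) :=
    (ContDiff.sum fun k _ => contDiff_const.mul (hc.pow _)).add (contDiff_const.mul (hc.pow _))
  rcases hε with rfl | rfl
  · refine h1.contDiffOn.congr fun y _ => ?_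
    simp [typeA]
  · exact h1.contDiffOn.add (contDiffOn_const.mul (contDiffOn_const.div (hc.pow 2).contDiffOn
      fun y hy => pow_ne_zero 2 (hy.2 rfl μ)))

theorem smooth_fQ (hε : ε = 0 ∨ ε = 1) (a : Fin n ⊕ Fin ε) : SmoothOn (regular n ε) (P.fQ a) := by
  have := subsingleton_fin hε
  rcases a with μ | b
  · exact (P.smooth_X hε μ).div (contDiff_vand_sqs μ).contDiffOn fun y hy =>
      vand_ne_zero (injective_sqs (injective_of_regular hε hy)) μ
  · have e : ε = 1 := hε.resolve_left fun e => by subst e; exact b.elim0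
    exact contDiffOn_const.div (contDiff_prod fun ρ _ =>
      (contDiff_apply ℝ ℝ (Sum.inl ρ)).pow 2).contDiffOn fun y hy =>
        Finset.prod_ne_zero_iff.mpr fun ρ _ => pow_ne_zero 2 (hy.2 e ρ)

theorem smooth_N (μ : Fin n) : SmoothOn (regular n ε) fun y => (P.typeA ε).N μ (y (Sum.inl μ)) := by
  have hc : ContDiff ℝ ∞ fun y : Pt n ε => y (Sum.inl μ) := contDiff_apply ℝ ℝ _
  exact ((ContDiff.sum fun k _ => contDiff_const.mul (hc.pow _)).add
    (contDiff_const.mul (hc.pow _))).contDiffOn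

theorem differentiable_N (ε : ℕ) (μ : Fin n) : Differentiable ℝ ((P.typeA ε).N μ) := by
  unfold typeA
  fun_prop

theorem smooth_N_div (hε : ε = 0 ∨ ε = 1) (μ : Fin n) :
    SmoothOn (regular n ε) fun y => (P.typeA ε).N μ (y (Sum.inl μ)) / vand (sqs y) μ :=
  have := subsingleton_fin hε
  (P.smooth_N μ).div (contDiff_vand_sqs μ).contDiffOn fun _ hy =>
    vand_ne_zero (injective_sqs (injective_of_regular hε hy)) μ

theorem Phi_apply (y : Pt n ε) : (P.typeA ε).Phi y
    = 1 + ∑ μ, (P.typeA ε).N μ (y (Sum.inl μ)) / vand (sqs y) μ := rfl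

theorem smooth_Phi (hε : ε = 0 ∨ ε = 1) : SmoothOn (regular n ε) (P.typeA ε).Phi :=
  contDiffOn_const.add (ContDiffOn.sum fun μ _ => P.smooth_N_div hε μ)

theorem domain_subset : P.domain ε ⊆ regular n ε := fun _ h => ⟨h.1, h.2.2.2⟩

theorem isOpen_domain (hε : ε = 0 ∨ ε = 1) : IsOpen (P.domain ε) := by
  have h : P.domain ε = (⋂ μ, regular n ε ∩ P.fQ (Sum.inl μ : Fin n ⊕ Fin ε) ⁻¹' Set.Ioi 0)
      ∩ (regular n ε ∩ (P.typeA ε).Phi ⁻¹' Set.Ioi 0) := by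
    ext p
    simp only [Set.mem_inter_iff, Set.mem_iInter]
    exact ⟨fun h => ⟨fun μ => ⟨P.domain_subset h, h.2.1 μ⟩, P.domain_subset h, h.2.2.1⟩,
      fun h => ⟨h.2.1.1, fun μ => (h.1 μ).2, h.2.2, h.2.1.2⟩⟩
  rw [h]
  exact (isOpen_iInter_of_finite fun μ => (P.smooth_fQ hε _).continuousOn.isOpen_inter_preimage
    isOpen_regular isOpen_Ioi).inter ((P.smooth_Phi hε).continuousOn.isOpen_inter_preimage
      isOpen_regular isOpen_Ioi)

theorem basic_fQ (a : Fin n ⊕ Fin ε) : IsBasic (P.fQ a) := by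
  intro x y h
  rcases a with μ | b
  · simp only [frameQ, Sum.elim_inl, h, sqs_congr h]
  · simp only [frameQ, Sum.elim_inr, q₀, xc, h]

theorem basic_Phi : IsBasic ((P.typeA ε).Phi : Pt n ε → ℝ) := by
  intro x y h
  simp only [Phi_apply, h, sqs_congr h]

theorem hasPd_q₀ {p : Pt n ε} (h0 : ∀ μ, p (Sum.inl μ) ≠ 0) (ν : Fin n) :
    HasPd (Sum.inl ν) (P.q₀ : Pt n ε → ℝ) (-(2 / p (Sum.inl ν) * P.q₀ p)) p := by
  have h1 : ∏ ρ, p (Sum.inl ρ) ^ 2 ≠ 0 :=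
    Finset.prod_ne_zero_iff.mpr fun ρ _ => pow_ne_zero 2 (h0 ρ)
  have h3 : HasPd (Sum.inl ν) (fun y : Pt n ε => ∏ ρ, y (Sum.inl ρ) ^ 2) _ p :=
    HasPd.prod fun ρ _ => hasPd_zsq (β := Empty) ν (Sum.inl ρ) p
  refine ((hasPd_const P.c0).div h3 h1).congr_val ?_
  have h2 : ∑ a, (∏ b ∈ Finset.univ.erase a, p (Sum.inl b) ^ 2)
      * (if (Sum.inl a : Fin n ⊕ Empty) = Sum.inl ν then 2 * p (Sum.inl ν) else 0)
      = (∏ ρ, p (Sum.inl ρ) ^ 2) * (2 / p (Sum.inl ν)) := by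
    have := h0 ν
    simp only [Sum.inl.injEq, mul_ite, mul_zero, Finset.sum_ite_eq', Finset.mem_univ, if_true]
    rw [← Finset.mul_prod_erase _ _ (Finset.mem_univ ν)]
    field_simp
  refine (congrArg (fun t => 0 / ∏ ρ, p (Sum.inl ρ) ^ 2
    - P.c0 * t / (∏ ρ, p (Sum.inl ρ) ^ 2) ^ 2) h2).trans ?_
  rw [q₀]
  simp only [xc]
  have := h0 ν
  field_simp
  ring

theorem pd_fQ (hε : ε = 0 ∨ ε = 1) {p : Pt n ε} (hp : p ∈ regular n ε) (τ : Fin n)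
    (a : Fin n ⊕ Fin ε) (e : a ≠ Sum.inl τ) :
    pd (Sum.inl τ) (P.fQ a) p = -(lam τ a p * P.fQ a p) := by
  have := subsingleton_fin hε
  have h := injective_of_regular hε hp
  rcases a with μ | b
  · have e' : μ ≠ τ := fun h => e (by rw [h])
    have h1 := hasPd_quot h (τ := τ) (P.hasDerivAt_X hε (fun e => hp.2 e μ) μ)
    rw [if_neg e'] at h1
    exact h1.eq
  · have e1 : ε = 1 := hε.resolve_left fun e => by subst e; exact b.elim0
    rw [lam_inr h]
    exact (P.hasPd_q₀ (hp.2 e1) τ).eq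

theorem pd_fQ_self (hε : ε = 0 ∨ ε = 1) {p : Pt n ε} (hp : p ∈ regular n ε) (μ : Fin n) :
    pd (Sum.inl μ) (P.fQ (Sum.inl μ : Fin n ⊕ Fin ε)) p
      = P.dX ε μ (p (Sum.inl μ)) / vand (sqs p) μ
        - (∑ σ, lam μ (Sum.inl σ : Fin n ⊕ Fin ε) p) * P.fQ (Sum.inl μ : Fin n ⊕ Fin ε) p := by
  have := subsingleton_fin hε
  have h1 := hasPd_quot (injective_of_regular hε hp) (τ := μ)
    (P.hasDerivAt_X hε (fun e => hp.2 e μ) μ)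
  rw [if_pos rfl, sub_div, mul_div_assoc] at h1
  exact h1.eq

theorem pd_pd_fQ_self (hε : ε = 0 ∨ ε = 1) {p : Pt n ε} (hp : p ∈ regular n ε) (μ : Fin n) :
    pd (Sum.inl μ) (pd (Sum.inl μ) (P.fQ (Sum.inl μ : Fin n ⊕ Fin ε))) p
      = P.ddX ε (p (Sum.inl μ)) / vand (sqs p) μ
        - 2 * (∑ σ, lam μ (Sum.inl σ : Fin n ⊕ Fin ε) p)
          * (P.dX ε μ (p (Sum.inl μ)) / vand (sqs p) μ)
        + ((∑ σ, lam μ (Sum.inl σ : Fin n ⊕ Fin ε) p) ^ 2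
          - ∑ σ, (rho μ (Sum.inl σ : Fin n ⊕ Fin ε) p - lam μ (Sum.inl σ : Fin n ⊕ Fin ε) p ^ 2))
          * P.fQ (Sum.inl μ : Fin n ⊕ Fin ε) p := by
  have := subsingleton_fin hε
  have h1 := hasPd_quot_snd (injective_of_regular hε hp) (X' := P.dX ε)
    (X'' := fun _ => P.ddX ε) (P.hasDerivAt_X hε (fun e => hp.2 e μ) μ)
    (P.hasDerivAt_dX hε (fun e => hp.2 e μ) μ)
  have h2 := h1.congr_on
    (f' := pd (Sum.inl μ) (P.fQ (Sum.inl μ : Fin n ⊕ Fin ε))) isOpen_regular hp fun y hy => by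
    rw [P.pd_fQ_self hε hy, sub_div, mul_div_assoc]
    rfl
  rw [h2.eq]
  simp only [frameQ, Sum.elim_inl]
  ring

/-- Twice `deriv_identity`: ρ_μν is 2/(z_μ - z_ν), the first two terms are 2 y'(z_μ)/U_μ by
`ddX_add`, and the extra frame vector contributes λ_μ0² Q_0 = 4c/(x_μ² ∏ x_ρ²). -/
theorem vacuum_inl_aux (hε : ε = 0 ∨ ε = 1) (hn : 1 ≤ n) {p : Pt n ε} (hp : p ∈ regular n ε)
    (μ : Fin n) :
    P.ddX ε (p (Sum.inl μ)) / vand (sqs p) μ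
      + ∑ _b : Fin ε, 1 / p (Sum.inl μ) * (P.dX ε μ (p (Sum.inl μ)) / vand (sqs p) μ)
      - ∑ ν, rho μ (Sum.inl ν : Fin n ⊕ Fin ε) p
        * (p (Sum.inl μ) * (P.dX ε μ (p (Sum.inl μ)) / vand (sqs p) μ)
          - (1 - Fintype.card (Fin ε)) * P.fQ (Sum.inl μ : Fin n ⊕ Fin ε) p
        + (p (Sum.inl ν) * (P.dX ε ν (p (Sum.inl ν)) / vand (sqs p) ν)
          - (1 - Fintype.card (Fin ε)) * P.fQ (Sum.inl ν : Fin n ⊕ Fin ε) p))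
      + ∑ b, lam μ (Sum.inr b : Fin n ⊕ Fin ε) p ^ 2 * P.fQ (Sum.inr b : Fin n ⊕ Fin ε) p = 0 := by
  have := subsingleton_fin hε
  have h := injective_of_regular hε hp
  have h1 := P.deriv_identity hε hn (injective_sqs h) (fun e ν => pow_ne_zero 2 (hp.2 e ν)) μ
  have h2 := P.ddX_add hε (x := p (Sum.inl μ)) (fun e => hp.2 e μ) μ
  have h3 : ∀ ν, p (Sum.inl ν) * (P.dX ε ν (p (Sum.inl ν)) / vand (sqs p) ν)
      - (1 - Fintype.card (Fin ε)) * P.fQ (Sum.inl ν : Fin n ⊕ Fin ε) p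
      = P.yfun ε (sqs p ν) / vand (sqs p) ν := by
    intro ν
    rw [sqs, ← P.mul_dX_sub hε (x := p (Sum.inl ν)) (fun e => hp.2 e ν) ν, Fintype.card_fin]
    simp only [frameQ, Sum.elim_inl]
    ring
  have h4 : ∑ b, lam μ (Sum.inr b : Fin n ⊕ Fin ε) p ^ 2 * P.fQ (Sum.inr b : Fin n ⊕ Fin ε) p
      = 2 * (2 * ε * P.c0 / (sqs p μ * ∏ ν, sqs p ν)) := by
    simp only [lam_inr h, frameQ, Sum.elim_inr, q₀]
    rw [Finset.sum_const, Finset.card_univ, Fintype.card_fin, nsmul_eq_mul]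
    simp only [sqs, xc]
    ring
  have h5 : ∀ ν, rho μ (Sum.inl ν : Fin n ⊕ Fin ε) p = 2 * (1 / (sqs p μ - sqs p ν)) := fun ν => by
    simp only [rho, sqs, zsq_inl]; ring
  rw [h4, Finset.sum_const, Finset.card_univ, Fintype.card_fin, nsmul_eq_mul]
  rw [Fintype.card_fin] at h3
  simp only [h3, h5]
  have h6 : P.ddX ε (p (Sum.inl μ)) / vand (sqs p) μ
      + ε * (1 / p (Sum.inl μ) * (P.dX ε μ (p (Sum.inl μ)) / vand (sqs p) μ))
      = 2 * (P.dyfun ε (sqs p μ) / vand (sqs p) μ) := by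
    rw [sqs]
    linear_combination 1 / vand (sqs p) μ * h2
  have h7 : ∑ ν, 2 * (1 / (sqs p μ - sqs p ν)) * (P.yfun ε (sqs p μ) / vand (sqs p) μ
        + P.yfun ε (sqs p ν) / vand (sqs p) ν)
      = 2 * ∑ ν, 1 / (sqs p μ - sqs p ν) * (P.yfun ε (sqs p μ) / vand (sqs p) μ
        + P.yfun ε (sqs p ν) / vand (sqs p) ν) := by
    rw [Finset.mul_sum]
    exact Finset.sum_congr rfl fun ν _ => by ring
  rw [h6, h7]
  linear_combination 2 * h1

theorem vacuum_inr_aux (hn : 1 ≤ n) {p : Pt n 1} (hp : p ∈ regular n 1) (b : Fin 1) :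
    ∑ ν, lam ν (Sum.inr b : Fin n ⊕ Fin 1) p * (P.dX 1 ν (p (Sum.inl ν)) / vand (sqs p) ν)
      = P.fQ (Sum.inr b : Fin n ⊕ Fin 1) p * ∑ ν, lam ν (Sum.inr b : Fin n ⊕ Fin 1) p ^ 2 := by
  have h := injective_of_regular (Or.inr rfl) hp
  have h1 := P.sum_dX_div_vand (x := fun ν => p (Sum.inl ν)) hn (injective_sqs h) (hp.2 rfl)
  simp only [lam_inr h]
  have h2 : ∑ ν, 2 / p (Sum.inl ν) * (P.dX 1 ν (p (Sum.inl ν)) / vand (sqs p) ν)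
      = 2 * ∑ ν, 1 / p (Sum.inl ν) * P.dX 1 ν (p (Sum.inl ν))
        / vand (fun ν => p (Sum.inl ν) ^ 2) ν := by
    rw [Finset.mul_sum]
    exact Finset.sum_congr rfl fun ν _ => by unfold sqs; ring
  rw [h2, h1, ← mul_assoc, Finset.mul_sum, Finset.mul_sum]
  refine Finset.sum_congr rfl fun ν _ => ?_
  simp only [frameQ, Sum.elim_inr, q₀, xc]
  ring

theorem vacuumFrame (hε : ε = 0 ∨ ε = 1) (hn : 1 ≤ n) (hc : ε = 1 → 0 < P.c0)
    [Subsingleton (Fin ε)] :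
    VacuumFrame (P.domain ε) (P.fQ : Fin n ⊕ Fin ε → _) (fun a (k : Fin (n + ε)) => frameA a k)
      (fun k a => frameE (n + ε) k a) where
  isOpen := P.isOpen_domain hε
  injective x hx := injective_of_regular hε (P.domain_subset hx)
  smooth_Q a := (P.smooth_fQ hε a).mono P.domain_subset
  smooth_A a k := (contDiff_frameA a k).contDiffOn
  smooth_E k a := smoothOn_frameE
    (fun x hx => injective_of_regular hε (P.domain_subset hx)) _ _ _
  basic_Q := P.basic_fQ
  basic_A a k x y h := by simp only [frameA, zsq_congr h]
  basic_E k a x y h := by simp only [frameE, zsq_congr h]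
  Q_pos x hx a := by
    rcases a with μ | b
    · exact hx.2.1 μ
    · have e : ε = 1 := hε.resolve_left fun e => by subst e; exact b.elim0
      exact div_pos (hc e) (Finset.prod_pos fun ρ _ => (sq_pos_of_ne_zero (hx.2.2.2 e ρ)))
  pd_Q x hx ν a e := P.pd_fQ hε (P.domain_subset hx) ν a e
  pd_A x hx ν a k := (hasPd_frameA (injective_of_regular hε (P.domain_subset hx)) ν a k).eq
  dual x hx a b := dual_aux (injective_of_regular hε (P.domain_subset hx)) (by simp) a b
  dual' x hx k l := dual_aux' (injective_of_regular hε (P.domain_subset hx)) (by simp) k l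
  vacuum_inl x hx μ := by
    have hp := P.domain_subset hx
    have h := vacuum_inl_of (injective_of_regular hε hp) (q := fun b => P.fQ (Sum.inr b) x)
      (R := fun ν => P.dX ε ν (x (Sum.inl ν)) / vand (sqs x) ν)
      (q' := fun ν => P.fQ (Sum.inl ν : Fin n ⊕ Fin ε) x) μ (P.vacuum_inl_aux hε hn hp μ)
    rw [Fintype.sum_sum_type]
    simp only [P.pd_fQ_self hε hp, P.pd_pd_fQ_self hε hp]
    exact h
  vacuum_inr x hx b := by
    obtain rfl : ε = 1 := hε.resolve_left fun e => by subst e; exact b.elim0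
    have hp := P.domain_subset hx
    simp only [P.pd_fQ_self hε hp]
    exact vacuum_inr_of (injective_of_regular hε hp)
      (R := fun ν => P.dX 1 ν (x (Sum.inl ν)) / vand (sqs x) ν)
      (q' := fun ν => P.fQ (Sum.inl ν : Fin n ⊕ Fin 1) x) b (P.vacuum_inr_aux hn hp b)

end Params

/-! ### Φ and A_(1) as charging data -/

namespace Params

variable {n ε : ℕ} (P : Params n)

theorem sum_N_div_vand (hn : 1 ≤ n) {p : Pt n ε} (h : Function.Injective (sqs p)) :
    ∑ μ, (P.typeA ε).N μ (p (Sum.inl μ)) / vand (sqs p) μ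
      = P.b (n - 1) + P.a * ∑ μ, P.m μ * p (Sum.inl μ) ^ (1 - ε) / vand (sqs p) μ := by
  rw [← sum_poly_div_vand h (Fintype.card_fin n) hn P.b, Finset.mul_sum, ← Finset.sum_add_distrib]
  refine Finset.sum_congr rfl fun μ _ => ?_
  simp only [typeA, sqs, ← pow_mul]
  ring

theorem Phi_eq_add_sum (hn : 1 ≤ n) {p : Pt n ε} (h : Function.Injective (sqs p)) :
    (P.typeA ε).Phi p
      = 1 + P.b (n - 1) + P.a * ∑ μ, P.m μ * p (Sum.inl μ) ^ (1 - ε) / vand (sqs p) μ := by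
  rw [P.Phi_apply, P.sum_N_div_vand hn h, add_assoc]

/-- This is the squared length V of the Killing vector ∂/∂ψ_0. The terms with c in the Q_μ add up to
-c/∏ x_ρ² and cancel Q_0. -/
theorem sum_fQ (hε : ε = 0 ∨ ε = 1) (hn : 1 ≤ n) {p : Pt n ε} (hp : p ∈ regular n ε) :
    ∑ a : Fin n ⊕ Fin ε, P.fQ a p
      = P.c (n - 1) + ∑ μ, P.m μ * p (Sum.inl μ) ^ (1 - ε) / vand (sqs p) μ := by
  have := subsingleton_fin hε
  have h := injective_sqs (injective_of_regular hε hp)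
  have h1 : ∑ μ, P.fQ (Sum.inl μ : Fin n ⊕ Fin ε) p = P.c (n - 1)
      + ∑ μ, P.m μ * p (Sum.inl μ) ^ (1 - ε) / vand (sqs p) μ
      + ε * ((-1) ^ n * P.c0) * ∑ μ, 1 / sqs p μ / vand (sqs p) μ := by
    rw [← sum_poly_div_vand h (Fintype.card_fin n) hn P.c, Finset.mul_sum,
      ← Finset.sum_add_distrib, ← Finset.sum_add_distrib]
    refine Finset.sum_congr rfl fun μ _ => ?_
    simp only [frameQ, Sum.elim_inl, typeA, sqs, ← pow_mul]
    ring
  rw [Fintype.sum_sum_type, h1]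
  rcases hε with rfl | rfl
  · simp
  · have : Nonempty (Fin n) := ⟨⟨0, hn⟩⟩
    rw [sum_inv_div_vand h fun μ => pow_ne_zero 2 (hp.2 rfl μ), Fintype.card_fin]
    have h2 : ((-1 : ℝ) ^ n) * (-1) ^ n = 1 := by rw [← mul_pow]; simp
    simp only [frameQ, Sum.elim_inr, Finset.univ_unique, Finset.sum_singleton, q₀]
    have h3 : ∏ ρ, xc p ρ ^ 2 = ∏ ρ, sqs p ρ := rfl
    rw [h3, Nat.cast_one]
    linear_combination (-P.c0 / ∏ ρ, sqs p ρ) * h2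

/-- The components of `∑_μ (N_μ / U_μ) A_μ`. -/
def weightedA (i : Fin (n + ε)) (p : Pt n ε) : ℝ :=
  ∑ μ, (P.typeA ε).N μ (p (Sum.inl μ)) / vand (sqs p) μ
    * frameA (Sum.inl μ : Fin n ⊕ Fin ε) i p

/-- The components of `A_(1)`. -/
def fu (i : Fin (n + ε)) (p : Pt n ε) : ℝ := P.weightedA i p / (P.typeA ε).Phi p

/-- One number `d` serves both derivatives: for μ ≠ τ and w = N_μ/U_μ, -λ w A_μ + λ w (A_μ - A_τ) =
-λ w A_τ, so every summand of the derivative is proportional to A_τ. -/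
theorem hasPd_Phi_weightedA (hε : ε = 0 ∨ ε = 1) {p : Pt n ε} (hp : p ∈ regular n ε) (τ : Fin n)
    (i : Fin (n + ε)) : ∃ d, HasPd (Sum.inl τ) (P.typeA ε).Phi d p ∧
      HasPd (Sum.inl τ) (P.weightedA i) (d * frameA (Sum.inl τ : Fin n ⊕ Fin ε) i p) p := by
  have := subsingleton_fin hε
  have h := injective_of_regular hε hp
  have h1 := fun μ => hasPd_quot (X := (P.typeA ε).N) h (τ := τ)
    ((P.differentiable_N ε μ) (p (Sum.inl μ))).hasDerivAt
  have h2 := HasPd.sum (s := Finset.univ) fun μ _ => h1 μ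
  refine ⟨_, ((hasPd_const 1).add h2).congr_val (zero_add _), ?_⟩
  refine (HasPd.sum (s := Finset.univ) fun μ _ =>
    (h1 μ).mul (hasPd_frameA h τ (Sum.inl μ) i)).congr_val ?_
  rw [Finset.sum_mul]
  refine Finset.sum_congr rfl fun μ _ => ?_
  by_cases e : μ = τ
  · subst e; simp
  · simp only [if_neg e]; ring

theorem smooth_fu (hε : ε = 0 ∨ ε = 1) (i : Fin (n + ε)) : SmoothOn (P.domain ε) (P.fu i) := by
  refine ContDiffOn.div ?_ ((P.smooth_Phi hε).mono P.domain_subset) fun y hy => hy.2.2.1.ne'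
  exact (ContDiffOn.sum fun μ _ => (P.smooth_N_div hε μ).mul
    (contDiff_frameA _ _).contDiffOn).mono P.domain_subset

theorem basic_fu (i : Fin (n + ε)) : IsBasic (P.fu i) := by
  intro x y h
  simp only [fu, weightedA, P.basic_Phi x y h, h, sqs_congr h, frameA, zsq_congr h]

theorem pd_fu (hε : ε = 0 ∨ ε = 1) {p : Pt n ε} (hp : p ∈ P.domain ε) (μ : Fin n)
    (i : Fin (n + ε)) : pd (Sum.inl μ) (P.fu i) p = pd (Sum.inl μ) (P.typeA ε).Phi p
      / (P.typeA ε).Phi p * (frameA (Sum.inl μ : Fin n ⊕ Fin ε) i p - P.fu i p) := by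
  have h0 := hp.2.2.1.ne'
  obtain ⟨d, h1, h2⟩ := P.hasPd_Phi_weightedA hε (P.domain_subset hp) μ i
  refine ((h2.div h1 h0).eq : pd (Sum.inl μ) (P.fu i) p = _).trans ?_
  rw [h1.eq, fu]
  field_simp

theorem chargedVacuum (hε : ε = 0 ∨ ε = 1) (hn : 1 ≤ n) (hc : ε = 1 → 0 < P.c0)
    (hrel : 1 + P.b (n - 1) = P.a * P.c (n - 1) + P.a * P.q ^ 2) {o : Fin (n + ε)}
    (ho : (o : ℕ) = 0) :
    ChargedVacuum (P.domain ε) (fun μ => P.fQ (Sum.inl μ : Fin n ⊕ Fin ε))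
      (volDer (Fin n) (Fin ε) (Fin (n + ε)))
      (frameG P.fQ (fun (a : Fin n ⊕ Fin ε) (k : Fin (n + ε)) => frameA a k))
      (frameC P.fQ (fun (k : Fin (n + ε)) (a : Fin n ⊕ Fin ε) => frameE (n + ε) k a))
      o P.fu (P.typeA ε).Phi P.a P.q := by
  have := subsingleton_fin hε
  have hA : ∀ (a : Fin n ⊕ Fin ε) (y : Pt n ε), frameA a o y = 1 := fun a y => by
    rw [frameA, ho, esym_zero]
  refine (P.vacuumFrame hε hn hc).chargedVacuum (fun a y _ => hA a y) (P.smooth_fu hε)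
    ((P.smooth_Phi hε).mono P.domain_subset) P.basic_fu P.basic_Phi (fun x hx => hx.2.2.1)
    (fun x hx => ?_) (fun x hx => ?_) fun x hx => P.pd_fu hε hx
  · have hp := P.domain_subset hx
    -- The relation between the constants enters here: it is precisely what makes Φ = a (V + q²).
    rw [P.sum_fQ hε hn hp, P.Phi_eq_add_sum hn (injective_sqs (injective_of_regular hε hp)), hrel]
    ring
  · have h0 := hx.2.2.1.ne'
    simp only [fu, weightedA, hA, mul_one]
    rw [eq_sub_of_add_eq' (P.Phi_apply x).symm]
    field_simp

end Params

/-! ### Forms on the torus and squares of 1-forms -/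

section TorusForms

variable {α κ : Type} [Fintype α] [DecidableEq α] [Fintype κ] [DecidableEq κ]

theorem torusForm_smul (r : ℝ) (w : κ → ℝ) :
    (torusForm (fun i => r * w i) : Form (α ⊕ κ) 1) = r • torusForm w := by
  simp only [torusForm, Finset.smul_sum, smul_smul]

theorem torusForm_sub (w w' : κ → ℝ) :
    (torusForm (fun i => w i - w' i) : Form (α ⊕ κ) 1) = torusForm w - torusForm w' := by
  rw [eq_sub_iff_add_eq]
  simp only [torusForm, ← Finset.sum_add_distrib, ← add_smul, sub_add_cancel]

theorem torusForm_sum {X : Type} (s : Finset X) (w : X → κ → ℝ) :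
    (torusForm (fun i => ∑ a ∈ s, w a i) : Form (α ⊕ κ) 1) = ∑ a ∈ s, torusForm (w a) := by
  simp only [torusForm, Finset.sum_smul]
  exact Finset.sum_comm

theorem torusForm_inl (w : κ → ℝ) (μ : α) :
    (torusForm w : Form (α ⊕ κ) 1) ![cvec (Sum.inl μ)] = 0 := by
  rw [torusForm_apply]
  simp [cvec]

theorem torusForm_inr (w : κ → ℝ) (i : κ) :
    (torusForm w : Form (α ⊕ κ) 1) ![cvec (Sum.inr i)] = w i := by
  rw [torusForm_apply]
  simp [cvec, Pi.single_apply]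

theorem wedge_wedge_self {ι : Type} [Fintype ι] [DecidableEq ι] (η ζ : Form ι 1) :
    wedge (wedge η ζ) ζ = 0 := by
  refine form_ext_three fun i j k => ?_
  rw [wedge_two_one, wedge_one_one, wedge_one_one, wedge_one_one]
  change _ = (0 : ℝ)
  ring

theorem tsq_smul {ι : Type} [Fintype ι] [DecidableEq ι] (r : ℝ) (η : Form ι 1) :
    tsq (r • η) = r ^ 2 • tsq η := by
  ext i j
  simp only [tsq, ContinuousAlternatingMap.smul_apply, Matrix.smul_apply, smul_eq_mul]
  ring

theorem posSemidef_tsq {ι : Type} [Fintype ι] [DecidableEq ι] (η : Form ι 1) :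
    (tsq η).PosSemidef :=
  Matrix.posSemidef_vecMulVec_self_star fun i => η ![cvec i]

end TorusForms

/-! ### Symmetric polynomials with an additional zero variable -/

section Symmetric

variable {n ε : ℕ}

/-- The extra variable is 0, so subsets containing it contribute nothing. -/
theorem esym_eq_symA (p : Pt n ε) {S : Finset (Fin n ⊕ Fin ε)} {T : Finset (Fin n)}
    (h : ∀ μ, Sum.inl μ ∈ S ↔ μ ∈ T) (k : ℕ) : esym (zsq p) S k = symA p T k := by
  symm
  refine Finset.sum_of_injOn (fun s => s.map Function.Embedding.inl)
    (fun s _ t _ e => Finset.map_injective _ e) (fun s hs => ?_) (fun t ht hn => ?_) fun s _ => ?_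
  · have hs' := Finset.mem_powersetCard.mp hs
    refine Finset.mem_powersetCard.mpr ⟨fun a ha => ?_, by rw [Finset.card_map]; exact hs'.2⟩
    obtain ⟨μ, hμ, rfl⟩ := Finset.mem_map.mp ha
    exact (h μ).mpr (hs'.1 hμ)
  · have ht' := Finset.mem_powersetCard.mp ht
    by_cases e : ∃ b, Sum.inr b ∈ t
    · obtain ⟨b, hb⟩ := e
      exact Finset.prod_eq_zero hb rfl
    · refine absurd ⟨t.toLeft, ?_, ?_⟩ hn
      · have e0 : t.toRight = ∅ := by
          ext b
          simpa using fun hb => e ⟨b, hb⟩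
        refine Finset.mem_powersetCard.mpr ⟨fun μ hμ => ?_, ?_⟩
        · exact (h μ).mp (ht'.1 (Finset.mem_toLeft.mp hμ))
        · rw [← ht'.2, ← Finset.card_toLeft_add_card_toRight (u := t), e0, Finset.card_empty,
            add_zero]
      · ext (μ | b)
        · simp
        · simpa using fun hb => e ⟨b, hb⟩
  · rw [Finset.prod_map]
    rfl

theorem frameA_inl (p : Pt n ε) (μ : Fin n) (k : ℕ) :
    frameA (Sum.inl μ : Fin n ⊕ Fin ε) k p = symA p (Finset.univ.erase μ) k :=
  esym_eq_symA p (fun ν => by simp) k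

theorem frameA_inr (p : Pt n ε) (b : Fin ε) (k : ℕ) :
    frameA (Sum.inr b : Fin n ⊕ Fin ε) k p = symA p Finset.univ k :=
  esym_eq_symA p (fun ν => by simp) k

theorem torusForm_eq_sum_range (w : ℕ → ℝ) :
    (torusForm (fun i : Fin (n + ε) => w i) : Form (Idx n ε) 1)
      = ∑ k ∈ Finset.range (n + ε), w k • dpsi k := by
  rw [torusForm, Finset.sum_range]
  exact Finset.sum_congr rfl fun i _ => by rw [dpsi, dif_pos i.2]

theorem calA_eq (p : Pt n ε) (μ : Fin n) :
    calA p μ = torusForm fun i : Fin (n + ε) => frameA (Sum.inl μ : Fin n ⊕ Fin ε) i p := by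
  simp only [frameA_inl]
  rw [torusForm_eq_sum_range fun k => symA p (Finset.univ.erase μ) k, calA]
  refine Finset.sum_subset (Finset.range_mono (Nat.le_add_right n ε)) fun k _ hk => ?_
  have hk' : n ≤ k := by simpa using hk
  -- Only n - 1 squares other than x_μ² are available, so the additional component present for ε = 1
  -- is zero.
  have h1 : symA p (Finset.univ.erase μ) k = 0 := by
    rw [symA, Finset.powersetCard_eq_empty.mpr, Finset.sum_empty]
    rw [Finset.card_erase_of_mem (Finset.mem_univ _), Finset.card_univ, Fintype.card_fin]
    have := μ.pos
    omega
  rw [h1, zero_smul]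

theorem calA0_eq (p : Pt n 1) (b : Fin 1) :
    calA0 p = torusForm fun i : Fin (n + 1) => frameA (Sum.inr b : Fin n ⊕ Fin 1) i p := by
  simp only [frameA_inr]
  rw [torusForm_eq_sum_range fun k => symA p Finset.univ k, calA0]

end Symmetric

/-! ### Identification of the type A metric with the charged vacuum metric -/

namespace Params

variable {n ε : ℕ} (P : Params n)

theorem A1_eq (p : Pt n ε) : (P.typeA ε).A1 p = torusForm fun i => P.fu i p := by
  have h : ∀ i, P.fu i p = 1 / (P.typeA ε).Phi p * P.weightedA i p := fun i => by
    rw [fu]; ring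
  simp only [h]
  rw [torusForm_smul, TypeAData.A1]
  congr 1
  unfold weightedA
  rw [torusForm_sum]
  refine Finset.sum_congr rfl fun μ _ => ?_
  rw [torusForm_smul, calA_eq]
  rfl

/-- The components of `A_a - A_(1)`. -/
def relA (a : Fin n ⊕ Fin ε) (i : Fin (n + ε)) (p : Pt n ε) : ℝ := frameA a i p - P.fu i p

theorem calA_sub_A1 (p : Pt n ε) (μ : Fin n) :
    calA p μ - (P.typeA ε).A1 p = torusForm fun i => P.relA (Sum.inl μ : Fin n ⊕ Fin ε) i p := by
  rw [calA_eq, P.A1_eq]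
  exact (torusForm_sub _ _).symm

/-- A sum over `Fin ε` is empty or has one term, which treats both parities at once. The map `f` is
arbitrary because the lemma serves the metric, with f = `tsq`, as well as H, with f the identity. -/
theorem smul_calA0_sub_A1 {M : Type} [AddCommGroup M] [Module ℝ M] (hε : ε = 0 ∨ ε = 1)
    (f : Form (Idx n ε) 1 → M) (p : Pt n ε) :
    (ε * P.c0 / ∏ ρ, xc p ρ ^ 2) • f (calA0 p - (P.typeA ε).A1 p)
      = ∑ b : Fin ε, P.fQ (Sum.inr b : Fin n ⊕ Fin ε) p
        • f (torusForm fun i => P.relA (Sum.inr b : Fin n ⊕ Fin ε) i p) := by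
  rcases hε with rfl | rfl
  · simp
  · simp only [Finset.univ_unique, Finset.sum_singleton, P.A1_eq, Nat.cast_one, one_mul]
    rw [calA0_eq p default, ← torusForm_sub]
    rfl

theorem e0_eq (p : Pt n ε) :
    (P.typeA ε).e0 p = P.sqrtQ0 ε p • (calA0 p - (P.typeA ε).A1 p) := by
  have h : (P.typeA ε).k₂ = 0 := rfl
  rw [TypeAData.e0, h, zero_mul, zero_smul, add_zero]
  rfl

theorem mul_sqrtQ0_sq (hc : ε = 1 → 0 < P.c0) (hε : ε = 0 ∨ ε = 1) (p : Pt n ε) :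
    (ε : ℝ) * P.sqrtQ0 ε p ^ 2 = ε * P.c0 / ∏ ρ, xc p ρ ^ 2 := by
  rcases hε with rfl | rfl
  · simp
  · rw [sqrtQ0, div_pow, Real.sq_sqrt (hc rfl).le, Finset.prod_pow, mul_div_assoc]

theorem metric_eq (hc : ε = 1 → 0 < P.c0) (hε : ε = 0 ∨ ε = 1) (p : Pt n ε) :
    (P.typeA ε).metric p
      = ∑ μ, (Ufun p μ / (P.typeA ε).X μ (xc p μ)) • tsq (dxForm μ)
        + ∑ μ, ((P.typeA ε).X μ (xc p μ) / Ufun p μ) • tsq (calA p μ - (P.typeA ε).A1 p)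
        + (ε * P.c0 / ∏ ρ, xc p ρ ^ 2) • tsq (calA0 p - (P.typeA ε).A1 p) := by
  have h : ∀ μ x, (P.typeA ε).f μ x = 1 := fun _ _ => rfl
  simp only [TypeAData.metric, h, one_pow, one_mul]
  rw [P.e0_eq, tsq_smul, smul_smul, P.mul_sqrtQ0_sq hc hε]

theorem metric_eq_frame (hc : ε = 1 → 0 < P.c0) (hε : ε = 0 ∨ ε = 1) (p : Pt n ε) :
    (P.typeA ε).metric p
      = ∑ μ, (1 / P.fQ (Sum.inl μ : Fin n ⊕ Fin ε) p) • tsq (dxForm μ)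
        + ∑ a : Fin n ⊕ Fin ε, P.fQ a p • tsq (torusForm fun i => P.relA a i p) := by
  rw [P.metric_eq hc hε, P.smul_calA0_sub_A1 hε tsq, Fintype.sum_sum_type, ← add_assoc]
  simp only [P.calA_sub_A1]
  congr 2
  refine Finset.sum_congr rfl fun μ _ => ?_
  simp only [frameQ, Sum.elim_inl, one_div_div]
  rfl

theorem metric_congr {y z : Pt n ε} (h : ∀ μ, y (Sum.inl μ) = z (Sum.inl μ)) :
    (P.typeA ε).metric y = (P.typeA ε).metric z := by
  have e : xc y = xc z := funext h
  simp only [TypeAData.metric, TypeAData.e0, TypeAData.A1, TypeAData.Phi, calA, calA0, symA, Ufun,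
    e]

/-- All covectors A_a have o-component 1, so shifting dψ_o by u subtracts u from each of them. -/
theorem chargedG_eq {o : Fin (n + ε)} (ho : (o : ℕ) = 0) (i j : Fin (n + ε)) (p : Pt n ε) :
    chargedG (frameG P.fQ (fun (a : Fin n ⊕ Fin ε) (k : Fin (n + ε)) => frameA a k)) o P.fu i j p
      = ∑ a : Fin n ⊕ Fin ε, P.fQ a p * (P.relA a i p * P.relA a j p) := by
  have hA : ∀ (a : Fin n ⊕ Fin ε) (y : Pt n ε), frameA a o y = 1 := fun a y => by
    rw [frameA, ho, esym_zero]
  simp only [chargedG, twist, frameG, relA, hA]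
  rw [Finset.mul_sum, Finset.sum_mul, Finset.sum_mul, ← Finset.sum_sub_distrib,
    ← Finset.sum_sub_distrib, ← Finset.sum_add_distrib]
  exact Finset.sum_congr rfl fun a _ => by ring

theorem chargedZ_eq {o : Fin (n + ε)} (ho : (o : ℕ) = 0) (i : Fin (n + ε)) (p : Pt n ε) :
    chargedZ (frameG P.fQ (fun (a : Fin n ⊕ Fin ε) (k : Fin (n + ε)) => frameA a k)) o P.fu i p
      = ∑ a : Fin n ⊕ Fin ε, P.fQ a p * P.relA a i p := by
  have hA : ∀ (a : Fin n ⊕ Fin ε) (y : Pt n ε), frameA a o y = 1 := fun a y => by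
    rw [frameA, ho, esym_zero]
  simp only [chargedZ, frameG, relA, hA]
  rw [Finset.sum_mul, ← Finset.sum_sub_distrib]
  exact Finset.sum_congr rfl fun a _ => by ring

theorem blockMetric (hε : ε = 0 ∨ ε = 1) (hn : 1 ≤ n) (hc : ε = 1 → 0 < P.c0)
    (hrel : 1 + P.b (n - 1) = P.a * P.c (n - 1) + P.a * P.q ^ 2) {o : Fin (n + ε)}
    (ho : (o : ℕ) = 0) :
    BlockMetric (P.domain ε) (P.typeA ε).metric
      (fun μ y => 1 / P.fQ (Sum.inl μ : Fin n ⊕ Fin ε) y)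
      (chargedG (frameG P.fQ (fun (a : Fin n ⊕ Fin ε) (k : Fin (n + ε)) => frameA a k)) o P.fu)
      (chargedC (frameC P.fQ (fun (k : Fin (n + ε)) (a : Fin n ⊕ Fin ε) => frameE (n + ε) k a))
        o P.fu (P.typeA ε).Phi) := by
  have hd : ∀ (μ : Fin n) (i : Idx n ε), (dxForm μ : Form (Idx n ε) 1) ![cvec i]
      = if i = Sum.inl μ then 1 else 0 := fun μ i => by
    rw [dxForm, dcoord_apply, cvec, Pi.single_apply]
    simp only [eq_comm]
  have hg : ∀ (p : Pt n ε) (i j : Idx n ε), (P.typeA ε).metric p i j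
      = ∑ μ, 1 / P.fQ (Sum.inl μ : Fin n ⊕ Fin ε) p
          * ((if i = Sum.inl μ then 1 else 0) * if j = Sum.inl μ then 1 else 0)
        + ∑ a : Fin n ⊕ Fin ε, P.fQ a p * ((torusForm fun i => P.relA a i p) ![cvec i]
          * (torusForm fun i => P.relA a i p) ![cvec j]) := fun p i j => by
    rw [P.metric_eq_frame hc hε, Matrix.add_apply, Matrix.sum_apply, Matrix.sum_apply]
    simp only [Matrix.smul_apply, tsq, hd, smul_eq_mul]
  refine (P.chargedVacuum hε hn hc hrel ho).blockMetric (fun p _ μ ν => ?_) (fun p _ μ j => ?_)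
    (fun p _ i ν => ?_) fun p _ i j => ?_
  · rw [hg]
    simp only [torusForm_inl, mul_zero, Finset.sum_const_zero, add_zero, Sum.inl.injEq]
    by_cases e : μ = ν
    · subst e; simp
    · rw [if_neg e]
      refine Finset.sum_eq_zero fun σ _ => ?_
      by_cases e' : μ = σ
      · subst e'; simp [Ne.symm e]
      · simp [e']
  · rw [hg]; simp [torusForm_inl]
  · rw [hg]; simp [torusForm_inl]
  · rw [hg, P.chargedG_eq ho]
    simp only [torusForm_inr, reduceCtorEq, if_false, mul_zero, Finset.sum_const_zero, zero_add]

/-- A sum of squares with positive coefficients is positive semidefinite, and the block structure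
provides an inverse, so it is definite. -/
theorem posDef_metric (hε : ε = 0 ∨ ε = 1) (hn : 1 ≤ n) (hc : ε = 1 → 0 < P.c0)
    (hrel : 1 + P.b (n - 1) = P.a * P.c (n - 1) + P.a * P.q ^ 2) {p : Pt n ε}
    (hp : p ∈ P.domain ε) : ((P.typeA ε).metric p).PosDef := by
  have := subsingleton_fin hε
  have hQ := (P.vacuumFrame hε hn hc).Q_pos p hp
  refine (Matrix.PosSemidef.posDef_iff_isUnit ?_).mpr
    ((P.blockMetric hε hn hc hrel (o := ⟨0, by omega⟩) rfl).isUnit hp)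
  rw [P.metric_eq_frame hc hε]
  exact (Matrix.posSemidef_sum _ fun μ _ => (posSemidef_tsq _).smul
    (one_div_pos.mpr (hQ (Sum.inl μ))).le).add
      (Matrix.posSemidef_sum _ fun a _ => (posSemidef_tsq _).smul (hQ a).le)

end Params

theorem form_neg_eq {ι : Type} [Fintype ι] {k : ℕ} (η : Form ι k) : -η = (-1 : ℝ) • η := by
  ext v
  simp

/-! ### Coframe expressions, the field strengths and the case b = 0 -/

namespace Params

variable {n ε : ℕ} (P : Params n)

theorem sq_sqrt_Q {p : Pt n ε} (hp : p ∈ P.domain ε) (μ : Fin n) :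
    √((P.typeA ε).Q p μ) ^ 2 = (P.typeA ε).Q p μ := Real.sq_sqrt (hp.2.1 μ).le

theorem eHat_eq (p : Pt n ε) (μ : Fin n) :
    (P.typeA ε).eHat p μ = √((P.typeA ε).Q p μ) • (calA p μ - (P.typeA ε).A1 p) := by
  have h : ∀ μ x, (P.typeA ε).f μ x = 1 := fun _ _ => rfl
  rw [TypeAData.eHat, h, one_mul]

theorem metric_eq_coframe (hc : ε = 1 → 0 < P.c0) (hε : ε = 0 ∨ ε = 1) {p : Pt n ε}
    (hp : p ∈ P.domain ε) :
    (P.typeA ε).metric p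
      = ∑ μ, (tsq ((P.typeA ε).e p μ) + tsq ((P.typeA ε).eHat p μ))
        + (ε : ℝ) • tsq ((P.typeA ε).e0 p) := by
  rw [P.metric_eq hc hε, P.e0_eq, tsq_smul, smul_smul, P.mul_sqrtQ0_sq hc hε,
    Finset.sum_add_distrib]
  congr 2
  · refine Finset.sum_congr rfl fun μ _ => ?_
    rw [TypeAData.e, tsq_smul, one_div, inv_pow, P.sq_sqrt_Q hp, TypeAData.Q, inv_div]
  · refine Finset.sum_congr rfl fun μ _ => ?_
    rw [P.eHat_eq, tsq_smul, P.sq_sqrt_Q hp, TypeAData.Q]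

theorem wedge_e_eHat {p : Pt n ε} (hp : p ∈ P.domain ε) (μ : Fin n) :
    wedge ((P.typeA ε).e p μ) ((P.typeA ε).eHat p μ)
      = wedge (dxForm μ) (calA p μ - (P.typeA ε).A1 p) := by
  rw [P.eHat_eq, TypeAData.e, wedge_smul_left, wedge_smul_right, smul_smul,
    one_div_mul_cancel (Real.sqrt_pos.mpr (hp.2.1 μ)).ne', one_smul]

theorem dlnPhi_eq (hε : ε = 0 ∨ ε = 1) {p : Pt n ε} (hp : p ∈ P.domain ε) (μ : Fin n) :
    (P.typeA ε).dlnPhi p μ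
      = pd (Sum.inl μ) (P.typeA ε).Phi p / (P.typeA ε).Phi p :=
  pd_log (((P.smooth_Phi hε).hasPd isOpen_regular (P.domain_subset hp) (Sum.inl μ)).1)
    hp.2.2.1.ne'

/-- By `pd_fu` one has ∂_μ ln Φ (A_μ - u) = ∂_μ u, so that summation over μ gives du. The factors
√Q_μ cancel between the two coframe covectors. -/
theorem dlnPhi_smul_wedge (hε : ε = 0 ∨ ε = 1) {p : Pt n ε} (hp : p ∈ P.domain ε) (μ : Fin n) :
    (P.typeA ε).dlnPhi p μ • wedge ((P.typeA ε).e p μ) ((P.typeA ε).eHat p μ)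
      = wedge (dcoord (Sum.inl μ)) (torusForm fun i => pd (Sum.inl μ) (P.fu i) p) := by
  rw [P.wedge_e_eHat hp, P.calA_sub_A1, P.dlnPhi_eq hε hp, ← wedge_smul_right, ← torusForm_smul]
  simp only [P.pd_fu hε hp]
  rfl

theorem fieldF_eq (hε : ε = 0 ∨ ε = 1) {p : Pt n ε} (hp : p ∈ P.domain ε) :
    P.fieldF ε p = chargedF P.fu P.q p := by
  simp only [fieldF, chargedF, P.dlnPhi_smul_wedge hε hp, torusForm_smul, wedge_smul_right,
    Finset.smul_sum]

/-- With f = 1, k₂ = 0 and √Q_0 = k₁/∏ x_ρ the rational terms of the torsion cancel. The diagonal ν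
= μ may be added since it contains a repeated factor. -/
theorem fieldH_eq_fieldHClosed (p : Pt n ε) : P.fieldH ε p = P.fieldHClosed ε p := by
  have hf : ∀ μ x, (P.typeA ε).f μ x = 1 := fun _ _ => rfl
  have h1 : (P.typeA ε).k₁ = √P.c0 := rfl
  have h2 : (P.typeA ε).k₂ = 0 := rfl
  rw [fieldH, TypeAData.torsion, fieldHClosed, wedge_add_right, wedge_sum_right, form_neg_eq,
    smul_add]
  congr 1
  · simp only [wedge_sum_left, wedge_smul_left, wedge_smul_right, Finset.smul_sum]
    rw [Finset.sum_comm]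
    refine Finset.sum_congr rfl fun μ _ => ?_
    rw [← Finset.add_sum_erase _ _ (Finset.mem_univ μ), wedge_wedge_self, smul_zero, smul_zero,
      smul_zero, zero_add]
    refine Finset.sum_congr rfl fun ν _ => ?_
    rw [smul_smul, smul_smul, hf, hf]
    congr 1
    ring
  · simp only [wedge_sum_left, wedge_smul_left, wedge_smul_right, Finset.smul_sum]
    refine Finset.sum_congr rfl fun μ _ => ?_
    simp only [smul_smul]
    rw [hf, h1, h2, sqrtQ0]
    congr 1
    ring

theorem sum_smul_eHat_add (hc : ε = 1 → 0 < P.c0) (hε : ε = 0 ∨ ε = 1) {p : Pt n ε}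
    (hp : p ∈ P.domain ε) :
    ∑ ν, √((P.typeA ε).Q p ν) • (P.typeA ε).eHat p ν
        + (ε : ℝ) • P.sqrtQ0 ε p • (P.typeA ε).e0 p
      = ∑ ν, ((P.typeA ε).X ν (xc p ν) / Ufun p ν) • (calA p ν - (P.typeA ε).A1 p)
        + (ε * P.c0 / ∏ ρ, xc p ρ ^ 2) • (calA0 p - (P.typeA ε).A1 p) := by
  rw [P.e0_eq, smul_smul, smul_smul, mul_assoc, ← sq, P.mul_sqrtQ0_sq hc hε]
  congr 1
  refine Finset.sum_congr rfl fun ν _ => ?_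
  rw [P.eHat_eq, smul_smul, ← sq, P.sq_sqrt_Q hp, TypeAData.Q]

/-- The second factor of H is Σ_a Q_a (A_a - u) = v - V u, by `chargedZ_eq`, and the first one is
du. -/
theorem fieldH_eq (hc : ε = 1 → 0 < P.c0) (hε : ε = 0 ∨ ε = 1) {o : Fin (n + ε)}
    (ho : (o : ℕ) = 0) {p : Pt n ε} (hp : p ∈ P.domain ε) :
    P.fieldH ε p
      = chargedH (frameG P.fQ (fun (a : Fin n ⊕ Fin ε) (k : Fin (n + ε)) => frameA a k)) o
        P.fu p := by
  rw [P.fieldH_eq_fieldHClosed, fieldHClosed, P.sum_smul_eHat_add hc hε hp,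
    P.smul_calA0_sub_A1 hε (fun η => η)]
  simp only [P.dlnPhi_smul_wedge hε hp, chargedH, ← wedge_sum_left, P.chargedZ_eq ho]
  rw [torusForm_sum]
  simp only [torusForm_smul, Fintype.sum_sum_type, P.calA_sub_A1]
  rfl

theorem exists_solvesHeterotic (hε : ε = 0 ∨ ε = 1) (hn : 1 ≤ n) (hc : ε = 1 → 0 < P.c0)
    (hrel : 1 + P.b (n - 1) = P.a * P.c (n - 1) + P.a * P.q ^ 2) {D : ℕ} (o : Fin D ≃ Idx n ε) :
    ∃ B : Pt n ε → Form (Idx n ε) 2,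
      SolvesHeterotic o (P.domain ε) (P.typeA ε).metric (P.dilaton ε) (P.gaugeA ε) B
        (P.fieldF ε) (P.fieldH ε) := by
  have ho : ((⟨0, by omega⟩ : Fin (n + ε)) : ℕ) = 0 := rfl
  have h := (P.chargedVacuum hε hn hc hrel ho).solvesHeterotic
    (P.blockMetric hε hn hc hrel ho) (fun p hp => P.posDef_metric hε hn hc hrel hp)
    (fun y z h => P.metric_congr h) o (fun p hp => P.fieldF_eq hε hp)
    (fun p hp => P.fieldH_eq hc hε ho hp)
  have hA : P.gaugeA ε = fun y => P.q • (torusForm (fun i => P.fu i y) : Form (Idx n ε) 1) := by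
    funext y
    rw [gaugeA, P.A1_eq]
  rw [hA]
  exact ⟨_, h⟩

theorem N_of_b_eq_zero (hb : ∀ k < n, P.b k = 0) (μ : Fin n) (x : ℝ) :
    (P.typeA ε).N μ x = P.a * P.m μ * x ^ (1 - ε) := by
  have h : ∑ k ∈ Finset.range n, P.b k * x ^ (2 * k) = 0 :=
    Finset.sum_eq_zero fun k hk => by rw [hb k (Finset.mem_range.mp hk), zero_mul]
  change ∑ k ∈ Finset.range n, P.b k * x ^ (2 * k) + _ = _
  rw [h, zero_add]

theorem Phi_of_b_eq_zero (hb : ∀ k < n, P.b k = 0) :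
    (P.typeA ε).Phi = (knPhi P.m P.a : Pt n ε → ℝ) := by
  funext p
  simp only [TypeAData.Phi, knPhi, P.N_of_b_eq_zero hb, Finset.mul_sum]
  congr 1
  exact Finset.sum_congr rfl fun μ _ => by ring

theorem A1_of_b_eq_zero (hb : ∀ k < n, P.b k = 0) (p : Pt n ε) :
    (P.typeA ε).A1 p = knA1 P.m P.a p := by
  rw [TypeAData.A1, knA1, P.Phi_of_b_eq_zero hb, Finset.smul_sum, Finset.smul_sum]
  refine Finset.sum_congr rfl fun μ _ => ?_
  rw [P.N_of_b_eq_zero hb, smul_smul, smul_smul]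
  congr 1
  ring

theorem sum_dlnPhi_of_b_eq_zero (hb : ∀ k < n, P.b k = 0) {p : Pt n ε}
    (hp : p ∈ P.domain ε) :
    ∑ μ, (P.typeA ε).dlnPhi p μ • wedge ((P.typeA ε).e p μ) ((P.typeA ε).eHat p μ)
      = ∑ μ, dmu μ (fun y : Pt n ε => Real.log (knPhi P.m P.a y)) p •
        wedge (dxForm μ) (calA p μ - knA1 P.m P.a p) := by
  simp only [P.wedge_e_eHat hp, P.A1_of_b_eq_zero hb, TypeAData.dlnPhi, P.Phi_of_b_eq_zero hb]

end Params

end ChargedKerrNUT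

end

theorem mainTheorem9 (n ε : ℕ) (hn : 1 ≤ n) (hε : ε = 0 ∨ ε = 1) (P : Params n)
    (hc : ε = 1 → 0 < P.c0)
    (hrel : 1 + P.b (n - 1) = P.a * P.c (n - 1) + P.a * P.q ^ 2)
    (o : Fin (2 * n + ε) ≃ Idx n ε) :
    -- the fields solve the equations of abelian heterotic supergravity
    (∃ B : Pt n ε → Form (Idx n ε) 2,
      SolvesHeterotic o (P.domain ε) (P.typeA ε).metric (P.dilaton ε) (P.gaugeA ε) B
        (P.fieldF ε) (P.fieldH ε)) ∧
    -- their explicit form; `e^μ, e^μ̂, e^0` is an orthonormal coframe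
    (∀ p ∈ P.domain ε,
      (P.typeA ε).metric p
        = ∑ μ, (tsq ((P.typeA ε).e p μ) + tsq ((P.typeA ε).eHat p μ))
          + (ε : ℝ) • tsq ((P.typeA ε).e0 p) ∧
      (P.typeA ε).metric p
        = ∑ μ, (Ufun p μ / (P.typeA ε).X μ (xc p μ)) • tsq (dxForm μ)
          + ∑ μ, ((P.typeA ε).X μ (xc p μ) / Ufun p μ) • tsq (calA p μ - (P.typeA ε).A1 p)
          + (ε * P.c0 / ∏ ρ, xc p ρ ^ 2) • tsq (calA0 p - (P.typeA ε).A1 p) ∧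
      P.fieldF ε p = P.q • (P.typeA ε).F2 p ∧
      P.fieldH ε p = P.fieldHClosed ε p ∧
      (P.typeA ε).Phi p
        = 1 + P.b (n - 1) + P.a * ∑ μ, P.m μ * xc p μ ^ (1 - ε) / Ufun p μ) ∧
    -- for `b_k = 0` they are the charged Kerr–NUT fields
    ((∀ k < n, P.b k = 0) → ∀ p ∈ P.domain ε,
      (P.typeA ε).metric p = knMetric P.m P.c P.a P.c0 p ∧
      P.dilaton ε p = Real.log (knPhi P.m P.a p) ∧
      P.gaugeA ε p = P.q • knA1 P.m P.a p ∧
      P.fieldF ε p = knF P.m P.a P.q p ∧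
      P.fieldH ε p = knH P.m P.c P.a P.c0 p) := by 
  refine ⟨P.exists_solvesHeterotic hε hn hc hrel o, fun p hp => ⟨P.metric_eq_coframe hc hε hp,
    P.metric_eq hc hε p, ?_, P.fieldH_eq_fieldHClosed p, ?_⟩, fun hb p hp => ⟨?_, ?_, ?_, ?_, ?_⟩⟩
  · have hf : ∀ μ x, (P.typeA ε).f μ x = 1 := fun _ _ => rfl
    simp only [Params.fieldF, TypeAData.F2, hf, div_one]
  · have := subsingleton_fin hε
    exact P.Phi_eq_add_sum hn (injective_sqs (injective_of_regular hε (P.domain_subset hp)))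
  · rw [P.metric_eq hc hε, P.A1_of_b_eq_zero hb]
    rfl
  · rw [Params.dilaton, P.Phi_of_b_eq_zero hb]
  · rw [Params.gaugeA, P.A1_of_b_eq_zero hb]
  · rw [Params.fieldF, P.sum_dlnPhi_of_b_eq_zero hb hp, knF]
  · rw [P.fieldH_eq_fieldHClosed, Params.fieldHClosed, P.sum_dlnPhi_of_b_eq_zero hb hp,
      P.sum_smul_eHat_add hc hε hp, P.A1_of_b_eq_zero hb]
    rfl
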